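/- Let $k$ be a field, $t\ge 1$ and $K=k^t$. Let $A$ be an augmented dg $K$-ring: a $\mathbb Z$-graded $k$-algebra $A=\bigoplus_i A_i$ with a unital $k$-algebra map $\eta:K\to A_0$ (whose image need not be central), a differential $d_A$ of degree $-1$ that is a graded derivation with $d_A\eta=0$, $d_A^2=0$, and a degree-preserving $k$-algebra map $\varepsilon:A\to K$ ($K$ in degree $0$) with $\varepsilon\eta=\mathrm{id}_K$, $\varepsilon d_A=0$. Put $\overline A=\ker\varepsilon$; elements of $A$ are projected to $\overline A$ along $A=\eta(K)\oplus\overline A$ whenever they are placed in a bar entry. Let $s$ be the suspension, $BA=\bigoplus_{n\ge0}(s\overline A)^{\otimes_K n}$, write $[a_1|\cdots|a_n]=sa_1\otimes\cdots\otimes sa_n$, and put $\varepsilon_i=\sum_{j=1}^i(|a_j|+1)$, $\eta_i=\sum_{j=0}^i(|a_j|+1)$. All signs below are for homogeneous arguments. Cochains: $C^\bullet(A)=\mathrm{Hom}_{K^e}(BA,A)$ (graded $K$-bimodule maps, $|f|$ the degree of $f$), with differential $\delta=\delta_0+\delta_1$, $$\delta_0(f)[a_1|\cdots|a_n]=d_Af[a_1|\cdots|a_n]+\sum_{i=1}^n(-1)^{\varepsilon_{i-1}+|f|}f[a_1|\cdots|d_Aa_i|\cdots|a_n],$$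 $$\delta_1(f)[a_1|\cdots|a_{n+1}]=(-1)^{|f|(|a_1|+1)}a_1f[a_2|\cdots|a_{n+1}]+\sum_{i=1}^n(-1)^{|f|+\varepsilon_i}f[a_1|\cdots|a_ia_{i+1}|\cdots|a_{n+1}]+(-1)^{|f|+\varepsilon_n+1}f[a_1|\cdots|a_n]a_{n+1}.$$ $HH^p(A)$ is its cohomology at cochains of lower degree $-p$. For $f$ of weight $m$ (i.e. supported on $(s\overline A)^{\otimes_K m}$) and $g$ of weight $n$ (extended to products over all weights), $$(f\cup g)[a_1|\cdots|a_{m+n}]=(-1)^{|g|\varepsilon_m}f[a_1|\cdots|a_m]\,g[a_{m+1}|\cdots|a_{m+n}],$$ $$(f\circ g)[a_1|\cdots|a_{m+n-1}]=\sum_{i=1}^m(-1)^{\varepsilon_{i-1}(|g|+1)}f[a_1|\cdots|g[a_i|\cdots|a_{i+n-1}]|\cdots|a_{m+n-1}],$$ $$[f,g]=f\circ g-(-1)^{(|f|+1)(|g|+1)}g\circ f.$$ Chains: $C_\bullet(A)=A\otimes_{K^e}BA$, with differential $b=b_0+b_1$, $$b_0(a_0\otimes[a_1|\cdots|a_n])=d_Aa_0\otimes[a_1|\cdots|a_n]+\sum_{i=1}^n(-1)^{\eta_{i-1}}a_0\otimes[a_1|\cdots|d_Aa_i|\cdots|a_n],$$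 $$b_1(a_0\otimes[a_1|\cdots|a_n])=(-1)^{|a_0|+1}a_0a_1\otimes[a_2|\cdots|a_n]+\sum_{i=1}^{n-1}(-1)^{\eta_i}a_0\otimes[a_1|\cdots|a_ia_{i+1}|\cdots|a_n]+(-1)^{(\eta_{n-1}+1)(|a_n|+1)}a_na_0\otimes[a_1|\cdots|a_{n-1}]$$ for $n\ge 1$, and $b_1=0$ for $n=0$. $HH_n(A)$ is its homology in degree $n$. Define $$B(a_0\otimes[a_1|\cdots|a_n])=\sum_{i=0}^n(-1)^{\eta_i(\eta_n-\eta_i)}1\otimes[a_{i+1}|\cdots|a_n|a_0|\cdots|a_i],$$ and, for $f$ of weight $m$, $$i_f(a_0\otimes[a_1|\cdots|a_n])=(-1)^{|a_0||f|}a_0f[a_1|\cdots|a_m]\otimes[a_{m+1}|\cdots|a_n],$$ $$L_f(a_0\otimes[a_1|\cdots|a_n])=\sum_{i=0}^{n-m}(-1)^{(\eta_i+1)(|f|+1)}a_0\otimes[a_1|\cdots|a_i|f[a_{i+1}|\cdots|a_{i+m}]|a_{i+m+1}|\cdots|a_n]$$ $$\qquad+\sum_{i=\max(n-m+1,0)}^n(-1)^{(\eta_n-\eta_i)\eta_i+|f|+1}f[a_{i+1}|\cdots|a_n|a_0|\cdots|a_{m+i-n-1}]\otimes[a_{m+i-n}|\cdots|a_i],$$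 where $i_f=0$ if $m>n$ and $L_f=0$ if $m>n+1$. **Theorem.** The operations $\cup$, $[-,-]$, $i_f$, $L_f$ and $B$ are well defined on (co)homology, and with them $(HH^\bullet(A),HH_\bullet(A),B)$ is a Tamarkin–Tsygan calculus. That is, for homogeneous $f,g,h\in HH^\bullet(A)$ (of upper degrees $|f|,|g|,|h|$): 1. $(HH^\bullet(A),\cup)$ is a graded commutative associative algebra whose unit is the class of the cochain $BA\to K\xrightarrow{\eta}A$; the bracket has degree $-1$ and satisfies $[f,g]=-(-1)^{(|f|+1)(|g|+1)}[g,f]$, the graded Jacobi identity $(-1)^{(|f|+1)(|h|+1)}[[f,g],h]+(-1)^{(|g|+1)(|f|+1)}[[g,h],f]+(-1)^{(|h|+1)(|g|+1)}[[h,f],g]=0$, and $[f,g\cup h]=[f,g]\cup h+(-1)^{(|f|+1)|g|}g\cup[f,h]$; 2. $i_f:HH_n(A)\to HH_{n-|f|}(A)$ satisfies $i_1=\mathrm{id}$ and $i_{f\cup g}=i_f\circ i_g$; 3. $L_f:HH_n(A)\to HH_{n-|f|+1}(A)$ satisfies $L_{[f,g]}=L_f L_g-(-1)^{(|f|+1)(|g|+1)}L_gL_f$;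 4. $B:HH_n(A)\to HH_{n+1}(A)$ satisfies $B^2=0$; 5. $i_{[f,g]}=i_fL_g-(-1)^{|f|(|g|+1)}L_gi_f$, $\;L_{f\cup g}=L_f\, i_g+(-1)^{|f|}i_f\, L_g$, and $L_f=B\,i_f-(-1)^{|f|}i_f\,B$. -/

import Mathlib

universe u v w

/-! ### Sums over decompositions of a word -/

/-- `splitSum F w` is the sum of `F x y` over all decompositions `w = x ++ y`. -/
def splitSum {α : Type u} {M : Type v} [AddCommGroup M] (F : List α → List α → M) : List α → M
  | [] => F [] []
  | a :: w => F [] (a :: w) + splitSum (fun x y => F (a :: x) y) w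

/-- `letterSum F w` is the sum of `F x a y` over all decompositions `w = x ++ a :: y`. -/
def letterSum {α : Type u} {M : Type v} [AddCommGroup M] (F : List α → α → List α → M) :
    List α → M
  | [] => 0
  | a :: w => F [] a w + letterSum (fun x b y => F (a :: x) b y) w

section sums

variable {α : Type u} {k : Type w} [Field k] {M : Type v} [AddCommGroup M] [Module k M]

theorem splitSum_append (F : List α → List α → M) (u : List α) (x : α) (v : List α) :
    splitSum F (u ++ x :: v) = splitSum (fun a b => F a (b ++ x :: v)) u
      + splitSum (fun a b => F (u ++ x :: a) b) v := by
  induction u generalizing F with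
  | nil => simp [splitSum]
  | cons a u ih => simp [splitSum, ih, add_assoc]

theorem letterSum_append (F : List α → α → List α → M) (u : List α) (x : α) (v : List α) :
    letterSum F (u ++ x :: v) = letterSum (fun a l b => F a l (b ++ x :: v)) u
      + (F u x v + letterSum (fun a l b => F (u ++ x :: a) l b) v) := by
  induction u generalizing F with
  | nil => simp [letterSum]
  | cons a u ih => simp [letterSum, ih, add_assoc]

theorem splitSum_lin (c : k) {F G H : List α → List α → M}
    (h : ∀ a b, F a b = c • G a b + H a b) (w : List α) :
    splitSum F w = c • splitSum G w + splitSum H w := by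
  induction w generalizing F G H with
  | nil => simp [splitSum, h]
  | cons a w ih =>
    simp only [splitSum, h]
    rw [ih (G := fun x y => G (a :: x) y) (H := fun x y => H (a :: x) y) (fun x y => by rfl)]
    rw [smul_add]; abel

theorem letterSum_lin (c : k) {F G H : List α → α → List α → M}
    (h : ∀ a l b, F a l b = c • G a l b + H a l b) (w : List α) :
    letterSum F w = c • letterSum G w + letterSum H w := by
  induction w generalizing F G H with
  | nil => simp [letterSum]
  | cons a w ih =>
    simp only [letterSum, h]
    rw [ih (G := fun x l y => G (a :: x) l y) (H := fun x l y => H (a :: x) l y)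
      (fun x l y => by rfl)]
    rw [smul_add]; abel

theorem splitSum_congr {F G : List α → List α → M} (h : ∀ a b, F a b = G a b) (w : List α) :
    splitSum F w = splitSum G w := by
  have : F = G := by funext a b; exact h a b
  rw [this]

theorem letterSum_congr {F G : List α → α → List α → M} (h : ∀ a l b, F a l b = G a l b)
    (w : List α) : letterSum F w = letterSum G w := by
  have : F = G := by funext a l b; exact h a l b
  rw [this]

theorem splitSum_slot (c : k) {F : List α → List α → M} {u v : List α} {x y z : α}
    (h1 : ∀ a b, F a (b ++ x :: v) = c • F a (b ++ y :: v) + F a (b ++ z :: v))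
    (h2 : ∀ a b, F (u ++ x :: a) b = c • F (u ++ y :: a) b + F (u ++ z :: a) b) :
    splitSum F (u ++ x :: v) = c • splitSum F (u ++ y :: v) + splitSum F (u ++ z :: v) := by
  simp only [splitSum_append]
  rw [splitSum_lin c h1, splitSum_lin c h2, smul_add]; abel

theorem letterSum_slot (c : k) {F : List α → α → List α → M} {u v : List α} {x y z : α}
    (h1 : ∀ a l b, F a l (b ++ x :: v) = c • F a l (b ++ y :: v) + F a l (b ++ z :: v))
    (h2 : F u x v = c • F u y v + F u z v)
    (h3 : ∀ a l b, F (u ++ x :: a) l b = c • F (u ++ y :: a) l b + F (u ++ z :: a) l b) :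
    letterSum F (u ++ x :: v) = c • letterSum F (u ++ y :: v) + letterSum F (u ++ z :: v) := by
  simp only [letterSum_append]
  rw [letterSum_lin c h1, letterSum_lin c h3, h2]; simp only [smul_add]; abel

theorem splitSum_pair {F : List α → List α → M} {u v : List α} {x y x' y' : α}
    (h1 : ∀ a b, F a (b ++ x :: y :: v) = F a (b ++ x' :: y' :: v))
    (h2 : F (u ++ [x]) (y :: v) = F (u ++ [x']) (y' :: v))
    (h3 : ∀ a b, F (u ++ x :: y :: a) b = F (u ++ x' :: y' :: a) b) :
    splitSum F (u ++ x :: y :: v) = splitSum F (u ++ x' :: y' :: v) := by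
  simp only [splitSum_append, splitSum]
  rw [splitSum_congr h1, splitSum_congr h3, h2]

theorem letterSum_pair {F : List α → α → List α → M} {u v : List α} {x y x' y' : α}
    (h1 : ∀ a l b, F a l (b ++ x :: y :: v) = F a l (b ++ x' :: y' :: v))
    (h2 : F u x (y :: v) + F (u ++ [x]) y v = F u x' (y' :: v) + F (u ++ [x']) y' v)
    (h3 : ∀ a l b, F (u ++ x :: y :: a) l b = F (u ++ x' :: y' :: a) l b) :
    letterSum F (u ++ x :: y :: v) = letterSum F (u ++ x' :: y' :: v) := by
  simp only [letterSum_append, letterSum]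
  rw [letterSum_congr h1, letterSum_congr h3, ← add_assoc (F u x (y :: v)), h2, add_assoc]

theorem splitSum_last {F G : List α → List α → M} {u : List α} {x y : α}
    (h1 : ∀ a b, F a (b ++ [x]) = G a (b ++ [y])) (h2 : F (u ++ [x]) [] = G (u ++ [y]) []) :
    splitSum F (u ++ [x]) = splitSum G (u ++ [y]) := by
  simp only [splitSum_append, splitSum]
  rw [splitSum_congr h1, h2]

theorem letterSum_last {F G : List α → α → List α → M} {u : List α} {x y : α}
    (h1 : ∀ a l b, F a l (b ++ [x]) = G a l (b ++ [y])) (h2 : F u x [] = G u y []) :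
    letterSum F (u ++ [x]) = letterSum G (u ++ [y]) := by
  simp only [letterSum_append, letterSum]
  rw [letterSum_congr h1, h2]

end sums

/-! ### Augmented dg `K`-rings, `K = k^t` -/

/-- An augmented dg `K`-ring over `K = k^t`: a `ℤ`-graded `k`-algebra `A` with a (not necessarily
central) unit map `K → A`, a differential of (lower) degree `-1` and an augmentation `A → K`. -/
structure AugDGRing (k : Type u) [Field k] (t : ℕ) where
  /-- the underlying space -/
  carrier : Type v
  [ring : Ring carrier]
  [algebra : Algebra k carrier]
  /-- the homogeneous components, in lower grading -/
  gr : ℤ → Submodule k carrier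
  internal : DirectSum.IsInternal gr
  mul_mem : ∀ {p q : ℤ} {x y : carrier}, x ∈ gr p → y ∈ gr q → x * y ∈ gr (p + q)
  /-- the unit `η : K → A` -/
  η : (Fin t → k) →ₐ[k] carrier
  η_mem : ∀ κ, η κ ∈ gr 0
  /-- the differential -/
  d : carrier →ₗ[k] carrier
  d_mem : ∀ {p : ℤ} {x : carrier}, x ∈ gr p → d x ∈ gr (p - 1)
  d_d : ∀ x, d (d x) = 0
  d_mul : ∀ {p : ℤ} {x : carrier}, x ∈ gr p → ∀ y, d (x * y) = d x * y + p.negOnePow • (x * d y)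
  d_η : ∀ κ, d (η κ) = 0
  /-- the augmentation `ε : A → K` -/
  aug : carrier →ₐ[k] (Fin t → k)
  aug_gr : ∀ {p : ℤ} {x : carrier}, x ∈ gr p → p ≠ 0 → aug x = 0
  aug_d : ∀ x, aug (d x) = 0
  aug_η : ∀ κ, aug (η κ) = κ

/-- A graded Gerstenhaber algebra `(G^•, ·, [-,-])` over `k`. The index is the upper degree; the
operations take a proof of the equation between the degrees involved. -/
structure GerstenhaberAlgebra (k : Type u) [Field k] (G : ℤ → Type v)
    [∀ p, AddCommGroup (G p)] [∀ p, Module k (G p)] where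
  mul : ∀ {p q r : ℤ}, p + q = r → G p →ₗ[k] G q →ₗ[k] G r
  one : G 0
  bracket : ∀ {p q r : ℤ}, p + q - 1 = r → G p →ₗ[k] G q →ₗ[k] G r
  one_mul : ∀ {p : ℤ} (h : 0 + p = p) (a : G p), mul h one a = a
  mul_one : ∀ {p : ℤ} (h : p + 0 = p) (a : G p), mul h a one = a
  mul_assoc : ∀ {p q r pq qr s : ℤ} (h₁ : p + q = pq) (h₂ : pq + r = s) (h₃ : q + r = qr)
    (h₄ : p + qr = s) (a : G p) (b : G q) (c : G r),
    mul h₂ (mul h₁ a b) c = mul h₄ a (mul h₃ b c)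
  mul_comm : ∀ {p q r : ℤ} (h : p + q = r) (h' : q + p = r) (a : G p) (b : G q),
    mul h a b = (p * q).negOnePow • mul h' b a
  bracket_antisymm : ∀ {p q r : ℤ} (h : p + q - 1 = r) (h' : q + p - 1 = r) (a : G p) (b : G q),
    bracket h a b = -(((p + 1) * (q + 1)).negOnePow • bracket h' b a)
  jacobi : ∀ {p q r pq qr rp s : ℤ} (h₁ : p + q - 1 = pq) (h₁' : pq + r - 1 = s)
    (h₂ : q + r - 1 = qr) (h₂' : qr + p - 1 = s) (h₃ : r + p - 1 = rp) (h₃' : rp + q - 1 = s)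
    (a : G p) (b : G q) (c : G r),
    ((p + 1) * (r + 1)).negOnePow • bracket h₁' (bracket h₁ a b) c
      + ((q + 1) * (p + 1)).negOnePow • bracket h₂' (bracket h₂ b c) a
      + ((r + 1) * (q + 1)).negOnePow • bracket h₃' (bracket h₃ c a) b = 0
  leibniz : ∀ {p q r qr pq pr s : ℤ} (h₁ : q + r = qr) (h₁' : p + qr - 1 = s)
    (h₂ : p + q - 1 = pq) (h₂' : pq + r = s) (h₃ : p + r - 1 = pr) (h₃' : q + pr = s)
    (a : G p) (b : G q) (c : G r),
    bracket h₁' a (mul h₁ b c) = mul h₂' (bracket h₂ a b) c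
      + ((p + 1) * q).negOnePow • mul h₃' b (bracket h₃ a c)

/-- A Tamarkin–Tsygan calculus `(G^•, M^•, d)`. Elements of `G p` act on `M` through `i` and `L`,
by operators of degree `-p` and `-p + 1`, so that it is `M^{-•}` that is a graded module over
`G^•` and a graded Lie module over `G^{• + 1}`. Commutators are graded commutators. -/
structure Calculus (k : Type u) [Field k] (G : ℤ → Type v) (M : ℤ → Type w)
    [∀ p, AddCommGroup (G p)] [∀ p, Module k (G p)]
    [∀ n, AddCommGroup (M n)] [∀ n, Module k (M n)] extends GerstenhaberAlgebra k G where
  i : ∀ {p m n : ℤ}, m - p = n → G p →ₗ[k] M m →ₗ[k] M n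
  L : ∀ {p m n : ℤ}, m - p + 1 = n → G p →ₗ[k] M m →ₗ[k] M n
  d : ∀ {m n : ℤ}, m + 1 = n → M m →ₗ[k] M n
  i_one : ∀ {m : ℤ} (h : m - 0 = m) (x : M m), i h one x = x
  i_mul : ∀ {p q pq m m' n : ℤ} (h : p + q = pq) (h₁ : m - pq = n) (h₂ : m - q = m')
    (h₃ : m' - p = n) (a : G p) (b : G q) (x : M m),
    i h₁ (mul h a b) x = i h₃ a (i h₂ b x)
  L_bracket : ∀ {p q pq m m₁ m₂ n : ℤ} (h : p + q - 1 = pq) (h₀ : m - pq + 1 = n)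
    (h₁ : m - q + 1 = m₁) (h₁' : m₁ - p + 1 = n) (h₂ : m - p + 1 = m₂) (h₂' : m₂ - q + 1 = n)
    (a : G p) (b : G q) (x : M m),
    L h₀ (bracket h a b) x = L h₁' a (L h₁ b x)
      - ((p + 1) * (q + 1)).negOnePow • L h₂' b (L h₂ a x)
  d_d : ∀ {m m' n : ℤ} (h : m + 1 = m') (h' : m' + 1 = n) (x : M m), d h' (d h x) = 0
  i_bracket : ∀ {p q pq m m₁ m₂ n : ℤ} (h : p + q - 1 = pq) (h₀ : m - pq = n)
    (h₁ : m - q + 1 = m₁) (h₁' : m₁ - p = n) (h₂ : m - p = m₂) (h₂' : m₂ - q + 1 = n)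
    (a : G p) (b : G q) (x : M m),
    i h₀ (bracket h a b) x = i h₁' a (L h₁ b x) - (p * (q + 1)).negOnePow • L h₂' b (i h₂ a x)
  L_mul : ∀ {p q pq m m₁ m₂ n : ℤ} (h : p + q = pq) (h₀ : m - pq + 1 = n)
    (h₁ : m - q = m₁) (h₁' : m₁ - p + 1 = n) (h₂ : m - q + 1 = m₂) (h₂' : m₂ - p = n)
    (a : G p) (b : G q) (x : M m),
    L h₀ (mul h a b) x = L h₁' a (i h₁ b x) + p.negOnePow • i h₂' a (L h₂ b x)
  L_eq : ∀ {p m m₁ m₂ n : ℤ} (h₀ : m - p + 1 = n) (h₁ : m - p = m₁) (h₁' : m₁ + 1 = n)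
    (h₂ : m + 1 = m₂) (h₂' : m₂ - p = n) (a : G p) (x : M m),
    L h₀ a x = d h₁' (i h₁ a x) - p.negOnePow • i h₂' a (d h₂ x)

namespace AugDGRing

attribute [instance] AugDGRing.ring AugDGRing.algebra

variable {k : Type u} [Field k] {t : ℕ} (A : AugDGRing.{u, v} k t)

theorem one_mem : (1 : A.carrier) ∈ A.gr 0 := by
  simpa using A.η_mem 1

/-- The homogeneous components of the augmentation ideal `Ā = Ker ε`. -/
def red (p : ℤ) : Submodule k A.carrier := A.gr p ⊓ LinearMap.ker A.aug.toLinearMap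

theorem mem_red {p : ℤ} {x : A.carrier} : x ∈ A.red p ↔ x ∈ A.gr p ∧ A.aug x = 0 := Iff.rfl

theorem η_mul_mem {p : ℤ} (κ : Fin t → k) {x : A.carrier} (h : x ∈ A.gr p) :
    A.η κ * x ∈ A.gr p := by
  simpa using A.mul_mem (A.η_mem κ) h

theorem mul_η_mem {p : ℤ} (κ : Fin t → k) {x : A.carrier} (h : x ∈ A.gr p) :
    x * A.η κ ∈ A.gr p := by
  simpa using A.mul_mem h (A.η_mem κ)

theorem d_η_mul (κ : Fin t → k) (x : A.carrier) : A.d (A.η κ * x) = A.η κ * A.d x := by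
  simp [A.d_mul (A.η_mem κ), A.d_η]

theorem sub_aug_mem {p : ℤ} {x : A.carrier} (h : x ∈ A.gr p) : x - A.η (A.aug x) ∈ A.red p := by
  refine A.mem_red.2 ⟨?_, by simp [A.aug_η]⟩
  by_cases hp : p = 0
  · subst hp
    exact Submodule.sub_mem _ h (A.η_mem _)
  · simpa [A.aug_gr h hp] using h

/-- A homogeneous element of `A`, together with a degree. -/
abbrev Elt := Σ p : ℤ, A.gr p

/-- A homogeneous element of the augmentation ideal `Ā`, together with a degree. -/
abbrev RElt := Σ p : ℤ, A.red p

variable {A}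

namespace RElt

/-- `κ x` for `κ ∈ K` and `x ∈ Ā`. -/
def lmul (κ : Fin t → k) (x : A.RElt) : A.RElt :=
  ⟨x.1, ⟨A.η κ * x.2.1, A.mem_red.2 ⟨A.η_mul_mem κ x.2.2.1, by
    rw [map_mul, (A.mem_red.1 x.2.2).2, mul_zero]⟩⟩⟩

/-- `x κ` for `κ ∈ K` and `x ∈ Ā`. -/
def rmul (x : A.RElt) (κ : Fin t → k) : A.RElt :=
  ⟨x.1, ⟨x.2.1 * A.η κ, A.mem_red.2 ⟨A.mul_η_mem κ x.2.2.1, by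
    rw [map_mul, (A.mem_red.1 x.2.2).2, zero_mul]⟩⟩⟩

/-- The product in `Ā`. -/
def mul (x y : A.RElt) : A.RElt :=
  ⟨x.1 + y.1, ⟨x.2.1 * y.2.1, A.mem_red.2 ⟨A.mul_mem x.2.2.1 y.2.2.1, by
    rw [map_mul, (A.mem_red.1 x.2.2).2, zero_mul]⟩⟩⟩

/-- The differential of `Ā`. -/
def d (x : A.RElt) : A.RElt :=
  ⟨x.1 - 1, ⟨A.d x.2.1, A.mem_red.2 ⟨A.d_mem x.2.2.1, A.aug_d _⟩⟩⟩

/-- The inclusion of `Ā` into `A`. -/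
def toElt (x : A.RElt) : A.Elt := ⟨x.1, ⟨x.2.1, x.2.2.1⟩⟩

end RElt

namespace Elt

/-- `κ a` for `κ ∈ K` and `a ∈ A`. -/
def lmul (κ : Fin t → k) (a : A.Elt) : A.Elt := ⟨a.1, ⟨A.η κ * a.2.1, A.η_mul_mem κ a.2.2⟩⟩

/-- `a κ` for `κ ∈ K` and `a ∈ A`. -/
def rmul (a : A.Elt) (κ : Fin t → k) : A.Elt := ⟨a.1, ⟨a.2.1 * A.η κ, A.mul_η_mem κ a.2.2⟩⟩

/-- The product of `A`. -/
def mul (a b : A.Elt) : A.Elt := ⟨a.1 + b.1, ⟨a.2.1 * b.2.1, A.mul_mem a.2.2 b.2.2⟩⟩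

/-- The differential of `A`. -/
def d (a : A.Elt) : A.Elt := ⟨a.1 - 1, ⟨A.d a.2.1, A.d_mem a.2.2⟩⟩

variable (A) in
/-- The identity of `A`, in degree `0`. -/
def one : A.Elt := ⟨0, ⟨1, A.one_mem⟩⟩

/-- The projection `A → Ā`, `a ↦ a - η (ε a)`, along `A = K ⊕ Ā`. -/
def bar (a : A.Elt) : A.RElt := ⟨a.1, ⟨a.2.1 - A.η (A.aug a.2.1), A.sub_aug_mem a.2.2⟩⟩

end Elt

/-- The degree `∑ (|a_j| + 1)` of `[a_1|⋯|a_n]` in the bar construction. -/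
def sdeg (w : List A.RElt) : ℤ := (w.map fun a => a.1 + 1).sum

/-! ### Hochschild cochains -/

/-- `f` is a graded `K`-bimodule morphism `BA → A` of (lower) degree `q`, where
`BA = ⨁ₙ (sĀ)^{⊗_K n}`: it is given by its values `f [a_1|⋯|a_n]` on homogeneous elements, for all
`n ≥ 0`; it raises degrees by `q`, is `k`-linear in each `a_i` and `K`-balanced, and it respects
the left and the right action of `K`, also on `K = (sĀ)^{⊗_K 0}`, where `f []` is the value
at `1 ∈ K`. -/
structure IsCochain (q : ℤ) (f : List A.RElt → A.carrier) : Prop where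
  mem : ∀ w, f w ∈ A.gr (q + sdeg w)
  slot_lin : ∀ (u v : List A.RElt) (p : ℤ) (c : k) (x y : A.red p),
    f (u ++ ⟨p, c • x + y⟩ :: v) = c • f (u ++ ⟨p, x⟩ :: v) + f (u ++ ⟨p, y⟩ :: v)
  slot_bal : ∀ (u v : List A.RElt) (x y : A.RElt) (κ : Fin t → k),
    f (u ++ x.rmul κ :: y :: v) = f (u ++ x :: y.lmul κ :: v)
  left_lin : ∀ (v : List A.RElt) (x : A.RElt) (κ : Fin t → k),
    f (x.lmul κ :: v) = A.η κ * f (x :: v)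
  right_lin : ∀ (u : List A.RElt) (x : A.RElt) (κ : Fin t → k),
    f (u ++ [x.rmul κ]) = f (u ++ [x]) * A.η κ
  nil_comm : ∀ κ : Fin t → k, A.η κ * f [] = f [] * A.η κ

variable (A) in
/-- The component of (lower) degree `q` of the Hochschild cochain complex
`C^•(A) = Hom_{K^e}(BA, A)`. -/
def Cochain (q : ℤ) : Submodule k (List A.RElt → A.carrier) where
  carrier := {f | IsCochain q f}
  zero_mem' := by
    constructor <;> intros <;> simp
  add_mem' := by
    intro f g hf hg
    constructor <;> intros <;> simp only [Pi.add_apply]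
    · exact Submodule.add_mem _ (hf.mem _) (hg.mem _)
    · rw [hf.slot_lin, hg.slot_lin, smul_add]; abel
    · rw [hf.slot_bal, hg.slot_bal]
    · rw [hf.left_lin, hg.left_lin, mul_add]
    · rw [hf.right_lin, hg.right_lin, add_mul]
    · rw [mul_add, add_mul, hf.nil_comm, hg.nil_comm]
  smul_mem' := by
    intro e f hf
    constructor <;> intros <;> simp only [Pi.smul_apply]
    · exact Submodule.smul_mem _ _ (hf.mem _)
    · rw [hf.slot_lin, smul_add, smul_comm]
    · rw [hf.slot_bal]
    · rw [hf.left_lin, mul_smul_comm]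
    · rw [hf.right_lin, smul_mul_assoc]
    · rw [mul_smul_comm, smul_mul_assoc, hf.nil_comm]

/-- The homogeneous element `f [a_1|⋯|a_n]` of `A`. -/
def cval {q : ℤ} (f : A.Cochain q) (w : List A.RElt) : A.Elt :=
  ⟨q + sdeg w, ⟨f.1 w, f.2.mem w⟩⟩

/-- The component in `Ā` of the homogeneous element `f [a_1|⋯|a_n]` of `A`. -/
def ins {q : ℤ} (f : A.Cochain q) (w : List A.RElt) : A.RElt := (cval f w).bar

/-- The inner differential `δ₀` on cochains of degree `q`. -/
def delta₀ (q : ℤ) (f : List A.RElt → A.carrier) (w : List A.RElt) : A.carrier :=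
  A.d (f w) + letterSum (fun x a y => (sdeg x + q).negOnePow • f (x ++ a.d :: y)) w

/-- The external differential `δ₁` on cochains of degree `q`. -/
def delta₁ (q : ℤ) (f : List A.RElt → A.carrier) (w : List A.RElt) : A.carrier :=
  (match w with
    | [] => 0
    | a :: y => (q * (a.1 + 1)).negOnePow • (a.2.1 * f y))
  + letterSum (fun x a z => match z with
    | [] => 0
    | b :: y => (q + (sdeg x + (a.1 + 1))).negOnePow • f (x ++ a.mul b :: y)) w
  + letterSum (fun x a z => match z with
    | [] => (q + sdeg x + 1).negOnePow • (f x * a.2.1)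
    | _ :: _ => 0) w

/-- The Hochschild differential `δ = δ₀ + δ₁` on cochains of degree `q`. -/
def delta (q : ℤ) (f : List A.RElt → A.carrier) (w : List A.RElt) : A.carrier :=
  delta₀ q f w + delta₁ q f w

/-- The cup product `f ∪ g`, where `g` has degree `r`. -/
def cup (f : List A.RElt → A.carrier) (r : ℤ) (g : List A.RElt → A.carrier) (w : List A.RElt) :
    A.carrier :=
  splitSum (fun x y => (r * sdeg x).negOnePow • (f x * g y)) w

/-- The circle product `f ∘ g`, where `g` has degree `r`. -/
def circ (f : List A.RElt → A.carrier) {r : ℤ} (g : A.Cochain r) (w : List A.RElt) : A.carrier :=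
  splitSum (fun x z => splitSum (fun y v =>
    (sdeg x * (r + 1)).negOnePow • f (x ++ ins g y :: v)) z) w

/-- The Gerstenhaber bracket `[f, g] = f ∘ g - (-1)^{(|f|+1)(|g|+1)} g ∘ f`. -/
def gbracket {q r : ℤ} (f : A.Cochain q) (g : A.Cochain r) : List A.RElt → A.carrier :=
  circ f.1 g - ((q + 1) * (r + 1)).negOnePow • circ g.1 f

variable (A) in
/-- The unit cochain `BA → K → A`. -/
def unitCochain (w : List A.RElt) : A.carrier :=
  match w with
  | [] => 1
  | _ :: _ => 0

/-! ### Hochschild chains -/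

/-- A function of a homogeneous `a_0 ∈ A` and of homogeneous `a_1, …, a_n ∈ Ā` (for all `n ≥ 0`) is
admissible if it is `k`-linear in each argument and `K`-balanced, cyclically: it corresponds to
a `k`-linear map on `⨁ₙ A ⊗_{K^e} (sĀ)^{⊗_K n}`. -/
structure IsAdmissible {M : Type w} [AddCommGroup M] [Module k M]
    (ψ : A.Elt → List A.RElt → M) : Prop where
  head_lin : ∀ (p : ℤ) (c : k) (x y : A.gr p) (v : List A.RElt),
    ψ ⟨p, c • x + y⟩ v = c • ψ ⟨p, x⟩ v + ψ ⟨p, y⟩ v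
  slot_lin : ∀ (a : A.Elt) (u v : List A.RElt) (p : ℤ) (c : k) (x y : A.red p),
    ψ a (u ++ ⟨p, c • x + y⟩ :: v) = c • ψ a (u ++ ⟨p, x⟩ :: v) + ψ a (u ++ ⟨p, y⟩ :: v)
  head_bal : ∀ (a : A.Elt) (x : A.RElt) (v : List A.RElt) (κ : Fin t → k),
    ψ (a.rmul κ) (x :: v) = ψ a (x.lmul κ :: v)
  slot_bal : ∀ (a : A.Elt) (u v : List A.RElt) (x y : A.RElt) (κ : Fin t → k),
    ψ a (u ++ x.rmul κ :: y :: v) = ψ a (u ++ x :: y.lmul κ :: v)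
  last_bal : ∀ (a : A.Elt) (u : List A.RElt) (x : A.RElt) (κ : Fin t → k),
    ψ a (u ++ [x.rmul κ]) = ψ (a.lmul κ) (u ++ [x])
  nil_bal : ∀ (a : A.Elt) (κ : Fin t → k), ψ (a.rmul κ) [] = ψ (a.lmul κ) []

variable (A) in
/-- The free vector space on the symbols `a_0 ⊗ [a_1|⋯|a_n]`. -/
abbrev FreeChain := (A.Elt × List A.RElt) →₀ k

variable (A) in
/-- The symbol `a_0 ⊗ [a_1|⋯|a_n]` as an element of the free vector space. -/
noncomputable def symb (a : A.Elt) (w : List A.RElt) : A.FreeChain := Finsupp.single (a, w) 1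

variable (A) in
/-- The defining relations of `⨁ₙ A ⊗_{K^e} (sĀ)^{⊗_K n}`. -/
inductive Rel : A.FreeChain → Prop
  | head_lin (p : ℤ) (c : k) (x y : A.gr p) (v : List A.RElt) :
    Rel (symb A ⟨p, c • x + y⟩ v - (c • symb A ⟨p, x⟩ v + symb A ⟨p, y⟩ v))
  | slot_lin (a : A.Elt) (u v : List A.RElt) (p : ℤ) (c : k) (x y : A.red p) :
    Rel (symb A a (u ++ ⟨p, c • x + y⟩ :: v)
      - (c • symb A a (u ++ ⟨p, x⟩ :: v) + symb A a (u ++ ⟨p, y⟩ :: v)))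
  | head_bal (a : A.Elt) (x : A.RElt) (v : List A.RElt) (κ : Fin t → k) :
    Rel (symb A (a.rmul κ) (x :: v) - symb A a (x.lmul κ :: v))
  | slot_bal (a : A.Elt) (u v : List A.RElt) (x y : A.RElt) (κ : Fin t → k) :
    Rel (symb A a (u ++ x.rmul κ :: y :: v) - symb A a (u ++ x :: y.lmul κ :: v))
  | last_bal (a : A.Elt) (u : List A.RElt) (x : A.RElt) (κ : Fin t → k) :
    Rel (symb A a (u ++ [x.rmul κ]) - symb A (a.lmul κ) (u ++ [x]))
  | nil_bal (a : A.Elt) (κ : Fin t → k) :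
    Rel (symb A (a.rmul κ) [] - symb A (a.lmul κ) [])

variable (A) in
/-- The Hochschild chains `C_•(A) = A ⊗_{K^e} BA = ⨁ₙ A ⊗_{K^e} (sĀ)^{⊗_K n}`. -/
abbrev Chain : Type _ := A.FreeChain ⧸ Submodule.span k {r | Rel A r}

/-- The Hochschild chain `a_0 ⊗ [a_1|⋯|a_n]`. -/
noncomputable def gen (a : A.Elt) (w : List A.RElt) : A.Chain :=
  Submodule.Quotient.mk (symb A a w)

theorem gen_admissible : IsAdmissible (gen (A := A)) := by
  constructor <;> intros <;> unfold gen <;>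
    (try simp only [← Submodule.Quotient.mk_smul, ← Submodule.Quotient.mk_add]) <;>
    rw [Submodule.Quotient.eq] <;> apply Submodule.subset_span
  · exact Rel.head_lin ..
  · exact Rel.slot_lin ..
  · exact Rel.head_bal ..
  · exact Rel.slot_bal ..
  · exact Rel.last_bal ..
  · exact Rel.nil_bal ..

/-- The linear map on Hochschild chains that an admissible function defines. -/
noncomputable def chainLift {M : Type w} [AddCommGroup M] [Module k M]
    (ψ : A.Elt → List A.RElt → M) (h : IsAdmissible ψ) : A.Chain →ₗ[k] M :=
  Submodule.liftQ _ (Finsupp.linearCombination k fun s : A.Elt × List A.RElt => ψ s.1 s.2) <| by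
    rw [Submodule.span_le]
    intro r hr
    cases hr <;> simp only [SetLike.mem_coe, LinearMap.mem_ker, map_sub, map_add, map_smul, symb,
      Finsupp.linearCombination_single, one_smul, sub_eq_zero]
    · exact h.head_lin ..
    · exact h.slot_lin ..
    · exact h.head_bal ..
    · exact h.slot_bal ..
    · exact h.last_bal ..
    · exact h.nil_bal ..

theorem chainLift_gen {M : Type w} [AddCommGroup M] [Module k M]
    (ψ : A.Elt → List A.RElt → M) (h : IsAdmissible ψ) (a : A.Elt) (w : List A.RElt) :
    chainLift ψ h (gen a w) = ψ a w := by
  simp [chainLift, gen, symb]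

variable (A) in
/-- The chains of degree `n`, where `a_0 ⊗ [a_1|⋯|a_n]` has degree `|a_0| + ∑ (|a_j| + 1)`. -/
noncomputable def chainDeg (n : ℤ) : Submodule k A.Chain :=
  Submodule.span k {c | ∃ (a : A.Elt) (w : List A.RElt), a.1 + sdeg w = n ∧ c = gen a w}

/-- `η_i = ∑_{j=0}^i (|a_j| + 1)`, where `x = [a_1|⋯|a_i]`. -/
def eta (a : A.Elt) (x : List A.RElt) : ℤ := (a.1 + 1) + sdeg x

/-- The inner differential `b₀` on generators. -/
noncomputable def bFun₀ (a : A.Elt) (w : List A.RElt) : A.Chain :=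
  gen a.d w + letterSum (fun x c y => (eta a x).negOnePow • gen a (x ++ c.d :: y)) w

/-- The external differential `b₁` on generators. -/
noncomputable def bFun₁ (a : A.Elt) (w : List A.RElt) : A.Chain :=
  (match w with
    | [] => 0
    | c :: y => (a.1 + 1).negOnePow • gen (a.mul c.toElt) y)
  + letterSum (fun x c z => match z with
    | [] => 0
    | e :: y => (eta a x + (c.1 + 1)).negOnePow • gen a (x ++ c.mul e :: y)) w
  + letterSum (fun x c z => match z with
    | [] => ((eta a x + 1) * (c.1 + 1)).negOnePow • gen (c.toElt.mul a) x
    | _ :: _ => 0) w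

/-- The Connes operator on generators. In the term of the decomposition `w = x y` with
`x = [a_1|⋯|a_i]`, one has `η_i = eta a x` and `η_n - η_i = sdeg y`. -/
noncomputable def connesFun (a : A.Elt) (w : List A.RElt) : A.Chain :=
  splitSum (fun x y => (eta a x * sdeg y).negOnePow •
    gen (Elt.one A) (y ++ a.bar :: x)) w

/-- The operator `i_f` on generators. -/
noncomputable def iFun {q : ℤ} (f : A.Cochain q) (a : A.Elt) (w : List A.RElt) : A.Chain :=
  splitSum (fun x y => (a.1 * q).negOnePow • gen (a.mul (cval f x)) y) w

/-- The operator `L_f` on generators. In the first sum `w = x y v` and the letters in `y` are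
inserted into `f`; in the second sum `w = x y z` and `f` is applied to
`[z|a_0|x]`; there `η_i = eta a (x y)` and `η_n - η_i = sdeg z`. -/
noncomputable def LFun {q : ℤ} (f : A.Cochain q) (a : A.Elt) (w : List A.RElt) : A.Chain :=
  splitSum (fun x z => splitSum (fun y v =>
    ((eta a x + 1) * (q + 1)).negOnePow • gen a (x ++ ins f y :: v)) z) w
  + splitSum (fun s z => splitSum (fun x y =>
    (sdeg z * eta a s + q + 1).negOnePow • gen (cval f (z ++ a.bar :: x)) y) s) w

/-! ### The operators descend to chains -/

section descend

theorem Elt.ext' {a b : A.Elt} (h : a.1 = b.1) (h' : a.2.1 = b.2.1) : a = b := by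
  obtain ⟨p, x, hx⟩ := a
  obtain ⟨q, y, hy⟩ := b
  obtain rfl : p = q := h
  obtain rfl : x = y := h'
  rfl

theorem RElt.ext' {a b : A.RElt} (h : a.1 = b.1) (h' : a.2.1 = b.2.1) : a = b := by
  obtain ⟨p, x, hx⟩ := a
  obtain ⟨q, y, hy⟩ := b
  obtain rfl : p = q := h
  obtain rfl : x = y := h'
  rfl

theorem gen_head (c : k) {X Y Z : A.Elt} (h1 : Y.1 = X.1) (h2 : Z.1 = X.1)
    (h : X.2.1 = c • Y.2.1 + Z.2.1) (w : List A.RElt) :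
    gen X w = c • gen Y w + gen Z w := by
  obtain ⟨p, y, hy⟩ := Y
  obtain ⟨q, z, hz⟩ := Z
  obtain rfl : q = p := h2.trans h1.symm
  rw [← gen_admissible.head_lin]
  exact congrArg (fun X => gen X w) (Elt.ext' h1.symm h)

theorem gen_slot (c : k) {X Y Z : A.RElt} (h1 : Y.1 = X.1) (h2 : Z.1 = X.1)
    (h : X.2.1 = c • Y.2.1 + Z.2.1) (a : A.Elt) (u v : List A.RElt) :
    gen a (u ++ X :: v) = c • gen a (u ++ Y :: v) + gen a (u ++ Z :: v) := by
  obtain ⟨p, y, hy⟩ := Y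
  obtain ⟨q, z, hz⟩ := Z
  obtain rfl : q = p := h2.trans h1.symm
  rw [← gen_admissible.slot_lin]
  exact congrArg (fun X => gen a (u ++ X :: v)) (RElt.ext' h1.symm h)

theorem sign_lin {M : Type w} [AddCommGroup M] [Module k M] (e : ℤˣ) (c : k) {X Y Z : M}
    (h : X = c • Y + Z) : e • X = c • e • Y + e • Z := by
  rw [h, smul_add, smul_comm]

theorem IsAdmissible.add {M : Type w} [AddCommGroup M] [Module k M]
    {ψ φ : A.Elt → List A.RElt → M} (h : IsAdmissible ψ) (h' : IsAdmissible φ) :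
    IsAdmissible (fun a w => ψ a w + φ a w) := by
  constructor <;> intros
  · rw [h.head_lin, h'.head_lin, smul_add]; abel
  · rw [h.slot_lin, h'.slot_lin, smul_add]; abel
  · rw [h.head_bal, h'.head_bal]
  · rw [h.slot_bal, h'.slot_bal]
  · rw [h.last_bal, h'.last_bal]
  · rw [h.nil_bal, h'.nil_bal]

@[simp] theorem RElt.lmul_fst (κ : Fin t → k) (x : A.RElt) : (x.lmul κ).1 = x.1 := rfl
@[simp] theorem RElt.rmul_fst (κ : Fin t → k) (x : A.RElt) : (x.rmul κ).1 = x.1 := rfl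
@[simp] theorem RElt.mul_fst (x y : A.RElt) : (x.mul y).1 = x.1 + y.1 := rfl
@[simp] theorem RElt.d_fst (x : A.RElt) : x.d.1 = x.1 - 1 := rfl
@[simp] theorem RElt.toElt_fst (x : A.RElt) : x.toElt.1 = x.1 := rfl
@[simp] theorem Elt.lmul_fst (κ : Fin t → k) (x : A.Elt) : (x.lmul κ).1 = x.1 := rfl
@[simp] theorem Elt.rmul_fst (κ : Fin t → k) (x : A.Elt) : (x.rmul κ).1 = x.1 := rfl
@[simp] theorem Elt.mul_fst (x y : A.Elt) : (x.mul y).1 = x.1 + y.1 := rfl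
@[simp] theorem Elt.d_fst (x : A.Elt) : x.d.1 = x.1 - 1 := rfl
@[simp] theorem Elt.bar_fst (x : A.Elt) : x.bar.1 = x.1 := rfl
@[simp] theorem cval_fst {q : ℤ} (f : A.Cochain q) (w : List A.RElt) :
    (cval f w).1 = q + sdeg w := rfl
@[simp] theorem ins_fst {q : ℤ} (f : A.Cochain q) (w : List A.RElt) :
    (ins f w).1 = q + sdeg w := rfl
@[simp] theorem sdeg_nil : sdeg ([] : List A.RElt) = 0 := rfl
@[simp] theorem sdeg_cons (x : A.RElt) (w : List A.RElt) :
    sdeg (x :: w) = (x.1 + 1) + sdeg w := rfl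
@[simp] theorem sdeg_append (u v : List A.RElt) : sdeg (u ++ v) = sdeg u + sdeg v := by
  simp [sdeg]

theorem bar_lmul (κ : Fin t → k) (a : A.Elt) : (a.lmul κ).bar = a.bar.lmul κ :=
  RElt.ext' rfl (by
    show A.η κ * a.2.1 - A.η (A.aug (A.η κ * a.2.1)) = A.η κ * (a.2.1 - A.η (A.aug a.2.1))
    simp [A.aug_η, mul_sub])

theorem bar_rmul (κ : Fin t → k) (a : A.Elt) : (a.rmul κ).bar = a.bar.rmul κ :=
  RElt.ext' rfl (by
    show a.2.1 * A.η κ - A.η (A.aug (a.2.1 * A.η κ)) = (a.2.1 - A.η (A.aug a.2.1)) * A.η κ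
    simp [A.aug_η, sub_mul])

theorem bar_lin (c : k) {X Y Z : A.Elt} (h : X.2.1 = c • Y.2.1 + Z.2.1) :
    X.bar.2.1 = c • Y.bar.2.1 + Z.bar.2.1 := by
  show X.2.1 - A.η (A.aug X.2.1) = c • (Y.2.1 - A.η (A.aug Y.2.1)) + (Z.2.1 - A.η (A.aug Z.2.1))
  rw [h]; simp only [map_add, map_smul, smul_sub]; abel

theorem one_lmul (κ : Fin t → k) : (Elt.one A).lmul κ = (Elt.one A).rmul κ :=
  Elt.ext' rfl (by show A.η κ * 1 = 1 * A.η κ; simp)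

theorem gen_last (a : A.Elt) (u : List A.RElt) (x : A.RElt) (κ : Fin t → k) :
    gen a (u ++ [x.rmul κ]) = gen (a.lmul κ) (u ++ [x]) := gen_admissible.last_bal ..

theorem gen_pair (a : A.Elt) (u v : List A.RElt) (x y : A.RElt) (κ : Fin t → k) :
    gen a (u ++ x.rmul κ :: y :: v) = gen a (u ++ x :: y.lmul κ :: v) :=
  gen_admissible.slot_bal ..

theorem gen_cons (a : A.Elt) (x : A.RElt) (v : List A.RElt) (κ : Fin t → k) :
    gen (a.rmul κ) (x :: v) = gen a (x.lmul κ :: v) := gen_admissible.head_bal ..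

theorem gen_nil (a : A.Elt) (κ : Fin t → k) :
    gen (a.rmul κ) [] = gen (a.lmul κ) [] := gen_admissible.nil_bal ..

section

variable {q : ℤ} (f : A.Cochain q)

theorem cval_lin (u v : List A.RElt) (p : ℤ) (c : k) (x y : A.red p) :
    (cval f (u ++ ⟨p, c • x + y⟩ :: v)).2.1
      = c • (cval f (u ++ ⟨p, x⟩ :: v)).2.1 + (cval f (u ++ ⟨p, y⟩ :: v)).2.1 :=
  f.2.slot_lin ..

theorem cval_pair (u v : List A.RElt) (x y : A.RElt) (κ : Fin t → k) :
    cval f (u ++ x.rmul κ :: y :: v) = cval f (u ++ x :: y.lmul κ :: v) :=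
  Elt.ext' (by simp) (f.2.slot_bal ..)

theorem cval_cons (v : List A.RElt) (x : A.RElt) (κ : Fin t → k) :
    cval f (x.lmul κ :: v) = (cval f (x :: v)).lmul κ := Elt.ext' (by simp) (f.2.left_lin ..)

theorem cval_last (u : List A.RElt) (x : A.RElt) (κ : Fin t → k) :
    cval f (u ++ [x.rmul κ]) = (cval f (u ++ [x])).rmul κ := Elt.ext' (by simp) (f.2.right_lin ..)

theorem cval_nil (κ : Fin t → k) : (cval f []).lmul κ = (cval f []).rmul κ :=
  Elt.ext' (by simp) (f.2.nil_comm κ)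

theorem ins_lin (u v : List A.RElt) (p : ℤ) (c : k) (x y : A.red p) :
    (ins f (u ++ ⟨p, c • x + y⟩ :: v)).2.1
      = c • (ins f (u ++ ⟨p, x⟩ :: v)).2.1 + (ins f (u ++ ⟨p, y⟩ :: v)).2.1 :=
  bar_lin c (cval_lin ..)

theorem ins_pair (u v : List A.RElt) (x y : A.RElt) (κ : Fin t → k) :
    ins f (u ++ x.rmul κ :: y :: v) = ins f (u ++ x :: y.lmul κ :: v) := by
  simp only [ins, cval_pair]

theorem ins_cons (v : List A.RElt) (x : A.RElt) (κ : Fin t → k) :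
    ins f (x.lmul κ :: v) = (ins f (x :: v)).lmul κ := by
  simp only [ins, cval_cons, bar_lmul]

theorem ins_last (u : List A.RElt) (x : A.RElt) (κ : Fin t → k) :
    ins f (u ++ [x.rmul κ]) = (ins f (u ++ [x])).rmul κ := by
  simp only [ins, cval_last, bar_rmul]

theorem ins_nil (κ : Fin t → k) : (ins f []).lmul κ = (ins f []).rmul κ := by
  simp only [ins, ← bar_lmul, ← bar_rmul, cval_nil]

end

theorem connesFun_admissible : IsAdmissible (connesFun (A := A)) := by
  constructor <;> intros <;> unfold connesFun
  case head_lin p c x y v =>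
    refine splitSum_lin c (fun a b => sign_lin _ c ?_) _
    exact gen_slot c (by rfl) (by rfl) (bar_lin c (by rfl)) _ _ _
  case slot_lin e u v p c x y =>
    refine splitSum_slot c (fun a b => ?_) (fun a b => ?_) <;> simp only [eta, sdeg_append, sdeg_cons]
    · refine sign_lin _ c ?_
      simp only [List.append_assoc, List.cons_append]
      exact gen_slot c (by rfl) (by rfl) (by rfl) _ _ _
    · refine sign_lin _ c ?_
      have := fun X : A.RElt => (List.append_assoc b (e.bar :: u) (X :: a))
      simp only [List.cons_append] at this
      simp only [← this]
      exact gen_slot c (by rfl) (by rfl) (by rfl) _ _ _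
  case head_bal e x v κ =>
    simp only [splitSum, bar_rmul]
    congr 1
    · have := gen_last (Elt.one A) (x :: v) e.bar κ
      simp only [List.cons_append] at this
      simp [eta, this, one_lmul, gen_cons]
    · refine splitSum_congr (fun a b => ?_) _
      simp [eta, gen_pair]
  case slot_bal e u v x y κ =>
    refine splitSum_pair (fun a b => ?_) ?_ (fun a b => ?_)
    · simp [eta, gen_pair]
    · have := gen_last (Elt.one A) (y :: v ++ e.bar :: u) x κ
      simp only [List.append_assoc, List.cons_append] at this
      simp [eta, this, one_lmul, gen_cons]
    · have := gen_pair (Elt.one A) (b ++ e.bar :: u) a x y κ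
      simp only [List.append_assoc, List.cons_append] at this
      simp [eta, this]
  case last_bal e u x κ =>
    refine splitSum_last (fun a b => ?_) ?_
    · simp [eta, gen_pair, bar_lmul]
    · have := gen_last (Elt.one A) (e.bar :: u) x κ
      simp only [List.cons_append] at this
      simp [eta, this, one_lmul, gen_cons, bar_lmul]
  case nil_bal e κ =>
    have := gen_last (Elt.one A) [] e.bar κ
    simp only [List.nil_append] at this
    simp [splitSum, eta, this, one_lmul, gen_cons, bar_lmul, bar_rmul]

theorem iFun_admissible {q : ℤ} (f : A.Cochain q) : IsAdmissible (iFun f) := by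
  have hl : ∀ (a b : A.Elt) κ, (a.rmul κ).mul b = a.mul (b.lmul κ) := fun a b κ =>
    Elt.ext' rfl (mul_assoc ..)
  have hr : ∀ (a b : A.Elt) κ, a.mul (b.rmul κ) = (a.mul b).rmul κ := fun a b κ =>
    Elt.ext' rfl (mul_assoc ..).symm
  have hm : ∀ (a b : A.Elt) κ, (a.lmul κ).mul b = (a.mul b).lmul κ := fun a b κ =>
    Elt.ext' rfl (mul_assoc ..)
  constructor <;> intros <;> unfold iFun
  case head_lin p c x y v =>
    refine splitSum_lin c (fun a b => sign_lin _ c ?_) _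
    refine gen_head c (by rfl) (by rfl) ?_ _
    simp [Elt.mul, add_mul]
  case slot_lin e u v p c x y =>
    refine splitSum_slot c (fun a b => ?_) (fun a b => ?_)
    · exact sign_lin _ c (gen_slot c (by rfl) (by rfl) (by rfl) _ _ _)
    · refine sign_lin _ c (gen_head c (by simp) (by simp) ?_ _)
      simp only [Elt.mul]
      rw [cval_lin, mul_add, mul_smul_comm]
  case head_bal e x v κ =>
    simp only [splitSum, hl]
    congr 1
    · rw [cval_nil, hr, gen_cons]; rfl
    · refine splitSum_congr (fun a b => ?_) _
      rw [cval_cons]; rfl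
  case slot_bal e u v x y κ =>
    refine splitSum_pair (fun a b => ?_) ?_ (fun a b => ?_)
    · rw [gen_pair]
    · rw [cval_last, hr, gen_cons]
    · rw [cval_pair]
  case last_bal e u x κ =>
    refine splitSum_last (fun a b => ?_) ?_
    · rw [gen_last, hm]; rfl
    · rw [cval_last, hr, gen_nil, hm]; rfl
  case nil_bal e κ =>
    simp only [splitSum, hl, cval_nil]
    rw [hr, gen_nil, hm]; rfl

theorem LFun₁_admissible {q : ℤ} (f : A.Cochain q) : IsAdmissible (fun a w =>
    splitSum (fun x z => splitSum (fun y v =>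
      ((eta a x + 1) * (q + 1)).negOnePow • gen a (x ++ ins f y :: v)) z) w) := by
  constructor <;> intros
  case head_lin p c x y v =>
    refine splitSum_lin c (fun a b => splitSum_lin c (fun a' b' => sign_lin _ c ?_) _) _
    exact gen_head c (by rfl) (by rfl) (by rfl) _
  case slot_lin e u v p c x y =>
    refine splitSum_slot c (fun a b => splitSum_slot c (fun a' b' => sign_lin _ c ?_)
      (fun a' b' => sign_lin _ c ?_)) (fun a b => splitSum_lin c (fun a' b' => ?_) _)
    · have := fun X : A.RElt => (List.append_assoc a (ins f a' :: b') (X :: v))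
      simp only [List.cons_append] at this
      simp only [← this]
      exact gen_slot c (by rfl) (by rfl) (by rfl) _ _ _
    · exact gen_slot c (by simp) (by simp) (ins_lin ..) _ _ _
    · simp only [eta, sdeg_append, sdeg_cons]
      refine sign_lin _ c ?_
      simp only [List.append_assoc, List.cons_append]
      exact gen_slot c (by rfl) (by rfl) (by rfl) _ _ _
  case head_bal e x v κ =>
    simp only [splitSum]
    congr 1
    · congr 1
      · have := gen_pair e [] v (ins f []) x κ
        simp only [List.nil_append] at this
        simp [eta, gen_cons, ins_nil, this]
      · exact splitSum_congr (fun a b => by simp [eta, gen_cons, ins_cons]) _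
    · refine splitSum_congr (fun a b => splitSum_congr (fun a' b' => ?_) _) _
      simp [eta, gen_cons]
  case slot_bal e u v x y κ =>
    refine splitSum_pair (fun a b => splitSum_pair (fun a' b' => ?_) ?_ (fun a' b' => ?_)) ?_
      (fun a b => splitSum_congr (fun a' b' => ?_) _)
    · have := gen_pair e (a ++ ins f a' :: b') v x y κ
      simp only [List.append_assoc, List.cons_append] at this
      rw [this]
    · rw [ins_last, gen_pair]
    · rw [ins_pair]
    · simp only [splitSum]
      congr 1
      · have h1 := gen_pair e u (y :: v) x (ins f []) κ
        have h2 := gen_pair e (u ++ [x]) v (ins f []) y κ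
        simp only [List.append_assoc, List.cons_append, List.nil_append] at h1 h2
        simp [eta, h1, ins_nil, h2]
      · refine splitSum_congr (fun a b => ?_) _
        have h1 := gen_pair e u b x (ins f (y :: a)) κ
        simp [eta, h1, ins_cons]
    · have := gen_pair e u (a ++ ins f a' :: b') x y κ
      simp [eta, this]
  case last_bal e u x κ =>
    refine splitSum_last (fun a b => splitSum_last (fun a' b' => ?_) ?_) ?_
    · have := gen_last e (a ++ ins f a' :: b') x κ
      simp only [List.append_assoc, List.cons_append] at this
      simp [eta, this]
    · simp [eta, ins_last, gen_last]
    · have h1 := gen_pair e u [] x (ins f []) κ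
      have h2 := gen_last e (u ++ [x]) (ins f []) κ
      simp only [List.append_assoc, List.cons_append, List.nil_append] at h2
      simp [splitSum, eta, h1, ins_nil, h2]
  case nil_bal e κ =>
    have h2 := gen_last e [] (ins f []) κ
    simp only [List.nil_append] at h2
    simp [splitSum, eta, gen_cons, ins_nil, h2]

theorem LFun₂_admissible {q : ℤ} (f : A.Cochain q) : IsAdmissible (fun a w =>
    splitSum (fun s z => splitSum (fun x y =>
      (sdeg z * eta a s + q + 1).negOnePow • gen (cval f (z ++ a.bar :: x)) y) s) w) := by
  have assoc : ∀ (a b c : List A.RElt) (x : A.RElt),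
      a ++ x :: (b ++ c) = (a ++ x :: b) ++ c := by intros; simp
  have cvl : ∀ (c : k) (X Y Z : A.RElt) (h1 : Y.1 = X.1) (h2 : Z.1 = X.1)
      (h : X.2.1 = c • Y.2.1 + Z.2.1) (u v : List A.RElt),
      (cval f (u ++ X :: v)).2.1 = c • (cval f (u ++ Y :: v)).2.1
        + (cval f (u ++ Z :: v)).2.1 := by
    intro c X Y Z h1 h2 h u v
    obtain ⟨p, y, hy⟩ := Y
    obtain ⟨q, z, hz⟩ := Z
    obtain rfl : q = p := h2.trans h1.symm
    rw [← cval_lin]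
    rw [RElt.ext' (a := X) (b := ⟨q, c • ⟨y, hy⟩ + ⟨z, hz⟩⟩) h1.symm h]
  have last2 : ∀ (u v : List A.RElt) (x y : A.RElt) κ,
      cval f (u ++ y :: (v ++ [x.rmul κ])) = (cval f (u ++ y :: (v ++ [x]))).rmul κ := by
    intro u v x y κ
    rw [assoc, assoc, cval_last]
  constructor <;> intros
  case head_lin p c x y v =>
    refine splitSum_lin c (fun a b => splitSum_lin c (fun a' b' => sign_lin _ c ?_) _) _
    refine gen_head c (by simp) (by simp) ?_ _
    exact cvl c _ _ _ (by rfl) (by rfl) (bar_lin c (by rfl)) _ _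
  case slot_lin e u v p c x y =>
    refine splitSum_slot c (fun a b => splitSum_lin c (fun a' b' => ?_) _) (fun a b => ?_) <;>
      simp only [eta, sdeg_append, sdeg_cons]
    · refine sign_lin _ c ?_
      have key := cvl c (⟨p, c • x + y⟩ : A.RElt) ⟨p, x⟩ ⟨p, y⟩ rfl rfl rfl b (v ++ e.bar :: a')
      simp only [List.append_assoc, List.cons_append]
      exact gen_head c (by simp) (by simp) key _
    · refine splitSum_slot c (fun a' b' => ?_) (fun a' b' => ?_)
      · exact sign_lin _ c (gen_slot c (by rfl) (by rfl) (by rfl) _ _ _)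
      · refine sign_lin _ c ?_
        have key := cvl c (⟨p, c • x + y⟩ : A.RElt) ⟨p, x⟩ ⟨p, y⟩ rfl rfl rfl (b ++ e.bar :: u) a'
        simp only [assoc]
        exact gen_head c (by simp) (by simp) key _
  case head_bal e x v κ =>
    simp only [splitSum, bar_rmul]
    congr 1
    · have := cval_last f (x :: v) e.bar κ
      simp only [List.cons_append] at this
      simp [eta, this, cval_cons, gen_nil]
    · refine splitSum_congr (fun a b => ?_) _
      congr 1
      · have := cval_last f b e.bar κ
        simp [eta, this, gen_cons]
      · refine splitSum_congr (fun a' b' => ?_) _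
        simp [eta, cval_pair]
  case slot_bal e u v x y κ =>
    refine splitSum_pair (fun a b => splitSum_congr (fun a' b' => ?_) _) ?_ (fun a b => ?_)
    · simp [eta, cval_pair]
    · refine splitSum_last (fun a b => ?_) ?_
      · have := cval_cons f (v ++ e.bar :: a) y κ
        simp [eta, gen_last, this]
      · have := cval_cons f (v ++ e.bar :: (u ++ [x])) y κ
        have h := last2 (y :: v) u x e.bar κ
        simp only [List.cons_append] at h
        simp [eta, h, gen_nil, this]
    · simp only [eta, sdeg_append, sdeg_cons, RElt.rmul_fst, RElt.lmul_fst]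
      refine splitSum_pair (fun a' b' => ?_) ?_ (fun a' b' => ?_)
      · simp [gen_pair]
      · simp [last2, gen_cons]
      · have := cval_pair f (b ++ e.bar :: u) a' x y κ
        simp only [List.append_assoc, List.cons_append] at this
        simp [this]
  case last_bal e u x κ =>
    refine splitSum_last (fun a b => splitSum_congr (fun a' b' => ?_) _)
      (splitSum_last (fun a b => ?_) ?_)
    · simp [eta, bar_lmul, cval_pair]
    · have := cval_cons f a e.bar κ
      simp [eta, bar_lmul, gen_last, this]
    · have := cval_cons f (u ++ [x]) e.bar κ
      have h := last2 [] u x e.bar κ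
      simp only [List.nil_append] at h
      simp [eta, bar_lmul, this, h, gen_nil]
  case nil_bal e κ =>
    have := cval_last f [] e.bar κ
    simp only [List.nil_append] at this
    simp [splitSum, eta, bar_lmul, bar_rmul, this, cval_cons, gen_nil]

theorem LFun_admissible {q : ℤ} (f : A.Cochain q) : IsAdmissible (LFun f) :=
  (LFun₁_admissible f).add (LFun₂_admissible f)

theorem bFun₀_admissible : IsAdmissible (bFun₀ (A := A)) := by
  have rd : ∀ (x : A.RElt) κ, (x.rmul κ).d = x.d.rmul κ := fun x κ => RElt.ext' rfl (by
    show A.d (x.2.1 * A.η κ) = A.d x.2.1 * A.η κ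
    simp [A.d_mul x.2.2.1, A.d_η])
  have ld : ∀ (x : A.RElt) κ, (x.lmul κ).d = x.d.lmul κ := fun x κ => RElt.ext' rfl
    (A.d_η_mul ..)
  have rd' : ∀ (x : A.Elt) κ, (x.rmul κ).d = x.d.rmul κ := fun x κ => Elt.ext' rfl (by
    show A.d (x.2.1 * A.η κ) = A.d x.2.1 * A.η κ
    simp [A.d_mul x.2.2, A.d_η])
  have ld' : ∀ (x : A.Elt) κ, (x.lmul κ).d = x.d.lmul κ := fun x κ => Elt.ext' rfl
    (A.d_η_mul ..)
  refine IsAdmissible.add ?_ ?_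
  · constructor <;> intros
    · exact gen_head _ (by rfl) (by rfl) (by simp [Elt.d]) _
    · exact gen_slot _ (by rfl) (by rfl) (by rfl) _ _ _
    · rw [rd', gen_cons]
    · rw [gen_pair]
    · rw [ld', gen_last]
    · rw [rd', ld', gen_nil]
  · constructor <;> intros
    case head_lin p c x y v =>
      exact letterSum_lin c (fun a l b => sign_lin _ c
        (gen_head c (by rfl) (by rfl) (by rfl) _)) _
    case slot_lin e u v p c x y =>
      refine letterSum_slot c (fun a l b => sign_lin _ c ?_) (sign_lin _ c ?_)
        (fun a l b => ?_)
      · simp only [← List.append_assoc, ← List.cons_append]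
        exact gen_slot c (by rfl) (by rfl) (by rfl) _ _ _
      · exact gen_slot c (by rfl) (by rfl) (by simp [RElt.d]) _ _ _
      · simp only [eta, sdeg_append, sdeg_cons]
        refine sign_lin _ c ?_
        simp only [List.append_assoc, List.cons_append]
        exact gen_slot c (by rfl) (by rfl) (by rfl) _ _ _
    case head_bal e x v κ =>
      simp only [letterSum]
      congr 1
      · simp [eta, gen_cons, ld]
      · exact letterSum_congr (fun a l b => by simp [eta, gen_cons]) _
    case slot_bal e u v x y κ =>
      refine letterSum_pair (fun a l b => ?_) ?_ (fun a l b => ?_)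
      · have := gen_pair e (a ++ l.d :: b) v x y κ
        simp only [List.append_assoc, List.cons_append] at this
        simp [this]
      · have := gen_pair e u v x y.d κ
        simp [eta, rd, ld, gen_pair, this]
      · have := gen_pair e u (a ++ l.d :: b) x y κ
        simp [eta, this]
    case last_bal e u x κ =>
      refine letterSum_last (fun a l b => ?_) ?_
      · have := gen_last e (a ++ l.d :: b) x κ
        simp only [List.append_assoc, List.cons_append] at this
        simp [eta, this]
      · simp [eta, rd, gen_last]
    case nil_bal e κ => simp [letterSum]

theorem bFun₁_admissible : IsAdmissible (bFun₁ (A := A)) := by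
  have h1 : ∀ (a : A.Elt) (x : A.RElt) κ, (a.rmul κ).mul x.toElt = a.mul (x.lmul κ).toElt :=
    fun a b κ => Elt.ext' rfl (mul_assoc ..)
  have h2 : ∀ (a : A.Elt) (x : A.RElt) κ, a.mul (x.rmul κ).toElt = (a.mul x.toElt).rmul κ :=
    fun a b κ => Elt.ext' rfl (mul_assoc ..).symm
  have h3 : ∀ (a : A.Elt) (x : A.RElt) κ, (a.lmul κ).mul x.toElt = (a.mul x.toElt).lmul κ :=
    fun a b κ => Elt.ext' rfl (mul_assoc ..)
  have h4 : ∀ (a : A.Elt) (x : A.RElt) κ, (x.rmul κ).toElt.mul a = x.toElt.mul (a.lmul κ) :=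
    fun a b κ => Elt.ext' rfl (mul_assoc ..)
  have h5 : ∀ (a : A.Elt) (x : A.RElt) κ, x.toElt.mul (a.rmul κ) = (x.toElt.mul a).rmul κ :=
    fun a b κ => Elt.ext' rfl (mul_assoc ..).symm
  have h6 : ∀ (a : A.Elt) (x : A.RElt) κ, (x.lmul κ).toElt.mul a = (x.toElt.mul a).lmul κ :=
    fun a b κ => Elt.ext' rfl (mul_assoc ..)
  have r1 : ∀ (x y : A.RElt) κ, (x.rmul κ).mul y = x.mul (y.lmul κ) :=
    fun a b κ => RElt.ext' rfl (mul_assoc ..)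
  have r2 : ∀ (x y : A.RElt) κ, x.mul (y.rmul κ) = (x.mul y).rmul κ :=
    fun a b κ => RElt.ext' rfl (mul_assoc ..).symm
  have r3 : ∀ (x y : A.RElt) κ, (x.lmul κ).mul y = (x.mul y).lmul κ :=
    fun a b κ => RElt.ext' rfl (mul_assoc ..)
  refine IsAdmissible.add (IsAdmissible.add ?_ ?_) ?_
  · constructor <;> intros
    case head_lin p c x y v =>
      cases v with
      | nil => simp
      | cons z v =>
        exact sign_lin _ c (gen_head c (by rfl) (by rfl) (by simp [Elt.mul, add_mul]) _)
    case slot_lin e u v p c x y =>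
      cases u with
      | nil =>
        exact sign_lin _ c (gen_head c (by rfl) (by rfl) (by simp [Elt.mul, RElt.toElt, mul_add]) _)
      | cons z u => exact sign_lin _ c (gen_slot c (by rfl) (by rfl) (by rfl) _ _ _)
    case head_bal e x v κ => simp [h1]
    case slot_bal e u v x y κ =>
      cases u with
      | nil => simp [h2, gen_cons]
      | cons z u => simp [gen_pair]
    case last_bal e u x κ =>
      cases u with
      | nil => simp [h2, h3, gen_nil]
      | cons z u => simp [gen_last, h3]
    case nil_bal e κ => rfl
  · constructor <;> intros
    case head_lin p c x y v =>
      refine letterSum_lin c (fun a l b => ?_) _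
      cases b with
      | nil => simp
      | cons z b => exact sign_lin _ c (gen_head c (by rfl) (by rfl) (by rfl) _)
    case slot_lin e u v p c x y =>
      refine letterSum_slot c (fun a l b => ?_) ?_ (fun a l b => ?_)
      · cases b with
        | nil =>
          exact sign_lin _ c (gen_slot c (by rfl) (by rfl) (by simp [RElt.mul, mul_add]) _ _ _)
        | cons z b =>
          simp only [List.cons_append]
          refine sign_lin _ c ?_
          simp only [← List.append_assoc, ← List.cons_append]
          exact gen_slot c (by rfl) (by rfl) (by rfl) _ _ _
      · cases v with
        | nil => simp
        | cons z v =>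
          exact sign_lin _ c (gen_slot c (by rfl) (by rfl) (by simp [RElt.mul, add_mul]) _ _ _)
      · cases b with
        | nil => simp
        | cons z b =>
          simp only [eta, sdeg_append, sdeg_cons]
          refine sign_lin _ c ?_
          simp only [List.append_assoc, List.cons_append]
          exact gen_slot c (by rfl) (by rfl) (by rfl) _ _ _
    case head_bal e x v κ =>
      simp only [letterSum]
      congr 1
      · cases v with
        | nil => rfl
        | cons z v => simp [eta, gen_cons, r3]
      · refine letterSum_congr (fun a l b => ?_) _
        cases b with
        | nil => rfl
        | cons z b => simp [eta, gen_cons]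
    case slot_bal e u v x y κ =>
      refine letterSum_pair (fun a l b => ?_) ?_ (fun a l b => ?_)
      · cases b with
        | nil => simp [r2, gen_pair]
        | cons z b =>
          have := gen_pair e (a ++ l.mul z :: b) v x y κ
          simp only [List.append_assoc, List.cons_append] at this
          simp [this]
      · cases v with
        | nil => simp [r1]
        | cons z v =>
          have := gen_pair e u v x (y.mul z) κ
          simp [r1, r3, eta, this]
      · cases b with
        | nil => rfl
        | cons z b =>
          have := gen_pair e u (a ++ l.mul z :: b) x y κ
          simp [eta, this]
    case last_bal e u x κ =>
      refine letterSum_last (fun a l b => ?_) ?_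
      · cases b with
        | nil => simp [r2, eta, gen_last]
        | cons z b =>
          have := gen_last e (a ++ l.mul z :: b) x κ
          simp only [List.append_assoc, List.cons_append] at this
          simp [eta, this]
      · rfl
    case nil_bal e κ => rfl
  · constructor <;> intros
    case head_lin p c x y v =>
      refine letterSum_lin c (fun a l b => ?_) _
      cases b with
      | nil => exact sign_lin _ c (gen_head c (by rfl) (by rfl) (by simp [Elt.mul, mul_add]) _)
      | cons z b => simp
    case slot_lin e u v p c x y =>
      refine letterSum_slot c (fun a l b => ?_) ?_ (fun a l b => ?_)
      · cases b <;> simp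
      · cases v with
        | nil =>
          exact sign_lin _ c (gen_head c (by rfl) (by rfl)
            (by simp [Elt.mul, RElt.toElt, add_mul]) _)
        | cons z v => simp
      · cases b with
        | nil =>
          simp only [eta, sdeg_append, sdeg_cons]
          exact sign_lin _ c (gen_slot c (by rfl) (by rfl) (by rfl) _ _ _)
        | cons z b => simp
    case head_bal e x v κ =>
      simp only [letterSum]
      congr 1
      · cases v with
        | nil => simp [eta, h5, h6, gen_nil]
        | cons z v => rfl
      · refine letterSum_congr (fun a l b => ?_) _
        cases b with
        | nil => simp [eta, h5, gen_cons]
        | cons z b => rfl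
    case slot_bal e u v x y κ =>
      refine letterSum_pair (fun a l b => ?_) ?_ (fun a l b => ?_)
      · cases b <;> simp
      · cases v with
        | nil => simp [eta, h6, gen_last]
        | cons z v => rfl
      · cases b with
        | nil => simp [eta, gen_pair]
        | cons z b => rfl
    case last_bal e u x κ =>
      refine letterSum_last (fun a l b => ?_) ?_
      · cases b <;> simp
      · simp [eta, h4]
    case nil_bal e κ => rfl

theorem bFun_admissible : IsAdmissible (fun (a : A.Elt) w => bFun₀ a w + bFun₁ a w) :=
  bFun₀_admissible.add bFun₁_admissible

end descend

/-- The differential `b = b₀ + b₁` of the Hochschild chain complex. -/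
noncomputable def b : A.Chain →ₗ[k] A.Chain :=
  chainLift (fun a w => bFun₀ a w + bFun₁ a w) bFun_admissible

/-- The Connes operator `B` on Hochschild chains. -/
noncomputable def connes : A.Chain →ₗ[k] A.Chain := chainLift connesFun connesFun_admissible

/-- The operator `i_f` on Hochschild chains. -/
noncomputable def iOp {q : ℤ} (f : A.Cochain q) : A.Chain →ₗ[k] A.Chain :=
  chainLift (iFun f) (iFun_admissible f)

/-- The operator `L_f` on Hochschild chains. -/
noncomputable def LOp {q : ℤ} (f : A.Cochain q) : A.Chain →ₗ[k] A.Chain :=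
  chainLift (LFun f) (LFun_admissible f)

/-! ### Hochschild homology and cohomology -/

theorem delta_lin (q : ℤ) (c : k) (f g : List A.RElt → A.carrier) (w : List A.RElt) :
    delta q (c • f + g) w = c • delta q f w + delta q g w := by
  have e0 : delta₀ q (c • f + g) w = c • delta₀ q f w + delta₀ q g w := by
    unfold delta₀
    rw [letterSum_lin c (fun x a y => sign_lin _ c
      (show (c • f + g) (x ++ a.d :: y) = c • f (x ++ a.d :: y) + g (x ++ a.d :: y) from rfl))]
    simp only [Pi.add_apply, Pi.smul_apply, map_add, map_smul, smul_add]; abel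
  have e1 : delta₁ q (c • f + g) w = c • delta₁ q f w + delta₁ q g w := by
    unfold delta₁
    have add_lin : ∀ {X X₁ X₂ Y Y₁ Y₂ : A.carrier}, X = c • X₁ + X₂ → Y = c • Y₁ + Y₂ →
        X + Y = c • (X₁ + Y₁) + (X₂ + Y₂) := by
      intro X X₁ X₂ Y Y₁ Y₂ hX hY
      rw [hX, hY, smul_add]; abel
    refine add_lin (add_lin ?_ (letterSum_lin c ?_ w)) (letterSum_lin c ?_ w)
    · cases w with
      | nil => simp
      | cons a y => exact sign_lin _ c (by simp [mul_add])
    · intro x a z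
      cases z with
      | nil => simp
      | cons z y => exact sign_lin _ c rfl
    · intro x a z
      cases z with
      | nil => exact sign_lin _ c (by simp [add_mul])
      | cons z y => simp
  unfold delta
  rw [e0, e1, smul_add]; abel

/-- The Hochschild differential on cochains of degree `q`, as a linear map. -/
def deltaMap (q : ℤ) : (List A.RElt → A.carrier) →ₗ[k] (List A.RElt → A.carrier) :=
  have h0 : delta q (0 : List A.RElt → A.carrier) = 0 := by
    funext w
    simpa using delta_lin q (1 : k) (0 : List A.RElt → A.carrier) 0 w
  { toFun := delta q
    map_add' := fun f g => by
      funext w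
      simpa using delta_lin q (1 : k) f g w
    map_smul' := fun c f => by
      funext w
      simpa [h0] using delta_lin q c f 0 w }

variable (A)

/-- Hochschild cocycles of (lower) degree `q`. -/
def cocycles (q : ℤ) : Submodule k (List A.RElt → A.carrier) :=
  A.Cochain q ⊓ LinearMap.ker (deltaMap q)

/-- Hochschild coboundaries of (lower) degree `q`. -/
def coboundaries (q : ℤ) : Submodule k (List A.RElt → A.carrier) :=
  (A.Cochain (q + 1)).map (deltaMap (q + 1))

/-- The Hochschild cohomology `HH^p(A)`; upper degree `p` is lower degree `-p`. -/
abbrev HHCohomology (p : ℤ) : Type _ :=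
  A.cocycles (-p) ⧸ (A.coboundaries (-p)).submoduleOf (A.cocycles (-p))

/-- The cohomology class of a cocycle. -/
def cohClass (p : ℤ) : A.cocycles (-p) →ₗ[k] A.HHCohomology p := Submodule.mkQ _

/-- Hochschild cycles of degree `n`. -/
noncomputable def cycles (n : ℤ) : Submodule k A.Chain := A.chainDeg n ⊓ LinearMap.ker b

/-- Hochschild boundaries of degree `n`. -/
noncomputable def boundaries (n : ℤ) : Submodule k A.Chain := (A.chainDeg (n + 1)).map b

/-- The Hochschild homology `HH_n(A)`. -/
abbrev HHHomology (n : ℤ) : Type _ := A.cycles n ⧸ (A.boundaries n).submoduleOf (A.cycles n)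

/-- The homology class of a cycle. -/
noncomputable def homClass (n : ℤ) : A.cycles n →ₗ[k] A.HHHomology n := Submodule.mkQ _

variable {A}

/-- A cocycle as a cochain. -/
def cocycles.toCochain {q : ℤ} (f : A.cocycles q) : A.Cochain q := ⟨f.1, f.2.1⟩

/-- The operations of a calculus on `(HH^•(A), HH_•(A))` are the ones induced by the unit cochain,
the cup product, the Gerstenhaber bracket, the operators `i_f` and `L_f` and the Connes operator:
these operations take (co)cycles to (co)cycles, and the operations of `S` are given by them on
representatives. -/
structure IsInduced (S : Calculus k A.HHCohomology A.HHHomology) : Prop where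
  one : ∃ h : A.unitCochain ∈ A.cocycles (-0), S.one = A.cohClass 0 ⟨A.unitCochain, h⟩
  mul : ∀ {p q r : ℤ} (h : p + q = r) (f : A.cocycles (-p)) (g : A.cocycles (-q)),
    ∃ hc : cup f.1 (-q) g.1 ∈ A.cocycles (-r),
      S.mul h (A.cohClass p f) (A.cohClass q g) = A.cohClass r ⟨cup f.1 (-q) g.1, hc⟩
  bracket : ∀ {p q r : ℤ} (h : p + q - 1 = r) (f : A.cocycles (-p)) (g : A.cocycles (-q)),
    ∃ hc : gbracket (cocycles.toCochain f) (cocycles.toCochain g) ∈ A.cocycles (-r),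
      S.bracket h (A.cohClass p f) (A.cohClass q g) = A.cohClass r ⟨_, hc⟩
  i : ∀ {p m n : ℤ} (h : m - p = n) (f : A.cocycles (-p)) (x : A.cycles m),
    ∃ hc : iOp (cocycles.toCochain f) x.1 ∈ A.cycles n,
      S.i h (A.cohClass p f) (A.homClass m x) = A.homClass n ⟨_, hc⟩
  L : ∀ {p m n : ℤ} (h : m - p + 1 = n) (f : A.cocycles (-p)) (x : A.cycles m),
    ∃ hc : LOp (cocycles.toCochain f) x.1 ∈ A.cycles n,
      S.L h (A.cohClass p f) (A.homClass m x) = A.homClass n ⟨_, hc⟩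
  d : ∀ {m n : ℤ} (h : m + 1 = n) (x : A.cycles m),
    ∃ hc : connes x.1 ∈ A.cycles n, S.d h (A.homClass m x) = A.homClass n ⟨_, hc⟩

end AugDGRing

set_option linter.unusedSectionVars false

/-! ### Rearranging sums over decompositions -/

section Sums

variable {α : Type u} {M : Type v} {N : Type w} [AddCommGroup M] [AddCommGroup N]

/-! The proof expresses every operation through insertions (braces). For a functional Φ of words,
write Φ{g}(w) for the signed sum of Φ(x, g(y), v) over w = x y v (`rins`), and Φ{g, h} for the sum
with two disjoint blocks, g to the left of h (`br2`). The differential and the product of A form a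
single functional m (`AugDGRing.mm`) of odd suspended degree, and d² = 0, the Leibniz rule and
associativity together say m{m} = 0 (`mm_mm`). In these terms δf = m{f} - (-1)^{|f|+1} f{m}
(`wordDelta`, `ext_delta`), f ∪ g = ± m{f, g} (`ext_cup`) and f ∘ g = f{g} (`ext_circ`).

Cohomology rests on two combinatorial identities, both obtained by asking where one block lies
relative to another. The first is the graded pre-Lie identity for Φ{g}{P} (`rins_rins`); it gives
the Jacobi identity. The second expands Φ{P}{g, h} (`br2_rins`). With Φ = P = m it says that δ is a
derivation of the cup product. Comparing the case (Φ, P) = (f, m) with (m, f) gives the Poisson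
rule, with f{g, h} as homotopy (`wordBracket_br2`). The failure of δ to be a derivation of f{g}
consists of m{f, g} and m{g, f}, so the circle product is a homotopy for commutativity of the cup
product (`wordDelta_rins`).

For homology, an operator on chains is encoded as a transformation of functionals Φ(a, w) of a head
and a tail; composites therefore appear in the reversed order. Here b is `lie` along m, L_f is up to
sign `lie` along f, and i_f is up to sign `contr` with P = m, where `contr` applies P to a cyclic
subword containing the head and, to its right, a value of f. The commutator of `lie` and `contr` is
computed once and for all in `lie_contr`. Taking it for (m, g) and for (g, m) and eliminating the
doubly nested terms shows that `contr` with P = g is a homotopy between i_{[f,g]} and the commutator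
of i_f and L_g (`lie_contr_bracket`). The identity b² = 0 is `lie_sq`.

The Cartan formula comes from the chains 1 ⊗ [rotated word]. The boundary of 1 ⊗ w is, up to
insertion of m into w, the difference between taking the last and the first letter as head
(`lie_mm_unit`), and over all rotations these cancel; hence bB + Bb = 0. If a value of f is first
inserted to the right of the old head, the cancellation fails exactly where f interferes with the
choice of head. The surviving terms combine with i_f B to give L_f (`cartan`).

On homology L is then determined by the Cartan formula, so the formulas for L_{[f,g]} and L_{f∪g}
follow formally from those for i and from B² = 0. The relation i_{f∪g} = i_f i_g needs commutativity
of the cup product, because at chain level the order of f and g is reversed (`iOp_iOp`).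

Letters are arbitrary pairs (degree, element of A), so that insertions can be studied over any
abelian group. The passage to homogeneous and reduced letters is made by `ext` and `genL`; it is
compatible with m because terms with a scalar in a bar entry cancel (`wordDelta_scalar`,
`lie_mm_genL_wordKill`). Separate arguments show that the constructions are K-balanced, so that the
homotopies are defined on the tensor products over K. -/

theorem splitSum_add (F G : List α → List α → M) (w : List α) :
    splitSum (fun x y => F x y + G x y) w = splitSum F w + splitSum G w := by
  induction w generalizing F G with
  | nil => rfl
  | cons a w ih => simp only [splitSum, ih]; abel

theorem map_splitSum (φ : M →+ N) (F : List α → List α → M) (w : List α) :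
    φ (splitSum F w) = splitSum (fun x y => φ (F x y)) w := by
  induction w generalizing F with
  | nil => rfl
  | cons a w ih => simp only [splitSum, ih, map_add]

theorem map_letterSum (φ : M →+ N) (F : List α → α → List α → M) (w : List α) :
    φ (letterSum F w) = letterSum (fun x a y => φ (F x a y)) w := by
  induction w generalizing F with
  | nil => exact map_zero φ
  | cons a w ih => simp only [letterSum, ih, map_add]

theorem splitSum_smul (e : ℤˣ) (F : List α → List α → M) (w : List α) :
    splitSum (fun x y => e • F x y) w = e • splitSum F w :=
  (map_splitSum (DistribSMul.toAddMonoidHom M e) F w).symm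

theorem letterSum_smul (e : ℤˣ) (F : List α → α → List α → M) (w : List α) :
    letterSum (fun x a y => e • F x a y) w = e • letterSum F w :=
  (map_letterSum (DistribSMul.toAddMonoidHom M e) F w).symm

theorem splitSum_neg (F : List α → List α → M) (w : List α) :
    splitSum (fun x y => - F x y) w = - splitSum F w :=
  (map_splitSum (negAddMonoidHom : M →+ M) F w).symm

theorem splitSum_sub (F G : List α → List α → M) (w : List α) :
    splitSum (fun x y => F x y - G x y) w = splitSum F w - splitSum G w := by
  simp only [sub_eq_add_neg, splitSum_add, splitSum_neg]

theorem splitSum_zero (w : List α) : splitSum (fun _ _ => (0 : M)) w = 0 := by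
  induction w with
  | nil => rfl
  | cons a w ih => simp only [splitSum, ih, add_zero]

/-- The hypothesis x ++ y = w lets the degree of w be split as that of x plus that of y; most sign
comparisons depend on this. -/
theorem splitSum_congr_append {F G : List α → List α → M} {w : List α}
    (h : ∀ x y, x ++ y = w → F x y = G x y) : splitSum F w = splitSum G w := by
  induction w generalizing F G with
  | nil => exact h _ _ rfl
  | cons a w ih =>
    simp only [splitSum]
    rw [h [] (a :: w) rfl, ih fun x y hxy => h (a :: x) y (by rw [List.cons_append, hxy])]

/-- Both sides run over w = a b z. Together with `splitSum_comm` this is the Fubini rule behind the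
reindexings below. -/
theorem splitSum_assoc (F : List α → List α → List α → M) (w : List α) :
    splitSum (fun x z => splitSum (fun a b => F a b z) x) w
      = splitSum (fun a r => splitSum (fun b z => F a b z) r) w := by
  induction w generalizing F with
  | nil => rfl
  | cons a w ih =>
    simp only [splitSum, splitSum_add, ih fun x b z => F (a :: x) b z]
    abel

theorem splitSum_comm {β : Type*} (F : List α → List α → List β → List β → M) (u : List α)
    (v : List β) :
    splitSum (fun a b => splitSum (fun c d => F a b c d) v) u
      = splitSum (fun c d => splitSum (fun a b => F a b c d) u) v := by
  induction u generalizing F with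
  | nil => rfl
  | cons a u ih => simp only [splitSum, splitSum_add, ih]

/-- Both sides run over w = x y v t z, with the block t to the right of the block y. The next two
lemmas treat t inside a larger block y t y' and t to the left of y. These are the possible positions
of one inserted block relative to another. -/
theorem splitSum_nested_right {F : List α → List α → List α → List α → List α → List α → M}
    {G : List α → List α → List α → List α → List α → M}
    (h : ∀ x y v t z, F (x ++ (y ++ v)) t z x y v = G x y v t z) (w : List α) :
    splitSum (fun s r => splitSum (fun t z => splitSum (fun x s' => splitSum (fun y v =>
      F s t z x y v) s') s) r) w
      = splitSum (fun x r => splitSum (fun y r' => splitSum (fun v r'' => splitSum (fun t z =>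
        G x y v t z) r'') r') r) w := by
  trans splitSum (fun s r => splitSum (fun x s' => splitSum (fun t z => splitSum (fun y v =>
      G x y v t z) s') r) s) w
  · refine splitSum_congr (fun s r => ?_) w
    rw [splitSum_comm]
    refine splitSum_congr_append fun x s' hs => splitSum_congr (fun t z => ?_) _
    exact splitSum_congr_append fun y v hv => by rw [← h, hv, hs]
  rw [splitSum_assoc (fun x s' r => splitSum (fun t z => splitSum (fun y v => G x y v t z) s') r)]
  refine splitSum_congr (fun x r => ?_) w
  trans splitSum (fun s' r => splitSum (fun y v => splitSum (fun t z => G x y v t z) r) s') r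
  · exact splitSum_congr (fun s' r => splitSum_comm (fun t z y v => G x y v t z) r s') r
  exact splitSum_assoc (fun y v r => splitSum (fun t z => G x y v t z) r) r

theorem splitSum_nested_around {F : List α → List α → List α → List α → List α → List α → M}
    {G : List α → List α → List α → List α → List α → M}
    (h : ∀ x y t y' v, F (x ++ y) x y t y' v = G x y t y' v) (w : List α) :
    splitSum (fun s r => splitSum (fun t z => splitSum (fun x y => splitSum (fun y' v =>
      F s x y t y' v) z) s) r) w
      = splitSum (fun x r => splitSum (fun Y v => splitSum (fun y Y' => splitSum (fun t y' =>
        G x y t y' v) Y') Y) r) w := by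
  trans splitSum (fun s r => splitSum (fun x y => splitSum (fun t z => splitSum (fun y' v =>
      G x y t y' v) z) r) s) w
  · refine splitSum_congr (fun s r => ?_) w
    rw [splitSum_comm]
    refine splitSum_congr_append fun x s' hs => splitSum_congr (fun t z => ?_) _
    exact splitSum_congr (fun y v => by rw [← h, hs]) _
  rw [splitSum_assoc (fun x y r => splitSum (fun t z => splitSum (fun y' v => G x y t y' v) z) r)]
  refine splitSum_congr (fun x r => ?_) w
  rw [splitSum_assoc (fun y Y' v => splitSum (fun t y' => G x y t y' v) Y')]
  exact splitSum_congr (fun y r => (splitSum_assoc (fun t y' v => G x y t y' v) r).symm) r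

theorem splitSum_nested_left {F : List α → List α → List α → List α → List α → M}
    {G : List α → List α → List α → List α → List α → List α → M}
    (h : ∀ s t x y v, F s t x y v = G (s ++ (t ++ x)) s t x y v) (w : List α) :
    splitSum (fun s r => splitSum (fun t z => splitSum (fun x z' => splitSum (fun y v =>
      F s t x y v) z') z) r) w
      = splitSum (fun X r => splitSum (fun y v => splitSum (fun s X' => splitSum (fun t x =>
        G X s t x y v) X') X) r) w := by
  trans splitSum (fun X r => splitSum (fun s X' => splitSum (fun t x => splitSum (fun y v =>
        F s t x y v) r) X') X) w
  · rw [splitSum_assoc (fun s X' r => splitSum (fun t x => splitSum (fun y v => F s t x y v) r) X')]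
    refine splitSum_congr (fun s r => ?_) w
    exact (splitSum_assoc (fun t x r => splitSum (fun y v => F s t x y v) r) r).symm
  · refine splitSum_congr (fun X r => ?_) w
    trans splitSum (fun s X' => splitSum (fun y v => splitSum (fun t x => F s t x y v) X') r) X
    · exact splitSum_congr (fun s X' => splitSum_comm (fun t x y v => F s t x y v) X' r) X
    · rw [splitSum_comm]
      refine splitSum_congr (fun y v => splitSum_congr_append fun s X' hs => ?_) _
      exact splitSum_congr_append fun t x ht => by rw [h, ht, hs]

theorem splitSum_map {β : Type*} (φ : β → α) (F : List α → List α → M) (w : List β) :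
    splitSum F (w.map φ) = splitSum (fun x y => F (x.map φ) (y.map φ)) w := by
  induction w generalizing F with
  | nil => rfl
  | cons a w ih => simp only [List.map_cons, splitSum, ih, List.map_nil]

theorem letterSum_map {β : Type*} (φ : β → α) (F : List α → α → List α → M) (w : List β) :
    letterSum F (w.map φ) = letterSum (fun x a y => F (x.map φ) (φ a) (y.map φ)) w := by
  induction w generalizing F with
  | nil => rfl
  | cons a w ih => simp only [List.map_cons, letterSum, ih, List.map_nil]

theorem negOnePow_congr {a b : ℤ} (h : Even a ↔ Even b) : a.negOnePow = b.negOnePow := by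
  rw [Int.negOnePow_eq_iff]
  simpa only [Int.even_sub] using h

theorem negOnePow_smul_congr {a b : ℤ} {x y : M} (h : Even a ↔ Even b) (h' : x = y) :
    a.negOnePow • x = b.negOnePow • y := by
  rw [negOnePow_congr h, h']

theorem negOnePow_smul_smul (a b : ℤ) (x : M) :
    a.negOnePow • b.negOnePow • x = (a + b).negOnePow • x := by
  rw [smul_smul, Int.negOnePow_add]

end Sums

/-! ### Insertions into words and the graded pre-Lie identity -/

namespace Braces

variable {V : Type u} {M : Type v} [AddCommGroup V] [AddCommGroup M]

/-- The degree of a word in letters `(p, a)`, where `a` has degree `p` before suspension. -/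
def wd (w : List (ℤ × V)) : ℤ := (w.map fun a => a.1 + 1).sum

@[simp] theorem wd_nil : wd ([] : List (ℤ × V)) = 0 := rfl
@[simp] theorem wd_cons (a : ℤ × V) (w : List (ℤ × V)) : wd (a :: w) = (a.1 + 1) + wd w := rfl
@[simp] theorem wd_append (u v : List (ℤ × V)) : wd (u ++ v) = wd u + wd v := by simp [wd]

/-- The value of a word functional of degree `q`, as a letter. -/
def lt (q : ℤ) (f : List (ℤ × V) → V) (y : List (ℤ × V)) : ℤ × V := (q + wd y, f y)

@[simp] theorem lt_fst (q : ℤ) (f : List (ℤ × V) → V) (y : List (ℤ × V)) :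
    (lt q f y).1 = q + wd y := rfl

/-- Additivity of a function of a letter. -/
def LetterAdd (θ : ℤ × V → M) : Prop := ∀ p a b, θ (p, a + b) = θ (p, a) + θ (p, b)

/-- Additivity of a word functional in each letter. -/
def WordAdd (Φ : List (ℤ × V) → M) : Prop := ∀ x r, LetterAdd fun c => Φ (x ++ c :: r)

/-- The sum of `Θ x (g y) v` over all decompositions `w = x y v`, with Koszul signs. -/
def ins3 (q : ℤ) (g : List (ℤ × V) → V) (Θ : List (ℤ × V) → ℤ × V → List (ℤ × V) → M)
    (w : List (ℤ × V)) : M :=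
  splitSum (fun x z => splitSum (fun y v =>
    (wd x * (q + 1)).negOnePow • Θ x (lt q g y) v) z) w

/-- The sum of `Φ (x, g y, v)` over all decompositions `w = x y v`, with Koszul signs. -/
def rins (q : ℤ) (g : List (ℤ × V) → V) (Φ : List (ℤ × V) → M) (w : List (ℤ × V)) : M :=
  ins3 q g (fun x c v => Φ (x ++ c :: v)) w

/-- Insertion of `g` to the left of the marked letter. -/
def mL (q : ℤ) (g : List (ℤ × V) → V) (Θ : List (ℤ × V) → ℤ × V → List (ℤ × V) → M)
    (z : List (ℤ × V)) (a : ℤ × V) (r : List (ℤ × V)) : M :=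
  rins q g (fun z' => Θ z' a r) z

/-- Insertion of `g` to the right of the marked letter. -/
def mR (q : ℤ) (g : List (ℤ × V) → V) (Θ : List (ℤ × V) → ℤ × V → List (ℤ × V) → M)
    (z : List (ℤ × V)) (a : ℤ × V) (r : List (ℤ × V)) : M :=
  ((q + 1) * (wd z + (a.1 + 1))).negOnePow • rins q g (Θ z a) r

/-- Insertion of `g` around the marked letter. -/
def ar (q : ℤ) (g : List (ℤ × V) → V) (Θ : List (ℤ × V) → ℤ × V → List (ℤ × V) → M)
    (z : List (ℤ × V)) (a : ℤ × V) (r : List (ℤ × V)) : M :=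
  splitSum (fun z₁ z₂ => splitSum (fun r₁ r₂ =>
    (wd z₁ * (q + 1)).negOnePow • Θ z₁ (lt q g (z₂ ++ a :: r₁)) r₂) r) z

theorem LetterAdd.splitSum {α : Type*} {θ : ℤ × V → M} (h : LetterAdd θ) (p : ℤ)
    (F : List α → List α → V) (w : List α) :
    θ (p, splitSum F w) = splitSum (fun x y => θ (p, F x y)) w :=
  map_splitSum (AddMonoidHom.mk' (fun a => θ (p, a)) (h p)) F w

theorem LetterAdd.zero {θ : ℤ × V → M} (h : LetterAdd θ) (p : ℤ) : θ (p, 0) = 0 :=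
  map_zero (AddMonoidHom.mk' (fun a => θ (p, a)) (h p))

theorem LetterAdd.sub {θ : ℤ × V → M} (h : LetterAdd θ) (p : ℤ) (a b : V) :
    θ (p, a - b) = θ (p, a) - θ (p, b) :=
  map_sub (AddMonoidHom.mk' (fun a => θ (p, a)) (h p)) a b

theorem LetterAdd.smul {θ : ℤ × V → M} (h : LetterAdd θ) (p : ℤ) (e : ℤˣ) (a : V) :
    θ (p, e • a) = e • θ (p, a) :=
  map_zsmul (AddMonoidHom.mk' (fun a => θ (p, a)) (h p)) (e : ℤ) a

section ins

variable (p q : ℤ) (P g : List (ℤ × V) → V)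

theorem ins3_congr {Θ Θ' : List (ℤ × V) → ℤ × V → List (ℤ × V) → M} {w : List (ℤ × V)}
    (h : ∀ x c v, Θ x c v = Θ' x c v) : ins3 q g Θ w = ins3 q g Θ' w := by
  rw [show Θ = Θ' from funext fun x => funext fun c => funext fun v => h x c v]

theorem ins3_add (Θ Θ' : List (ℤ × V) → ℤ × V → List (ℤ × V) → M) (w : List (ℤ × V)) :
    ins3 q g (fun x c v => Θ x c v + Θ' x c v) w = ins3 q g Θ w + ins3 q g Θ' w := by
  simp only [ins3, smul_add, splitSum_add]

theorem ins3_map {N : Type*} [AddCommGroup N] (φ : M →+ N)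
    (Θ : List (ℤ × V) → ℤ × V → List (ℤ × V) → M) (w : List (ℤ × V)) :
    φ (ins3 q g Θ w) = ins3 q g (fun x c v => φ (Θ x c v)) w := by
  simp only [ins3, map_splitSum, Units.smul_def, map_zsmul]

theorem ins3_smul (e : ℤˣ) (Θ : List (ℤ × V) → ℤ × V → List (ℤ × V) → M) (w : List (ℤ × V)) :
    ins3 q g (fun x c v => e • Θ x c v) w = e • ins3 q g Θ w :=
  (ins3_map q g (DistribSMul.toAddMonoidHom M e) Θ w).symm

theorem ins3_splitSum {α : Type*} (s : List α)
    (Θ : List α → List α → List (ℤ × V) → ℤ × V → List (ℤ × V) → M) (w : List (ℤ × V)) :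
    ins3 q g (fun x c v => splitSum (fun a b => Θ a b x c v) s) w
      = splitSum (fun a b => ins3 q g (Θ a b) w) s := by
  simp only [ins3, ← splitSum_smul]
  rw [splitSum_comm]
  refine splitSum_congr (fun x z => ?_) _
  rw [splitSum_comm]

/-- All summands of `rins p P g` on a given word have the same degree, so an additive θ passes
through the sum. This turns nested insertions into the insertion of a composite. -/
theorem lt_rins {θ : ℤ × V → M} (h : LetterAdd θ) (Y : List (ℤ × V)) :
    θ (lt (p + q + 1) (rins p P g) Y) = rins p P (fun Y' => θ (lt q g Y')) Y := by
  simp only [lt, rins, ins3, h.splitSum, h.smul]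
  refine splitSum_congr_append fun x z hz => splitSum_congr_append fun y v hv => ?_
  subst hv hz
  simp only [wd_append, wd_cons]
  congr 3
  ring

/-- The block on which P is evaluated lies to the left of the marked letter, contains it, or lies to
its right. -/
theorem rins_mark (Φ : List (ℤ × V) → M) (z : List (ℤ × V)) (a : ℤ × V) (r : List (ℤ × V)) :
    rins p P Φ (z ++ a :: r) = mL p P (fun z a r => Φ (z ++ a :: r)) z a r
      + ar p P (fun z a r => Φ (z ++ a :: r)) z a r
      + mR p P (fun z a r => Φ (z ++ a :: r)) z a r := by
  simp only [rins, ins3, splitSum_append, splitSum_add, mL, ar, mR, List.append_assoc,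
    List.cons_append]
  simp only [← splitSum_smul, negOnePow_smul_smul]
  congr 1
  refine splitSum_congr (fun x y => splitSum_congr (fun s t => ?_) _) _
  refine negOnePow_smul_congr ?_ rfl
  simp only [wd_append, wd_cons, parity_simps]
  grind

/-- The value of P is either swallowed by the block of g, giving the composite g{P}, or stays
outside it on one side. -/
theorem rins_ins3 {Θ : List (ℤ × V) → ℤ × V → List (ℤ × V) → M}
    (h : ∀ x v, LetterAdd fun c => Θ x c v) (w : List (ℤ × V)) :
    rins p P (ins3 q g Θ) w = ins3 (p + q + 1) (rins p P g) Θ w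
      + ((p + 1) * (q + 1)).negOnePow •
        ins3 q g (fun x c v => mL p P Θ x c v + mR p P Θ x c v) w := by
  have e1 : ins3 (p + q + 1) (rins p P g) Θ w = splitSum (fun x z => splitSum (fun Y v =>
      (wd x * (p + q + 1 + 1)).negOnePow • rins p P (fun Y' => Θ x (lt q g Y') v) Y) z) w := by
    refine splitSum_congr (fun x z => splitSum_congr (fun Y v => ?_) _) _
    rw [lt_rins p q P g (h x v)]
  rw [e1, ins3_add, smul_add]
  simp only [rins, ins3, splitSum_append, splitSum_add, mL, mR, smul_add]
  simp only [← splitSum_smul, negOnePow_smul_smul]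
  -- On the left the three sums have P to the right of, inside, and to the left of the block of g,
  -- in this order.
  have reorder : ∀ {A₁ A₂ A₃ B₁ B₂ B₃ : M}, A₁ = B₃ → A₂ = B₁ → A₃ = B₂ →
      A₁ + A₂ + A₃ = B₁ + (B₂ + B₃) := by
    rintro _ _ _ _ _ _ rfl rfl rfl; abel
  refine reorder (splitSum_nested_right (fun x y v t z => ?_) w)
    (splitSum_nested_around (fun x y t y' v => ?_) w)
    (splitSum_nested_left (fun s t x y v => ?_) w)
  all_goals
    refine negOnePow_smul_congr ?_ rfl
    simp only [wd_append, wd_cons, lt_fst, parity_simps]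
    grind

/-- A value of P around a value of g is a value of the composite P{g}. -/
theorem ins3_ar {Θ : List (ℤ × V) → ℤ × V → List (ℤ × V) → M}
    (h : ∀ x v, LetterAdd fun c => Θ x c v) (w : List (ℤ × V)) :
    ins3 q g (ar p P Θ) w = ins3 (q + p + 1) (rins q g P) Θ w := by
  have e1 : ins3 (q + p + 1) (rins q g P) Θ w = splitSum (fun x z => splitSum (fun Y v =>
      (wd x * (q + p + 1 + 1)).negOnePow • rins q g (fun Y' => Θ x (lt p P Y') v) Y) z) w := by
    refine splitSum_congr (fun x z => splitSum_congr (fun Y v => ?_) _) _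
    rw [lt_rins q p g P (h x v)]
  rw [e1]
  simp only [ins3, rins, ar, ← splitSum_smul, negOnePow_smul_smul]
  refine Eq.trans ?_ (splitSum_nested_around (F := fun s x y t y' v => (wd s * (q + 1)
    + wd x * (p + 1)).negOnePow • Θ x (lt p P (y ++ lt q g t :: y')) v) (fun x y t y' v => ?_) w)
  · rfl
  · refine negOnePow_smul_congr ?_ rfl
    simp only [wd_append, parity_simps]
    grind

/-- The pre-Lie identity: Φ{g}{P} - Φ{g{P}} counts the insertions of g and P into disjoint blocks,
which is graded symmetric in g and P. -/
theorem rins_rins {Φ : List (ℤ × V) → M} (h : WordAdd Φ) (w : List (ℤ × V)) :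
    rins p P (rins q g Φ) w = rins (p + q + 1) (rins p P g) Φ w
      + ((p + 1) * (q + 1)).negOnePow • (rins q g (rins p P Φ) w
        - rins (q + p + 1) (rins q g P) Φ w) := by
  -- The opposite order: g is inserted first, and P is then located relative to the value of g as
  -- marked letter.
  have e : rins q g (rins p P Φ) w = rins (q + p + 1) (rins q g P) Φ w
      + ins3 q g (fun x c v => mL p P (fun z a r => Φ (z ++ a :: r)) x c v
        + mR p P (fun z a r => Φ (z ++ a :: r)) x c v) w := by
    conv_lhs => rw [rins]
    simp only [rins_mark]
    rw [ins3_add, ins3_add, ins3_add, ins3_ar p q P g (fun x v => h x v)]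
    simp only [rins]
    abel
  rw [e, add_sub_cancel_left]
  exact rins_ins3 p q P g (fun x v => h x v) w

end ins
end Braces

/-! ### Insertions to the right of a marked letter -/

namespace Braces

variable {V : Type u} {M : Type v} [AddCommGroup V] [AddCommGroup M]
variable (p q : ℤ) (P g f : List (ℤ × V) → V)

theorem ins3_congr_append {Θ Θ' : List (ℤ × V) → ℤ × V → List (ℤ × V) → M} {w : List (ℤ × V)}
    (h : ∀ x y v, x ++ (y ++ v) = w → Θ x (lt q g y) v = Θ' x (lt q g y) v) :
    ins3 q g Θ w = ins3 q g Θ' w :=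
  splitSum_congr_append fun x z hz => splitSum_congr_append fun y v hv => by
    rw [h x y v (by rw [hv, hz])]

theorem ins3_comm (Θ : List (ℤ × V) → ℤ × V → List (ℤ × V) → List (ℤ × V) → ℤ × V →
    List (ℤ × V) → M) (r z : List (ℤ × V)) :
    ins3 q g (fun s c t => ins3 p P (fun x d v => Θ x d v s c t) z) r
      = ins3 p P (fun x d v => ins3 q g (fun s c t => Θ x d v s c t) r) z := by
  conv_lhs => enter [3, s, c, t]; rw [ins3]
  rw [ins3_splitSum q g z (fun x z' s c t => splitSum (fun y v =>
    (wd x * (p + 1)).negOnePow • Θ x (lt p P y) v s c t) z')]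
  refine splitSum_congr (fun x z' => ?_) z
  rw [ins3_splitSum q g z' (fun y v s c t => (wd x * (p + 1)).negOnePow • Θ x (lt p P y) v s c t)]
  exact splitSum_congr (fun y v => ins3_smul ..) z'

theorem mL_mR (Θ : List (ℤ × V) → ℤ × V → List (ℤ × V) → M) (z : List (ℤ × V)) (a : ℤ × V)
    (r : List (ℤ × V)) :
    mL p P (mR q f Θ) z a r = ((p + 1) * (q + 1)).negOnePow • mR q f (mL p P Θ) z a r := by
  simp only [mL, mR, rins]
  rw [ins3_comm p q P f (fun x c v s d t => Θ (x ++ c :: v) a (s ++ d :: t)) r z]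
  rw [← ins3_smul, ← ins3_smul]
  refine ins3_congr_append p P fun x y v hz => ?_
  rw [negOnePow_smul_smul]
  refine negOnePow_smul_congr ?_ rfl
  subst hz
  simp only [wd_append, wd_cons, lt_fst, parity_simps]
  grind

/-- Insertion of `g` is a derivation with respect to sums over decompositions. -/
theorem rins_splitSum (K : List (ℤ × V) → List (ℤ × V) → M) (r : List (ℤ × V)) :
    rins q g (splitSum K) r = splitSum (fun r₁ r₂ => rins q g (fun s => K s r₂) r₁
      + (wd r₁ * (q + 1)).negOnePow • rins q g (K r₁) r₂) r := by
  simp only [rins, ins3, splitSum_append, splitSum_add, smul_add, ← splitSum_smul,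
    negOnePow_smul_smul]
  rw [add_comm]
  congr 1
  · rw [splitSum_assoc (fun x z r₂ => splitSum (fun y v =>
      (wd x * (q + 1)).negOnePow • K (x ++ lt q g y :: v) r₂) z)]
    refine splitSum_congr (fun x z => ?_) r
    exact (splitSum_assoc (fun y v r₂ =>
      (wd x * (q + 1)).negOnePow • K (x ++ lt q g y :: v) r₂) z).symm
  · rw [← splitSum_assoc (fun a b z => splitSum (fun y v =>
      (wd a * (q + 1) + wd b * (q + 1)).negOnePow • K a (b ++ lt q g y :: v)) z)]
    refine splitSum_congr (fun x z => ?_) r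
    rw [splitSum_comm]
    refine splitSum_congr_append fun a b h => splitSum_congr (fun y v => ?_) z
    subst h
    rw [wd_append, add_mul]

/-- Insertion of `P` around the marked letter and an inserted value of `f`. -/
def both (p : ℤ) (P : List (ℤ × V) → V) (q : ℤ) (f : List (ℤ × V) → V)
    (Θ : List (ℤ × V) → ℤ × V → List (ℤ × V) → M)
    (z : List (ℤ × V)) (a : ℤ × V) (r : List (ℤ × V)) : M :=
  splitSum (fun z₁ z₂ => splitSum (fun r₁ r₂ =>
    (wd z₁ * (p + 1) + (q + 1) * (wd z + (a.1 + 1))).negOnePow •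
      rins q f (fun s => Θ z₁ (lt p P (z₂ ++ a :: s)) r₂) r₁) r) z

theorem rins_smul (e : ℤˣ) (Φ : List (ℤ × V) → M) (w : List (ℤ × V)) :
    rins q g (fun w => e • Φ w) w = e • rins q g Φ w := ins3_smul ..

theorem rins_add (Φ Ψ : List (ℤ × V) → M) (w : List (ℤ × V)) :
    rins q g (fun w => Φ w + Ψ w) w = rins q g Φ w + rins q g Ψ w := ins3_add ..

theorem rins_outer_splitSum {α : Type*} (s : List α) (K : List α → List α → List (ℤ × V) → M)
    (w : List (ℤ × V)) :
    rins q g (fun w => splitSum (fun a b => K a b w) s) w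
      = splitSum (fun a b => rins q g (K a b) w) s := ins3_splitSum ..

/-- The value of f lies to the right of the marked letter, hence either beyond the block of P or
inside it; the second case is `both`. -/
theorem mR_ar (Θ : List (ℤ × V) → ℤ × V → List (ℤ × V) → M) (z : List (ℤ × V)) (a : ℤ × V)
    (r : List (ℤ × V)) :
    mR q f (ar p P Θ) z a r = ((p + 1) * (q + 1)).negOnePow • ar p P (mR q f Θ) z a r
      + both p P q f Θ z a r := by
  unfold mR ar both
  simp only [← splitSum_smul]
  rw [← splitSum_add, rins_outer_splitSum, ← splitSum_smul]
  refine splitSum_congr_append fun z₁ z₂ hz => ?_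
  rw [rins_splitSum, ← splitSum_smul, ← splitSum_add]
  refine splitSum_congr (fun r₁ r₂ => ?_) r
  rw [rins_smul, rins_smul, smul_add, add_comm]
  simp only [negOnePow_smul_smul]
  subst hz
  congr 1
  all_goals
    refine negOnePow_smul_congr ?_ rfl
    simp only [wd_append, wd_cons, lt_fst, parity_simps]
    grind

/-- This is `rins_rins` for the functional of the part to the right of the mark, with the sign for
passing the mark. -/
theorem mR_mR {Θ : List (ℤ × V) → ℤ × V → List (ℤ × V) → M} (z : List (ℤ × V)) (a : ℤ × V)
    (h : WordAdd (Θ z a)) (r : List (ℤ × V)) :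
    mR q f (mR p P Θ) z a r = ((p + 1) * (q + 1)).negOnePow • mR p P (mR q f Θ) z a r
      + (mR (q + p + 1) (rins q f P) Θ z a r
        - ((p + 1) * (q + 1)).negOnePow • mR (p + q + 1) (rins p P f) Θ z a r) := by
  unfold mR
  rw [rins_smul, rins_smul, rins_rins q p f P h]
  simp only [smul_add, smul_sub, negOnePow_smul_smul]
  have reorder : ∀ {A B C A' B' C' : M}, A = A' → B = B' → C = C' →
      A + (B - C) = B' + (A' - C') := by
    rintro _ _ _ _ _ _ rfl rfl rfl; abel
  refine reorder ?_ ?_ ?_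
  all_goals
    refine negOnePow_smul_congr ?_ rfl
    simp only [parity_simps]
    grind

/-- The block of P is split by its position relative to the mark, and f is moved past each of the
three cases. The corrections are the composites P{f} and f{P} and the term in which P covers both
the mark and the value of f. -/
theorem mR_rins {Φ : List (ℤ × V) → M} (h : WordAdd Φ) (z : List (ℤ × V)) (a : ℤ × V)
    (r : List (ℤ × V)) :
    mR q f (fun z a r => rins p P Φ (z ++ a :: r)) z a r
      = ((p + 1) * (q + 1)).negOnePow •
          (mL p P (mR q f fun z a r => Φ (z ++ a :: r)) z a r
            + ar p P (mR q f fun z a r => Φ (z ++ a :: r)) z a r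
            + mR p P (mR q f fun z a r => Φ (z ++ a :: r)) z a r)
        + (mR (q + p + 1) (rins q f P) (fun z a r => Φ (z ++ a :: r)) z a r
          - ((p + 1) * (q + 1)).negOnePow •
              mR (p + q + 1) (rins p P f) (fun z a r => Φ (z ++ a :: r)) z a r)
        + both p P q f (fun z a r => Φ (z ++ a :: r)) z a r := by
  have e : mR q f (fun z a r => rins p P Φ (z ++ a :: r)) z a r
      = mR q f (mL p P fun z a r => Φ (z ++ a :: r)) z a r
        + mR q f (ar p P fun z a r => Φ (z ++ a :: r)) z a r
        + mR q f (mR p P fun z a r => Φ (z ++ a :: r)) z a r := by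
    simp only [mR, ← smul_add, ← rins_add]
    congr 2
    funext r
    exact rins_mark p P Φ z a r
  have h' : WordAdd fun r => Φ (z ++ a :: r) := fun x r => by
    simpa using h (z ++ a :: x) r
  rw [e, mR_ar, mR_mR p q P f z a h', mL_mR]
  simp only [smul_add, smul_smul, Int.units_mul_self, one_smul]
  abel

/-! ### Pairs of insertions -/

/-- The sum of `Φ (x, g y, u, h v, z)` over all decompositions `w = x y u v z`. -/
def br2 (q : ℤ) (g : List (ℤ × V) → V) (r : ℤ) (h : List (ℤ × V) → V) (Φ : List (ℤ × V) → M)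
    (w : List (ℤ × V)) : M :=
  ins3 q g (mR r h fun z a r => Φ (z ++ a :: r)) w

theorem LetterAdd.rins {Θ : ℤ × V → List (ℤ × V) → M} (h : ∀ r, LetterAdd fun c => Θ c r)
    (r : List (ℤ × V)) : LetterAdd fun c => rins q g (Θ c) r := fun p a b => by
  dsimp only
  rw [← rins_add]
  congr 1
  funext r
  exact h r p a b

theorem LetterAdd.mR {Θ : List (ℤ × V) → ℤ × V → List (ℤ × V) → M}
    (h : ∀ x r, LetterAdd fun c => Θ x c r) (x r : List (ℤ × V)) :
    LetterAdd fun c => mR q g Θ x c r := fun p a b => by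
  have := LetterAdd.rins q g (h x) r p a b
  dsimp only at this
  simp only [Braces.mR, this, smul_add]

variable (r : ℤ) (h : List (ℤ × V) → V)

theorem lt_br2 {θ : ℤ × V → M} (hθ : LetterAdd θ) (Y : List (ℤ × V)) :
    θ (lt (p + q + r + 2) (br2 q g r h P) Y) = br2 q g r h (fun Y' => θ (lt p P Y')) Y := by
  simp only [lt, br2, mR, rins, ins3, hθ.splitSum, hθ.smul]
  refine splitSum_congr_append fun x z hz => splitSum_congr_append fun y v hv => ?_
  congr 2
  refine splitSum_congr_append fun x' z' hz' => splitSum_congr_append fun y' v' hv' => ?_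
  subst hv' hz' hv hz
  simp only [wd_append, wd_cons]
  congr 3
  ring

/-- P applied around values of g and h is the composite P{g, h}. -/
theorem ins3_both {Φ : List (ℤ × V) → M} (hΦ : WordAdd Φ) (w : List (ℤ × V)) :
    ins3 q g (both p P r h fun z a r => Φ (z ++ a :: r)) w
      = rins (p + q + r + 2) (br2 q g r h P) Φ w := by
  have e1 : rins (p + q + r + 2) (br2 q g r h P) Φ w = splitSum (fun x z => splitSum (fun Y v =>
      (wd x * (p + q + r + 2 + 1)).negOnePow •
        br2 q g r h (fun Y' => Φ (x ++ lt p P Y' :: v)) Y) z) w := by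
    refine splitSum_congr (fun x z => splitSum_congr (fun Y v => ?_) _) _
    exact congrArg _ (lt_br2 p q P g r h (hΦ x v) Y)
  rw [e1]
  simp only [br2, ins3, mR, both, ← splitSum_smul, negOnePow_smul_smul]
  refine splitSum_nested_around (fun x y t y' v => ?_) w
  refine negOnePow_smul_congr ?_ rfl
  simp only [wd_append, lt_fst, parity_simps]
  grind

/-- The expansion of Φ{P}{g, h}: the block of P covers neither value, only that of g, only that of
h, or both. The terms in which P covers neither are rewritten through Φ{g, h}{P}, which introduces
g{P} and h{P}. -/
theorem br2_rins {Φ : List (ℤ × V) → M} (hΦ : WordAdd Φ) (w : List (ℤ × V)) :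
    br2 q g r h (rins p P Φ) w
      = ((p + 1) * (q + r)).negOnePow •
          (rins p P (br2 q g r h Φ) w - br2 (p + q + 1) (rins p P g) r h Φ w)
        + ((p + 1) * (r + 1)).negOnePow • br2 (q + p + 1) (rins q g P) r h Φ w
        + (br2 q g (r + p + 1) (rins r h P) Φ w
          - ((p + 1) * (r + 1)).negOnePow • br2 q g (p + r + 1) (rins p P h) Φ w)
        + rins (p + q + r + 2) (br2 q g r h P) Φ w := by
  have hm : ∀ x v, LetterAdd fun c => mR r h (fun z a r => Φ (z ++ a :: r)) x c v :=
    LetterAdd.mR r h fun x v => hΦ x v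
  have e1 : rins p P (br2 q g r h Φ) w = br2 (p + q + 1) (rins p P g) r h Φ w + _ :=
    rins_ins3 p q P g hm w
  rw [e1, add_sub_cancel_left, ← ins3_both p q P g r h hΦ]
  unfold br2
  -- The value of g is taken as the marked letter, and h is inserted to its right.
  conv_lhs => rw [ins3_congr q g fun x c v => mR_rins p r P h hΦ x c v]
  rw [← ins3_ar p q P g hm]
  simp only [ins3_add, ins3_smul, smul_add, sub_eq_add_neg]
  have en : ∀ Θ : List (ℤ × V) → ℤ × V → List (ℤ × V) → M,
      ins3 q g (fun x c v => - Θ x c v) w = - ins3 q g Θ w := fun Θ =>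
    (ins3_map q g (negAddMonoidHom : M →+ M) Θ w).symm
  rw [en, ins3_smul]
  have es : ((p + 1) * (q + r)).negOnePow * ((p + 1) * (q + 1)).negOnePow
      = ((p + 1) * (r + 1)).negOnePow := by
    rw [← Int.negOnePow_add]
    refine negOnePow_congr ?_
    simp only [parity_simps]
    grind
  simp only [smul_smul, es]
  abel

end Braces

/-! ### Reindexing for cyclic words -/

section Sums

variable {α : Type u} {M : Type v} [AddCommGroup M]

theorem splitSum_three_left {F : List α → List α → List α → List α → List α → M}
    {G : List α → List α → List α → List α → List α → M}
    (h : ∀ r x y v, F (r ++ x) y v r x = G (x ++ (y ++ v)) r x y v) (w : List α) :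
    splitSum (fun s R => splitSum (fun y v => splitSum (fun r x => F s y v r x) s) R) w
      = splitSum (fun r z => splitSum (fun x z' => splitSum (fun y v => G z r x y v) z') z) w := by
  trans splitSum (fun s R => splitSum (fun r x => splitSum (fun y v => F s y v r x) R) s) w
  · exact splitSum_congr (fun s R => by rw [splitSum_comm]) w
  trans splitSum (fun s R => splitSum (fun r x => splitSum (fun y v => F (r ++ x) y v r x) R) s) w
  · exact splitSum_congr (fun s R => splitSum_congr_append fun r x hx => by rw [hx]) w
  rw [splitSum_assoc (fun r x R => splitSum (fun y v => F (r ++ x) y v r x) R)]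
  refine splitSum_congr (fun r z => splitSum_congr_append fun x R hx =>
    splitSum_congr_append fun y v hv => ?_) w
  rw [h, hv, hx]

theorem splitSum_three_right {F : List α → List α → List α → List α → M}
    {G : List α → List α → List α → List α → List α → M}
    (h : ∀ s y c d, F s y c d = G (s ++ (y ++ c)) s y c d) (w : List α) :
    splitSum (fun s R => splitSum (fun y v => splitSum (fun c d => F s y c d) v) R) w
      = splitSum (fun r d => splitSum (fun s R => splitSum (fun y c => G r s y c d) R) r) w := by
  trans splitSum (fun r d => splitSum (fun s R => splitSum (fun y c => F s y c d) R) r) w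
  · rw [splitSum_assoc (fun s R d => splitSum (fun y c => F s y c d) R)]
    exact splitSum_congr (fun s z => (splitSum_assoc (fun y c d => F s y c d) z).symm) w
  refine splitSum_congr (fun r z => splitSum_congr_append fun x R hx =>
    splitSum_congr_append fun y v hv => ?_) w
  rw [h, hv, hx]

/-- Both sides run over the decompositions `w = x y' z' z`. -/
theorem splitSum_three_cyc {F G : List α → List α → List α → List α → M}
    (h : ∀ x y' z' z, F x y' z' z = G x y' z' z) (w : List α) :
    splitSum (fun r z => splitSum (fun x y => splitSum (fun y' z' => F x y' z' z) y) r) w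
      = splitSum (fun r z => splitSum (fun z' z => splitSum (fun x y' => G x y' z' z) r) z) w := by
  obtain rfl : F = G := by funext x y z w; exact h x y z w
  trans splitSum (fun r z => splitSum (fun r z' => splitSum (fun x y' => F x y' z' z) r) r) w
  · exact splitSum_congr (fun r z => (splitSum_assoc (fun x y' z' => F x y' z' z) r).symm) w
  exact splitSum_assoc (fun r z' z => splitSum (fun x y' => F x y' z' z) r) w

/-- Both sides run over the decompositions `w = s x y z' z`. -/
theorem splitSum_cyc_around (F : List α → List α → List α → List α → List α → M) (w : List α) :
    splitSum (fun R z => splitSum (fun s v => splitSum (fun T z' => splitSum (fun x y =>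
      F s x y z' z) T) v) R) w
      = splitSum (fun R z => splitSum (fun S y => splitSum (fun z' z => splitSum (fun s x =>
        F s x y z' z) S) z) R) w := by
  trans splitSum (fun R z => splitSum (fun R z' => splitSum (fun S y => splitSum (fun s x =>
    F s x y z' z) S) R) R) w
  · refine splitSum_congr (fun R z => ?_) w
    rw [← splitSum_assoc (fun s T z' => splitSum (fun x y => F s x y z' z) T)]
    exact splitSum_congr (fun R z' => (splitSum_assoc (fun s x y => F s x y z' z) R).symm) R
  rw [splitSum_assoc (fun R z' z => splitSum (fun S y => splitSum (fun s x =>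
    F s x y z' z) S) R)]
  exact splitSum_congr (fun R z => by rw [splitSum_comm]) w

end Sums

/-! ### Rotations, Lie derivatives and contractions of cyclic words -/

namespace Braces

variable {V : Type u} {M : Type v} [AddCommGroup V] [AddCommGroup M]

/-- The sum of `Ψ z a r` over all decompositions `w = r z`, with Koszul signs: the sum over all
rotations `z a r` of the cyclic word `a w`. -/
def cyc (Ψ : List (ℤ × V) → ℤ × V → List (ℤ × V) → M) (a : ℤ × V) (w : List (ℤ × V)) : M :=
  splitSum (fun r z => (wd z * ((a.1 + 1) + wd r)).negOnePow • Ψ z a r) w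

theorem cyc_congr {Ψ Ψ' : List (ℤ × V) → ℤ × V → List (ℤ × V) → M} {a : ℤ × V}
    {w : List (ℤ × V)} (h : ∀ z r, Ψ z a r = Ψ' z a r) : cyc Ψ a w = cyc Ψ' a w :=
  splitSum_congr (fun r z => by rw [h]) w

theorem cyc_add (Ψ Ψ' : List (ℤ × V) → ℤ × V → List (ℤ × V) → M) (a : ℤ × V)
    (w : List (ℤ × V)) :
    cyc (fun z a r => Ψ z a r + Ψ' z a r) a w = cyc Ψ a w + cyc Ψ' a w := by
  simp only [cyc, smul_add, splitSum_add]

theorem cyc_sub (Ψ Ψ' : List (ℤ × V) → ℤ × V → List (ℤ × V) → M) (a : ℤ × V)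
    (w : List (ℤ × V)) :
    cyc (fun z a r => Ψ z a r - Ψ' z a r) a w = cyc Ψ a w - cyc Ψ' a w := by
  simp only [cyc, smul_sub, splitSum_sub]

theorem cyc_neg (Ψ : List (ℤ × V) → ℤ × V → List (ℤ × V) → M) (a : ℤ × V)
    (w : List (ℤ × V)) : cyc (fun z a r => - Ψ z a r) a w = - cyc Ψ a w := by
  simp only [cyc, smul_neg, splitSum_neg]

theorem cyc_smul (e : ℤˣ) (Ψ : List (ℤ × V) → ℤ × V → List (ℤ × V) → M) (a : ℤ × V)
    (w : List (ℤ × V)) : cyc (fun z a r => e • Ψ z a r) a w = e • cyc Ψ a w := by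
  simp only [cyc, smul_comm _ e, splitSum_smul]

/-- Insertion of `P` into the tail of a chain. -/
def tl (p : ℤ) (P : List (ℤ × V) → V) (Φ : ℤ × V → List (ℤ × V) → M) (a : ℤ × V)
    (w : List (ℤ × V)) : M :=
  ((p + 1) * (a.1 + 1)).negOnePow • rins p P (Φ a) w

/-- Application of `P` to the cyclic subwords of a chain that contain the head. -/
def hd (p : ℤ) (P : List (ℤ × V) → V) (Φ : ℤ × V → List (ℤ × V) → M) : ℤ × V →
    List (ℤ × V) → M :=
  cyc fun z a r => splitSum (fun x y => Φ (lt p P (z ++ a :: x)) y) r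

/-- The Lie derivative along `P`, with natural Koszul signs. -/
def lie (p : ℤ) (P : List (ℤ × V) → V) (Φ : ℤ × V → List (ℤ × V) → M) (a : ℤ × V)
    (w : List (ℤ × V)) : M :=
  tl p P Φ a w + hd p P Φ a w

/-- Application of `P` to the cyclic subwords of a chain that contain the head and, to the right
of the head, an inserted value of `f`. -/
def contr (p : ℤ) (P : List (ℤ × V) → V) (q : ℤ) (f : List (ℤ × V) → V)
    (Φ : ℤ × V → List (ℤ × V) → M) : ℤ × V → List (ℤ × V) → M :=
  cyc fun z a r => splitSum (fun s v =>
    mR q f (fun z a s => Φ (lt p P (z ++ a :: s)) v) z a s) r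

/-- Application of `P` to the cyclic subwords of a chain that contain a value of `g`, which in turn
contains the head and, to the right of the head, an inserted value of `f`. -/
def contr₂ (p : ℤ) (P : List (ℤ × V) → V) (r : ℤ) (g : List (ℤ × V) → V) (q : ℤ)
    (f : List (ℤ × V) → V) (Φ : ℤ × V → List (ℤ × V) → M) : ℤ × V → List (ℤ × V) → M :=
  cyc fun z a r' => splitSum (fun s v =>
    both r g q f (fun z a s => Φ (lt p P (z ++ a :: s)) v) z a s) r'

variable (p q r : ℤ) (P g f : List (ℤ × V) → V)

/-- After an insertion into the tail, a rotation cuts the new tail outside the inserted letter,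
which thus ends up to the left or to the right of the old head. -/
theorem tl_cyc (Ψ : List (ℤ × V) → ℤ × V → List (ℤ × V) → M) (a : ℤ × V) (w : List (ℤ × V)) :
    tl p P (cyc Ψ) a w = cyc (fun z a r => mL p P Ψ z a r + mR p P Ψ z a r) a w := by
  rw [cyc_add]
  simp only [tl, mL, mR, cyc, rins, ins3, splitSum_append, ← splitSum_smul, smul_add, splitSum_add,
    negOnePow_smul_smul]
  refine congrArg₂ _ ?_ ?_
  · refine splitSum_three_left ?_ w
    intro r x y v
    refine negOnePow_smul_congr ?_ rfl
    simp only [wd_append, wd_cons, lt_fst, parity_simps]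
    grind (splits := 40)
  · refine splitSum_three_right ?_ w
    intro r x y v
    refine negOnePow_smul_congr ?_ rfl
    simp only [wd_append, wd_cons, lt_fst, parity_simps]
    grind (splits := 40)

/-- If P swallows the head and the result is rotated, the value of P is the new marked letter: this
is the same as rotating first and applying P around the mark. -/
theorem hd_cyc (Ψ : List (ℤ × V) → ℤ × V → List (ℤ × V) → M) (a : ℤ × V) (w : List (ℤ × V)) :
    hd p P (cyc Ψ) a w = cyc (ar p P Ψ) a w := by
  simp only [hd, ar, cyc, ← splitSum_smul, negOnePow_smul_smul]
  trans splitSum (fun r z => splitSum (fun x y => splitSum (fun y' z' =>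
    ((wd z + wd z') * (a.1 + 1 + wd x + wd y') + wd z' * (p + 1)).negOnePow
      • Ψ z' (lt p P (z ++ a :: x)) y') y) r) w
  · refine splitSum_congr (fun r z => splitSum_congr_append fun x y hx =>
      splitSum_congr_append fun y' z' hy => negOnePow_smul_congr ?_ rfl) w
    subst hy hx
    simp only [wd_append, wd_cons, lt_fst, parity_simps]
    grind (splits := 40)
  · refine (splitSum_three_cyc (fun x y' z' z => rfl) w).trans ?_
    refine splitSum_congr (fun r z => splitSum_congr_append fun x y hx =>
      splitSum_congr_append fun y' z' hy => negOnePow_smul_congr ?_ rfl) w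
    subst hy hx
    simp only [wd_append, parity_simps]
    grind (splits := 40)

/-- On a sum over rotations the Lie derivative becomes insertion at every place of the rotated word,
so identities for words can be used on cyclic words. -/
theorem lie_cyc (Ψ : List (ℤ × V) → ℤ × V → List (ℤ × V) → M) (a : ℤ × V) (w : List (ℤ × V)) :
    lie p P (cyc Ψ) a w
      = cyc (fun z a r => mL p P Ψ z a r + ar p P Ψ z a r + mR p P Ψ z a r) a w := by
  rw [lie, tl_cyc, hd_cyc, ← cyc_add]
  exact cyc_congr fun z r => by abel

/-- The new head is a value of P that already contains the old head and a value of f; a further g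
that swallows it produces the doubly nested term. -/
theorem contr_hd (Φ : ℤ × V → List (ℤ × V) → M) (a : ℤ × V) (w : List (ℤ × V)) :
    contr p P q f (hd r g Φ) a w = contr₂ r g p P q f Φ a w := by
  have e : contr p P q f (hd r g Φ) a w = splitSum (fun R z => splitSum (fun s v =>
      splitSum (fun T z' => splitSum (fun x y => ((wd z + wd z') * (a.1 + 1 + wd s + wd x + wd y)
        + wd z' * (p + 1) + (q + 1) * (wd z' + wd z + (a.1 + 1))).negOnePow • rins q f (fun s =>
          Φ (lt r g (z' ++ lt p P (z ++ a :: s) :: x)) y) s) T) v) R) w := by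
    simp only [contr, cyc, mR, hd, ← splitSum_smul]
    refine splitSum_congr (fun R z => splitSum_congr_append fun s v hs => ?_) w
    rw [rins_outer_splitSum, ← splitSum_smul, ← splitSum_smul]
    refine splitSum_congr_append fun T z' hv => ?_
    rw [rins_outer_splitSum, ← splitSum_smul, ← splitSum_smul]
    refine splitSum_congr_append fun x y hT => ?_
    simp only [rins]
    rw [← ins3_smul, ← ins3_smul, ← ins3_smul]
    refine ins3_congr_append q f fun b c d hb => ?_
    rw [negOnePow_smul_smul, negOnePow_smul_smul]
    subst hb hT hv hs
    refine negOnePow_smul_congr ?_ rfl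
    simp only [wd_append, wd_cons, lt_fst, parity_simps]
    grind (splits := 40)
  rw [e]
  simp only [contr₂, cyc, both, ← splitSum_smul, negOnePow_smul_smul]
  trans splitSum (fun R z => splitSum (fun S y => splitSum (fun z' z => splitSum (fun s x =>
    ((wd z + wd z') * (a.1 + 1 + wd s + wd x + wd y)
        + wd z' * (p + 1) + (q + 1) * (wd z' + wd z + (a.1 + 1))).negOnePow • rins q f (fun s =>
          Φ (lt r g (z' ++ lt p P (z ++ a :: s) :: x)) y) s) S) z) R) w
  · exact splitSum_cyc_around _ w
  · refine splitSum_congr (fun R z => splitSum_congr_append fun s v hs =>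
      splitSum_congr_append fun T z' hv => splitSum_congr_append fun x y hT =>
        negOnePow_smul_congr ?_ rfl) w
    subst hT hv hs
    simp only [wd_append, parity_simps]
    grind (splits := 40)

theorem contr_tl (Φ : ℤ × V → List (ℤ × V) → M) (a : ℤ × V) (w : List (ℤ × V)) :
    contr p P q f (tl r g Φ) a w = ((p + q) * (r + 1)).negOnePow •
      cyc (fun z a R => splitSum (fun s v => ((r + 1) * (wd z + (a.1 + 1) + wd s)).negOnePow •
        rins r g (fun v => mR q f (fun z a s => Φ (lt p P (z ++ a :: s)) v) z a s) v) R) a w := by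
  rw [← cyc_smul]
  refine cyc_congr fun z R => ?_
  rw [← splitSum_smul]
  refine splitSum_congr (fun s v => ?_) R
  simp only [mR, tl]
  rw [rins_smul, negOnePow_smul_smul, negOnePow_smul_smul]
  simp only [rins]
  rw [ins3_comm q r f g, ← ins3_smul, ← ins3_smul]
  refine ins3_congr_append q f fun b c d hb => ?_
  rw [negOnePow_smul_smul]
  subst hb
  refine negOnePow_smul_congr ?_ rfl
  simp only [wd_append, wd_cons, lt_fst, parity_simps]
  grind (splits := 40)

/-- By the derivation rule `rins_splitSum`, an insertion to the right of the mark, followed by a cut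
of that part into s and v, falls into s or into v. -/
theorem lie_contr_aux (Θ : List (ℤ × V) → List (ℤ × V) → ℤ × V → List (ℤ × V) → M)
    (a : ℤ × V) (w : List (ℤ × V)) :
    lie r g (cyc fun z a R => splitSum (fun s v => Θ v z a s) R) a w
      = cyc (fun z a R => splitSum (fun s v => mL r g (Θ v) z a s + ar r g (Θ v) z a s
        + mR r g (Θ v) z a s) R) a w
      + cyc (fun z a R => splitSum (fun s v => ((r + 1) * (wd z + (a.1 + 1) + wd s)).negOnePow •
        rins r g (fun v => Θ v z a s) v) R) a w := by
  rw [lie_cyc, ← cyc_add]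
  refine cyc_congr fun z R => ?_
  have e1 : mL r g (fun z a R => splitSum (fun s v => Θ v z a s) R) z a R
      = splitSum (fun s v => mL r g (Θ v) z a s) R :=
    rins_outer_splitSum r g R (fun s v z => Θ v z a s) z
  have e2 : ar r g (fun z a R => splitSum (fun s v => Θ v z a s) R) z a R
      = splitSum (fun s v => ar r g (Θ v) z a s) R := by
    simp only [ar, ← splitSum_smul]
    symm
    rw [splitSum_comm]
    refine splitSum_congr (fun z₁ z₂ => ?_) z
    exact splitSum_assoc (fun r₁ s v => (wd z₁ * (r + 1)).negOnePow •
      Θ v z₁ (lt r g (z₂ ++ a :: r₁)) s) R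
  have e3 : mR r g (fun z a R => splitSum (fun s v => Θ v z a s) R) z a R
      = splitSum (fun s v => mR r g (Θ v) z a s) R
        + splitSum (fun s v => ((r + 1) * (wd z + (a.1 + 1) + wd s)).negOnePow •
          rins r g (fun v => Θ v z a s) v) R := by
    simp only [mR]
    rw [show (fun R => splitSum (fun s v => Θ v z a s) R) = splitSum (fun s v => Θ v z a s)
      from rfl, rins_splitSum, ← splitSum_smul, ← splitSum_add]
    refine splitSum_congr (fun s v => ?_) R
    rw [smul_add, negOnePow_smul_smul]
    congr 3
    ring
  rw [e1, e2, e3, ← add_assoc]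
  simp only [splitSum_add]

theorem wordAdd_lt (hP : WordAdd P) {Φ : ℤ × V → M} (hΦ : LetterAdd Φ) :
    WordAdd fun w => Φ (lt p P w) := fun x y e a b => by
  simp only [lt, wd_append, wd_cons]
  rw [show P (x ++ (e, a + b) :: y) = P (x ++ (e, a) :: y) + P (x ++ (e, b) :: y) from
    hP x y e a b]
  exact hΦ _ _ _

/-- The commutator of a contraction and a Lie derivative. -/
theorem lie_contr (hP : WordAdd P) {Φ : ℤ × V → List (ℤ × V) → M}
    (hΦ : ∀ w, LetterAdd fun a => Φ a w) (a : ℤ × V) (w : List (ℤ × V)) :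
    lie r g (contr p P q f Φ) a w = ((p + q) * (r + 1)).negOnePow • contr p P q f (lie r g Φ) a w
      + contr p P (r + q + 1) (rins r g f) Φ a w
      + ((q + 1) * (r + 1)).negOnePow • (contr (r + p + 1) (rins r g P) q f Φ a w
        - contr p P (q + r + 1) (rins q f g) Φ a w
        - contr₂ p P r g q f Φ a w
        - ((p + 1) * (r + 1)).negOnePow • contr₂ r g p P q f Φ a w) := by
  have e0 : contr p P q f (lie r g Φ) a w = contr p P q f (tl r g Φ) a w
      + contr p P q f (hd r g Φ) a w := by
    simp only [contr, lie, mR, rins_add, smul_add, splitSum_add]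
    exact cyc_add ..
  -- By `mR_rins`, the three positions of g in the block of P amount to g inserted into P or into f,
  -- less the cases where g swallows the value of f, without or together with the head.
  have key : ∀ v z a s, mL r g (mR q f fun z a s => Φ (lt p P (z ++ a :: s)) v) z a s
      + ar r g (mR q f fun z a s => Φ (lt p P (z ++ a :: s)) v) z a s
      + mR r g (mR q f fun z a s => Φ (lt p P (z ++ a :: s)) v) z a s
      = mR (r + q + 1) (rins r g f) (fun z a s => Φ (lt p P (z ++ a :: s)) v) z a s
        + ((q + 1) * (r + 1)).negOnePow • (mR q f (fun z a s => Φ (lt (r + p + 1) (rins r g P)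
            (z ++ a :: s)) v) z a s
          - mR (q + r + 1) (rins q f g) (fun z a s => Φ (lt p P (z ++ a :: s)) v) z a s
          - both r g q f (fun z a s => Φ (lt p P (z ++ a :: s)) v) z a s) := by
    intro v z a s
    have h1 := mR_rins r q g f (wordAdd_lt p P hP (hΦ v)) z a s
    have h2 : mR q f (fun z a s => Φ (lt (r + p + 1) (rins r g P) (z ++ a :: s)) v) z a s
        = mR q f (fun z a s => rins r g (fun w => Φ (lt p P w) v) (z ++ a :: s)) z a s := by
      congr 1
      funext z a s
      exact lt_rins r p g P (hΦ v) (z ++ a :: s)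
    rw [h2, h1, show (q + 1) * (r + 1) = (r + 1) * (q + 1) from mul_comm _ _]
    simp only [smul_add, smul_sub, smul_smul, Int.units_mul_self, one_smul]
    abel
  rw [e0, contr_tl, contr_hd, smul_add, smul_smul, Int.units_mul_self, one_smul]
  unfold contr
  rw [lie_contr_aux]
  simp only [key]
  simp only [splitSum_add, splitSum_smul, splitSum_sub]
  simp only [cyc_add, cyc_smul, cyc_sub]
  have es : ((q + 1) * (r + 1)).negOnePow * ((p + 1) * (r + 1)).negOnePow
      = ((p + q) * (r + 1)).negOnePow := by
    rw [← Int.negOnePow_add]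
    refine negOnePow_congr ?_
    simp only [parity_simps]
    grind (splits := 40)
  simp only [smul_sub, smul_smul, es, contr₂]
  abel

end Braces

/-! ### First and last letters of a word -/

section Sums

variable {α : Type u} {M : Type v} [AddCommGroup M]

/-- `F a y` if the word is `a y`. -/
def frontSum (F : α → List α → M) : List α → M
  | [] => 0
  | a :: y => F a y

/-- `F x a` if the word is `x a`. -/
def backSum (F : List α → α → M) (w : List α) : M :=
  letterSum (fun x a z => match z with
    | [] => F x a
    | _ :: _ => 0) w

theorem letterSum_zero (w : List α) : letterSum (fun _ _ _ => (0 : M)) w = 0 := by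
  induction w with
  | nil => rfl
  | cons a w ih => simp only [letterSum, ih, add_zero]

theorem letterSum_add (F G : List α → α → List α → M) (w : List α) :
    letterSum (fun x a y => F x a y + G x a y) w = letterSum F w + letterSum G w := by
  induction w generalizing F G with
  | nil => simp [letterSum]
  | cons a w ih => simp only [letterSum, ih]; abel

theorem letterSum_congr_append {F G : List α → α → List α → M} {w : List α}
    (h : ∀ x a y, x ++ a :: y = w → F x a y = G x a y) : letterSum F w = letterSum G w := by
  induction w generalizing F G with
  | nil => rfl
  | cons a w ih =>
    simp only [letterSum]
    rw [h [] a w rfl, ih fun x b y hxy => h (a :: x) b y (by rw [List.cons_append, hxy])]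

@[simp] theorem backSum_nil (F : List α → α → M) : backSum F [] = 0 := rfl

@[simp] theorem backSum_concat (F : List α → α → M) (x : List α) (a : α) :
    backSum F (x ++ [a]) = F x a := by
  unfold backSum
  rw [letterSum_append]
  rw [letterSum_congr (G := fun _ _ _ => 0), letterSum_zero]
  · simp [letterSum]
  · intro u b v
    cases v <;> rfl

theorem backSum_cons (F : List α → α → M) (a : α) (w : List α) :
    backSum F (a :: w) = (match w with
      | [] => F [] a
      | _ :: _ => 0) + backSum (fun x => F (a :: x)) w := rfl

theorem backSum_mid (F : List α → α → M) (u : List α) (a b : α) (v : List α) :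
    backSum F (u ++ a :: b :: v) = backSum (fun x => F (u ++ a :: x)) (b :: v) := by
  obtain ⟨y, c, h⟩ : ∃ y c, b :: v = y ++ [c] := by
    rcases List.eq_nil_or_concat (b :: v) with h | ⟨y, c, h⟩
    · simp at h
    · exact ⟨y, c, by simpa using h⟩
  rw [h, show u ++ a :: (y ++ [c]) = (u ++ a :: y) ++ [c] by simp, backSum_concat, backSum_concat]

theorem map_frontSum {N : Type w} [AddCommGroup N] (φ : M →+ N) (F : α → List α → M)
    (w : List α) : φ (frontSum F w) = frontSum (fun a y => φ (F a y)) w := by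
  cases w with
  | nil => exact map_zero φ
  | cons a w => rfl

theorem map_backSum {N : Type w} [AddCommGroup N] (φ : M →+ N) (F : List α → α → M)
    (w : List α) : φ (backSum F w) = backSum (fun a y => φ (F a y)) w := by
  unfold backSum
  rw [map_letterSum]
  refine letterSum_congr (fun x a z => ?_) w
  cases z with
  | nil => rfl
  | cons b z => exact map_zero φ

theorem frontSum_smul (e : ℤˣ) (F : α → List α → M) (w : List α) :
    frontSum (fun a y => e • F a y) w = e • frontSum F w :=
  (map_frontSum (DistribSMul.toAddMonoidHom M e) F w).symm

theorem backSum_smul (e : ℤˣ) (F : List α → α → M) (w : List α) :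
    backSum (fun a y => e • F a y) w = e • backSum F w :=
  (map_backSum (DistribSMul.toAddMonoidHom M e) F w).symm

theorem backSum_congr_append {F G : List α → α → M} {w : List α}
    (h : ∀ x a, x ++ [a] = w → F x a = G x a) : backSum F w = backSum G w := by
  rcases List.eq_nil_or_concat w with rfl | ⟨y, c, rfl⟩
  · rfl
  · simp only [List.concat_eq_append, backSum_concat]
    exact h y c (by simp)

theorem frontSum_congr {F G : α → List α → M} {w : List α}
    (h : ∀ a y, a :: y = w → F a y = G a y) : frontSum F w = frontSum G w := by
  cases w with
  | nil => rfl
  | cons a y => exact h a y rfl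

/-- `F x` if `y` is empty. -/
theorem splitSum_eq_self {F : List α → List α → M} (h : ∀ x a y, F x (a :: y) = 0) (w : List α) :
    splitSum F w = F w [] := by
  induction w generalizing F with
  | nil => rfl
  | cons a w ih => simp only [splitSum, h, zero_add, ih fun x b y => h (a :: x) b y]

theorem splitSum_eq_self' {F : List α → List α → M} (h : ∀ a x y, F (a :: x) y = 0) (w : List α) :
    splitSum F w = F [] w := by
  cases w with
  | nil => rfl
  | cons a w => simp only [splitSum, h, splitSum_zero, add_zero]

theorem splitSum_eq_frontSum {F : List α → List α → M} (h : ∀ a b x y, F (a :: b :: x) y = 0)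
    (w : List α) : splitSum F w = F [] w + frontSum (fun a y => F [a] y) w := by
  cases w with
  | nil => simp [splitSum, frontSum]
  | cons a w =>
    simp only [splitSum, frontSum]
    rw [splitSum_eq_self' fun b x y => h a b x y]

theorem splitSum_eq_backSum {F : List α → List α → M} (h : ∀ x a b y, F x (a :: b :: y) = 0)
    (w : List α) : splitSum F w = F w [] + backSum (fun x a => F x [a]) w := by
  induction w generalizing F with
  | nil => simp [splitSum]
  | cons a w ih =>
    simp only [splitSum, ih fun x => h (a :: x), backSum_cons]
    cases w with
    | nil => simp; abel
    | cons b w => simp [h]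

theorem splitSum_backSum (L : List α → List α → α → M) (w : List α) :
    splitSum (fun u v => backSum (L u) v) w
      = backSum (fun w c => splitSum (fun u v => L u v c) w) w := by
  rcases List.eq_nil_or_concat w with rfl | ⟨y, c, rfl⟩
  · rfl
  · simp [splitSum_append, splitSum]

theorem splitSum_frontSum (L : List α → α → List α → M) (w : List α) :
    splitSum (fun r z => frontSum (L r) z) w = letterSum L w := by
  induction w generalizing L with
  | nil => rfl
  | cons a w ih =>
    simp only [splitSum, letterSum]
    rw [ih fun r => L (a :: r)]
    rfl

theorem splitSum_backSum_left (L : List α → α → List α → M) (w : List α) :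
    splitSum (fun r z => backSum (fun x c => L x c z) r) w = letterSum L w := by
  induction w generalizing L with
  | nil => rfl
  | cons a w ih =>
    have e : ∀ x y, backSum (fun x c => L x c y) (a :: x) = (match x with
      | [] => L [] a y
      | _ :: _ => 0) + backSum (fun x c => L (a :: x) c y) x := fun x y => backSum_cons ..
    simp only [splitSum, letterSum, backSum_nil, zero_add, e, splitSum_add]
    rw [ih fun r => L (a :: r), splitSum_eq_self']
    intro b x y
    rfl

end Sums

/-! ### Odd functionals with P{P} = 0 -/

namespace Braces

variable {V : Type u} {M : Type v} [AddCommGroup V] [AddCommGroup M]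
variable (p q : ℤ) (P g f : List (ℤ × V) → V)

/-- P to the left of g is g to the right of P: the same pair of disjoint blocks, with the Koszul
sign of the exchange. -/
theorem ins3_mL (Φ : List (ℤ × V) → M) (w : List (ℤ × V)) :
    ins3 q g (mL p P fun z a r => Φ (z ++ a :: r)) w = ((p + 1) * (q + 1)).negOnePow •
      ins3 p P (mR q g fun z a r => Φ (z ++ a :: r)) w := by
  simp only [ins3, mL, mR, rins, ← splitSum_smul, negOnePow_smul_smul]
  symm
  refine splitSum_nested_left ?_ w
  intro s t x y v
  refine negOnePow_smul_congr ?_ (by simp)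
  simp only [wd_append, lt_fst, parity_simps]
  grind (splits := 40)

/-- Insertion of an odd `P` with `P ∘ P = 0` squares to zero. -/
theorem rins_sq (hp : Odd (p + 1)) (hP : ∀ w, rins p P P w = 0) {Φ : List (ℤ × V) → M}
    (hΦ : WordAdd Φ) (w : List (ℤ × V)) : rins p P (rins p P Φ) w = 0 := by
  have e : ((p + 1) * (p + 1)).negOnePow = -1 := Int.negOnePow_odd _ (hp.mul hp)
  have e1 : rins p P (rins p P Φ) w = _ := rins_ins3 p p P P (fun x v => hΦ x v) w
  rw [e1, ins3_add, ins3_mL, e]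
  simp only [Units.neg_smul, one_smul, neg_add_cancel, neg_zero, add_zero]
  have : ∀ x v Y, Φ (x ++ lt (p + p + 1) (rins p P P) Y :: v) = 0 := fun x v Y => by
    simp only [lt, hP]
    exact (hΦ x v).zero _
  simp only [ins3, this, smul_zero, splitSum_zero]

/-- Two insertions into the tail cancel by `rins_sq`. If the first insertion meets a block to which
P is then applied, P{P} = 0 applies. The remaining terms have one P on the head block and one in the
tail; they occur in both orders with opposite signs. -/
theorem lie_sq (hp : Odd (p + 1)) (hP : ∀ w, rins p P P w = 0)
    {Φ : ℤ × V → List (ℤ × V) → M} (hΦ : ∀ w, LetterAdd fun a => Φ a w)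
    (hΦ' : ∀ a, WordAdd (Φ a)) (a : ℤ × V) (w : List (ℤ × V)) : lie p P (lie p P Φ) a w = 0 := by
  have e0 : lie p P (lie p P Φ) a w = tl p P (tl p P Φ) a w + hd p P (tl p P Φ) a w
      + lie p P (hd p P Φ) a w := by
    have e1 : tl p P (lie p P Φ) a w = tl p P (tl p P Φ) a w + tl p P (hd p P Φ) a w := by
      change _ • rins p P (fun w => tl p P Φ a w + hd p P Φ a w) w = _
      rw [rins_add, smul_add]
      rfl
    have e2 : hd p P (lie p P Φ) a w = hd p P (tl p P Φ) a w + hd p P (hd p P Φ) a w := by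
      simp only [hd, ← cyc_add, lie, ← splitSum_add]
    rw [lie, e1, e2, lie]
    abel
  have e1 : tl p P (tl p P Φ) a w = 0 := by
    change _ • rins p P (fun w => _ • rins p P (Φ a) w) w = 0
    rw [rins_smul, rins_sq p P hp hP (hΦ' a), smul_zero, smul_zero]
  have e2 : ∀ v z a s, mL p P (fun z a s => Φ (lt p P (z ++ a :: s)) v) z a s
      + ar p P (fun z a s => Φ (lt p P (z ++ a :: s)) v) z a s
      + mR p P (fun z a s => Φ (lt p P (z ++ a :: s)) v) z a s = 0 := by
    intro v z a s
    rw [← rins_mark p P (fun w => Φ (lt p P w) v), ← lt_rins p p P P (hΦ v)]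
    simp only [lt, hP]
    exact (hΦ v).zero _
  rw [e0, e1, zero_add]
  unfold hd
  rw [lie_contr_aux p P fun v z a s => Φ (lt p P (z ++ a :: s)) v]
  simp only [e2]
  rw [← cyc_add, ← cyc_add]
  refine (cyc_congr (Ψ' := fun _ _ _ => 0) fun z r => ?_).trans ?_
  · rw [splitSum_zero, zero_add, ← splitSum_add]
    refine (splitSum_congr (fun s v => ?_) r).trans (splitSum_zero r)
    -- Since p is even, applying P to the head block changes the parity of its suspended degree;
    -- this is the sign that makes the two orders cancel.
    have : ((p + 1) * ((lt p P (z ++ a :: s)).1 + 1)).negOnePow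
        = -((p + 1) * (wd z + (a.1 + 1) + wd s)).negOnePow := by
      rw [← Int.negOnePow_succ]
      refine negOnePow_congr ?_
      have h2 : Even p := by simpa [parity_simps] using hp
      simp only [wd_append, wd_cons, lt_fst, parity_simps]
      grind
    rw [tl, this]
    simp
  · simp only [cyc, smul_zero, splitSum_zero]

end Braces

theorem backSum_append_cons {α : Type u} {M : Type v} [AddCommGroup M] (F : List α → α → M)
    (u : List α) (a : α) (v : List α) :
    backSum F (u ++ a :: v) = (match v with
      | [] => F u a
      | _ :: _ => 0) + backSum (fun x => F (u ++ a :: x)) v := by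
  cases v with
  | nil => simp
  | cons b v => rw [backSum_mid, zero_add]

/-! ### The differential and the product as one word functional -/

namespace AugDGRing
open Braces

variable {k : Type u} [Field k] {t : ℕ} (A : AugDGRing.{u, v} k t)
variable {M : Type w} [AddCommGroup M]

theorem gr_bijective : Function.Bijective (DirectSum.coeLinearMap A.gr) := A.internal

/-- The projection onto the component of degree `p`. -/
noncomputable def prj (p : ℤ) : A.carrier →ₗ[k] A.carrier :=
  (A.gr p).subtype ∘ₗ DirectSum.component k ℤ (fun i => A.gr i) p ∘ₗ
    (LinearEquiv.ofBijective (DirectSum.coeLinearMap A.gr) A.gr_bijective).symm.toLinearMap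

variable {A}

theorem prj_mem (p : ℤ) (x : A.carrier) : A.prj p x ∈ A.gr p := by
  simp [prj]

theorem prj_of_mem {p : ℤ} {x : A.carrier} (h : x ∈ A.gr p) : A.prj p x = x := by
  have : (LinearEquiv.ofBijective (DirectSum.coeLinearMap A.gr) A.gr_bijective).symm x
      = DirectSum.lof k ℤ (fun i => A.gr i) p ⟨x, h⟩ := by
    rw [LinearEquiv.symm_apply_eq]
    simp
  simp [prj, this, DirectSum.component.lof_self]

theorem prj_of_mem_ne {p q : ℤ} {x : A.carrier} (h : x ∈ A.gr q) (hpq : q ≠ p) :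
    A.prj p x = 0 := by
  have : (LinearEquiv.ofBijective (DirectSum.coeLinearMap A.gr) A.gr_bijective).symm x
      = DirectSum.lof k ℤ (fun i => A.gr i) q ⟨x, h⟩ := by
    rw [LinearEquiv.symm_apply_eq]
    simp
  simp [prj, this, DirectSum.component.of, hpq]

@[simp] theorem prj_prj (p : ℤ) (x : A.carrier) : A.prj p (A.prj p x) = A.prj p x :=
  prj_of_mem (prj_mem p x)

theorem linearMap_ext_gr {N : Type*} [AddCommGroup N] [Module k N] {φ ψ : A.carrier →ₗ[k] N}
    (h : ∀ p, ∀ x ∈ A.gr p, φ x = ψ x) : φ = ψ := by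
  have ht : ⨆ p, A.gr p = ⊤ := A.internal.submodule_iSup_eq_top
  ext x
  have hx : x ∈ ⨆ p, A.gr p := by rw [ht]; trivial
  induction hx using Submodule.iSup_induction' with
  | mem p x hx => exact h p x hx
  | zero => simp
  | add x y _ _ hx hy => simp [hx, hy]

theorem prj_η_mul (p : ℤ) (κ : Fin t → k) (x : A.carrier) :
    A.prj p (A.η κ * x) = A.η κ * A.prj p x := by
  have : A.prj p ∘ₗ LinearMap.mulLeft k (A.η κ) = LinearMap.mulLeft k (A.η κ) ∘ₗ A.prj p := by
    refine linearMap_ext_gr fun q x hx => ?_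
    by_cases hq : q = p
    · subst hq
      simp [prj_of_mem hx, prj_of_mem (A.η_mul_mem κ hx)]
    · simp [prj_of_mem_ne hx hq, prj_of_mem_ne (A.η_mul_mem κ hx) hq]
  exact LinearMap.congr_fun this x

theorem prj_mul_η (p : ℤ) (κ : Fin t → k) (x : A.carrier) :
    A.prj p (x * A.η κ) = A.prj p x * A.η κ := by
  have : A.prj p ∘ₗ LinearMap.mulRight k (A.η κ) = LinearMap.mulRight k (A.η κ) ∘ₗ A.prj p := by
    refine linearMap_ext_gr fun q x hx => ?_
    by_cases hq : q = p
    · subst hq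
      simp [prj_of_mem hx, prj_of_mem (A.mul_η_mem κ hx)]
    · simp [prj_of_mem_ne hx hq, prj_of_mem_ne (A.mul_η_mem κ hx) hq]
  exact LinearMap.congr_fun this x

variable (A) in
/-- The differential and the product of `A` as one word functional of degree `-2`. -/
noncomputable def mm : List (ℤ × A.carrier) → A.carrier
  | [a] => A.d (A.prj a.1 a.2)
  | [a, b] => (a.1 + 1).negOnePow • (A.prj a.1 a.2 * A.prj b.1 b.2)
  | _ => 0

theorem mm_of_three (a b c : ℤ × A.carrier) (w : List (ℤ × A.carrier)) :
    A.mm (a :: b :: c :: w) = 0 := rfl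

theorem mm_of_length {w : List (ℤ × A.carrier)} (h : 3 ≤ w.length) : A.mm w = 0 := by
  match w, h with
  | a :: b :: c :: w, _ => rfl

theorem mm_wordAdd : WordAdd A.mm := by
  intro x y p a b
  match x, y with
  | [], [] => simp [mm]
  | [], [c] => simp [mm, add_mul]
  | [c], [] => simp [mm, mul_add]
  | [], c :: d :: y => simp [mm]
  | [c], d :: y => simp [mm]
  | c :: d :: x, y =>
    simp only [List.cons_append]
    rw [mm_of_length, mm_of_length, mm_of_length, add_zero] <;> simp <;> omega

/-- Only blocks of length one and two contribute, since `mm` vanishes on all others. -/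
theorem rins_mm {Φ : List (ℤ × A.carrier) → M} (hΦ : WordAdd Φ) (w : List (ℤ × A.carrier)) :
    rins (-2) A.mm Φ w
      = letterSum (fun x a y => (wd x).negOnePow • Φ (x ++ (a.1 - 1, A.d (A.prj a.1 a.2)) :: y)) w
      + letterSum (fun x a z => frontSum (fun b y => (wd x + (a.1 + 1)).negOnePow •
          Φ (x ++ (a.1 + b.1, A.prj a.1 a.2 * A.prj b.1 b.2) :: y)) z) w := by
  have e : ∀ x : List (ℤ × A.carrier), (wd x * (-2 + 1)).negOnePow = (wd x).negOnePow := fun x =>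
    negOnePow_congr (by simp only [parity_simps]; grind)
  rw [rins, ins3]
  simp only [e]
  rw [← letterSum_add, ← splitSum_frontSum]
  refine splitSum_congr (fun x z => ?_) w
  cases z with
  | nil =>
    simp only [splitSum, frontSum, lt, mm]
    rw [(hΦ x []).zero, smul_zero]
  | cons a z =>
    simp only [splitSum, frontSum]
    rw [splitSum_eq_frontSum]
    · have h1 : Φ (x ++ lt (-2) A.mm [] :: a :: z) = 0 := (hΦ x _).zero _
      rw [h1, smul_zero, zero_add]
      congr 1
      · simp [lt, mm]
        congr 4
        ring
      · refine frontSum_congr fun b y _ => ?_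
        simp only [lt, mm, wd_cons, wd_nil]
        rw [(hΦ x y).smul, negOnePow_smul_smul]
        congr 5
        ring
    · intro b c u v
      rw [lt, mm_of_three, (hΦ x v).zero, smul_zero]

/-- In lengths one, two and three this is d² = 0, the Leibniz rule and associativity. From length
four on, each inner value leaves at least three letters for the outer `mm`. -/
theorem mm_mm (w : List (ℤ × A.carrier)) : rins (-2) A.mm A.mm w = 0 := by
  rw [rins_mm mm_wordAdd]
  match w with
  | [] => simp [letterSum]
  | [a] => simp [letterSum, frontSum, mm, prj_of_mem (A.d_mem (prj_mem _ _)), A.d_d]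
  | [a, b] =>
    simp [letterSum, frontSum, mm, prj_of_mem (A.d_mem (prj_mem _ _)),
      prj_of_mem (A.mul_mem (prj_mem _ _) (prj_mem _ _)), A.d_mul (prj_mem _ _)]
    simp only [Int.negOnePow_add, Int.negOnePow_one, mul_neg, mul_one, Units.neg_smul, smul_neg]
    abel
  | [a, b, c] =>
    simp [letterSum, frontSum, mm, prj_of_mem (A.mul_mem (prj_mem _ _) (prj_mem _ _))]
    simp only [Int.negOnePow_add, Int.negOnePow_one, mul_neg, mul_one, Units.neg_smul, smul_neg,
      mul_assoc, smul_smul, neg_neg, neg_mul]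
    rw [mul_comm b.1.negOnePow a.1.negOnePow, add_neg_cancel]
  | a :: b :: c :: d :: w =>
    rw [letterSum_congr_append (G := fun _ _ _ => 0), letterSum_zero, zero_add,
      letterSum_congr_append (G := fun _ _ _ => 0), letterSum_zero]
    · intro x e y h
      cases y with
      | nil => rfl
      | cons f y =>
        simp only [frontSum]
        rw [mm_of_length, smul_zero]
        have := congrArg List.length h
        simp at this ⊢
        omega
    · intro x e y h
      rw [mm_of_length, smul_zero]
      have := congrArg List.length h
      simp at this ⊢
      omega

end AugDGRing

theorem splitSum_eq_add_letterSum {α : Type u} {M : Type v} [AddCommGroup M]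
    (F : List α → List α → M) (w : List α) :
    splitSum F w = F w [] + letterSum (fun r c z => F r (c :: z)) w := by
  induction w generalizing F with
  | nil => simp [splitSum, letterSum]
  | cons a w ih => simp only [splitSum, letterSum, ih]; abel

/-! ### Rotations and the choice of a head -/

namespace Braces

variable {V : Type u} {M : Type v} [AddCommGroup V] [AddCommGroup M]

/-- The first letter of a word becomes the head of a chain. -/
def firstHead (Φ : ℤ × V → List (ℤ × V) → M) : List (ℤ × V) → M := frontSum Φ

/-- The last letter of a word becomes the head of a chain. -/
def lastHead (Φ : ℤ × V → List (ℤ × V) → M) : List (ℤ × V) → M :=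
  backSum fun y c => ((c.1 + 1) * wd y).negOnePow • Φ c y

/-- As the rotations run, every letter of the cyclic word is first exactly once and last exactly
once, so both sides sum over all choices of a head. -/
theorem cyc_firstHead (Φ : ℤ × V → List (ℤ × V) → M) (a : ℤ × V) (w : List (ℤ × V)) :
    cyc (fun z a r => firstHead Φ (z ++ a :: r)) a w
      = cyc (fun z a r => lastHead Φ (z ++ a :: r)) a w := by
  have e1 : cyc (fun z a r => firstHead Φ (z ++ a :: r)) a w
      = Φ a w + letterSum (fun r c z => (((c.1 + 1) + wd z) * ((a.1 + 1) + wd r)).negOnePow •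
        Φ c (z ++ a :: r)) w := by
    rw [cyc, splitSum_eq_add_letterSum]
    simp [firstHead, frontSum]
  have e2 : cyc (fun z a r => lastHead Φ (z ++ a :: r)) a w
      = Φ a w + letterSum (fun r c z => (((c.1 + 1) + wd z) * ((a.1 + 1) + wd r)).negOnePow •
        Φ c (z ++ a :: r)) w := by
    simp only [cyc, lastHead, backSum_append_cons, smul_add, splitSum_add, ← backSum_smul]
    congr 1
    · rw [splitSum_eq_self']
      · simp only [negOnePow_smul_smul, wd_nil]
        rw [Int.negOnePow_even _ (by grind), one_smul]
      · intro b x y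
        simp
    · rw [← splitSum_backSum_left]
      refine splitSum_congr (fun x y => backSum_congr_append fun r c h => ?_) w
      subst h
      rw [negOnePow_smul_smul]
      refine negOnePow_smul_congr ?_ rfl
      simp only [wd_append, wd_cons, wd_nil, parity_simps]
      grind (splits := 40)
  rw [e1, e2]

variable (p q : ℤ) (P f : List (ℤ × V) → V)

/-- Contracting and then rotating is rotating and then applying P around the mark and a value of f;
both sides run over the same cyclic decompositions. -/
theorem contr_cyc (Ψ : List (ℤ × V) → ℤ × V → List (ℤ × V) → M) (a : ℤ × V)
    (w : List (ℤ × V)) : contr p P q f (cyc Ψ) a w = cyc (both p P q f Ψ) a w := by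
  have e : contr p P q f (cyc Ψ) a w = splitSum (fun R z => splitSum (fun s v =>
      splitSum (fun T z' => ((wd z + wd z') * (a.1 + 1 + wd s + wd T)
        + wd z' * (p + 1) + (q + 1) * (wd z' + wd z + (a.1 + 1))).negOnePow • rins q f (fun s =>
          Ψ z' (lt p P (z ++ a :: s)) T) s) v) R) w := by
    simp only [contr, cyc, mR, ← splitSum_smul]
    refine splitSum_congr (fun R z => splitSum_congr_append fun s v hs => ?_) w
    rw [rins_outer_splitSum, ← splitSum_smul, ← splitSum_smul]
    refine splitSum_congr_append fun T z' hv => ?_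
    simp only [rins]
    rw [← ins3_smul, ← ins3_smul, ← ins3_smul]
    refine ins3_congr_append q f fun b c d hb => ?_
    rw [negOnePow_smul_smul, negOnePow_smul_smul]
    subst hb hv hs
    refine negOnePow_smul_congr ?_ rfl
    simp only [wd_append, wd_cons, lt_fst, parity_simps]
    grind (splits := 40)
  rw [e]
  simp only [cyc, both, ← splitSum_smul, negOnePow_smul_smul]
  refine (splitSum_three_cyc (G := fun s T z' z => ((wd z + wd z') * (a.1 + 1 + wd s + wd T)
        + wd z' * (p + 1) + (q + 1) * (wd z' + wd z + (a.1 + 1))).negOnePow • rins q f (fun s =>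
          Ψ z' (lt p P (z ++ a :: s)) T) s) (fun _ _ _ _ => rfl) w).trans ?_
  refine splitSum_congr (fun R z => splitSum_congr_append fun s v hs =>
    splitSum_congr_append fun T z' hv => negOnePow_smul_congr ?_ rfl) w
  subst hv hs
  simp only [wd_append, parity_simps]
  grind (splits := 40)

/-- If nothing stands before the old head, it remains the head and f acts on the tail. Otherwise the
head is the first letter of z, which f does not touch. -/
theorem cyc_mR_firstHead (Φ : ℤ × V → List (ℤ × V) → M) (a : ℤ × V) (w : List (ℤ × V)) :
    cyc (mR q f fun z a r => firstHead Φ (z ++ a :: r)) a w = tl q f Φ a w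
      + letterSum (fun r c z => ((q + 1) * ((c.1 + 1) + wd z + (a.1 + 1))
          + ((c.1 + 1) + wd z) * ((a.1 + 1) + wd r)).negOnePow •
        rins q f (fun s => Φ c (z ++ a :: s)) r) w := by
  rw [cyc, splitSum_eq_add_letterSum]
  congr 1
  · simp only [mR, tl, firstHead, List.nil_append, frontSum, wd_nil, negOnePow_smul_smul]
    exact negOnePow_smul_congr (by simp) rfl
  · refine letterSum_congr (fun r c z => ?_) w
    simp only [mR, firstHead, List.cons_append, frontSum, wd_cons, negOnePow_smul_smul]
    exact negOnePow_smul_congr (by rw [add_comm]) rfl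

/-- Either the value of f is itself the last letter and becomes the head, or the last letter is an
original letter beyond the block of f. -/
theorem rins_lastHead (Φ : ℤ × V → List (ℤ × V) → M) (z : List (ℤ × V)) (a : ℤ × V)
    (r : List (ℤ × V)) :
    rins q f (fun r => lastHead Φ (z ++ a :: r)) r
      = splitSum (fun x u => (wd x * (q + 1) + (q + wd u + 1) * (wd z + (a.1 + 1) + wd x)).negOnePow
          • Φ (lt q f u) (z ++ a :: x)) r
        + backSum (fun s c => ((c.1 + 1) * (wd z + (a.1 + 1) + wd s + (q + 1))).negOnePow •
          rins q f (fun s => Φ c (z ++ a :: s)) s) r := by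
  have e : ∀ x y v, lastHead Φ (z ++ a :: (x ++ lt q f y :: v)) = (match v with
      | [] => ((q + wd y + 1) * wd (z ++ a :: x)).negOnePow • Φ (lt q f y) (z ++ a :: x)
      | _ :: _ => 0) + backSum (fun s c => ((c.1 + 1) * wd (z ++ a :: x ++ lt q f y :: s)).negOnePow
        • Φ c (z ++ a :: x ++ lt q f y :: s)) v := fun x y v => by
    have := backSum_append_cons (fun y c => ((c.1 + 1) * wd y).negOnePow • Φ c y)
      (z ++ a :: x) (lt q f y) v
    simp only [List.append_assoc, List.cons_append] at this ⊢
    refine this.trans ?_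
    cases v <;> rfl
  rw [rins, ins3]
  simp only [e, smul_add, splitSum_add, ← backSum_smul, splitSum_backSum]
  congr 1
  · refine splitSum_congr (fun x u => ?_) r
    rw [splitSum_eq_self]
    · simp only [negOnePow_smul_smul, wd_append, wd_cons]
      refine negOnePow_smul_congr ?_ rfl
      rw [show a.1 + 1 + wd x = (a.1 + 1) + wd x from rfl, ← add_assoc]
    · intro y b v
      simp
  · refine backSum_congr_append fun s c _ => ?_
    rw [rins, ins3, ← splitSum_smul]
    refine splitSum_congr_append fun x u hu => ?_
    rw [← splitSum_smul]
    refine splitSum_congr_append fun y v hv => ?_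
    subst hv hu
    simp only [negOnePow_smul_smul, List.append_assoc, List.cons_append]
    refine negOnePow_smul_congr ?_ rfl
    simp only [wd_append, wd_cons, lt_fst, parity_simps]
    grind (splits := 40)

/-- The second sum is literally that of `cyc_mR_firstHead`. The difference of the two lemmas
therefore leaves only `tl` and the terms whose head is a value of f. -/
theorem cyc_mR_lastHead (Φ : ℤ × V → List (ℤ × V) → M) (a : ℤ × V) (w : List (ℤ × V)) :
    cyc (mR q f fun z a r => lastHead Φ (z ++ a :: r)) a w
      = cyc (fun z a r => splitSum (fun s b => Φ (lt q f s) (b ++ a :: r)) z) a w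
      + letterSum (fun r c z => ((q + 1) * ((c.1 + 1) + wd z + (a.1 + 1))
          + ((c.1 + 1) + wd z) * ((a.1 + 1) + wd r)).negOnePow •
        rins q f (fun s => Φ c (z ++ a :: s)) r) w := by
  simp only [cyc, mR, rins_lastHead, smul_add, splitSum_add, ← splitSum_smul, ← backSum_smul,
    negOnePow_smul_smul]
  congr 1
  · refine Eq.trans ?_ ((splitSum_assoc (fun x u z => (wd (u ++ z) * (a.1 + 1 + wd x)).negOnePow •
      Φ (lt q f u) (z ++ a :: x)) w).trans ?_)
    · refine splitSum_congr (fun R z => splitSum_congr_append fun x u h =>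
        negOnePow_smul_congr ?_ rfl) w
      subst h
      simp only [wd_append, parity_simps]
      grind (splits := 40)
    · refine splitSum_congr (fun x R => splitSum_congr_append fun u z h => ?_) w
      rw [h]
  · rw [← splitSum_backSum_left]
    refine splitSum_congr (fun x y => backSum_congr_append fun r c h => ?_) w
    subst h
    refine negOnePow_smul_congr ?_ rfl
    simp only [wd_append, wd_cons, wd_nil, parity_simps]
    grind (splits := 40)

/-- A prefix of z a r on which f is evaluated either ends before a or contains a. -/
theorem contr_unit_cyc (Φ : ℤ × V → List (ℤ × V) → M) (a : ℤ × V) (w : List (ℤ × V)) :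
    cyc (fun z a r => splitSum (fun s v => Φ (lt q f s) v) (z ++ a :: r)) a w
      = cyc (fun z a r => splitSum (fun s b => Φ (lt q f s) (b ++ a :: r)) z) a w
        + hd q f Φ a w := by
  rw [hd, ← cyc_add]
  exact cyc_congr fun z r => splitSum_append ..

end Braces

/-! ### The Connes operator and the Cartan homotopy -/

namespace AugDGRing
open Braces

variable {k : Type u} [Field k] {t : ℕ} {A : AugDGRing.{u, v} k t}
variable {M : Type w} [AddCommGroup M]
variable {Φ : ℤ × A.carrier → List (ℤ × A.carrier) → M}

variable (A) in
/-- The unit of `A` as a letter. -/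
def unitLt : ℤ × A.carrier := (0, 1)

theorem hd_mm (hΦ : ∀ w, LetterAdd fun a => Φ a w) (a : ℤ × A.carrier)
    (w : List (ℤ × A.carrier)) :
    hd (-2) A.mm Φ a w = Φ (lt (-2) A.mm [a]) w
      + frontSum (fun c y => Φ (lt (-2) A.mm [a, c]) y) w
      + backSum (fun y c => ((c.1 + 1) * (a.1 + 1 + wd y)).negOnePow •
        Φ (lt (-2) A.mm [c, a]) y) w := by
  have h3 : ∀ x y, 3 ≤ x.length → Φ (lt (-2) A.mm x) y = 0 := fun x y h => by
    rw [lt, mm_of_length h]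
    exact (hΦ y).zero _
  rw [hd, cyc, splitSum_eq_backSum]
  · congr 1
    · rw [splitSum_eq_frontSum]
      · simp
      · intro b c x y
        exact h3 _ _ (by simp)
    · refine backSum_congr_append fun x c _ => ?_
      rw [splitSum_eq_self']
      · simp
      · intro b x y
        exact h3 _ _ (by simp)
  · intro x b c y
    have : ∀ x' y', Φ (lt (-2) A.mm (b :: c :: y ++ a :: x')) y' = 0 := fun x' y' =>
      h3 _ _ (by simp; omega)
    simp only [this, splitSum_zero, smul_zero]

/-- Since d1 = 0, what remains besides insertion of `mm` into w are the products of 1 with its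
cyclic neighbours, which make the first or the last letter the head. -/
theorem lie_mm_unit (hΦ : ∀ w, LetterAdd fun a => Φ a w)
    (hp : ∀ p x w, Φ (p, A.prj p x) w = Φ (p, x) w) (w : List (ℤ × A.carrier)) :
    lie (-2) A.mm Φ A.unitLt w
      = lastHead Φ w - firstHead Φ w - rins (-2) A.mm (Φ A.unitLt) w := by
  have h1 : A.prj 0 1 = 1 := prj_of_mem A.one_mem
  have e1 : Φ (lt (-2) A.mm [A.unitLt]) w = 0 := by
    have : A.mm [A.unitLt] = 0 := by
      have := A.d_η 1
      simpa [mm, unitLt, h1] using this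
    rw [lt, this]
    exact (hΦ w).zero _
  have e2 : ∀ c y, Φ (lt (-2) A.mm [A.unitLt, c]) y = - Φ c y := fun c y => by
    have : lt (-2) A.mm [A.unitLt, c] = (c.1, ((-1 : ℤˣ) • A.prj c.1 c.2)) := by
      simp [lt, mm, unitLt, h1]
      ring
    rw [this, (hΦ y).smul, hp]
    simp
  have e3 : ∀ c y, ((c.1 + 1) * (A.unitLt.1 + 1 + wd y)).negOnePow •
      Φ (lt (-2) A.mm [c, A.unitLt]) y = ((c.1 + 1) * wd y).negOnePow • Φ c y := fun c y => by
    have : lt (-2) A.mm [c, A.unitLt] = (c.1, ((c.1 + 1).negOnePow • A.prj c.1 c.2)) := by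
      simp [lt, mm, unitLt, h1]
      ring
    rw [this, (hΦ y).smul, hp, negOnePow_smul_smul]
    refine negOnePow_smul_congr ?_ rfl
    simp only [unitLt, parity_simps]
    grind
  rw [lie, hd_mm hΦ, tl]
  simp only [e1, e2, e3, firstHead, lastHead]
  have : frontSum (fun c y => - Φ c y) w = - frontSum Φ w :=
    (map_frontSum (negAddMonoidHom : M →+ M) Φ w).symm
  rw [this]
  simp [unitLt]
  abel

variable (A) in
/-- The Connes operator. -/
def connesOp (Φ : ℤ × A.carrier → List (ℤ × A.carrier) → M) :
    ℤ × A.carrier → List (ℤ × A.carrier) → M :=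
  cyc fun z a r => Φ A.unitLt (z ++ a :: r)

/-- This is bB + Bb = 0. Both composites insert `mm` into the rotated words, with opposite signs,
and the head terms from `lie_mm_unit` cancel by `cyc_firstHead`. -/
theorem lie_mm_connesOp (hΦ : ∀ w, LetterAdd fun a => Φ a w)
    (hp : ∀ p x w, Φ (p, A.prj p x) w = Φ (p, x) w) (a : ℤ × A.carrier)
    (w : List (ℤ × A.carrier)) :
    lie (-2) A.mm (A.connesOp Φ) a w + A.connesOp (lie (-2) A.mm Φ) a w = 0 := by
  have e1 : lie (-2) A.mm (A.connesOp Φ) a w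
      = cyc (fun z a r => rins (-2) A.mm (Φ A.unitLt) (z ++ a :: r)) a w := by
    rw [connesOp, lie_cyc]
    exact cyc_congr fun z r => (rins_mark ..).symm
  rw [e1]
  simp only [connesOp, lie_mm_unit hΦ hp, cyc_sub, cyc_firstHead]
  abel

/-- `mm` takes at most two arguments. The head and the value of f exhaust them, so nothing is
rotated and `contr` reduces to multiplication of the head by a value of f. -/
theorem contr_mm (hΦ : ∀ w, LetterAdd fun a => Φ a w) (q : ℤ)
    (f : List (ℤ × A.carrier) → A.carrier) (a : ℤ × A.carrier) (w : List (ℤ × A.carrier)) :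
    contr (-2) A.mm q f Φ a w = ((q + 1) * (a.1 + 1)).negOnePow •
      splitSum (fun s v => Φ (lt (-2) A.mm [a, lt q f s]) v) w := by
  have h3 : ∀ x y, 3 ≤ x.length → Φ (lt (-2) A.mm x) y = 0 := fun x y h => by
    rw [lt, mm_of_length h]
    exact (hΦ y).zero _
  rw [contr, cyc, splitSum_eq_self]
  · simp only [wd_nil, zero_mul, Int.negOnePow_zero, one_smul, mR, List.nil_append, zero_add,
      splitSum_smul]
    congr 1
    refine splitSum_congr (fun s v => ?_) w
    rw [rins, ins3, splitSum_eq_self', splitSum_eq_self]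
    · simp
    · intro x b y
      rw [h3 _ _ (by simp), smul_zero]
    · intro b x y
      have : ∀ y' v', Φ (lt (-2) A.mm (a :: (b :: x ++ lt q f y' :: v'))) v = 0 := fun y' v' =>
        h3 _ _ (by simp; omega)
      simp only [this, smul_zero, splitSum_zero]
  · intro x b y
    have : ∀ s v, rins q f (fun s => Φ (lt (-2) A.mm ((b :: y) ++ a :: s)) v) s = 0 := fun s v => by
      have : ∀ x' y' v', Φ (lt (-2) A.mm ((b :: y) ++ a :: (x' ++ lt q f y' :: v'))) v = 0 :=
        fun x' y' v' => h3 _ _ (by simp; omega)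
      simp only [rins, ins3, this, smul_zero, splitSum_zero]
    simp only [mR, this, smul_zero, splitSum_zero]

/-- The homotopy in the Cartan formula. -/
def cartanOp (q : ℤ) (f : List (ℤ × A.carrier) → A.carrier)
    (Φ : ℤ × A.carrier → List (ℤ × A.carrier) → M) : ℤ × A.carrier → List (ℤ × A.carrier) → M :=
  cyc (mR q f fun z a r => Φ A.unitLt (z ++ a :: r))

/-- In operator terms this is i_f B: f is evaluated on a prefix of the rotated word and multiplied
by the head 1. The prefixes that contain a give the head part of L_f. -/
theorem connesOp_contr (hΦ : ∀ w, LetterAdd fun a => Φ a w)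
    (hp : ∀ p x w, Φ (p, A.prj p x) w = Φ (p, x) w) (q : ℤ)
    (f : List (ℤ × A.carrier) → A.carrier) (a : ℤ × A.carrier)
    (w : List (ℤ × A.carrier)) :
    A.connesOp (contr (-2) A.mm q f Φ) a w = - ((q + 1).negOnePow •
      (cyc (fun z a r => splitSum (fun s b => Φ (lt q f s) (b ++ a :: r)) z) a w
        + hd q f Φ a w)) := by
  have e2 : ∀ c y, Φ (lt (-2) A.mm [A.unitLt, c]) y = - Φ c y := fun c y => by
    have : lt (-2) A.mm [A.unitLt, c] = (c.1, ((-1 : ℤˣ) • A.prj c.1 c.2)) := by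
      simp [lt, mm, unitLt, prj_of_mem A.one_mem]
      ring
    rw [this, (hΦ y).smul, hp]
    simp
  rw [← contr_unit_cyc, ← cyc_smul, ← cyc_neg, connesOp]
  refine cyc_congr fun z r => ?_
  rw [contr_mm hΦ]
  simp only [e2, splitSum_neg, smul_neg]
  simp [unitLt]

/-- With S_f for `cartanOp`, this is the relation between the commutator of b and S_f, S_{δf}, B
i_f, i_f B and L_f. It comes from `lie_mm_unit` with f inserted to the right of a: the insertion of
`mm` is moved past f, and the head terms cancel up to the part of L_f in the tail and terms
occurring in i_f B. -/
theorem cartan (hΦ : ∀ w, LetterAdd fun a => Φ a w) (hΦ' : ∀ a, WordAdd (Φ a))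
    (hp : ∀ p x w, Φ (p, A.prj p x) w = Φ (p, x) w) (q : ℤ)
    (f : List (ℤ × A.carrier) → A.carrier) (a : ℤ × A.carrier) (w : List (ℤ × A.carrier)) :
    cartanOp q f (lie (-2) A.mm Φ) a w + (q + 1).negOnePow • lie (-2) A.mm (cartanOp q f Φ) a w
      + cartanOp (q + -2 + 1) (rins q f A.mm) Φ a w
      - (q + 1).negOnePow • cartanOp (-2 + q + 1) (rins (-2) A.mm f) Φ a w
      + contr (-2) A.mm q f (A.connesOp Φ) a w + lie q f Φ a w
      + (q + 1).negOnePow • A.connesOp (contr (-2) A.mm q f Φ) a w = 0 := by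
  have e : (mR q f fun z a r => lie (-2) A.mm Φ A.unitLt (z ++ a :: r)) = fun z a r =>
      mR q f (fun z a r => lastHead Φ (z ++ a :: r)) z a r
        - mR q f (fun z a r => firstHead Φ (z ++ a :: r)) z a r
        - mR q f (fun z a r => rins (-2) A.mm (Φ A.unitLt) (z ++ a :: r)) z a r := by
    funext z a r
    rw [sub_sub, eq_sub_iff_add_eq]
    simp only [mR, ← smul_add, ← rins_add]
    congr 2
    funext s
    rw [lie_mm_unit hΦ hp]
    abel
  have es : ((-2 + 1) * (q + 1)).negOnePow = (q + 1).negOnePow :=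
    negOnePow_congr (by simp only [parity_simps]; grind)
  have e1 : cartanOp q f (lie (-2) A.mm Φ) a w
      = cyc (mR q f fun z a r => lastHead Φ (z ++ a :: r)) a w
        - cyc (mR q f fun z a r => firstHead Φ (z ++ a :: r)) a w
        - cyc (mR q f fun z a r => rins (-2) A.mm (Φ A.unitLt) (z ++ a :: r)) a w := by
    rw [cartanOp, e, cyc_sub, cyc_sub]
  -- In `mR_rins`, the term where `mm` covers both a and the value of f is the contraction followed
  -- by the Connes operator.
  have e2 : cyc (mR q f fun z a r => rins (-2) A.mm (Φ A.unitLt) (z ++ a :: r)) a w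
      = (q + 1).negOnePow • lie (-2) A.mm (cartanOp q f Φ) a w
        + (cartanOp (q + -2 + 1) (rins q f A.mm) Φ a w
          - (q + 1).negOnePow • cartanOp (-2 + q + 1) (rins (-2) A.mm f) Φ a w)
        + contr (-2) A.mm q f (A.connesOp Φ) a w := by
    have := funext fun z => funext fun a => funext fun r =>
      mR_rins (-2) q A.mm f (hΦ' A.unitLt) z a r
    rw [show (mR q f fun z a r => rins (-2) A.mm (Φ A.unitLt) (z ++ a :: r)) = _ from this, cyc_add,
      cyc_add, cyc_sub, cyc_smul, cyc_smul, ← lie_cyc, es, connesOp, contr_cyc]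
    rfl
  have e3 : lie q f Φ a w = tl q f Φ a w + hd q f Φ a w := rfl
  rw [e1, e2, connesOp_contr hΦ hp, cyc_mR_lastHead, cyc_mR_firstHead, e3, smul_neg, smul_smul,
    Int.units_mul_self, one_smul]
  abel

end AugDGRing

/-! ### Degrees and linearity of insertions and cyclic sums -/

namespace Braces

section
variable {V : Type u} {M : Type v} [AddCommGroup V] [AddCommGroup M]

theorem ins3_nil (q : ℤ) (g : List (ℤ × V) → V) (Θ : List (ℤ × V) → ℤ × V → List (ℤ × V) → M) :
    ins3 q g Θ [] = Θ [] (lt q g []) [] := by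
  simp [ins3, splitSum]

theorem rins_nil (q : ℤ) (g : List (ℤ × V) → V) (Φ : List (ℤ × V) → M) :
    rins q g Φ [] = Φ [lt q g []] := ins3_nil ..

theorem ins3_mark (q : ℤ) (g : List (ℤ × V) → V) (Θ : List (ℤ × V) → ℤ × V → List (ℤ × V) → M)
    (z : List (ℤ × V)) (a : ℤ × V) (r : List (ℤ × V)) :
    ins3 q g Θ (z ++ a :: r) = ins3 q g (fun x c v => Θ x c (v ++ a :: r)) z
      + splitSum (fun z₁ z₂ => splitSum (fun r₁ r₂ => (wd z₁ * (q + 1)).negOnePow •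
          Θ z₁ (lt q g (z₂ ++ a :: r₁)) r₂) r) z
      + ((q + 1) * (wd z + (a.1 + 1))).negOnePow •
        ins3 q g (fun x c v => Θ (z ++ a :: x) c v) r := by
  simp only [ins3, splitSum_append, splitSum_add]
  simp only [← splitSum_smul, negOnePow_smul_smul]
  congr 1
  refine splitSum_congr (fun x y => splitSum_congr (fun s t => ?_) _) _
  refine negOnePow_smul_congr ?_ rfl
  simp only [wd_append, wd_cons, parity_simps]
  grind (splits := 40)

theorem ins3_mark_cons (q : ℤ) (g : List (ℤ × V) → V)
    (Θ : List (ℤ × V) → ℤ × V → List (ℤ × V) → M) (a : ℤ × V) (r : List (ℤ × V)) :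
    ins3 q g Θ (a :: r) = Θ [] (lt q g []) (a :: r)
      + splitSum (fun r₁ r₂ => Θ [] (lt q g (a :: r₁)) r₂) r
      + ((q + 1) * (a.1 + 1)).negOnePow • ins3 q g (fun x c v => Θ (a :: x) c v) r := by
  have := ins3_mark q g Θ [] a r
  simpa [ins3_nil, splitSum] using this

variable {k : Type w} [Field k] [Module k V] [Module k M]

theorem units_smul_mem (S : Submodule k M) (e : ℤˣ) {x : M} (h : x ∈ S) : e • x ∈ S := by
  rcases Int.units_eq_one_or e with rfl | rfl
  · simpa using h
  · simpa [Units.neg_smul] using h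

theorem splitSum_mem {α : Type*} (S : Submodule k M) {F : List α → List α → M} {w : List α}
    (h : ∀ x y, x ++ y = w → F x y ∈ S) : splitSum F w ∈ S := by
  induction w generalizing F with
  | nil => exact h _ _ rfl
  | cons a w ih =>
    exact S.add_mem (h [] (a :: w) rfl) (ih fun x y hxy => h (a :: x) y (by
      rw [List.cons_append, hxy]))

variable {S : ℤ → Submodule k M} {n : ℤ} (q : ℤ) (g : List (ℤ × V) → V)

theorem ins3_mem {Θ : List (ℤ × V) → ℤ × V → List (ℤ × V) → M}
    (h : ∀ x a v, Θ x a v ∈ S (n + (wd x + (a.1 + 1) + wd v))) (w : List (ℤ × V)) :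
    ins3 q g Θ w ∈ S (n + (q + 1) + wd w) := by
  refine splitSum_mem _ fun x z hx => splitSum_mem _ fun y v hz => units_smul_mem _ _ ?_
  subst hz hx
  convert h x (lt q g y) v using 2
  simp only [wd_append, lt_fst]
  ring

theorem rins_mem {Φ : List (ℤ × V) → M} (h : ∀ w, Φ w ∈ S (n + wd w)) (w : List (ℤ × V)) :
    rins q g Φ w ∈ S (n + (q + 1) + wd w) := by
  refine ins3_mem q g (fun x a v => ?_) w
  convert h (x ++ a :: v) using 2
  simp only [wd_append, wd_cons]
  ring

theorem mR_mem {Θ : List (ℤ × V) → ℤ × V → List (ℤ × V) → M}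
    (h : ∀ x a v, Θ x a v ∈ S (n + (wd x + (a.1 + 1) + wd v))) (x : List (ℤ × V)) (a : ℤ × V)
    (v : List (ℤ × V)) :
    mR q g Θ x a v ∈ S (n + (q + 1) + (wd x + (a.1 + 1) + wd v)) := by
  refine units_smul_mem _ _ ?_
  have := rins_mem q g (S := S) (n := n + (wd x + (a.1 + 1))) (Φ := Θ x a) (fun w => by
    convert h x a w using 2; ring) v
  convert this using 2
  ring

theorem br2_mem (r : ℤ) (h : List (ℤ × V) → V) {Φ : List (ℤ × V) → M}
    (hΦ : ∀ w, Φ w ∈ S (n + wd w)) (w : List (ℤ × V)) :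
    br2 q g r h Φ w ∈ S (n + (r + 1) + (q + 1) + wd w) := by
  refine ins3_mem q g (fun x a v => mR_mem r h (fun x a v => ?_) x a v) w
  convert hΦ (x ++ a :: v) using 2
  simp only [wd_append, wd_cons]
  ring

theorem cyc_mem {Ψ : List (ℤ × V) → ℤ × V → List (ℤ × V) → M}
    (h : ∀ x a v, Ψ x a v ∈ S (n + (wd x + (a.1 + 1) + wd v))) (a : ℤ × V)
    (w : List (ℤ × V)) : cyc Ψ a w ∈ S (n + (a.1 + 1) + wd w) := by
  refine splitSum_mem _ fun r z hr => units_smul_mem _ _ ?_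
  subst hr
  convert h z a r using 2
  simp only [wd_append]
  ring

theorem tl_mem {Φ : ℤ × V → List (ℤ × V) → M} (h : ∀ a w, Φ a w ∈ S (n + (a.1 + 1) + wd w))
    (a : ℤ × V) (w : List (ℤ × V)) : tl q g Φ a w ∈ S (n + (q + 1) + (a.1 + 1) + wd w) := by
  refine units_smul_mem _ _ ?_
  convert rins_mem q g (h a) w using 2
  ring

theorem hd_mem {Φ : ℤ × V → List (ℤ × V) → M} (h : ∀ a w, Φ a w ∈ S (n + (a.1 + 1) + wd w))
    (a : ℤ × V) (w : List (ℤ × V)) : hd q g Φ a w ∈ S (n + (q + 1) + (a.1 + 1) + wd w) := by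
  refine cyc_mem (fun x a v => splitSum_mem _ fun s t hs => ?_) a w
  subst hs
  convert h (lt q g (x ++ a :: s)) t using 2
  simp only [wd_append, wd_cons, lt_fst]
  ring

theorem lie_mem {Φ : ℤ × V → List (ℤ × V) → M} (h : ∀ a w, Φ a w ∈ S (n + (a.1 + 1) + wd w))
    (a : ℤ × V) (w : List (ℤ × V)) : lie q g Φ a w ∈ S (n + (q + 1) + (a.1 + 1) + wd w) :=
  (S _).add_mem (tl_mem q g h a w) (hd_mem q g h a w)

theorem contr_mem (p : ℤ) (P : List (ℤ × V) → V) {Φ : ℤ × V → List (ℤ × V) → M}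
    (h : ∀ a w, Φ a w ∈ S (n + (a.1 + 1) + wd w)) (a : ℤ × V) (w : List (ℤ × V)) :
    contr p P q g Φ a w ∈ S (n + (p + 1) + (q + 1) + (a.1 + 1) + wd w) := by
  refine cyc_mem (fun x a v => splitSum_mem _ fun s t hs => ?_) a w
  subst hs
  have := mR_mem q g (S := S) (n := n + (p + 1) + wd t)
    (Θ := fun z a s => Φ (lt p P (z ++ a :: s)) t) (fun z a s => by
      convert h (lt p P (z ++ a :: s)) t using 2
      simp only [wd_append, wd_cons, lt_fst]
      ring) x a s
  convert this using 2
  simp only [wd_append]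
  ring

/-- Linearity of a function of a letter. -/
def LetterLin (k : Type w) [Field k] [Module k V] [Module k M] (θ : ℤ × V → M) : Prop :=
  ∀ p (c : k) x y, θ (p, c • x + y) = c • θ (p, x) + θ (p, y)

/-- Linearity of a word functional in each letter. -/
def WordLin (k : Type w) [Field k] [Module k V] [Module k M] (Φ : List (ℤ × V) → M) : Prop :=
  ∀ x r, LetterLin k fun c => Φ (x ++ c :: r)

/-- Linearity of a functional of words with a marked letter in each letter. -/
structure MarkLin (k : Type w) [Field k] [Module k V] [Module k M]
    (Θ : List (ℤ × V) → ℤ × V → List (ℤ × V) → M) : Prop where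
  left : ∀ a r, WordLin k fun z => Θ z a r
  mark : ∀ z r, LetterLin k fun a => Θ z a r
  right : ∀ z a, WordLin k (Θ z a)

theorem LetterLin.letterAdd {θ : ℤ × V → M} (h : LetterLin k θ) : LetterAdd θ := fun p x y => by
  simpa using h p 1 x y

theorem WordLin.wordAdd {Φ : List (ℤ × V) → M} (h : WordLin k Φ) : WordAdd Φ :=
  fun x r => (h x r).letterAdd

theorem LetterLin.smul {θ : ℤ × V → M} (h : LetterLin k θ) (e : ℤˣ) :
    LetterLin k fun a => e • θ a := fun p c x y => by
  simp only [h p c x y, smul_add, smul_comm c]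

theorem LetterLin.sign {θ : ℤ × V → M} (h : LetterLin k θ) (e : ℤ → ℤˣ) :
    LetterLin k fun a => e a.1 • θ a := fun p c x y => by
  simp only [h p c x y, smul_add, smul_comm c]

theorem LetterLin.add {θ θ' : ℤ × V → M} (h : LetterLin k θ) (h' : LetterLin k θ') :
    LetterLin k fun a => θ a + θ' a := fun p c x y => by
  simp only [h p c x y, h' p c x y, smul_add]; abel

theorem LetterLin.sum {α : Type*} {θ : List α → List α → ℤ × V → M}
    (h : ∀ x y, LetterLin k (θ x y)) (w : List α) :
    LetterLin k fun a => splitSum (fun x y => θ x y a) w := fun p c x y =>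
  splitSum_lin c (fun s t => h s t p c x y) w

theorem WordLin.marked {Φ : List (ℤ × V) → M} (h : WordLin k Φ) :
    MarkLin k fun z a r => Φ (z ++ a :: r) where
  left a r x y := by simpa using h x (y ++ a :: r)
  mark z r := h z r
  right z a x y := by simpa using h (z ++ a :: x) y

theorem WordLin.lt {g : List (ℤ × V) → V} (hg : WordLin k g) (q : ℤ) {θ : ℤ × V → M}
    (hθ : LetterLin k θ) : WordLin k fun y => θ (lt q g y) := fun x r p c a b => by
  have := hg x r p c a b
  simp only [Braces.lt, this, wd_append, wd_cons]
  exact hθ _ _ _ _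

theorem LetterLin.ins3 {Θ : ℤ × V → List (ℤ × V) → ℤ × V → List (ℤ × V) → M}
    (h : ∀ x c v, LetterLin k fun a => Θ a x c v) (w : List (ℤ × V)) :
    LetterLin k fun a => ins3 q g (Θ a) w :=
  LetterLin.sum (fun _ _ => LetterLin.sum (fun _ _ => (h _ _ _).smul _) _) w

variable {g}

theorem WordLin.ins3 (hg : WordLin k g) {Θ : List (ℤ × V) → ℤ × V → List (ℤ × V) → M}
    (h : MarkLin k Θ) : WordLin k (ins3 q g Θ) := fun z r => by
  simp only [ins3_mark]
  refine LetterLin.add (LetterLin.add ?_ ?_) ?_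
  · exact LetterLin.ins3 q g (fun x c v => h.right x c v r) z
  · refine LetterLin.sum (fun z₁ z₂ => LetterLin.sum (fun r₁ r₂ => LetterLin.smul ?_ _) _) _
    exact hg.lt q (h.mark z₁ r₂) z₂ r₁
  · refine LetterLin.sign (LetterLin.ins3 q g (fun x c v => h.left c v z x) r)
      fun n => ((q + 1) * (wd z + (n + 1))).negOnePow

theorem WordLin.rins (hg : WordLin k g) {Φ : List (ℤ × V) → M} (h : WordLin k Φ) :
    WordLin k (rins q g Φ) := WordLin.ins3 q hg h.marked

theorem MarkLin.mR (hg : WordLin k g) {Θ : List (ℤ × V) → ℤ × V → List (ℤ × V) → M}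
    (h : MarkLin k Θ) : MarkLin k (mR q g Θ) where
  left a r x y := by
    simp only [Braces.mR, wd_append, wd_cons]
    exact LetterLin.sign (LetterLin.ins3 q g (fun s c v => h.left a (s ++ c :: v) x y) r)
      fun n => ((q + 1) * (wd x + (n + 1 + wd y) + (a.1 + 1))).negOnePow
  mark z r := LetterLin.sign (LetterLin.ins3 q g (fun s c v => h.mark z (s ++ c :: v)) r)
      fun n => ((q + 1) * (wd z + (n + 1))).negOnePow
  right z a x y := (WordLin.rins q hg (h.right z a) x y).smul _

theorem WordLin.br2 (hg : WordLin k g) (r : ℤ) {f : List (ℤ × V) → V} (hf : WordLin k f)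
    {Φ : List (ℤ × V) → M} (h : WordLin k Φ) : WordLin k (br2 q g r f Φ) :=
  WordLin.ins3 q hg (MarkLin.mR r hf h.marked)

/-- Linearity of a functional of chains in each letter. -/
structure ChainLin (k : Type w) [Field k] [Module k V] [Module k M]
    (Φ : ℤ × V → List (ℤ × V) → M) : Prop where
  head : ∀ w, LetterLin k fun a => Φ a w
  tail : ∀ a, WordLin k (Φ a)

theorem ChainLin.cyc {Ψ : List (ℤ × V) → ℤ × V → List (ℤ × V) → M} (h : MarkLin k Ψ) :
    ChainLin k (cyc Ψ) where
  head w := LetterLin.sum (fun r z => LetterLin.sign (h.mark z r)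
    fun n => (wd z * ((n + 1) + wd r)).negOnePow) w
  tail a x y := by
    simp only [Braces.cyc, splitSum_append, wd_append, wd_cons]
    refine LetterLin.add (LetterLin.sum (fun r z => ?_) x) (LetterLin.sum (fun r z => ?_) y)
    · exact LetterLin.sign (h.left a r z y)
        fun n => ((wd z + (n + 1 + wd y)) * (a.1 + 1 + wd r)).negOnePow
    · exact LetterLin.sign (h.right z a x r)
        fun n => (wd z * (a.1 + 1 + (wd x + (n + 1 + wd r)))).negOnePow

end

end Braces

/-! ### Compatibility of insertions with the action of K -/

namespace AugDGRing
open Braces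

variable {k : Type u} [Field k] {t : ℕ} {A : AugDGRing.{u, v} k t}

variable (A) in
/-- A not necessarily reduced or homogeneous element of `A`, together with a degree. -/
abbrev Ltr := ℤ × A.carrier

/-- `κ c` for `κ ∈ K` and a letter `c`. -/
def Ltr.l (κ : Fin t → k) (c : A.Ltr) : A.Ltr := (c.1, A.η κ * c.2)

/-- `c κ` for `κ ∈ K` and a letter `c`. -/
def Ltr.r (c : A.Ltr) (κ : Fin t → k) : A.Ltr := (c.1, c.2 * A.η κ)

@[simp] theorem Ltr.l_fst (κ : Fin t → k) (c : A.Ltr) : (c.l κ).1 = c.1 := rfl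
@[simp] theorem Ltr.r_fst (κ : Fin t → k) (c : A.Ltr) : (c.r κ).1 = c.1 := rfl

variable {M : Type w}

/-- A word functional that is `K`-balanced. -/
def WordBal (Φ : List A.Ltr → M) : Prop :=
  ∀ u c d v κ, Φ (u ++ c.r κ :: d :: v) = Φ (u ++ c :: d.l κ :: v)

/-- A functional of words with a marked letter that is `K`-balanced. -/
structure MarkBal (Θ : List A.Ltr → A.Ltr → List A.Ltr → M) : Prop where
  left : ∀ a r, WordBal fun z => Θ z a r
  right : ∀ z a, WordBal (Θ z a)
  mark_left : ∀ u c a r κ, Θ (u ++ [c.r κ]) a r = Θ (u ++ [c]) (a.l κ) r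
  mark_right : ∀ z a c v κ, Θ z (a.r κ) (c :: v) = Θ z a (c.l κ :: v)

/-- A word functional of degree `q` with values in `A` that is a morphism of `K`-bimodules. -/
structure IsWordCochain (q : ℤ) (f : List A.Ltr → A.carrier) : Prop where
  mem : ∀ w, f w ∈ A.gr (q + wd w)
  lin : WordLin k f
  bal : WordBal f
  left : ∀ c v κ, f (c.l κ :: v) = A.η κ * f (c :: v)
  right : ∀ u c κ, f (u ++ [c.r κ]) = f (u ++ [c]) * A.η κ
  nil : ∀ κ, A.η κ * f [] = f [] * A.η κ

section
variable {q : ℤ} {f : List A.Ltr → A.carrier} (hf : IsWordCochain q f)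
include hf

theorem IsWordCochain.lt_bal : WordBal (lt q f) := fun u c d v κ => by
  simp [lt, hf.bal u c d v κ]

theorem IsWordCochain.lt_left (c : A.Ltr) (v : List A.Ltr) (κ : Fin t → k) :
    lt q f (c.l κ :: v) = Ltr.l κ (lt q f (c :: v)) :=
  Prod.ext (by simp) (hf.left c v κ)

theorem IsWordCochain.lt_right (u : List A.Ltr) (c : A.Ltr) (κ : Fin t → k) :
    lt q f (u ++ [c.r κ]) = Ltr.r (lt q f (u ++ [c])) κ :=
  Prod.ext (by simp) (hf.right u c κ)

theorem IsWordCochain.lt_nil (κ : Fin t → k) : Ltr.l κ (lt q f []) = Ltr.r (lt q f []) κ := by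
  simp [lt, hf.nil, Ltr.r, Ltr.l]

end

variable [AddCommGroup M]

section
variable {q : ℤ} {f : List A.Ltr → A.carrier} (hf : IsWordCochain q f)

theorem WordBal.marked {Φ : List A.Ltr → M} (h : WordBal Φ) :
    MarkBal fun z a r => Φ (z ++ a :: r) where
  left a r u c d v κ := by simpa using h u c d (v ++ a :: r) κ
  right z a u c d v κ := by simpa using h (z ++ a :: u) c d v κ
  mark_left u c a r κ := by simpa using h u c a r κ
  mark_right z a c v κ := h z a c v κ

include hf

/-- Allowing Θ and Θ' to differ covers both uses: κ enters the first letter either from a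
neighbouring letter, as in `ins3_bal`, or from a factor in front of the functional. For an empty
first block, the value f [] commutes with κ. -/
theorem IsWordCochain.ins3_left {Θ Θ' : List A.Ltr → A.Ltr → List A.Ltr → M} (h : MarkBal Θ')
    {κ : Fin t → k} (h₁ : ∀ c z a r, Θ (c :: z) a r = Θ' (c.l κ :: z) a r)
    (h₂ : ∀ a r, Θ [] a r = Θ' [] (a.l κ) r) (c : A.Ltr) (v : List A.Ltr) :
    ins3 q f Θ (c :: v) = ins3 q f Θ' (c.l κ :: v) := by
  simp only [ins3_mark_cons, h₁, h₂, hf.lt_nil, hf.lt_left, h.mark_right, Ltr.l_fst]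

theorem IsWordCochain.ins3_right {Θ Θ' : List A.Ltr → A.Ltr → List A.Ltr → M} (h : MarkBal Θ)
    {κ : Fin t → k} (h₁ : ∀ z a r c, Θ z a (r ++ [c.r κ]) = Θ' z a (r ++ [c]))
    (h₂ : ∀ z a, Θ z (a.r κ) [] = Θ' z a []) (u : List A.Ltr) (c : A.Ltr) :
    ins3 q f Θ (u ++ [c.r κ]) = ins3 q f Θ' (u ++ [c]) := by
  simp only [ins3_mark, h₁, h₂, splitSum, ins3_nil, hf.lt_right, h.mark_left, hf.lt_nil, Ltr.r_fst]

/-- If a boundary of the block of f falls between c and d, then κ is carried across the value of f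
by its one-sided linearity. An empty block between c and d lets κ pass because f [] commutes with K.
-/
theorem IsWordCochain.ins3_bal {Θ : List A.Ltr → A.Ltr → List A.Ltr → M} (h : MarkBal Θ) :
    WordBal (ins3 q f Θ) := fun u c d v κ => by
  rw [ins3_mark, ins3_mark]
  congr 1
  · congr 1
    · exact ins3_congr q f fun x a y => by
        simpa using h.right x a y c d v κ
    · refine splitSum_congr (fun z₁ z₂ => ?_) u
      simp only [splitSum, hf.lt_right, h.mark_right]
      congr 1
      refine splitSum_congr (fun r₁ r₂ => ?_) v
      rw [hf.lt_bal]
  · rw [Ltr.r_fst]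
    congr 1
    refine hf.ins3_left ?_ (fun e z a r => ?_) (fun a r => ?_) d v
    · constructor
      · intro a r u' c' d' v' κ'
        simpa using h.left a r (u ++ c :: u') c' d' v' κ'
      · intro z a
        exact h.right _ a
      · intro u' c' a r κ'
        simpa using h.mark_left (u ++ c :: u') c' a r κ'
      · intro z a c' v' κ'
        exact h.mark_right _ a c' v' κ'
    · exact h.left a r u c e z κ
    · exact h.mark_left u c a r κ

theorem IsWordCochain.rins_bal {Φ : List A.Ltr → M} (h : WordBal Φ) : WordBal (rins q f Φ) :=
  hf.ins3_bal h.marked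

theorem IsWordCochain.rins_left {Φ Φ' : List A.Ltr → M} (h : WordBal Φ') {κ : Fin t → k}
    (h₁ : ∀ c v, Φ (c :: v) = Φ' (c.l κ :: v)) (c : A.Ltr) (v : List A.Ltr) :
    rins q f Φ (c :: v) = rins q f Φ' (c.l κ :: v) :=
  hf.ins3_left h.marked (fun c z a r => h₁ c (z ++ a :: r)) (fun a r => h₁ a r) c v

theorem IsWordCochain.rins_right {Φ Φ' : List A.Ltr → M} (h : WordBal Φ) {κ : Fin t → k}
    (h₁ : ∀ u c, Φ (u ++ [c.r κ]) = Φ' (u ++ [c])) (u : List A.Ltr) (c : A.Ltr) :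
    rins q f Φ (u ++ [c.r κ]) = rins q f Φ' (u ++ [c]) :=
  hf.ins3_right h.marked (fun z a r c => by simpa using h₁ (z ++ a :: r) c) (fun z a => h₁ z a) u c

theorem IsWordCochain.mR_bal {Θ : List A.Ltr → A.Ltr → List A.Ltr → M} (h : MarkBal Θ) :
    MarkBal (mR q f Θ) where
  left a r u c d v κ := by
    simp only [mR, wd_append, wd_cons, Ltr.r_fst, Ltr.l_fst]
    congr 2
    funext s
    exact h.left a s u c d v κ
  right z a u c d v κ := by
    simp only [mR, hf.rins_bal (h.right z a) u c d v κ]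
  mark_left u c a r κ := by
    simp only [mR, wd_append, wd_cons, Ltr.r_fst, Ltr.l_fst]
    congr 2
    funext s
    exact h.mark_left u c a s κ
  mark_right z a c v κ := by
    simp only [mR, hf.rins_left (h.right z a) (fun c v => h.mark_right z a c v κ) c v, Ltr.r_fst]

end

theorem IsWordCochain.rins {p q : ℤ} {F f : List A.Ltr → A.carrier} (hF : IsWordCochain p F)
    (hf : IsWordCochain q f) : IsWordCochain (p + (q + 1)) (rins q f F) where
  mem w := rins_mem q f hF.mem w
  lin := hf.lin.rins q hF.lin
  bal := hf.rins_bal hF.bal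
  left c v κ := by
    rw [← hf.rins_left (Φ := fun w => A.η κ * F w) hF.bal fun c v => (hF.left c v κ).symm]
    exact (ins3_map q f (AddMonoidHom.mulLeft (A.η κ)) _ _).symm
  right u c κ := by
    rw [hf.rins_right (Φ' := fun w => F w * A.η κ) hF.bal fun u c => hF.right u c κ]
    exact (ins3_map q f (AddMonoidHom.mulRight (A.η κ)) _ _).symm
  nil κ := by
    -- On the empty word the only term is F on the letter f []. This letter commutes with κ, so left
    -- and right linearity of F give the claim.
    have h1 := hF.left (lt q f []) [] κ
    have h2 := hF.right [] (lt q f []) κ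
    rw [List.nil_append, List.nil_append, ← hf.lt_nil, h1] at h2
    rw [rins_nil, h2]

theorem IsWordCochain.br2 {p q r : ℤ} {F f g : List A.Ltr → A.carrier} (hF : IsWordCochain p F)
    (hf : IsWordCochain q f) (hg : IsWordCochain r g) :
    IsWordCochain (p + (r + 1) + (q + 1)) (br2 q f r g F) where
  mem w := br2_mem q f r g hF.mem w
  lin := hf.lin.br2 q r hg.lin hF.lin
  bal := hf.ins3_bal (hg.mR_bal hF.bal.marked)
  left c v κ := by
    have := hf.ins3_left (Θ := mR r g fun z a r => A.η κ * F (z ++ a :: r)) (κ := κ)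
      (hg.mR_bal hF.bal.marked) (fun c z a r => by simp [mR, hF.left])
      (fun a r => by simp [mR, hF.left]) c v
    rw [Braces.br2, ← this, Braces.br2]
    refine Eq.trans ?_ (ins3_map q f (AddMonoidHom.mulLeft (A.η κ)) _ _).symm
    refine ins3_congr q f fun x a v => ?_
    have := ins3_map r g (AddMonoidHom.mulLeft (A.η κ)) (fun s c t => F (x ++ a :: (s ++ c :: t))) v
    simp only [mR, Braces.rins, Units.smul_def, map_zsmul, this]
    rfl
  right u c κ := by
    have := hf.ins3_right (Θ' := mR r g fun z a r => F (z ++ a :: r) * A.η κ) (κ := κ)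
      (hg.mR_bal hF.bal.marked) (fun z a s c => congrArg _ (hg.rins_right
        (hF.bal.marked.right z a) (fun u c => by simpa using hF.right (z ++ a :: u) c κ) s c))
      (fun z a => by
        simp only [mR, rins_nil, Ltr.r_fst]
        rw [hF.bal, hg.lt_nil]
        congr 1
        simpa using hF.right (z ++ [a]) (lt r g []) κ) u c
    rw [Braces.br2, this, Braces.br2]
    refine Eq.trans ?_ (ins3_map q f (AddMonoidHom.mulRight (A.η κ)) _ _).symm
    refine ins3_congr q f fun x a v => ?_
    have := ins3_map r g (AddMonoidHom.mulRight (A.η κ)) (fun s c t => F (x ++ a :: (s ++ c :: t))) v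
    simp only [mR, Braces.rins, Units.smul_def, map_zsmul, this]
    rfl
  nil κ := by
    have e : Braces.br2 q f r g F [] = (((r + 1) * (q + 1)).negOnePow • F [lt q f [], lt r g []]) := by
      simp [Braces.br2, ins3_nil, mR, rins_nil]
    have h1 := hF.left (lt q f []) [lt r g []] κ
    have h2 := hF.right [lt q f []] (lt r g []) κ
    have h3 := hF.bal [] (lt q f []) (lt r g []) [] κ
    simp only [List.nil_append, List.singleton_append] at h2 h3
    rw [← hg.lt_nil, ← h3, ← hf.lt_nil, h1] at h2
    rw [e, mul_smul_comm, smul_mul_assoc, h2]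

theorem IsWordCochain.smul {q : ℤ} {f : List A.Ltr → A.carrier} (hf : IsWordCochain q f) (e : ℤˣ) :
    IsWordCochain q fun w => e • f w where
  mem w := units_smul_mem _ _ (hf.mem w)
  lin x r := (hf.lin x r).smul e
  bal u c d v κ := congrArg _ (hf.bal u c d v κ)
  left c v κ := by rw [hf.left, mul_smul_comm]
  right c v κ := by rw [hf.right, smul_mul_assoc]
  nil κ := by rw [mul_smul_comm, hf.nil, smul_mul_assoc]

theorem isWordCochain_mm : IsWordCochain (-2) A.mm where
  mem w := by
    match w with
    | [] => simp [mm]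
    | [a] =>
      convert A.d_mem (A.prj_mem a.1 a.2) using 2
      · simp; ring
      · rfl
    | [a, b] =>
      refine units_smul_mem _ _ ?_
      convert A.mul_mem (A.prj_mem a.1 a.2) (A.prj_mem b.1 b.2) using 2
      simp; ring
    | a :: b :: c :: w => simp [mm]
  lin x y p c a b := by
    match x, y with
    | [], [] => simp [mm]
    | [], [e] => simp [mm, add_mul, smul_comm c]
    | [e], [] => simp [mm, mul_add, smul_comm c]
    | [], e :: d :: y => simp [mm]
    | [e], d :: y => simp [mm]
    | e :: d :: x, y =>
      simp only [List.cons_append]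
      rw [mm_of_length, mm_of_length, mm_of_length, add_zero, smul_zero] <;> simp <;> omega
  bal u c d v κ := by
    match u, v with
    | [], [] => simp [mm, Ltr.l, Ltr.r, prj_η_mul, prj_mul_η, mul_assoc]
    | [], e :: v => simp [mm]
    | e :: u, v =>
      rw [mm_of_length, mm_of_length] <;> simp <;> omega
  left c v κ := by
    match v with
    | [] => simp [mm, Ltr.l, prj_η_mul, A.d_η_mul]
    | [e] => simp [mm, Ltr.l, prj_η_mul, mul_assoc, mul_smul_comm]
    | e :: d :: v => simp [mm]
  right u c κ := by
    match u with
    | [] => simp [mm, Ltr.r, prj_mul_η, A.d_mul (prj_mem _ _), A.d_η]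
    | [e] => simp [mm, Ltr.r, prj_mul_η, mul_assoc, smul_mul_assoc]
    | e :: d :: u =>
      rw [mm_of_length, mm_of_length, zero_mul] <;> simp
  nil κ := by simp [mm]

end AugDGRing

/-! ### Homogeneous and reduced letters -/

namespace AugDGRing
open Braces

variable {k : Type u} [Field k] {t : ℕ} {A : AugDGRing.{u, v} k t}

/-- The homogeneous element of `A` that a letter defines. -/
noncomputable def Ltr.elt (c : A.Ltr) : A.Elt := ⟨c.1, ⟨A.prj c.1 c.2, prj_mem _ _⟩⟩

/-- The homogeneous element of `Ā` that a letter defines. -/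
noncomputable def Ltr.red (c : A.Ltr) : A.RElt := (Ltr.elt c).bar

/-- A homogeneous element of `A` as a letter. -/
def Elt.ltr (a : A.Elt) : A.Ltr := (a.1, a.2.1)

/-- A homogeneous element of `Ā` as a letter. -/
def RElt.ltr (a : A.RElt) : A.Ltr := (a.1, a.2.1)

@[simp] theorem Ltr.elt_fst (c : A.Ltr) : (Ltr.elt c).1 = c.1 := rfl
@[simp] theorem Ltr.red_fst (c : A.Ltr) : (Ltr.red c).1 = c.1 := rfl
@[simp] theorem Elt.ltr_fst (c : A.Elt) : (Elt.ltr c).1 = c.1 := rfl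
@[simp] theorem RElt.ltr_fst (c : A.RElt) : (RElt.ltr c).1 = c.1 := rfl

theorem Ltr.red_val (c : A.Ltr) :
    (Ltr.red c).2.1 = A.prj c.1 c.2 - A.η (A.aug (A.prj c.1 c.2)) := rfl

@[simp] theorem Elt.elt_ltr (a : A.Elt) : Ltr.elt a.ltr = a :=
  Elt.ext' rfl (prj_of_mem a.2.2)

theorem RElt.bar_toElt (a : A.RElt) : a.toElt.bar = a :=
  RElt.ext' rfl (by
    change a.2.1 - A.η (A.aug a.2.1) = a.2.1
    rw [(A.mem_red.1 a.2.2).2, map_zero, sub_zero])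

@[simp] theorem RElt.red_ltr (a : A.RElt) : Ltr.red a.ltr = a := by
  have : Ltr.elt a.ltr = a.toElt := Elt.ext' rfl (prj_of_mem a.2.2.1)
  rw [Ltr.red, this, RElt.bar_toElt]

@[simp] theorem Ltr.elt_l (κ : Fin t → k) (c : A.Ltr) : Ltr.elt (c.l κ) = (Ltr.elt c).lmul κ :=
  Elt.ext' rfl (prj_η_mul ..)

@[simp] theorem Ltr.elt_r (κ : Fin t → k) (c : A.Ltr) : Ltr.elt (c.r κ) = (Ltr.elt c).rmul κ :=
  Elt.ext' rfl (prj_mul_η ..)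

@[simp] theorem Ltr.red_l (κ : Fin t → k) (c : A.Ltr) : Ltr.red (c.l κ) = (Ltr.red c).lmul κ := by
  rw [Ltr.red, Ltr.elt_l, bar_lmul, Ltr.red]

@[simp] theorem Ltr.red_r (κ : Fin t → k) (c : A.Ltr) : Ltr.red (c.r κ) = (Ltr.red c).rmul κ := by
  rw [Ltr.red, Ltr.elt_r, bar_rmul, Ltr.red]

@[simp] theorem RElt.ltr_lmul (κ : Fin t → k) (c : A.RElt) : (c.lmul κ).ltr = Ltr.l κ c.ltr := rfl
@[simp] theorem RElt.ltr_rmul (κ : Fin t → k) (c : A.RElt) : (c.rmul κ).ltr = Ltr.r c.ltr κ := rfl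
@[simp] theorem Elt.ltr_lmul (κ : Fin t → k) (c : A.Elt) : (c.lmul κ).ltr = Ltr.l κ c.ltr := rfl
@[simp] theorem Elt.ltr_rmul (κ : Fin t → k) (c : A.Elt) : (c.rmul κ).ltr = Ltr.r c.ltr κ := rfl

@[simp] theorem sdeg_map_red (w : List A.Ltr) : sdeg (w.map Ltr.red) = wd w := by
  simp [sdeg, wd, Function.comp_def]

@[simp] theorem wd_map_ltr (w : List A.RElt) : wd (w.map RElt.ltr) = sdeg w := by
  simp [sdeg, wd, Function.comp_def]

@[simp] theorem map_red_ltr (w : List A.RElt) : (w.map RElt.ltr).map Ltr.red = w := by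
  simp [Function.comp_def]

/-- The component of `x` in `A_p`. -/
noncomputable def eltAt (p : ℤ) (x : A.carrier) : A.gr p := (Ltr.elt (p, x)).2

/-- The component of `x` in `Ā_p`. -/
noncomputable def redAt (p : ℤ) (x : A.carrier) : A.red p := (Ltr.red (p, x)).2

theorem Ltr.elt_mk (p : ℤ) (x : A.carrier) : Ltr.elt (p, x) = ⟨p, eltAt p x⟩ := rfl

theorem Ltr.red_mk (p : ℤ) (x : A.carrier) : Ltr.red (p, x) = ⟨p, redAt p x⟩ := rfl

theorem eltAt_lin (p : ℤ) (c : k) (x y : A.carrier) :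
    eltAt p (c • x + y) = c • eltAt p x + eltAt p y :=
  Subtype.ext (by simp [eltAt, Ltr.elt])

theorem redAt_lin (p : ℤ) (c : k) (x y : A.carrier) :
    redAt p (c • x + y) = c • redAt p x + redAt p y :=
  Subtype.ext (bar_lin (X := Ltr.elt (p, c • x + y)) (Y := Ltr.elt (p, x)) (Z := Ltr.elt (p, y)) c
    (by simp [Ltr.elt]))

/-- A word functional on words in `Ā`, extended to all words. -/
noncomputable def ext {M : Type w} (f : List A.RElt → M) (w : List A.Ltr) : M := f (w.map Ltr.red)

@[simp] theorem ext_ltr {M : Type w} (f : List A.RElt → M) (w : List A.RElt) :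
    ext f (w.map RElt.ltr) = f w := by
  rw [ext, map_red_ltr]

theorem ext_injective {M : Type w} {f g : List A.RElt → M} (h : ∀ w, ext f w = ext g w) : f = g := by
  funext w
  rw [← ext_ltr f, h, ext_ltr]

theorem IsCochain.ext {q : ℤ} {f : List A.RElt → A.carrier} (hf : IsCochain q f) :
    IsWordCochain q (ext f) where
  mem w := by simpa [AugDGRing.ext] using hf.mem (w.map Ltr.red)
  lin x r p c a b := by
    simp only [AugDGRing.ext, List.map_append, List.map_cons, Ltr.red_mk, redAt_lin]
    exact hf.slot_lin ..
  bal u c d v κ := by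
    simp only [AugDGRing.ext, List.map_append, List.map_cons, Ltr.red_l, Ltr.red_r]
    exact hf.slot_bal ..
  left c v κ := by
    simp only [AugDGRing.ext, List.map_cons, Ltr.red_l]
    exact hf.left_lin ..
  right u c κ := by
    simp only [AugDGRing.ext, List.map_append, List.map_cons, List.map_nil, Ltr.red_r]
    exact hf.right_lin ..
  nil κ := hf.nil_comm κ

theorem IsWordCochain.res {q : ℤ} {f : List A.Ltr → A.carrier} (hf : IsWordCochain q f) :
    IsCochain q fun w => f (w.map RElt.ltr) where
  mem w := by simpa using hf.mem (w.map RElt.ltr)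
  slot_lin u v p c x y := by
    simp only [List.map_append, List.map_cons]
    exact hf.lin _ _ p c x.1 y.1
  slot_bal u v x y κ := by
    simpa using hf.bal (u.map RElt.ltr) x.ltr y.ltr (v.map RElt.ltr) κ
  left_lin v x κ := by simpa using hf.left x.ltr (v.map RElt.ltr) κ
  right_lin u x κ := by simpa using hf.right (u.map RElt.ltr) x.ltr κ
  nil_comm κ := hf.nil κ

theorem IsWordCochain.of_ext {q : ℤ} {f : List A.RElt → A.carrier} (hf : IsWordCochain q (ext f)) :
    IsCochain q f := by
  simpa using hf.res

/-- The projection to Ā that `ins` makes when a value is inserted is here made by the outer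
functional, since extensions reduce all their letters. -/
theorem red_lt {q : ℤ} (f : A.Cochain q) (w : List A.Ltr) :
    Ltr.red (lt q (ext f.1) w) = ins f (w.map Ltr.red) := by
  have : Ltr.elt (lt q (ext f.1) w) = cval f (w.map Ltr.red) :=
    Elt.ext' (by simp) (prj_of_mem (f.2.ext.mem w))
  rw [Ltr.red, this, ins]

theorem elt_lt {q : ℤ} (f : A.Cochain q) (w : List A.Ltr) :
    Ltr.elt (lt q (ext f.1) w) = cval f (w.map Ltr.red) :=
  Elt.ext' (by simp) (prj_of_mem (f.2.ext.mem w))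

theorem ext_circ {r : ℤ} (f : List A.RElt → A.carrier) (g : A.Cochain r) (w : List A.Ltr) :
    ext (circ f g) w = rins r (ext g.1) (ext f) w := by
  rw [ext, circ, splitSum_map]
  refine splitSum_congr (fun x z => ?_) w
  rw [splitSum_map]
  refine splitSum_congr (fun y v => ?_) z
  simp [ext, red_lt]

/-- The commutator with the structure of `A`. -/
noncomputable def wordDelta (q : ℤ) (f : List A.Ltr → A.carrier) (w : List A.Ltr) : A.carrier :=
  rins q f A.mm w - (q + 1).negOnePow • rins (-2) A.mm f w

theorem rins_left_mm (q : ℤ) (f : List A.Ltr → A.carrier) (w : List A.Ltr) :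
    rins q f A.mm w = A.mm [lt q f w]
      + frontSum (fun c y => ((c.1 + 1) * (q + 1)).negOnePow • A.mm [c, lt q f y]) w
      + backSum (fun y c => A.mm [lt q f y, c]) w := by
  rw [rins, ins3, splitSum_eq_frontSum]
  · rw [splitSum_eq_backSum]
    · rw [add_right_comm]
      congr 1
      · congr 1
        · simp
        · refine frontSum_congr fun c y _ => ?_
          rw [splitSum_eq_self]
          · simp
          · intro x a y
            simp [mm_of_three]
      · simp
    · intro x a b y
      simp [mm_of_three]
  · intro a b x y
    have : ∀ y' v', A.mm (a :: b :: x ++ lt q f y' :: v') = 0 := fun y' v' =>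
      mm_of_length (by simp; omega)
    simp only [this, smul_zero, splitSum_zero]

/-- The values of f and g use up both arguments of the product, so their blocks must exhaust the
word: this is the cup product up to sign. -/
theorem br2_mm {q r : ℤ} {f g : List A.Ltr → A.carrier} (hf : ∀ w, f w ∈ A.gr (q + wd w))
    (hg : ∀ w, g w ∈ A.gr (r + wd w)) (w : List A.Ltr) :
    br2 q f r g A.mm w = (r * (q + 1)).negOnePow •
      splitSum (fun x y => (r * wd x).negOnePow • (f x * g y)) w := by
  rw [br2, ins3, splitSum_eq_self', ← splitSum_smul]
  · refine splitSum_congr (fun x y => ?_) w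
    rw [mR, rins, ins3, splitSum_eq_self', splitSum_eq_self]
    · simp only [List.nil_append, mm, lt_fst]
      rw [lt, prj_of_mem (hf _), lt, prj_of_mem (hg _)]
      simp only [negOnePow_smul_smul]
      refine negOnePow_smul_congr ?_ rfl
      simp only [wd_nil, parity_simps]
      grind (splits := 40)
    · intro x a y
      simp [mm_of_three]
    · intro b x y
      have : ∀ c y' v', A.mm ([] ++ c :: (b :: x ++ lt r g y' :: v')) = 0 := fun c y' v' =>
        mm_of_length (by simp; omega)
      simp only [this, smul_zero, splitSum_zero]
  · intro a x y
    have : ∀ s c v, mR r g (fun z a r => A.mm (z ++ a :: r)) (a :: s) c v = 0 := fun s c v => by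
      have : ∀ x' y' v', A.mm ((a :: s) ++ c :: (x' ++ lt r g y' :: v')) = 0 := fun x' y' v' =>
        mm_of_length (by simp; omega)
      simp only [mR, rins, ins3, this, smul_zero, splitSum_zero]
    simp only [this, smul_zero, splitSum_zero]

theorem ext_cup {q r : ℤ} (f : A.Cochain q) (g : A.Cochain r) (w : List A.Ltr) :
    ext (cup f.1 r g.1) w
      = (r * (q + 1)).negOnePow • br2 q (ext f.1) r (ext g.1) A.mm w := by
  rw [br2_mm f.2.ext.mem g.2.ext.mem, smul_smul, Int.units_mul_self, one_smul, ext, cup,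
    splitSum_map]
  simp [ext]

end AugDGRing

/-! ### Scalars in bar entries and the Hochschild differential as a commutator -/

namespace AugDGRing
open Braces

variable {k : Type u} [Field k] {t : ℕ} {A : AugDGRing.{u, v} k t}

section
variable {M : Type w}

/-- A function of a letter `(p, x)` that depends on the component of `x` in `A_p` only. -/
def LetterPrj (θ : A.Ltr → M) : Prop := ∀ p y, θ (p, A.prj p y) = θ (p, y)

/-- A word functional that depends on the homogeneous elements defined by the letters only. -/
def WordPrj (Φ : List A.Ltr → M) : Prop := ∀ x r, LetterPrj fun c => Φ (x ++ c :: r)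

theorem Ltr.red_prj (p : ℤ) (y : A.carrier) : Ltr.red (A := A) (p, A.prj p y) = Ltr.red (p, y) :=
  RElt.ext' rfl (by simp [Ltr.red_val])

theorem ext_wordPrj (f : List A.RElt → M) : WordPrj (ext f) := fun x r p y => by
  simp [ext, Ltr.red_prj]

theorem mm_wordPrj : WordPrj A.mm := by
  intro x y p a
  match x, y with
  | [], [] => simp [mm]
  | [], [c] => simp [mm]
  | [c], [] => simp [mm]
  | [], c :: d :: y => simp [mm]
  | [c], d :: y => simp [mm]
  | c :: d :: x, y =>
    simp only [List.cons_append]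
    rw [mm_of_length, mm_of_length] <;> simp <;> omega

variable [AddCommGroup M]

theorem WordPrj.ins3 {q : ℤ} {g : List A.Ltr → A.carrier} (hg : WordPrj g)
    {Θ : List A.Ltr → A.Ltr → List A.Ltr → M} (h₁ : ∀ a r, WordPrj fun z => Θ z a r)
    (h₂ : ∀ z a, WordPrj (Θ z a)) : WordPrj (ins3 q g Θ) := fun z r p y => by
  simp only [ins3_mark]
  congr 1
  · congr 1
    · exact ins3_congr q g fun x c v => h₂ x c v r p y
    · refine splitSum_congr (fun z₁ z₂ => splitSum_congr (fun r₁ r₂ => ?_) r) z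
      have := hg z₂ r₁ p y
      simp only [lt, wd_append, wd_cons] at this ⊢
      rw [this]
  · congr 1
    exact ins3_congr q g fun x c v => h₁ c v z x p y

theorem WordPrj.marked_left {Φ : List A.Ltr → M} (h : WordPrj Φ) (a : A.Ltr) (r : List A.Ltr) :
    WordPrj fun z => Φ (z ++ a :: r) := fun x y p b => by
  simpa using h x (y ++ a :: r) p b

theorem WordPrj.marked_right {Φ : List A.Ltr → M} (h : WordPrj Φ) (z : List A.Ltr) (a : A.Ltr) :
    WordPrj fun r => Φ (z ++ a :: r) := fun x y p b => by
  simpa using h (z ++ a :: x) y p b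

theorem WordPrj.rins {q : ℤ} {g : List A.Ltr → A.carrier} (hg : WordPrj g) {Φ : List A.Ltr → M}
    (h : WordPrj Φ) : WordPrj (rins q g Φ) :=
  hg.ins3 (fun a r => h.marked_left a r) fun z a => h.marked_right z a

variable (A) in
/-- The image of `κ` in `A` as a letter of degree `0`. -/
def scalar (κ : Fin t → k) : A.Ltr := (0, A.η κ)

@[simp] theorem scalar_fst (κ : Fin t → k) : (A.scalar κ).1 = 0 := rfl

/-- A word functional that vanishes if one letter is a scalar. -/
def WordKill (Φ : List A.Ltr → M) : Prop := ∀ x κ r, Φ (x ++ A.scalar κ :: r) = 0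

theorem Ltr.red_scalar (κ : Fin t → k) : Ltr.red (A.scalar κ) = Ltr.red (0, 0) :=
  RElt.ext' rfl (by
    simp [Ltr.red_val, scalar, prj_of_mem (A.η_mem κ), A.aug_η])

theorem ext_wordKill {f : List A.RElt → M} (h : WordAdd (ext f)) : WordKill (ext f) :=
  fun x κ r => by
  have := (h x r).zero 0
  simpa only [ext, List.map_append, List.map_cons, Ltr.red_scalar] using this

/-- The reduced part of a letter. -/
noncomputable def Ltr.bar (c : A.Ltr) : A.Ltr := (Ltr.red c).ltr

/-- The homogeneous part of a letter differs from its reduced part by η of its augmentation. This is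
a scalar in degree 0 and zero in all other degrees, so letters can be replaced one by one. -/
theorem WordKill.eq_bar {Φ : List A.Ltr → M} (h : WordKill Φ) (hadd : WordAdd Φ) (hp : WordPrj Φ)
    (w : List A.Ltr) : Φ (w.map Ltr.bar) = Φ w := by
  -- The prefix x holds the letters already replaced.
  suffices ∀ x, Φ (x ++ w.map Ltr.bar) = Φ (x ++ w) from this []
  induction w with
  | nil => intro x; rfl
  | cons c w ih =>
    intro x
    have e : ∀ r, Φ (x ++ Ltr.bar c :: r) = Φ (x ++ c :: r) := fun r => by
      obtain ⟨p, y⟩ := c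
      have e1 : Φ (x ++ (p, A.η (A.aug (A.prj p y))) :: r) = 0 := by
        by_cases hp0 : p = 0
        · subst hp0
          exact h x _ r
        · rw [A.aug_gr (prj_mem p y) hp0, map_zero]
          exact (hadd x r).zero p
      have e2 := hadd x r p (Ltr.bar (p, y)).2 (A.η (A.aug (A.prj p y)))
      have e3 : (Ltr.bar (p, y)).2 + A.η (A.aug (A.prj p y)) = A.prj p y :=
        sub_add_cancel _ _
      have e4 := hp x r p y
      simp only at e2 e4
      rw [← e4, ← e3, e2, e1, add_zero]
      rfl
    have := ih (x ++ [Ltr.bar c])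
    simp only [List.append_assoc, List.cons_append, List.nil_append] at this
    rw [List.map_cons, this, e]

theorem ar_mm {Θ : List A.Ltr → A.Ltr → List A.Ltr → M} (hΘ : ∀ z r, LetterAdd fun a => Θ z a r)
    (z : List A.Ltr) (a : A.Ltr) (r : List A.Ltr) :
    ar (-2) A.mm Θ z a r = (wd z).negOnePow • (Θ z (lt (-2) A.mm [a]) r
        + frontSum (fun c y => Θ z (lt (-2) A.mm [a, c]) y) r)
      + backSum (fun x c => (wd x).negOnePow • Θ x (lt (-2) A.mm [c, a]) r) z := by
  have e : ∀ x : List A.Ltr, (wd x * (-2 + 1)).negOnePow = (wd x).negOnePow := fun x =>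
    negOnePow_congr (by simp only [parity_simps]; grind)
  have h3 : ∀ s x y, 3 ≤ x.length → Θ s (lt (-2) A.mm x) y = 0 := fun s x y h => by
    rw [lt, mm_of_length h]
    exact (hΘ s y).zero _
  simp only [ar, e]
  rw [splitSum_eq_backSum]
  · congr 1
    · rw [splitSum_eq_frontSum]
      · simp [frontSum_smul]
      · intro b c x y
        rw [h3 _ _ _ (by simp), smul_zero]
    · refine backSum_congr_append fun x c _ => ?_
      rw [splitSum_eq_self']
      · simp
      · intro b x y
        rw [h3 _ _ _ (by simp), smul_zero]
  · intro x b c y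
    have : ∀ x' y', Θ x (lt (-2) A.mm (b :: c :: y ++ a :: x')) y' = 0 := fun x' y' =>
      h3 _ _ _ (by simp; omega)
    simp only [this, smul_zero, splitSum_zero]

section
variable {θ : A.Ltr → M} (h : LetterAdd θ) (hp : LetterPrj θ) (κ : Fin t → k) (c : A.Ltr)
include h

theorem letter_mm_scalar : θ (lt (-2) A.mm [A.scalar κ]) = 0 := by
  have : A.mm [A.scalar κ] = 0 := by simp [mm, scalar, prj_of_mem (A.η_mem κ), A.d_η]
  rw [lt, this]
  exact h.zero _

include hp

theorem letter_mm_scalar_left : θ (lt (-2) A.mm [A.scalar κ, c]) = - θ (c.l κ) := by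
  have : lt (-2) A.mm [A.scalar κ, c] = (c.1, (-1 : ℤˣ) • A.prj c.1 (A.η κ * c.2)) := by
    simp [lt, mm, scalar, prj_of_mem (A.η_mem κ), prj_η_mul]
    ring
  rw [this, h.smul, hp]
  simp [Ltr.l]

theorem letter_mm_scalar_right :
    θ (lt (-2) A.mm [c, A.scalar κ]) = (c.1 + 1).negOnePow • θ (c.r κ) := by
  have : lt (-2) A.mm [c, A.scalar κ] = (c.1, (c.1 + 1).negOnePow • A.prj c.1 (c.2 * A.η κ)) := by
    simp [lt, mm, scalar, prj_of_mem (A.η_mem κ), prj_mul_η]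
    ring
  rw [this, h.smul, hp]
  rfl

end

/-- Every term that leaves the scalar as a letter vanishes, and so does its differential. Only its
products with the two neighbours remain. -/
theorem rins_mm_scalar {Φ : List A.Ltr → M} (h : WordAdd Φ) (hp : WordPrj Φ) (hk : WordKill Φ)
    (z : List A.Ltr) (κ : Fin t → k) (r : List A.Ltr) :
    rins (-2) A.mm Φ (z ++ A.scalar κ :: r)
      = backSum (fun x (c : A.Ltr) => (wd x + (c.1 + 1)).negOnePow • Φ (x ++ c.r κ :: r)) z
      - (wd z).negOnePow • frontSum (fun (c : A.Ltr) y => Φ (z ++ c.l κ :: y)) r := by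
  have e1 : mL (-2) A.mm (fun z a r => Φ (z ++ a :: r)) z (A.scalar κ) r = 0 := by
    have : ∀ x y v, Φ (x ++ y :: (v ++ A.scalar κ :: r)) = 0 := fun x y v => by
      simpa using hk (x ++ y :: v) κ r
    simp [mL, rins, ins3, this, splitSum_zero]
  have e2 : mR (-2) A.mm (fun z a r => Φ (z ++ a :: r)) z (A.scalar κ) r = 0 := by
    simp [mR, rins, ins3, hk z κ, splitSum_zero]
  rw [rins_mark, e1, e2, ar_mm h]
  simp only [letter_mm_scalar (h _ _), letter_mm_scalar_left (h _ _) (hp _ _),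
    letter_mm_scalar_right (h _ _) (hp _ _), negOnePow_smul_smul, zero_add, add_zero]
  have : frontSum (fun (c : A.Ltr) y => - Φ (z ++ c.l κ :: y)) r
      = - frontSum (fun (c : A.Ltr) y => Φ (z ++ c.l κ :: y)) r :=
    (map_frontSum (negAddMonoidHom : M →+ M) _ r).symm
  rw [this, smul_neg]
  abel

end

/-- Inside the word, the products of κ with its two neighbours cancel because f is K-balanced. At an
end of the word, the product with the remaining neighbour cancels against the outer term κ f or f κ
by K-linearity. For the one-letter word, f [] commutes with κ. -/
theorem IsWordCochain.wordDelta_scalar {q : ℤ} {f : List A.Ltr → A.carrier}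
    (hf : IsWordCochain q f) (hp : WordPrj f) (hk : WordKill f) : WordKill (wordDelta q f) := by
  intro z κ r
  have m0 : ∀ n, A.mm [(n, 0)] = 0 := fun n => by simp [mm]
  have m1 : ∀ n c, A.mm [(n, 0), c] = 0 := fun n c => by simp [mm]
  have m2 : ∀ n c, A.mm [c, (n, 0)] = 0 := fun n c => by simp [mm]
  have m3 : ∀ w, A.mm [lt q f w, A.scalar κ] = (q + wd w + 1).negOnePow • (f w * A.η κ) :=
    fun w => by simp [mm, lt, scalar, prj_of_mem (A.η_mem κ), prj_of_mem (hf.mem w)]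
  have m4 : ∀ w, A.mm [A.scalar κ, lt q f w] = - (A.η κ * f w) :=
    fun w => by simp [mm, lt, scalar, prj_of_mem (A.η_mem κ), prj_of_mem (hf.mem w)]
  have hk0 := hk []
  simp only [List.nil_append] at hk0
  rw [wordDelta, rins_mm_scalar hf.lin.wordAdd hp hk, rins_left_mm, lt, hk, m0, zero_add]
  rcases List.eq_nil_or_concat z with rfl | ⟨x, c, rfl⟩
  · cases r with
    | nil =>
      have : backSum (fun y c => A.mm [lt q f y, c]) ([] ++ [A.scalar κ])
        = A.mm [lt q f [], A.scalar κ] := backSum_concat _ [] _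
      rw [this, m3]
      simp [frontSum, m4, hf.nil]
    | cons d y =>
      have e : backSum (fun y c => A.mm [lt q f y, c]) ([] ++ A.scalar κ :: d :: y) = 0 := by
        rcases List.eq_nil_or_concat (d :: y) with h | ⟨s, c, h⟩
        · simp at h
        · have := backSum_concat (fun y c => A.mm [lt q f y, c]) (A.scalar κ :: s) c
          simp only [List.concat_eq_append] at h
          rw [List.nil_append, h, ← List.cons_append, this, lt, hk0, m1]
      rw [e]
      simp [frontSum, m4, hf.left]
  · simp only [List.concat_eq_append]
    have e0 : frontSum (fun c y => ((c.1 + 1) * (q + 1)).negOnePow • A.mm [c, lt q f y])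
        (x ++ [c] ++ A.scalar κ :: r) = 0 := by
      cases x with
      | nil => simp [frontSum, lt, hk0, m2]
      | cons b x =>
        have := hk (x ++ [c]) κ r
        simp only [List.append_assoc, List.cons_append, List.nil_append] at this
        simp [frontSum, lt, this, m2]
    rw [e0, zero_add, backSum_concat]
    cases r with
    | nil =>
      have : backSum (fun y c => A.mm [lt q f y, c]) ((x ++ [c]) ++ [A.scalar κ])
        = A.mm [lt q f (x ++ [c]), A.scalar κ] := backSum_concat _ _ _
      rw [this, m3]
      simp only [frontSum, smul_zero, sub_zero, hf.right, negOnePow_smul_smul]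
      rw [sub_eq_zero]
      refine negOnePow_smul_congr ?_ rfl
      simp only [wd_append, wd_cons, wd_nil, parity_simps]
      grind (splits := 40)
    | cons d y =>
      have e : backSum (fun y c => A.mm [lt q f y, c]) (x ++ [c] ++ A.scalar κ :: d :: y) = 0 := by
        rcases List.eq_nil_or_concat (d :: y) with h | ⟨s, b, h⟩
        · simp at h
        · have := backSum_concat (fun y c => A.mm [lt q f y, c]) (x ++ [c] ++ A.scalar κ :: s) b
          simp only [List.concat_eq_append] at h
          rw [h, ← List.cons_append, ← List.append_assoc, this, lt, hk, m1]
      rw [e]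
      simp only [frontSum, zero_sub, neg_eq_zero]
      have := hf.bal x c d y κ
      rw [this]
      simp only [List.append_assoc, List.cons_append, List.nil_append, wd_append, wd_cons, wd_nil,
        add_zero, sub_self, smul_zero]

theorem IsWordCochain.wordDelta {q : ℤ} {f : List A.Ltr → A.carrier} (hf : IsWordCochain q f) :
    IsWordCochain (q - 1) (wordDelta q f) := by
  have h1 := isWordCochain_mm.rins hf
  have h2 := (hf.rins isWordCochain_mm).smul ((q + 1).negOnePow)
  have e1 : -2 + (q + 1) = q - 1 := by ring
  have e2 : q + (-2 + 1) = q - 1 := by ring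
  rw [e1] at h1
  rw [e2] at h2
  constructor
  · exact fun w => Submodule.sub_mem _ (h1.mem w) (h2.mem w)
  · intro x r p c a b
    simp only [AugDGRing.wordDelta, h1.lin x r p c a b, h2.lin x r p c a b, smul_sub]
    abel
  · intro u c d v κ
    simp only [AugDGRing.wordDelta, h1.bal u c d v κ, h2.bal u c d v κ]
  · intro c v κ
    simp only [AugDGRing.wordDelta, h1.left c v κ, h2.left c v κ, mul_sub]
  · intro u c κ
    simp only [AugDGRing.wordDelta, h1.right u c κ, h2.right u c κ, sub_mul]
  · intro κ
    simp only [AugDGRing.wordDelta, mul_sub, sub_mul, h1.nil κ, h2.nil κ]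

theorem delta_eq {q : ℤ} {f : List A.RElt → A.carrier} (hf : IsCochain q f) (w : List A.RElt) :
    wordDelta q (ext f) (w.map RElt.ltr) = delta q f w := by
  have hx := hf.ext
  have ng : ∀ x : A.carrier, - x = (1 : ℤ).negOnePow • x := fun x => by simp
  have e2 : frontSum (fun c y => ((c.1 + 1) * (q + 1)).negOnePow • A.mm [c, lt q (ext f) y])
      (w.map RElt.ltr) = (match w with
        | [] => 0
        | a :: y => (q * (a.1 + 1)).negOnePow • (a.2.1 * f y)) := by
    cases w with
    | nil => rfl
    | cons a y =>
      simp only [List.map_cons, frontSum, mm, lt, RElt.ltr, negOnePow_smul_smul]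
      rw [prj_of_mem a.2.2.1, prj_of_mem (hx.mem _), ext_ltr]
      refine negOnePow_smul_congr ?_ rfl
      simp only [parity_simps]
      grind (splits := 40)
  have e1 : A.mm [lt q (ext f) (w.map RElt.ltr)] = A.d (f w) := by
    simp only [lt, mm]
    rw [prj_of_mem (hx.mem _), ext_ltr]
  have e3 : backSum (fun y c => A.mm [lt q (ext f) y, c]) (w.map RElt.ltr)
      = letterSum (fun x a z => match z with
        | [] => (q + sdeg x + 1).negOnePow • (f x * a.2.1)
        | _ :: _ => 0) w := by
    rw [backSum, letterSum_map]
    refine letterSum_congr (fun x a z => ?_) w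
    cases z with
    | nil =>
      simp only [List.map_nil, mm, lt, RElt.ltr]
      rw [prj_of_mem a.2.2.1, prj_of_mem (hx.mem _), ext_ltr, wd_map_ltr]
    | cons b z => rfl
  have e4 : (q + 1).negOnePow • letterSum (fun x a y =>
      (wd x).negOnePow • ext f (x ++ (a.1 - 1, A.d (A.prj a.1 a.2)) :: y)) (w.map RElt.ltr)
      = - letterSum (fun x a y => (sdeg x + q).negOnePow • f (x ++ a.d :: y)) w := by
    rw [letterSum_map, ← letterSum_smul, ng, ← letterSum_smul]
    refine letterSum_congr (fun x a y => ?_) w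
    have : f (x ++ a.d :: y) = ext f (x.map RElt.ltr ++ a.d.ltr :: y.map RElt.ltr) := by
      rw [ext, List.map_append, List.map_cons, map_red_ltr, map_red_ltr, RElt.red_ltr]
    rw [this, wd_map_ltr, negOnePow_smul_smul, negOnePow_smul_smul]
    refine negOnePow_smul_congr ?_ ?_
    · simp only [parity_simps]
      grind (splits := 40)
    · simp [RElt.ltr, prj_of_mem a.2.2.1, RElt.d]
  have e5 : (q + 1).negOnePow • letterSum (fun x a z => frontSum (fun b y =>
      (wd x + (a.1 + 1)).negOnePow •
        ext f (x ++ (a.1 + b.1, A.prj a.1 a.2 * A.prj b.1 b.2) :: y)) z) (w.map RElt.ltr)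
      = - letterSum (fun x a z => match z with
        | [] => 0
        | b :: y => (q + (sdeg x + (a.1 + 1))).negOnePow • f (x ++ a.mul b :: y)) w := by
    rw [letterSum_map, ← letterSum_smul, ng, ← letterSum_smul]
    refine letterSum_congr (fun x a z => ?_) w
    cases z with
    | nil => simp [frontSum]
    | cons b y =>
      have : f (x ++ a.mul b :: y)
          = ext f (x.map RElt.ltr ++ (a.mul b).ltr :: y.map RElt.ltr) := by
        rw [ext, List.map_append, List.map_cons, map_red_ltr, map_red_ltr, RElt.red_ltr]
      simp only [List.map_cons, frontSum]
      rw [this, wd_map_ltr, negOnePow_smul_smul, negOnePow_smul_smul]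
      refine negOnePow_smul_congr ?_ ?_
      · simp only [RElt.ltr, parity_simps]
        grind (splits := 40)
      · simp [RElt.ltr, prj_of_mem a.2.2.1, prj_of_mem b.2.2.1, RElt.mul]
  rw [wordDelta, rins_left_mm, rins_mm hx.lin.wordAdd, e1, e2, e3, smul_add, e4, e5]
  have reorder : ∀ a b c d e : A.carrier, a + b + c - (-d + -e) = (a + d) + (b + e + c) := by
    intros; abel
  exact reorder _ _ _ _ _

/-- Inner products of letters may have a scalar part, so `wordDelta` of an extension is not visibly
an extension. It vanishes on scalars, hence depends only on the reduced parts of the letters, and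
there `delta_eq` applies. -/
theorem ext_delta {q : ℤ} {f : List A.RElt → A.carrier} (hf : IsCochain q f) (w : List A.Ltr) :
    ext (delta q f) w = wordDelta q (ext f) w := by
  have hx := hf.ext
  have hk := hx.wordDelta_scalar (ext_wordPrj f) (ext_wordKill hx.lin.wordAdd)
  have hp : WordPrj (wordDelta q (ext f)) := fun x r p y => by
    have h1 := (ext_wordPrj f).rins (q := q) mm_wordPrj x r p y
    have h2 := mm_wordPrj.rins (q := -2) (ext_wordPrj f) x r p y
    simp only [wordDelta] at h1 h2 ⊢
    rw [h1, h2]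
  rw [← hk.eq_bar hx.wordDelta.lin.wordAdd hp, ext, ← delta_eq hf]
  rw [List.map_map]
  rfl

end AugDGRing

/-! ### Additivity in the inserted functional -/

namespace Braces

variable {V : Type u} {M : Type v} [AddCommGroup V] [AddCommGroup M]

theorem ins3_fun_sub (q : ℤ) (f g : List (ℤ × V) → V) (e : ℤˣ)
    {Θ : List (ℤ × V) → ℤ × V → List (ℤ × V) → M} (h : ∀ x v, LetterAdd fun c => Θ x c v)
    (w : List (ℤ × V)) :
    ins3 q (fun w => f w - e • g w) Θ w = ins3 q f Θ w - e • ins3 q g Θ w := by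
  simp only [ins3, ← splitSum_smul, ← splitSum_sub]
  refine splitSum_congr (fun x z => splitSum_congr (fun y v => ?_) z) w
  simp only [lt, (h x v).sub, (h x v).smul, smul_sub]
  rw [smul_comm]

theorem rins_fun_sub (q : ℤ) (f g : List (ℤ × V) → V) (e : ℤˣ) {Φ : List (ℤ × V) → M}
    (h : WordAdd Φ) (w : List (ℤ × V)) :
    rins q (fun w => f w - e • g w) Φ w = rins q f Φ w - e • rins q g Φ w :=
  ins3_fun_sub q f g e h w

theorem br2_fun_sub_left (q : ℤ) (f g : List (ℤ × V) → V) (e : ℤˣ) (r : ℤ)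
    (h : List (ℤ × V) → V) {Φ : List (ℤ × V) → M} (hΦ : WordAdd Φ) (w : List (ℤ × V)) :
    br2 q (fun w => f w - e • g w) r h Φ w = br2 q f r h Φ w - e • br2 q g r h Φ w :=
  ins3_fun_sub q f g e (LetterAdd.mR r h fun x v => hΦ x v) w

theorem br2_fun_sub_right (q : ℤ) (f g : List (ℤ × V) → V) (e : ℤˣ) (r : ℤ)
    (h : List (ℤ × V) → V) {Φ : List (ℤ × V) → M} (hΦ : WordAdd Φ) (w : List (ℤ × V)) :
    br2 r h q (fun w => f w - e • g w) Φ w = br2 r h q f Φ w - e • br2 r h q g Φ w := by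
  have : ∀ z a s, mR q (fun w => f w - e • g w) (fun z a s => Φ (z ++ a :: s)) z a s
      = mR q f (fun z a s => Φ (z ++ a :: s)) z a s
        - e • mR q g (fun z a s => Φ (z ++ a :: s)) z a s := fun z a s => by
    have hz : WordAdd fun s => Φ (z ++ a :: s) := fun x y => by
      simpa using hΦ (z ++ a :: x) y
    simp only [mR, rins_fun_sub q f g e hz, smul_sub]
    rw [smul_comm]
  simp only [br2, ins3, this, smul_sub, splitSum_sub]
  congr 1
  simp only [← splitSum_smul]
  refine splitSum_congr (fun x z => splitSum_congr (fun y v => ?_) z) w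
  rw [smul_comm]

theorem rins_fun_smul (q : ℤ) (f : List (ℤ × V) → V) (e : ℤˣ) {Φ : List (ℤ × V) → M}
    (h : WordAdd Φ) (w : List (ℤ × V)) :
    rins q (fun w => e • f w) Φ w = e • rins q f Φ w := by
  simp only [rins, ins3, ← splitSum_smul]
  refine splitSum_congr (fun x z => splitSum_congr (fun y v => ?_) z) w
  have : Φ (x ++ (q + wd y, e • f y) :: v) = e • Φ (x ++ (q + wd y, f y) :: v) :=
    (h x v).smul (q + wd y) e (f y)
  simp only [lt, this]
  rw [smul_comm]

theorem rins_sub (q : ℤ) (g : List (ℤ × V) → V) (Φ Ψ : List (ℤ × V) → M) (e : ℤˣ)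
    (w : List (ℤ × V)) :
    rins q g (fun w => Φ w - e • Ψ w) w = rins q g Φ w - e • rins q g Ψ w := by
  rw [eq_sub_iff_add_eq, ← rins_smul, ← rins_add]
  simp

/-- In Φ{F}{G} the value of G lies inside the block of F, to its left, or to its right. -/
theorem rins_twice (p q : ℤ) (F G : List (ℤ × V) → V) {Φ : List (ℤ × V) → M} (h : WordAdd Φ)
    (w : List (ℤ × V)) :
    rins q G (rins p F Φ) w = rins (p + q + 1) (rins q G F) Φ w + br2 q G p F Φ w
      + ((p + 1) * (q + 1)).negOnePow • br2 p F q G Φ w := by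
  have := rins_ins3 q p G F (Θ := fun x c v => Φ (x ++ c :: v)) (fun x v => h x v) w
  rw [ins3_add, ins3_mL, smul_add, smul_smul, mul_comm (q + 1), Int.units_mul_self, one_smul,
    add_comm q p] at this
  rw [add_assoc]
  exact this

theorem mR_smul (q : ℤ) (g : List (ℤ × V) → V) (e : ℤˣ)
    (Θ : List (ℤ × V) → ℤ × V → List (ℤ × V) → M) (z : List (ℤ × V)) (a : ℤ × V)
    (r : List (ℤ × V)) : mR q g (fun z a r => e • Θ z a r) z a r = e • mR q g Θ z a r := by
  rw [mR, rins_smul, smul_comm, mR]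

theorem br2_smul (q : ℤ) (g : List (ℤ × V) → V) (r : ℤ) (h : List (ℤ × V) → V) (e : ℤˣ)
    (Φ : List (ℤ × V) → M) (w : List (ℤ × V)) :
    br2 q g r h (fun w => e • Φ w) w = e • br2 q g r h Φ w := by
  rw [br2, ins3_congr q g fun x c v => mR_smul r h e (fun z a r => Φ (z ++ a :: r)) x c v,
    ins3_smul, br2]

end Braces

/-! ### Differentials of insertions, the Poisson rule and the Jacobi identity -/

namespace AugDGRing
open Braces

variable {k : Type u} [Field k] {t : ℕ} {A : AugDGRing.{u, v} k t}

/-- Here m{F{G}} is expanded by `rins_twice` and F{G}{m} by the pre-Lie identity. The pair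
insertions into m are cup products up to sign, so for cocycles F{G} is a homotopy for graded
commutativity. -/
theorem wordDelta_rins {p q : ℤ} {F G : List A.Ltr → A.carrier} (hF : WordAdd F)
    (w : List A.Ltr) :
    wordDelta (p + q + 1) (rins q G F) w = rins q G (wordDelta p F) w
      + (p + 1).negOnePow • rins (q - 1) (wordDelta q G) F w
      - br2 q G p F A.mm w - ((p + 1) * (q + 1)).negOnePow • br2 p F q G A.mm w := by
  have e1 := rins_twice p q F G mm_wordAdd w
  have e2 := rins_rins (-2) q A.mm G hF w
  rw [show -2 + q + 1 = q - 1 by ring, show q + -2 + 1 = q - 1 by ring] at e2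
  unfold wordDelta
  rw [rins_sub, rins_fun_sub (q - 1) _ _ _ hF, e1, e2]
  have s1 : ((-2 + 1) * (q + 1)).negOnePow = (q + 1).negOnePow :=
    negOnePow_congr (by simp only [parity_simps]; grind)
  have s2 : (p + q + 1 + 1).negOnePow = (p + 1).negOnePow * (q + 1).negOnePow := by
    rw [← Int.negOnePow_add]
    ring_nf
  rw [s1, s2]
  rcases Int.units_eq_one_or (p + 1).negOnePow with h1 | h1 <;>
  rcases Int.units_eq_one_or (q + 1).negOnePow with h2 | h2 <;>
  · rw [h1, h2]
    simp only [one_smul, mul_one, Units.neg_smul, mul_neg, neg_neg]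
    abel

/-- This is `br2_rins` for m inserted into m, whose left-hand side vanishes since m{m} = 0. -/
theorem wordDelta_br2 {q r : ℤ} {g h : List A.Ltr → A.carrier} (w : List A.Ltr) :
    wordDelta (q + r) (br2 q g r h A.mm) w
      + (r + 1).negOnePow • br2 (q - 1) (wordDelta q g) r h A.mm w
      + br2 q g (r - 1) (wordDelta r h) A.mm w = 0 := by
  have e := br2_rins (-2) q A.mm g r h mm_wordAdd w
  have e0 : br2 q g r h (rins (-2) A.mm A.mm) w = 0 := by
    have : rins (-2) A.mm A.mm = fun _ => 0 := funext mm_mm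
    rw [this]
    simp [br2, ins3, mR, rins, splitSum_zero]
  rw [e0, show -2 + q + 1 = q - 1 by ring, show q + -2 + 1 = q - 1 by ring,
    show -2 + r + 1 = r - 1 by ring, show r + -2 + 1 = r - 1 by ring,
    show -2 + q + r + 2 = q + r by ring] at e
  unfold wordDelta
  rw [br2_fun_sub_left _ _ _ _ _ _ mm_wordAdd, br2_fun_sub_right _ _ _ _ _ _ mm_wordAdd, e]
  have s1 : ((-2 + 1) * (q + r)).negOnePow = (q + 1).negOnePow * (r + 1).negOnePow := by
    rw [← Int.negOnePow_add]
    exact negOnePow_congr (by simp only [parity_simps]; grind)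
  have s2 : ((-2 + 1) * (r + 1)).negOnePow = (r + 1).negOnePow :=
    negOnePow_congr (by simp only [parity_simps]; grind)
  have s3 : (q + r + 1).negOnePow = - ((q + 1).negOnePow * (r + 1).negOnePow) := by
    rw [← Int.negOnePow_add, ← Int.negOnePow_succ]
    exact negOnePow_congr (by simp only [parity_simps]; grind)
  rw [s1, s2, s3]
  rcases Int.units_eq_one_or (q + 1).negOnePow with h1 | h1 <;>
  rcases Int.units_eq_one_or (r + 1).negOnePow with h2 | h2 <;>
  · rw [h1, h2]
    simp only [one_smul, mul_one, Units.neg_smul, mul_neg, neg_neg]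
    abel

/-- The Gerstenhaber bracket of word functionals. -/
def wordBracket (p : ℤ) (F : List A.Ltr → A.carrier) (q : ℤ) (G : List A.Ltr → A.carrier)
    (w : List A.Ltr) : A.carrier :=
  rins q G F w - ((p + 1) * (q + 1)).negOnePow • rins p F G w

/-- The pair insertions in `wordDelta_rins` are symmetric under exchange of F and G, so they drop
out of the bracket, on which δ is a derivation. -/
theorem wordDelta_wordBracket {p q : ℤ} {F G : List A.Ltr → A.carrier} (hF : WordAdd F)
    (hG : WordAdd G) (w : List A.Ltr) :
    wordDelta (p + q + 1) (wordBracket p F q G) w = rins q G (wordDelta p F) w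
      - ((p + 1) * (q + 1)).negOnePow • (q + 1).negOnePow • rins (p - 1) (wordDelta p F) G w
      + ((p + 1).negOnePow • rins (q - 1) (wordDelta q G) F w
        - ((p + 1) * (q + 1)).negOnePow • rins p F (wordDelta q G) w) := by
  have e1 := wordDelta_rins (p := p) (q := q) (G := G) hF w
  have e2 := wordDelta_rins (p := q) (q := p) (G := F) hG w
  have e3 : wordDelta (p + q + 1) (wordBracket p F q G) w
      = wordDelta (p + q + 1) (rins q G F) w
        - ((p + 1) * (q + 1)).negOnePow • wordDelta (q + p + 1) (rins p F G) w := by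
    unfold wordDelta wordBracket
    rw [rins_sub, rins_fun_sub _ _ _ _ mm_wordAdd, add_comm q p]
    simp only [smul_sub]
    rw [smul_comm]
    abel
  rw [e3, e1, e2, mul_comm (q + 1) (p + 1)]
  simp only [smul_sub, smul_add, smul_smul, Int.units_mul_self, one_smul]
  abel

/-- The identity `br2_rins` is used for F{m}{g, h} and for m{F}{g, h}, which agree up to sign for a
cocycle F. The terms with δg and δh vanish, and what is left over is the differential of F{g, h}. -/
theorem wordBracket_br2 {p q r : ℤ} {F g h : List A.Ltr → A.carrier} (hF : WordAdd F)
    (dF : ∀ w, wordDelta p F w = 0) (dg : ∀ w, wordDelta q g w = 0)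
    (dh : ∀ w, wordDelta r h w = 0) (w : List A.Ltr) :
    wordBracket p F (q + r) (br2 q g r h A.mm) w
      = (p + 1).negOnePow • (((p + 1) * (r + 1)).negOnePow •
          br2 (p + q + 1) (wordBracket p F q g) r h A.mm w
        + br2 q g (p + r + 1) (wordBracket p F r h) A.mm w
        + wordDelta (p + q + r + 2) (br2 q g r h F) w) := by
  have e1 := br2_rins (-2) q A.mm g r h hF w
  have e2 := br2_rins p q F g r h mm_wordAdd w
  have zF : rins (-2) A.mm F = fun w => (p + 1).negOnePow • rins p F A.mm w := by
    funext w
    have := dF w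
    rw [wordDelta, sub_eq_zero] at this
    rw [this, smul_smul, Int.units_mul_self, one_smul]
  have zg : br2 (q - 1) (rins q g A.mm) r h F w
      = (q + 1).negOnePow • br2 (q - 1) (rins (-2) A.mm g) r h F w := by
    have := br2_fun_sub_left (q - 1) (rins q g A.mm) (rins (-2) A.mm g) (q + 1).negOnePow r h hF w
    rw [← sub_eq_zero, ← this]
    have : (fun w => rins q g A.mm w - (q + 1).negOnePow • rins (-2) A.mm g w) = fun _ => 0 :=
      funext dg
    rw [this]
    simpa using br2_fun_sub_left (q - 1) (fun _ => 0) (fun _ => 0) 1 r h hF w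
  have zh : br2 q g (r - 1) (rins r h A.mm) F w
      = (r + 1).negOnePow • br2 q g (r - 1) (rins (-2) A.mm h) F w := by
    have := br2_fun_sub_right (r - 1) (rins r h A.mm) (rins (-2) A.mm h) (r + 1).negOnePow q g hF w
    rw [← sub_eq_zero, ← this]
    have : (fun w => rins r h A.mm w - (r + 1).negOnePow • rins (-2) A.mm h w) = fun _ => 0 :=
      funext dh
    rw [this]
    simpa using br2_fun_sub_right (r - 1) (fun _ => 0) (fun _ => 0) 1 q g hF w
  rw [show -2 + q + 1 = q - 1 by ring, show q + -2 + 1 = q - 1 by ring,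
    show -2 + r + 1 = r - 1 by ring, show r + -2 + 1 = r - 1 by ring,
    show -2 + q + r + 2 = q + r by ring, zF, br2_smul, zg, zh, e2, ← sub_eq_iff_eq_add'] at e1
  rw [wordBracket, wordDelta]
  unfold wordBracket
  rw [br2_fun_sub_left _ _ _ _ _ _ mm_wordAdd, br2_fun_sub_right _ _ _ _ _ _ mm_wordAdd, ← e1,
    add_comm q p, add_comm r p]
  have s1 : ((-2 + 1) * (q + r)).negOnePow = (q + 1).negOnePow * (r + 1).negOnePow := by
    rw [← Int.negOnePow_add]
    exact negOnePow_congr (by simp only [parity_simps]; grind)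
  have s2 : ((-2 + 1) * (r + 1)).negOnePow = (r + 1).negOnePow :=
    negOnePow_congr (by simp only [parity_simps]; grind)
  have s3 : (p + q + r + 2 + 1).negOnePow
      = (p + 1).negOnePow * ((q + 1).negOnePow * (r + 1).negOnePow) := by
    rw [← Int.negOnePow_add, ← Int.negOnePow_add]
    ring_nf
  have s4 : ((p + 1) * (q + r)).negOnePow
      = ((p + 1) * (q + 1)).negOnePow * ((p + 1) * (r + 1)).negOnePow := by
    rw [← Int.negOnePow_add]
    exact negOnePow_congr (by simp only [parity_simps]; grind)
  have s5 : ((p + 1) * (q + r + 1)).negOnePow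
      = (p + 1).negOnePow * (((p + 1) * (q + 1)).negOnePow * ((p + 1) * (r + 1)).negOnePow) := by
    rw [← Int.negOnePow_add, ← Int.negOnePow_add]
    exact negOnePow_congr (by simp only [parity_simps]; grind)
  rw [s1, s2, s3, s4, s5]
  generalize ((p + 1) * (q + 1)).negOnePow = a
  generalize ((p + 1) * (r + 1)).negOnePow = b
  generalize (p + 1).negOnePow = c
  generalize (q + 1).negOnePow = d
  generalize (r + 1).negOnePow = e
  rcases Int.units_eq_one_or a with rfl | rfl <;>
  rcases Int.units_eq_one_or b with rfl | rfl <;>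
  rcases Int.units_eq_one_or c with rfl | rfl <;>
  rcases Int.units_eq_one_or d with rfl | rfl <;>
  rcases Int.units_eq_one_or e with rfl | rfl <;>
  · simp only [one_smul, mul_one, Units.neg_smul, mul_neg, neg_neg]
    abel

/-- Any graded pre-Lie product has a graded Lie bracket: the hypotheses are the symmetries of the
three associators, and the signs are treated as independent units. -/
theorem jacobi_units {M : Type*} [AddCommGroup M] (a b c : ℤˣ)
    {fgh f_gh fhg f_hg ghf g_hf gfh g_fh hfg h_fg hgf h_gf : M}
    (h₁ : fgh - f_gh = b • (fhg - f_hg)) (h₂ : ghf - g_hf = c • (gfh - g_fh))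
    (h₃ : hfg - h_fg = a • (hgf - h_gf)) :
    c • ((fgh - a • gfh) - (c * b) • (h_fg - a • h_gf))
      + a • ((ghf - b • hgf) - (a * c) • (f_gh - b • f_hg))
      + b • ((hfg - c • fhg) - (b * a) • (g_hf - c • g_fh)) = 0 := by
  rw [sub_eq_iff_eq_add] at h₁ h₂ h₃
  subst h₁ h₂ h₃
  rcases Int.units_eq_one_or a with rfl | rfl <;>
  rcases Int.units_eq_one_or b with rfl | rfl <;>
  rcases Int.units_eq_one_or c with rfl | rfl <;>
  · simp only [one_smul, mul_one, Units.neg_smul, mul_neg, neg_neg]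
    abel

theorem wordBracket_jacobi {p q r : ℤ} {F G H : List A.Ltr → A.carrier} (hF : WordAdd F)
    (hG : WordAdd G) (hH : WordAdd H) (w : List A.Ltr) :
    ((p + 1) * (r + 1)).negOnePow • wordBracket (p + q + 1) (wordBracket p F q G) r H w
      + ((q + 1) * (p + 1)).negOnePow • wordBracket (q + r + 1) (wordBracket q G r H) p F w
      + ((r + 1) * (q + 1)).negOnePow • wordBracket (r + p + 1) (wordBracket r H p F) q G w
      = 0 := by
  have h1 := rins_rins r q H G hF w
  have h2 := rins_rins p r F H hG w
  have h3 := rins_rins q p G F hH w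
  have E := jacobi_units _ _ _ (sub_eq_of_eq_add' h1) (sub_eq_of_eq_add' h2) (sub_eq_of_eq_add' h3)
  have s1 : ((p + q + 1 + 1) * (r + 1)).negOnePow
      = ((p + 1) * (r + 1)).negOnePow * ((r + 1) * (q + 1)).negOnePow := by
    rw [← Int.negOnePow_add]
    ring_nf
  have s2 : ((q + r + 1 + 1) * (p + 1)).negOnePow
      = ((q + 1) * (p + 1)).negOnePow * ((p + 1) * (r + 1)).negOnePow := by
    rw [← Int.negOnePow_add]
    ring_nf
  have s3 : ((r + p + 1 + 1) * (q + 1)).negOnePow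
      = ((r + 1) * (q + 1)).negOnePow * ((q + 1) * (p + 1)).negOnePow := by
    rw [← Int.negOnePow_add]
    ring_nf
  have e : ∀ {x y z : ℤ} {X Y Z : List A.Ltr → A.carrier}, WordAdd Z → wordBracket (x + y + 1)
      (wordBracket x X y Y) z Z w = (rins z Z (rins y Y X) w - ((x + 1) * (y + 1)).negOnePow •
        rins z Z (rins x X Y) w) - ((x + y + 1 + 1) * (z + 1)).negOnePow •
        (rins (x + y + 1) (rins y Y X) Z w - ((x + 1) * (y + 1)).negOnePow •
          rins (x + y + 1) (rins x X Y) Z w) := fun h => by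
    conv_lhs => rw [wordBracket]
    unfold wordBracket
    rw [rins_sub, rins_fun_sub _ _ _ _ h]
  rw [e hH, e hF, e hG, s1, s2, s3, mul_comm (p + 1) (q + 1), mul_comm (q + 1) (r + 1),
    mul_comm (r + 1) (p + 1)]
  rw [add_comm r q, add_comm q p, add_comm p r] at E
  exact E

end AugDGRing

/-! ### Vanishing and k-linearity of insertions -/

namespace Braces

section
variable {V : Type u} {M : Type v} [AddCommGroup V] [AddCommGroup M]
variable (q r : ℤ) (g : List (ℤ × V) → V)

theorem rins_fun_zero {Φ : List (ℤ × V) → M} (h : WordAdd Φ) (w : List (ℤ × V)) :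
    rins q (fun _ => 0) Φ w = 0 := by
  simpa using rins_fun_sub q (fun _ => 0) (fun _ => 0) 1 h w

theorem rins_zero (w : List (ℤ × V)) : rins q g (fun _ => (0 : M)) w = 0 := by
  simpa using rins_sub q g (fun _ => (0 : M)) (fun _ => 0) 1 w

theorem br2_zero_left {Φ : List (ℤ × V) → M} (h : WordAdd Φ) (w : List (ℤ × V)) :
    br2 q (fun _ => 0) r g Φ w = 0 := by
  simpa using br2_fun_sub_left q (fun _ => 0) (fun _ => 0) 1 r g h w

theorem br2_zero_right {Φ : List (ℤ × V) → M} (h : WordAdd Φ) (w : List (ℤ × V)) :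
    br2 q g r (fun _ => 0) Φ w = 0 := by
  simpa using br2_fun_sub_right r (fun _ => 0) (fun _ => 0) 1 q g h w

variable {k : Type w} [Field k] [Module k V] [Module k M]

theorem ins3_fun_lin (c : k) (f g : List (ℤ × V) → V)
    {Θ : List (ℤ × V) → ℤ × V → List (ℤ × V) → M} (h : ∀ x v, LetterLin k fun c => Θ x c v)
    (w : List (ℤ × V)) :
    ins3 q (fun w => c • f w + g w) Θ w = c • ins3 q f Θ w + ins3 q g Θ w :=
  splitSum_lin c (fun x z => splitSum_lin c (fun y v => AugDGRing.sign_lin _ c (h x v _ c (f y) (g y))) z) w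

theorem rins_lin (c : k) (Φ Ψ : List (ℤ × V) → M) (w : List (ℤ × V)) :
    rins q g (fun w => c • Φ w + Ψ w) w = c • rins q g Φ w + rins q g Ψ w :=
  splitSum_lin c (fun _ z => splitSum_lin c (fun _ _ => AugDGRing.sign_lin _ c rfl) z) w

end

end Braces

/-! ### Cocycles and coboundaries under the cup product and the bracket -/

namespace AugDGRing
open Braces

variable {k : Type u} [Field k] {t : ℕ} {A : AugDGRing.{u, v} k t}

theorem mem_cocycles {q : ℤ} {f : List A.RElt → A.carrier} :
    f ∈ A.cocycles q ↔ IsCochain q f ∧ wordDelta q (ext f) = fun _ => 0 := by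
  constructor
  · rintro ⟨h1, h2⟩
    refine ⟨h1, funext fun w => ?_⟩
    rw [← ext_delta h1, show delta q f = 0 from h2]
    rfl
  · rintro ⟨h1, h2⟩
    refine ⟨h1, ext_injective fun w => ?_⟩
    rw [show deltaMap q f = delta q f from rfl, ext_delta h1, h2]
    rfl

theorem mem_coboundaries {q : ℤ} {f : List A.RElt → A.carrier} :
    f ∈ A.coboundaries q ↔ ∃ u, IsCochain (q + 1) u ∧ ext f = wordDelta (q + 1) (ext u) := by
  constructor
  · rintro ⟨u, h1, rfl⟩
    exact ⟨u, h1, funext fun w => ext_delta h1 w⟩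
  · rintro ⟨u, h1, h2⟩
    refine ⟨u, h1, ext_injective fun w => ?_⟩
    rw [show deltaMap (q + 1) u = delta (q + 1) u from rfl, ext_delta h1, h2]

/-- A global sign is allowed, so homotopies need not be normalised. -/
theorem mem_coboundaries' {q : ℤ} {f : List A.RElt → A.carrier} (e : ℤˣ) {n : ℤ} (hn : q + 1 = n)
    {u : List A.RElt → A.carrier} (hu : IsCochain n u)
    (h : ∀ w, ext f w = e • wordDelta n (ext u) w) : f ∈ A.coboundaries q := by
  subst hn
  have : e • f ∈ A.coboundaries q := mem_coboundaries.2 ⟨u, hu, funext fun w => by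
    rw [show ext (e • f) w = e • ext f w from rfl, h, smul_smul, Int.units_mul_self, one_smul]⟩
  have := units_smul_mem _ e this
  rwa [smul_smul, Int.units_mul_self, one_smul] at this

theorem wordDelta_smul (q : ℤ) (e : ℤˣ) {f : List A.Ltr → A.carrier} (w : List A.Ltr) :
    wordDelta q (fun w => e • f w) w = e • wordDelta q f w := by
  unfold wordDelta
  rw [rins_smul, rins_fun_smul _ _ _ mm_wordAdd, smul_sub, smul_comm e]

theorem IsCochain.cup {q r s : ℤ} (hs : q + r = s) {f g : List A.RElt → A.carrier}
    (hf : IsCochain q f) (hg : IsCochain r g) : IsCochain s (cup f r g) := by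
  subst hs
  have h := (isWordCochain_mm.br2 hf.ext hg.ext).smul (r * (q + 1)).negOnePow
  rw [show -2 + (r + 1) + (q + 1) = q + r by ring] at h
  have e : AugDGRing.ext (AugDGRing.cup f r g) = fun w => (r * (q + 1)).negOnePow •
      Braces.br2 q (AugDGRing.ext f) r (AugDGRing.ext g) A.mm w :=
    funext fun w => ext_cup ⟨f, hf⟩ ⟨g, hg⟩ w
  exact IsWordCochain.of_ext (e ▸ h)

theorem ext_cup_eq {q r : ℤ} {f g : List A.RElt → A.carrier} (hf : IsCochain q f)
    (hg : IsCochain r g) : ext (cup f r g) = fun w => (r * (q + 1)).negOnePow •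
      br2 q (ext f) r (ext g) A.mm w :=
  funext fun w => ext_cup ⟨f, hf⟩ ⟨g, hg⟩ w

theorem cup_mem_cocycles {q r s : ℤ} (hs : q + r = s) {f g : List A.RElt → A.carrier}
    (hf : f ∈ A.cocycles q) (hg : g ∈ A.cocycles r) : cup f r g ∈ A.cocycles s := by
  rw [mem_cocycles] at hf hg ⊢
  refine ⟨hf.1.cup hs hg.1, funext fun w => ?_⟩
  subst hs
  have := wordDelta_br2 (q := q) (r := r) (g := ext f) (h := ext g) w
  rw [hf.2, hg.2, br2_zero_left _ _ _ mm_wordAdd, br2_zero_right _ _ _ mm_wordAdd, smul_zero,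
    add_zero, add_zero] at this
  rw [ext_cup_eq hf.1 hg.1, wordDelta_smul, this, smul_zero]

theorem cup_mem_coboundaries_left {q r s : ℤ} (hs : q + r = s) {f g : List A.RElt → A.carrier}
    (hf' : IsCochain q f) (hf : f ∈ A.coboundaries q) (hg : g ∈ A.cocycles r) :
    cup f r g ∈ A.coboundaries s := by
  rw [mem_coboundaries] at hf
  rw [mem_cocycles] at hg
  obtain ⟨u, hu, e⟩ := hf
  subst hs
  refine mem_coboundaries' 1 (by ring) (hu.cup (s := q + 1 + r) rfl hg.1) fun w => ?_
  have := wordDelta_br2 (q := q + 1) (r := r) (g := ext u) (h := ext g) w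
  rw [hg.2, br2_zero_right _ _ _ mm_wordAdd, add_zero, ← e, add_sub_cancel_right,
    add_eq_zero_iff_eq_neg] at this
  rw [ext_cup_eq hu hg.1, ext_cup_eq hf' hg.1, wordDelta_smul, this, one_smul, ← Units.neg_smul,
    ← Int.negOnePow_succ, negOnePow_smul_smul]
  refine negOnePow_smul_congr ?_ rfl
  simp only [parity_simps]
  grind (splits := 40)

theorem cup_mem_coboundaries_right {q r s : ℤ} (hs : q + r = s) {f g : List A.RElt → A.carrier}
    (hf : f ∈ A.cocycles q) (hg' : IsCochain r g) (hg : g ∈ A.coboundaries r) :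
    cup f r g ∈ A.coboundaries s := by
  rw [mem_coboundaries] at hg
  rw [mem_cocycles] at hf
  obtain ⟨u, hu, e⟩ := hg
  subst hs
  refine mem_coboundaries' q.negOnePow (by ring) (hf.1.cup (s := q + (r + 1)) rfl hu) fun w => ?_
  have := wordDelta_br2 (q := q) (r := r + 1) (g := ext f) (h := ext u) w
  rw [hf.2, br2_zero_left _ _ _ mm_wordAdd, smul_zero, add_zero, ← e, add_sub_cancel_right,
    add_eq_zero_iff_eq_neg] at this
  rw [ext_cup_eq hf.1 hu, ext_cup_eq hf.1 hg', wordDelta_smul, this, negOnePow_smul_smul,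
    smul_neg, ← Units.neg_smul, ← Int.negOnePow_succ]
  refine negOnePow_smul_congr ?_ rfl
  simp only [parity_simps]
  grind (splits := 40)

theorem isCochain_circ {q r s : ℤ} (hs : q + r + 1 = s) (f : A.Cochain q) (g : A.Cochain r) :
    IsCochain s (circ f.1 g) := by
  subst hs
  have h := f.2.ext.rins g.2.ext
  rw [← add_assoc] at h
  have e : ext (circ f.1 g) = rins r (ext g.1) (ext f.1) := funext fun w => ext_circ f.1 g w
  exact IsWordCochain.of_ext (e ▸ h)

theorem ext_gbracket {q r : ℤ} (f : A.Cochain q) (g : A.Cochain r) :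
    ext (gbracket f g) = wordBracket q (ext f.1) r (ext g.1) := by
  funext w
  rw [show ext (gbracket f g) w = ext (circ f.1 g) w
    - ((q + 1) * (r + 1)).negOnePow • ext (circ g.1 f) w from rfl, ext_circ, ext_circ, wordBracket]

theorem isCochain_gbracket {q r s : ℤ} (hs : q + r + 1 = s) (f : A.Cochain q) (g : A.Cochain r) :
    IsCochain s (gbracket f g) :=
  (A.Cochain s).sub_mem (isCochain_circ hs f g)
    (units_smul_mem _ _ (isCochain_circ (by rw [← hs]; ring) g f))

theorem gbracket_mem_cocycles {q r s : ℤ} (hs : q + r + 1 = s) (f : A.Cochain q) (g : A.Cochain r)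
    (hf : f.1 ∈ A.cocycles q) (hg : g.1 ∈ A.cocycles r) : gbracket f g ∈ A.cocycles s := by
  rw [mem_cocycles] at hf hg ⊢
  refine ⟨isCochain_gbracket hs f g, funext fun w => ?_⟩
  subst hs
  rw [ext_gbracket, wordDelta_wordBracket hf.1.ext.lin.wordAdd hg.1.ext.lin.wordAdd, hf.2, hg.2,
    rins_zero, rins_fun_zero _ hg.1.ext.lin.wordAdd, rins_fun_zero _ hf.1.ext.lin.wordAdd,
    rins_zero]
  simp

theorem gbracket_antisymm {q r : ℤ} (f : A.Cochain q) (g : A.Cochain r) :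
    gbracket f g = - (((q + 1) * (r + 1)).negOnePow • gbracket g f) := by
  rw [gbracket, gbracket, smul_sub, smul_smul, mul_comm (r + 1), Int.units_mul_self, one_smul]
  abel

theorem gbracket_mem_coboundaries_left {q r s : ℤ} (hs : q + r + 1 = s) (f : A.Cochain q)
    (g : A.Cochain r) (hf : f.1 ∈ A.coboundaries q) (hg : g.1 ∈ A.cocycles r) :
    gbracket f g ∈ A.coboundaries s := by
  rw [mem_coboundaries] at hf
  rw [mem_cocycles] at hg
  obtain ⟨u, hu, e⟩ := hf
  subst hs
  refine mem_coboundaries' 1 (by ring) (isCochain_gbracket (s := q + 1 + r + 1) rfl ⟨u, hu⟩ g)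
    fun w => ?_
  rw [ext_gbracket, ext_gbracket, wordDelta_wordBracket hu.ext.lin.wordAdd hg.1.ext.lin.wordAdd,
    hg.2, rins_fun_zero _ hu.ext.lin.wordAdd, rins_zero, ← e, add_sub_cancel_right,
    negOnePow_smul_smul, wordBracket, smul_zero, smul_zero, sub_zero, add_zero, one_smul]
  congr 1
  refine negOnePow_smul_congr ?_ rfl
  simp only [parity_simps]
  grind (splits := 40)

theorem gbracket_mem_coboundaries_right {q r s : ℤ} (hs : q + r + 1 = s) (f : A.Cochain q)
    (g : A.Cochain r) (hf : f.1 ∈ A.cocycles q) (hg : g.1 ∈ A.coboundaries r) :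
    gbracket f g ∈ A.coboundaries s := by
  rw [gbracket_antisymm]
  exact Submodule.neg_mem _ (units_smul_mem _ _
    (gbracket_mem_coboundaries_left (by rw [← hs]; ring) g f hg hf))

theorem cup_comm_mem_coboundaries {q r s : ℤ} (hs : q + r = s) {f g : List A.RElt → A.carrier}
    (hf : f ∈ A.cocycles q) (hg : g ∈ A.cocycles r) :
    cup f r g - (q * r).negOnePow • cup g q f ∈ A.coboundaries s := by
  rw [mem_cocycles] at hf hg
  subst hs
  -- The homotopy for commutativity is the circle product f ∘ g.
  refine mem_coboundaries' q.negOnePow rfl (isCochain_circ rfl ⟨f, hf.1⟩ ⟨g, hg.1⟩) fun w => ?_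
  have e : ext (circ f ⟨g, hg.1⟩) = rins r (ext g) (ext f) := funext fun w => ext_circ f ⟨g, hg.1⟩ w
  rw [e, wordDelta_rins hf.1.ext.lin.wordAdd, hf.2, hg.2, rins_zero,
    rins_fun_zero _ hf.1.ext.lin.wordAdd,
    show ext (cup f r g - (q * r).negOnePow • cup g q f) w
      = ext (cup f r g) w - (q * r).negOnePow • ext (cup g q f) w from rfl,
    ext_cup_eq hf.1 hg.1, ext_cup_eq hg.1 hf.1, smul_zero, add_zero, zero_sub, smul_sub, smul_neg,
    negOnePow_smul_smul, negOnePow_smul_smul, sub_eq_add_neg, sub_eq_add_neg, add_comm,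
    ← Units.neg_smul, ← Units.neg_smul, ← Units.neg_smul, ← Int.negOnePow_succ,
    ← Int.negOnePow_succ, ← Int.negOnePow_succ]
  congr 1 <;>
  · refine negOnePow_smul_congr ?_ rfl
    simp only [parity_simps]
    grind (splits := 40)

theorem gbracket_cup_mem_coboundaries {p q r n s₂ s : ℤ} (hn : q + r = n)
    (h₂ : p + r + 1 = s₂) (hs : p + n + 1 = s) (f : A.Cochain p) (g : A.Cochain q) (h : A.Cochain r)
    (hf : f.1 ∈ A.cocycles p) (hg : g.1 ∈ A.cocycles q) (hh : h.1 ∈ A.cocycles r)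
    (gh : A.Cochain n) (hgh : gh.1 = cup g.1 r h.1) :
    gbracket f gh - (cup (gbracket f g) r h.1
      + ((p + 1) * q).negOnePow • cup g.1 s₂ (gbracket f h)) ∈ A.coboundaries s := by
  rw [mem_cocycles] at hf hg hh
  subst hn h₂ hs
  have hF := hf.1.ext.lin.wordAdd
  have hB : WordLin k (br2 q (ext g.1) r (ext h.1) A.mm) :=
    (isWordCochain_mm.br2 hg.1.ext hh.1.ext).lin
  have hX := hf.1.ext.br2 hg.1.ext hh.1.ext
  -- The homotopy for the Poisson rule is f{g, h}, restricted to reduced words.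
  have hX' : IsCochain (p + (r + 1) + (q + 1)) fun w =>
    br2 q (ext g.1) r (ext h.1) (ext f.1) (w.map RElt.ltr) := hX.res
  -- Restricting and extending again changes nothing: f reduces the letters left in place, and g and
  -- h reduce the letters in their blocks.
  have eX : ext (fun w => br2 q (ext g.1) r (ext h.1) (ext f.1) (w.map RElt.ltr))
      = br2 q (ext g.1) r (ext h.1) (ext f.1) := by
    funext w
    simp only [ext, br2, Braces.ins3, mR, Braces.rins, splitSum_map]
    have hwd : ∀ x : List A.Ltr, wd ((x.map Ltr.red).map RElt.ltr) = wd x := fun x => by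
      rw [wd_map_ltr, sdeg_map_red]
    refine splitSum_congr (fun x z => splitSum_congr (fun y v => ?_) z) w
    refine negOnePow_smul_congr (by rw [hwd]) (negOnePow_smul_congr (by simp only [hwd, lt_fst])
      (splitSum_congr (fun x' z' => splitSum_congr (fun y' v' =>
        negOnePow_smul_congr (by rw [hwd]) ?_) z') v))
    have e1 := red_lt g y
    have e2 := red_lt g ((y.map Ltr.red).map RElt.ltr)
    have e3 := red_lt h y'
    have e4 := red_lt h ((y'.map Ltr.red).map RElt.ltr)
    simp only [map_red_ltr] at e2 e4
    simp [-List.map_map] at e1 e2 e3 e4 ⊢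
    simp [-List.map_map, e1, e2, e3, e4]
  refine mem_coboundaries' ((p + 1).negOnePow * (r * (q + 1)).negOnePow) (by ring) hX' fun w => ?_
  have e0 := wordBracket_br2 (q := q) (r := r) hF (congrFun hf.2) (congrFun hg.2) (congrFun hh.2) w
  have e1 : ext (gbracket f gh) w = (r * (q + 1)).negOnePow •
      wordBracket p (ext f.1) (q + r) (br2 q (ext g.1) r (ext h.1) A.mm) w := by
    rw [ext_gbracket, hgh, ext_cup_eq hg.1 hh.1, wordBracket, rins_fun_smul _ _ _ hF, rins_smul,
      wordBracket, smul_sub, smul_comm ((r * (q + 1)).negOnePow)]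
  rw [show ext (gbracket f gh - (cup (gbracket f g) r h.1
      + ((p + 1) * q).negOnePow • cup g.1 (p + r + 1) (gbracket f h))) w = ext (gbracket f gh) w
      - (ext (cup (gbracket f g) r h.1) w
      + ((p + 1) * q).negOnePow • ext (cup g.1 (p + r + 1) (gbracket f h)) w) from rfl, e1, e0,
    ext_cup_eq (isCochain_gbracket rfl f g) hh.1, ext_cup_eq hg.1 (isCochain_gbracket rfl f h),
    ext_gbracket, ext_gbracket, eX]
  simp only [smul_add, negOnePow_smul_smul, ← Int.negOnePow_add]
  have reorder : ∀ {a b c a' b' c' : A.carrier}, a = a' → b = b' → c = c' →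
      a + b + c - (a' + b') = c' := by
    rintro a b c _ _ _ rfl rfl rfl
    abel
  refine reorder ?_ ?_ ?_
  · refine negOnePow_smul_congr ?_ rfl
    simp only [parity_simps]
    grind (splits := 40)
  · refine negOnePow_smul_congr ?_ rfl
    simp only [parity_simps]
    grind (splits := 40)
  · rw [show p + q + r + 2 = p + (r + 1) + (q + 1) by ring]
    refine negOnePow_smul_congr ?_ rfl
    simp only [parity_simps]
    grind (splits := 40)

end AugDGRing

/-! ### Identities that hold strictly on cochains -/

namespace AugDGRing
open Braces

variable {k : Type u} [Field k] {t : ℕ} {A : AugDGRing.{u, v} k t}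

theorem cup_assoc (f : List A.RElt → A.carrier) (q r s : ℤ) (hs : q + r = s)
    (g h : List A.RElt → A.carrier) : cup (cup f q g) r h = cup f s (cup g r h) := by
  subst hs
  funext w
  have e : ∀ (F : List A.RElt → List A.RElt → A.carrier) (x : A.carrier) (w : List A.RElt),
      splitSum F w * x = splitSum (fun a b => F a b * x) w := fun F x w =>
    map_splitSum (AddMonoidHom.mulRight x) F w
  have e' : ∀ (F : List A.RElt → List A.RElt → A.carrier) (x : A.carrier) (w : List A.RElt),
      x * splitSum F w = splitSum (fun a b => x * F a b) w := fun F x w =>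
    map_splitSum (AddMonoidHom.mulLeft x) F w
  simp only [cup, e, e', ← splitSum_smul]
  trans splitSum (fun R v => splitSum (fun x y => (r * sdeg (x ++ y)).negOnePow •
    ((q * sdeg x).negOnePow • (f x * g y) * h v)) R) w
  · refine splitSum_congr (fun R v => splitSum_congr_append fun x y hR => ?_) w
    rw [hR]
  rw [splitSum_assoc (fun x y v => (r * sdeg (x ++ y)).negOnePow •
    ((q * sdeg x).negOnePow • (f x * g y) * h v))]
  refine splitSum_congr (fun x z => splitSum_congr (fun y v => ?_) z) w
  rw [smul_mul_assoc, mul_smul_comm, negOnePow_smul_smul, negOnePow_smul_smul, mul_assoc]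
  refine negOnePow_smul_congr ?_ rfl
  simp only [sdeg_append, parity_simps]
  grind

theorem cup_lin_left (c : k) (f f' : List A.RElt → A.carrier) (r : ℤ)
    (g : List A.RElt → A.carrier) : cup (c • f + f') r g = c • cup f r g + cup f' r g :=
  funext fun w => splitSum_lin c (fun x y => sign_lin _ c (by simp [add_mul])) w

theorem cup_lin_right (c : k) (f : List A.RElt → A.carrier) (r : ℤ)
    (g g' : List A.RElt → A.carrier) : cup f r (c • g + g') = c • cup f r g + cup f r g' :=
  funext fun w => splitSum_lin c (fun x y => sign_lin _ c (by simp [mul_add])) w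

theorem unitCochain_cup (r : ℤ) (g : List A.RElt → A.carrier) : cup A.unitCochain r g = g := by
  funext w
  cases w with
  | nil => simp [cup, splitSum, unitCochain]
  | cons a w => simp [cup, splitSum, unitCochain, splitSum_zero]

theorem cup_unitCochain (f : List A.RElt → A.carrier) : cup f 0 A.unitCochain = f := by
  funext w
  rw [cup, splitSum_eq_self]
  · simp [unitCochain]
  · simp [unitCochain]

theorem isCochain_unitCochain : IsCochain 0 A.unitCochain where
  mem w := by
    cases w with
    | nil => simpa [unitCochain] using A.one_mem
    | cons a w => simp [unitCochain]
  slot_lin u v p c x y := by cases u <;> simp [unitCochain]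
  slot_bal u v x y κ := by cases u <;> simp [unitCochain]
  left_lin v x κ := by simp [unitCochain]
  right_lin u x κ := by cases u <;> simp [unitCochain]
  nil_comm κ := by simp [unitCochain]

theorem unitCochain_mem_cocycles : A.unitCochain ∈ A.cocycles 0 := by
  refine ⟨isCochain_unitCochain, ?_⟩
  have e : ∀ (x : List A.RElt) a y, A.unitCochain (x ++ a :: y) = 0 := fun x a y => by
    cases x <;> simp [unitCochain]
  have d1 : A.d 1 = 0 := by simpa using A.d_η 1
  funext w
  change delta 0 A.unitCochain w = 0
  match w with
  | [] => simp [delta, delta₀, delta₁, letterSum, unitCochain, d1]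
  | [a] => simp [delta, delta₀, delta₁, letterSum, unitCochain]
  | a :: b :: w =>
    have z : ∀ {F : List A.RElt → A.RElt → List A.RElt → A.carrier} {w : List A.RElt},
        (∀ x c z, F x c z = 0) → letterSum F w = 0 := fun h => by
      rw [letterSum_congr h, letterSum_zero]
    rw [delta, delta₁, delta₀, z fun x c y => by rw [e, smul_zero], z fun x c y => ?_,
      letterSum, z fun x c y => ?_]
    · simp [unitCochain]
    · cases y <;> simp [unitCochain]
    · cases y <;> simp [e]

section bilinear
variable {q r : ℤ}

theorem wordBracket_lin_left (c : k) {F F' G : List A.Ltr → A.carrier} (hG : WordLin k G)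
    (w : List A.Ltr) : wordBracket q (fun w => c • F w + F' w) r G w
      = c • wordBracket q F r G w + wordBracket q F' r G w := by
  have := ins3_fun_lin q c F F' (Θ := fun x a v => G (x ++ a :: v)) (fun x v => hG x v) w
  have h' := rins_lin r G c F F' w
  rw [wordBracket, h', Braces.rins, Braces.rins, Braces.rins, this, wordBracket, wordBracket, Braces.rins, Braces.rins,
    Braces.rins, Braces.rins]
  simp only [smul_add, smul_sub, smul_comm c]
  abel

theorem gbracket_lin_left (c : k) (f f' : A.Cochain q) (g : A.Cochain r) :
    gbracket (c • f + f') g = c • gbracket f g + gbracket f' g :=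
  ext_injective fun w => by
    rw [show ext (c • gbracket f g + gbracket f' g) w
      = c • ext (gbracket f g) w + ext (gbracket f' g) w from rfl, ext_gbracket, ext_gbracket,
      ext_gbracket]
    exact wordBracket_lin_left c g.2.ext.lin w

theorem gbracket_lin_right (c : k) (f : A.Cochain q) (g g' : A.Cochain r) :
    gbracket f (c • g + g') = c • gbracket f g + gbracket f g' := by
  rw [gbracket_antisymm, gbracket_lin_left, gbracket_antisymm f g, gbracket_antisymm f g', smul_add,
    smul_neg, smul_comm c]
  abel

end bilinear

theorem gbracket_jacobi {p q r pq qr rp : ℤ} (h₁ : p + q + 1 = pq) (h₂ : q + r + 1 = qr)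
    (h₃ : r + p + 1 = rp) (f : A.Cochain p) (g : A.Cochain q) (h : A.Cochain r) :
    ((p + 1) * (r + 1)).negOnePow • gbracket ⟨gbracket f g, isCochain_gbracket h₁ f g⟩ h
      + ((q + 1) * (p + 1)).negOnePow • gbracket ⟨gbracket g h, isCochain_gbracket h₂ g h⟩ f
      + ((r + 1) * (q + 1)).negOnePow • gbracket ⟨gbracket h f, isCochain_gbracket h₃ h f⟩ g = 0 := by
  subst h₁ h₂ h₃
  refine ext_injective fun w => ?_
  have := wordBracket_jacobi (p := p) (q := q) (r := r) f.2.ext.lin.wordAdd g.2.ext.lin.wordAdd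
    h.2.ext.lin.wordAdd w
  simp only [← ext_gbracket] at this
  have e : ∀ {a b : ℤ} (x : A.Cochain a) (y : A.Cochain b), wordBracket a (ext x.1) b (ext y.1)
    = ext (gbracket x y) := fun x y => (ext_gbracket x y).symm
  have e1 := e (⟨gbracket f g, isCochain_gbracket rfl f g⟩ : A.Cochain (p + q + 1)) h
  have e2 := e (⟨gbracket g h, isCochain_gbracket rfl g h⟩ : A.Cochain (q + r + 1)) f
  have e3 := e (⟨gbracket h f, isCochain_gbracket rfl h f⟩ : A.Cochain (r + p + 1)) g
  rw [e1, e2, e3] at this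
  exact this

end AugDGRing

/-! ### Operators on Hochschild chains in terms of letters -/

namespace AugDGRing
open Braces

variable {k : Type u} [Field k] {t : ℕ} {A : AugDGRing.{u, v} k t}

/-- The chain `a_0 ⊗ [a_1|⋯|a_n]` defined by letters. -/
noncomputable def genL (a : A.Ltr) (w : List A.Ltr) : A.Chain := gen (Ltr.elt a) (w.map Ltr.red)

theorem genL_ltr (a : A.Elt) (w : List A.RElt) : genL a.ltr (w.map RElt.ltr) = gen a w := by
  rw [genL, Elt.elt_ltr, map_red_ltr]

/-- Homogeneous elements of A and Ā are special letters, so the chains `genL a w` span. -/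
theorem chain_ext {M : Type w} [AddCommGroup M] [Module k M] {T T' : A.Chain →ₗ[k] M}
    (h : ∀ a w, T (genL a w) = T' (genL a w)) : T = T' := by
  refine Submodule.linearMap_qext _ (Finsupp.lhom_ext' fun s => LinearMap.ext_ring ?_)
  have := h s.1.ltr (s.2.map RElt.ltr)
  rw [genL_ltr] at this
  exact this

theorem genL_lin : ChainLin k (genL (A := A)) where
  head w p c x y := by
    simp only [genL, Ltr.elt_mk, eltAt_lin]
    exact gen_admissible.head_lin ..
  tail a x r p c b y := by
    simp only [genL, List.map_append, List.map_cons, Ltr.red_mk, redAt_lin]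
    exact gen_admissible.slot_lin ..

theorem genL_letterAdd (w : List A.Ltr) : LetterAdd fun a => genL a w := (genL_lin.head w).letterAdd

theorem genL_wordAdd (a : A.Ltr) : WordAdd (genL a) := (genL_lin.tail a).wordAdd

theorem genL_prj (p : ℤ) (x : A.carrier) (w : List A.Ltr) :
    genL (p, A.prj p x) w = genL (p, x) w := by
  rw [genL, genL]
  congr 1
  exact Elt.ext' rfl (prj_prj p x)

theorem genL_wordPrj (a : A.Ltr) : WordPrj (genL a) := ext_wordPrj fun w => gen (Ltr.elt a) w

theorem genL_wordKill (a : A.Ltr) : WordKill (genL a) :=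
  ext_wordKill (f := fun w => gen (Ltr.elt a) w) (genL_wordAdd a)

/-- A functional of chains that is cyclically `K`-balanced. -/
structure ChainBal {M : Type w} (Φ : A.Ltr → List A.Ltr → M) : Prop where
  head : ∀ (a c : A.Ltr) (v : List A.Ltr) (κ : Fin t → k), Φ (a.r κ) (c :: v) = Φ a (c.l κ :: v)
  tail : ∀ a, WordBal (Φ a)
  last : ∀ (a : A.Ltr) (u : List A.Ltr) (c : A.Ltr) (κ : Fin t → k),
    Φ a (u ++ [c.r κ]) = Φ (a.l κ) (u ++ [c])
  nil : ∀ (a : A.Ltr) (κ : Fin t → k), Φ (a.r κ) [] = Φ (a.l κ) []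

theorem genL_bal : ChainBal (genL (A := A)) where
  head a c v κ := by simp [genL, gen_cons]
  tail a u c d v κ := by simp [genL, gen_pair]
  last a u c κ := by simp [genL, gen_last]
  nil a κ := by simp [genL, gen_nil]

theorem ChainBal.isAdmissible {M : Type w} [AddCommGroup M] [Module k M]
    {Φ : A.Ltr → List A.Ltr → M} (h : ChainBal Φ) (hl : ChainLin k Φ) :
    IsAdmissible fun a w => Φ a.ltr (w.map RElt.ltr) where
  head_lin p c x y v := hl.head _ p c x.1 y.1
  slot_lin a u v p c x y := by
    simp only [List.map_append, List.map_cons]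
    exact hl.tail _ _ _ p c x.1 y.1
  head_bal a x v κ := by simp [h.head]
  slot_bal a u v x y κ := by simp [h.tail a.ltr _ _ _ _ _]
  last_bal a u x κ := by simp [h.last]
  nil_bal a κ := by simp [h.nil]

theorem connes_genL (a : A.Ltr) (w : List A.Ltr) : connes (genL a w) = A.connesOp genL a w := by
  have e1 : Ltr.elt A.unitLt = Elt.one A := Elt.ext' rfl (prj_of_mem A.one_mem)
  rw [connes, genL, chainLift_gen, connesFun, splitSum_map, connesOp, cyc]
  refine splitSum_congr (fun x y => ?_) w
  rw [eta, sdeg_map_red, sdeg_map_red, genL, e1, mul_comm]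
  simp [Ltr.red]

/-- Contraction is `contr` for P = m by `contr_mm`. Hence its commutators with b and with L_g are
both instances of `lie_contr`. -/
theorem iOp_genL {q : ℤ} (f : A.Cochain q) (a : A.Ltr) (w : List A.Ltr) :
    iOp f (genL a w) = q.negOnePow • contr (-2) A.mm q (ext f.1) genL a w := by
  rw [iOp, genL, chainLift_gen, iFun, splitSum_map, contr_mm genL_letterAdd, negOnePow_smul_smul,
    ← splitSum_smul]
  refine splitSum_congr (fun x y => ?_) w
  have e : genL (lt (-2) A.mm [a, lt q (ext f.1) x]) y
      = (a.1 + 1).negOnePow • gen ((Ltr.elt a).mul (cval f (x.map Ltr.red))) (y.map Ltr.red) := by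
    rw [lt, mm, (genL_letterAdd y).smul, genL]
    congr 2
    refine Elt.ext' ?_ ?_
    · simp
      ring
    · have h1 : A.prj a.1 a.2 * ext f.1 x ∈ A.gr (a.1 + (q + wd x)) :=
        A.mul_mem (prj_mem _ _) (f.2.ext.mem x)
      have h2 : -2 + wd [a, lt q (ext f.1) x] = a.1 + (q + wd x) := by
        simp
        ring
      simp only [Ltr.elt, lt, prj_of_mem (f.2.ext.mem x)]
      rw [lt] at h2
      rw [h2, prj_of_mem h1]
      rfl
  rw [e, negOnePow_smul_smul]
  refine negOnePow_smul_congr ?_ rfl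
  simp only [Ltr.elt_fst, parity_simps]
  grind

/-- The two sums defining L_f are the insertions into the tail and the applications to cyclic
subwords containing the head. Passing to the natural Koszul signs costs one global sign. -/
theorem LOp_genL {q : ℤ} (f : A.Cochain q) (a : A.Ltr) (w : List A.Ltr) :
    LOp f (genL a w) = (q + 1).negOnePow • lie q (ext f.1) genL a w := by
  rw [LOp, genL, chainLift_gen, LFun, lie, smul_add]
  congr 1
  · rw [splitSum_map, tl, rins, ins3, negOnePow_smul_smul, ← splitSum_smul]
    refine splitSum_congr (fun x z => ?_) w
    rw [splitSum_map, ← splitSum_smul]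
    refine splitSum_congr (fun y v => ?_) z
    rw [negOnePow_smul_smul]
    refine negOnePow_smul_congr ?_ ?_
    · simp only [eta, sdeg_map_red, Ltr.elt_fst, parity_simps]
      grind (splits := 40)
    · simp [genL, red_lt]
  · rw [splitSum_map, hd, cyc, ← splitSum_smul]
    refine splitSum_congr (fun s z => ?_) w
    rw [splitSum_map, negOnePow_smul_smul, ← splitSum_smul]
    refine splitSum_congr (fun x y => ?_) s
    refine negOnePow_smul_congr ?_ ?_
    · simp only [eta, sdeg_map_red, Ltr.elt_fst, parity_simps]
      grind (splits := 40)
    · simp [genL, elt_lt, Ltr.red]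

/-- This is the cyclic analogue of `wordDelta_scalar`. The scalar is multiplied into its two cyclic
neighbours, one or both of which may be the head, and the two products cancel by balancing over K.
-/
theorem lie_mm_genL_wordKill (a : A.Ltr) : WordKill (lie (-2) A.mm genL a) := by
  intro z κ r
  have k0 := genL_wordKill (A := A)
  have s1 : ∀ (a : A.Ltr) w, genL (lt (-2) A.mm [a, A.scalar κ]) w
      = (a.1 + 1).negOnePow • genL (a.r κ) w := fun a w =>
    letter_mm_scalar_right (genL_letterAdd w) (fun p x => genL_prj p x w) κ a
  have s2 : ∀ (a : A.Ltr) w, genL (lt (-2) A.mm [A.scalar κ, a]) w = - genL (a.l κ) w :=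
    fun a w => letter_mm_scalar_left (genL_letterAdd w) (fun p x => genL_prj p x w) κ a
  rw [lie, tl, rins_mm_scalar (genL_wordAdd a) (genL_wordPrj a) (k0 a), hd_mm genL_letterAdd, k0,
    zero_add]
  rcases List.eq_nil_or_concat z with rfl | ⟨x, c, rfl⟩
  · cases r with
    | nil =>
      have : backSum (fun y c => ((c.1 + 1) * (a.1 + 1 + wd y)).negOnePow •
          genL (lt (-2) A.mm [c, a]) y) ([] ++ [A.scalar κ])
          = ((0 + 1) * (a.1 + 1 + 0)).negOnePow • genL (lt (-2) A.mm [A.scalar κ, a]) [] :=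
        backSum_concat _ [] _
      rw [this, s2]
      simp only [List.nil_append, frontSum, s1, genL_bal.nil, backSum_nil, smul_zero, sub_zero,
        zero_add, one_mul, add_zero, smul_neg, add_neg_cancel]
    | cons d y =>
      have e : backSum (fun y c => ((c.1 + 1) * (a.1 + 1 + wd y)).negOnePow •
          genL (lt (-2) A.mm [c, a]) y) ([] ++ A.scalar κ :: d :: y) = 0 := by
        rcases List.eq_nil_or_concat (d :: y) with h | ⟨s, c, h⟩
        · simp at h
        · have := backSum_concat (fun y c => ((c.1 + 1) * (a.1 + 1 + wd y)).negOnePow •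
            genL (lt (-2) A.mm [c, a]) y) (A.scalar κ :: s) c
          simp only [List.concat_eq_append] at h
          have h' := k0 (lt (-2) A.mm [c, a]) [] κ s
          rw [List.nil_append] at h'
          rw [List.nil_append, h, ← List.cons_append, this, h', smul_zero]
      rw [e]
      simp only [List.nil_append, frontSum, s1, genL_bal.head, backSum_nil, zero_sub, wd_nil,
        Int.negOnePow_zero, one_smul, add_zero, smul_neg, ← Units.neg_smul, ← Int.negOnePow_succ]
      rw [add_eq_zero_iff_eq_neg, ← Units.neg_smul, ← Int.negOnePow_succ]
      refine negOnePow_smul_congr ?_ rfl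
      simp only [parity_simps]
      grind (splits := 40)
  · simp only [List.concat_eq_append]
    have e0 : frontSum (fun c y => genL (lt (-2) A.mm [a, c]) y) (x ++ [c] ++ A.scalar κ :: r)
        = 0 := by
      cases x with
      | nil =>
        have := k0 (lt (-2) A.mm [a, c]) [] κ r
        simpa [frontSum] using this
      | cons b x =>
        have := k0 (lt (-2) A.mm [a, b]) (x ++ [c]) κ r
        simpa [frontSum] using this
    rw [e0, zero_add, backSum_concat]
    cases r with
    | nil =>
      have : backSum (fun y c => ((c.1 + 1) * (a.1 + 1 + wd y)).negOnePow •
          genL (lt (-2) A.mm [c, a]) y) ((x ++ [c]) ++ [A.scalar κ]) = _ :=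
        backSum_concat _ _ _
      rw [this, s2]
      simp only [frontSum, smul_zero, sub_zero, genL_bal.last, negOnePow_smul_smul, smul_neg,
        ← Units.neg_smul, ← Int.negOnePow_succ]
      rw [add_eq_zero_iff_eq_neg, ← Units.neg_smul, ← Int.negOnePow_succ]
      refine negOnePow_smul_congr ?_ rfl
      simp only [wd_append, wd_cons, wd_nil, scalar_fst, parity_simps]
      grind (splits := 40)
    | cons d y =>
      have e : backSum (fun y c => ((c.1 + 1) * (a.1 + 1 + wd y)).negOnePow •
          genL (lt (-2) A.mm [c, a]) y) (x ++ [c] ++ A.scalar κ :: d :: y) = 0 := by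
        rcases List.eq_nil_or_concat (d :: y) with h | ⟨s, b, h⟩
        · simp at h
        · have := backSum_concat (fun y c => ((c.1 + 1) * (a.1 + 1 + wd y)).negOnePow •
            genL (lt (-2) A.mm [c, a]) y) (x ++ [c] ++ A.scalar κ :: s) b
          simp only [List.concat_eq_append] at h
          rw [h, ← List.cons_append, ← List.append_assoc, this, k0, smul_zero]
      rw [e]
      simp only [frontSum]
      have := genL_bal.tail a x c d y κ
      rw [this]
      simp only [List.append_assoc, List.cons_append, List.nil_append, wd_append, wd_cons, wd_nil,
        add_zero, sub_self, smul_zero]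

end AugDGRing

/-! ### Linearity of the chain operators -/

namespace Braces
variable {k : Type w} [Field k] {V : Type u} {M : Type v} [AddCommGroup V] [AddCommGroup M]
  [Module k V] [Module k M]

theorem MarkLin.sum {F : List (ℤ × V) → ℤ × V → List (ℤ × V) → List (ℤ × V) → M}
    (h₁ : ∀ v, MarkLin k fun z a s => F z a s v) (h₂ : ∀ z a s, WordLin k (F z a s)) :
    MarkLin k fun z a r => splitSum (F z a) r where
  left a r x y := LetterLin.sum (fun s v => (h₁ v).left a s x y) r
  mark z r := LetterLin.sum (fun s v => (h₁ v).mark z s) r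
  right z a x y := by
    simp only [splitSum_append]
    refine LetterLin.add (LetterLin.sum (fun s v => h₂ z a s v y) x)
      (LetterLin.sum (fun s v => (h₁ v).right z a x s) y)

variable {q p : ℤ} {f P : List (ℤ × V) → V} (hf : WordLin k f) (hP : WordLin k P)
  {Φ : ℤ × V → List (ℤ × V) → M} (hΦ : ChainLin k Φ)
include hf hΦ

theorem ChainLin.tl : ChainLin k (tl q f Φ) where
  head w := LetterLin.sign (LetterLin.ins3 q f (fun s c v => hΦ.head (s ++ c :: v)) w)
    fun n => ((q + 1) * (n + 1)).negOnePow
  tail a x y := (hf.rins q (hΦ.tail a) x y).smul _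

theorem ChainLin.hd : ChainLin k (hd q f Φ) :=
  ChainLin.cyc <| MarkLin.sum (F := fun z a s v => Φ (Braces.lt q f (z ++ a :: s)) v)
    (fun v => (hf.lt q (hΦ.head v)).marked) fun _ _ _ => hΦ.tail _

theorem ChainLin.lie : ChainLin k (lie q f Φ) where
  head w := ((ChainLin.tl hf hΦ).head w).add ((ChainLin.hd hf hΦ).head w)
  tail a x y := ((ChainLin.tl hf hΦ).tail a x y).add ((ChainLin.hd hf hΦ).tail a x y)

include hP

theorem ChainLin.contr : ChainLin k (contr p P q f Φ) :=
  ChainLin.cyc <| MarkLin.sum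
    (F := fun z a s v => mR q f (fun z a s => Φ (Braces.lt p P (z ++ a :: s)) v) z a s)
    (fun v => (hP.lt p (hΦ.head v)).marked.mR q hf) fun _ _ s x y =>
      (LetterLin.ins3 q f (fun _ _ _ => hΦ.tail _ x y) s).smul _

end Braces

/-! ### Cyclic balancing over K -/

namespace AugDGRing
open Braces

variable {k : Type u} [Field k] {t : ℕ} {A : AugDGRing.{u, v} k t} {M : Type w}

/-- A functional of words with a marked letter that is balanced for the cyclic word. -/
structure CycBal (Ψ : List A.Ltr → A.Ltr → List A.Ltr → M) : Prop extends MarkBal Ψ where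
  wrap : ∀ x z a u y κ, Ψ (x :: z) a (u ++ [y.r κ]) = Ψ (x.l κ :: z) a (u ++ [y])
  wrap_left : ∀ a u y κ, Ψ [] a (u ++ [y.r κ]) = Ψ [] (a.l κ) (u ++ [y])
  wrap_right : ∀ x z a κ, Ψ (x :: z) (a.r κ) [] = Ψ (x.l κ :: z) a []
  wrap_mark : ∀ (a : A.Ltr) κ, Ψ [] (a.r κ) [] = Ψ [] (a.l κ) []

/-- A word functional that is balanced for the cyclic word. -/
structure CycWord (W : List A.Ltr → M) : Prop where
  bal : WordBal W
  wrap : ∀ x u y κ, W (x :: (u ++ [y.r κ])) = W (x.l κ :: (u ++ [y]))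
  one : ∀ (y : A.Ltr) κ, W [y.r κ] = W [y.l κ]

variable [AddCommGroup M]

/-- A scalar between neighbours of the cyclic word is, in each rotation, either still between
neighbours or between the last and the first letter. The second case is covered by the `wrap`
fields, according to which of the two is the marked letter. -/
theorem CycBal.cyc {Ψ : List A.Ltr → A.Ltr → List A.Ltr → M} (h : CycBal Ψ) : ChainBal (cyc Ψ) where
  head a c v κ := by
    simp only [Braces.cyc, splitSum, h.wrap_right, h.mark_right, wd_cons, Ltr.l_fst, Ltr.r_fst]
  tail a u c d v κ := by
    refine splitSum_pair (fun r z => ?_) ?_ fun r z => ?_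
    · have := h.left a r z c d v κ
      dsimp only at this
      rw [this]
      simp only [wd_append, wd_cons, Ltr.l_fst, Ltr.r_fst]
    · rw [h.wrap]
      simp only [wd_append, wd_cons, Ltr.l_fst, Ltr.r_fst]
    · rw [h.right]
      simp only [wd_append, wd_cons, Ltr.l_fst, Ltr.r_fst]
  last a u c κ := by
    refine splitSum_last (fun r z => ?_) ?_
    · rw [h.mark_left]
      simp only [wd_append, wd_cons, Ltr.l_fst, Ltr.r_fst]
    · rw [h.wrap_left]
      simp only [wd_append, wd_cons, Ltr.l_fst, Ltr.r_fst]
  nil a κ := by simp only [Braces.cyc, splitSum, h.wrap_mark, Ltr.l_fst, Ltr.r_fst]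

theorem CycWord.mR {W : List A.Ltr → M} (h : CycWord W) {q : ℤ} {f : List A.Ltr → A.carrier}
    (hf : IsWordCochain q f) : CycBal (mR q f fun z a s => W (z ++ a :: s)) where
  toMarkBal := hf.mR_bal h.bal.marked
  wrap x z a u y κ := by
    refine congrArg₂ _ (by simp) (hf.rins_right (h.bal.marked.right _ a) (fun s c => ?_) u y)
    simpa using h.wrap x (z ++ a :: s) c κ
  wrap_left a u y κ := by
    unfold Braces.mR
    refine congrArg₂ _ (by simp) (hf.rins_right (h.bal.marked.right _ a) (fun s c => ?_) u y)
    exact h.wrap a s c κ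
  wrap_right x z a κ := by
    simp only [Braces.mR, rins_nil, wd_cons, Ltr.l_fst, Ltr.r_fst]
    rw [h.bal, hf.lt_nil]
    congr 1
    simpa using h.wrap x (z ++ [a]) (lt q f []) κ
  wrap_mark a κ := by
    simp only [Braces.mR, rins_nil, wd_nil, Ltr.l_fst, Ltr.r_fst]
    rw [h.bal, hf.lt_nil]
    congr 1
    exact h.wrap a [] (lt q f []) κ

/-- The part to the right of the mark is cut into s and v. The hypotheses `j₁` and `j₂` move a
scalar across this cut, and `w₁` and `w₂` move it from the end of v to the start of the word. -/
theorem CycBal.sum {F : List A.Ltr → A.Ltr → List A.Ltr → List A.Ltr → M}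
    (h₁ : ∀ v, MarkBal fun z a s => F z a s v) (h₂ : ∀ z a s, WordBal (F z a s))
    (h₃ : CycBal fun z a s => F z a s [])
    (j₁ : ∀ z a s c d v κ, F z a (s ++ [c.r κ]) (d :: v) = F z a (s ++ [c]) (d.l κ :: v))
    (j₂ : ∀ z a c v κ, F z (a.r κ) [] (c :: v) = F z a [] (c.l κ :: v))
    (w₁ : ∀ x z a s v y κ, F (x :: z) a s (v ++ [y.r κ]) = F (x.l κ :: z) a s (v ++ [y]))
    (w₂ : ∀ a s v y κ, F [] a s (v ++ [y.r κ]) = F [] (a.l κ) s (v ++ [y])) :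
    CycBal fun z a r => splitSum (F z a) r where
  left a r u c d v κ := splitSum_congr (fun s y => (h₁ y).left a s u c d v κ) r
  right z a u c d v κ := splitSum_pair (fun s y => h₂ z a s y c d v κ) (j₁ z a u c d v κ)
    fun s y => (h₁ y).right z a u c d s κ
  mark_left u c a r κ := splitSum_congr (fun s y => (h₁ y).mark_left u c a s κ) r
  mark_right z a c v κ := by
    simp only [splitSum, j₂]
    congr 1
    exact splitSum_congr (fun s y => (h₁ y).mark_right z a c s κ) v
  wrap x z a u y κ := splitSum_last (fun s v => w₁ x z a s v y κ) (h₃.wrap x z a u y κ)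
  wrap_left a u y κ := splitSum_last (fun s v => w₂ a s v y κ) (h₃.wrap_left a u y κ)
  wrap_right x z a κ := h₃.wrap_right x z a κ
  wrap_mark a κ := h₃.wrap_mark a κ

variable {p q : ℤ} {P f : List A.Ltr → A.carrier} (hP : IsWordCochain p P) (hf : IsWordCochain q f)
  {Φ : A.Ltr → List A.Ltr → M} (hΦ : ChainBal Φ)
include hf hΦ

/-- The head is 1, which commutes with scalars. A scalar at the end of the tail can therefore pass
through the head to the first letter. -/
theorem ChainBal.cartanOp : ChainBal (cartanOp q f Φ) := by
  refine (CycWord.mR (W := Φ A.unitLt) ⟨hΦ.tail _, fun x u y κ => ?_, fun y κ => ?_⟩ hf).cyc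
  · have := hΦ.last A.unitLt (x :: u) y κ
    rw [List.cons_append, List.cons_append] at this
    rw [this, ← hΦ.head]
    simp [unitLt, Ltr.l, Ltr.r]
  · have := hΦ.last A.unitLt [] y κ
    rw [List.nil_append, List.nil_append] at this
    rw [this, ← hΦ.head]
    simp [unitLt, Ltr.l, Ltr.r]

include hP

theorem ChainBal.contr : ChainBal (contr p P q f Φ) := by
  have hW : ∀ v, WordBal fun w => Φ (lt p P w) v := fun v u c d y κ => by
    dsimp only
    rw [hP.lt_bal]
  refine (CycBal.sum (F := fun z a s v =>
    Braces.mR q f (fun z a s => Φ (lt p P (z ++ a :: s)) v) z a s)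
    (fun v => hf.mR_bal (hW v).marked) (fun z a s u c d v κ => ?_) ?_ (fun z a s c d v κ => ?_)
    (fun z a c v κ => ?_) (fun x z a s v y κ => ?_) (fun a s v y κ => ?_)).cyc
  · simp only [mR, hΦ.tail _ u c d v κ]
  · refine CycWord.mR (W := fun w => Φ (lt p P w) []) ⟨hW [], fun x u y κ => ?_, fun y κ => ?_⟩ hf
    · have := hP.lt_right (x :: u) y κ
      rw [List.cons_append, List.cons_append] at this
      rw [this, hΦ.nil, hP.lt_left]
    · have := hP.lt_right [] y κ
      rw [List.nil_append, List.nil_append] at this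
      rw [this, hΦ.nil, hP.lt_left]
  · refine congrArg _ (hf.rins_right ((hW _).marked.right z a) (fun u e => ?_) s c)
    have := hP.lt_right (z ++ a :: u) e κ
    simp only [List.append_assoc, List.cons_append] at this
    rw [this, hΦ.head]
  · simp only [mR, rins_nil, Ltr.r_fst]
    congr 1
    rw [hP.lt_bal, hf.lt_nil]
    have := hP.lt_right (z ++ [a]) (lt q f []) κ
    simp only [List.append_assoc, List.cons_append, List.nil_append] at this
    rw [this, hΦ.head]
  · simp only [mR, wd_cons, Ltr.l_fst]
    congr 2
    funext s
    rw [hΦ.last, List.cons_append, List.cons_append, hP.lt_left]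
  · simp only [mR, wd_nil, Ltr.l_fst]
    congr 2
    funext s
    rw [hΦ.last, List.nil_append, List.nil_append, hP.lt_left]

end AugDGRing

/-! ### Naturality in the target and additivity in the contracted functionals -/

namespace Braces

section
variable {V : Type u} {M : Type v} {N : Type w} [AddCommGroup V] [AddCommGroup M] [AddCommGroup N]
variable (q p : ℤ) (f P : List (ℤ × V) → V)

section
variable (φ : M →+ N)

theorem map_units_smul' (e : ℤˣ) (x : M) : φ (e • x) = e • φ x := by
  simp only [Units.smul_def, map_zsmul]

theorem cyc_map (Ψ : List (ℤ × V) → ℤ × V → List (ℤ × V) → M) (a : ℤ × V) (w : List (ℤ × V)) :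
    φ (cyc Ψ a w) = cyc (fun z a r => φ (Ψ z a r)) a w := by
  simp only [cyc, map_splitSum, map_units_smul']

theorem mR_map (Θ : List (ℤ × V) → ℤ × V → List (ℤ × V) → M) (z : List (ℤ × V)) (a : ℤ × V)
    (r : List (ℤ × V)) : φ (mR q f Θ z a r) = mR q f (fun z a r => φ (Θ z a r)) z a r := by
  simp only [mR, map_units_smul', rins, ins3_map]

variable (Φ : ℤ × V → List (ℤ × V) → M) (a : ℤ × V) (w : List (ℤ × V))

theorem lie_map : φ (lie q f Φ a w) = lie q f (fun a w => φ (Φ a w)) a w := by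
  simp only [lie, map_add, tl, hd, cyc_map, map_units_smul', rins, ins3_map, map_splitSum]

theorem contr_map : φ (contr p P q f Φ a w) = contr p P q f (fun a w => φ (Φ a w)) a w := by
  simp only [contr, cyc_map, map_splitSum, mR_map]

end

variable {Φ : ℤ × V → List (ℤ × V) → M} (hΦ : ∀ w, LetterAdd fun a => Φ a w)
include hΦ

theorem contr_zero (a : ℤ × V) (w : List (ℤ × V)) : contr p (fun _ => 0) q f Φ a w = 0 := by
  simp only [contr, lt, mR, rins, ins3, (hΦ _).zero, smul_zero, splitSum_zero, cyc]

theorem contr_smul_left (e : ℤˣ) (a : ℤ × V) (w : List (ℤ × V)) :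
    contr p (fun w => e • P w) q f Φ a w = e • contr p P q f Φ a w := by
  simp only [contr, lt, (hΦ _).smul, mR_smul, splitSum_smul, cyc_smul]

theorem contr_fun_sub (hP : WordAdd P) (g : List (ℤ × V) → V) (e : ℤˣ) (a : ℤ × V)
    (w : List (ℤ × V)) : contr p P q (fun w => f w - e • g w) Φ a w
      = contr p P q f Φ a w - e • contr p P q g Φ a w := by
  have h : ∀ v z a s, mR q (fun w => f w - e • g w) (fun z a s => Φ (lt p P (z ++ a :: s)) v) z a s
      = mR q f (fun z a s => Φ (lt p P (z ++ a :: s)) v) z a s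
        - e • mR q g (fun z a s => Φ (lt p P (z ++ a :: s)) v) z a s := fun v z a s => by
    have hW : WordAdd fun s => Φ (lt p P (z ++ a :: s)) v := fun x y n b c => by
      have := hP (z ++ a :: x) y n b c
      simp only [List.append_assoc, List.cons_append] at this
      simp only [lt, this, wd_append, wd_cons]
      exact hΦ _ _ _ _
    simp only [mR]
    rw [rins_fun_sub q f g e hW, smul_sub, smul_comm e]
  simp only [contr, h, splitSum_sub, splitSum_smul, cyc_sub, cyc_smul]

end

end Braces

/-! ### The Hochschild boundary as a Lie derivative along the structure of A -/

namespace AugDGRing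
open Braces

variable {k : Type u} [Field k] {t : ℕ} {A : AugDGRing.{u, v} k t}

section
variable {M N : Type*} [AddCommGroup M] [AddCommGroup N]

theorem connesOp_map (φ : M →+ N) (Φ : A.Ltr → List A.Ltr → M) (a : A.Ltr) (w : List A.Ltr) :
    φ (A.connesOp Φ a w) = A.connesOp (fun a w => φ (Φ a w)) a w := by
  simp only [connesOp, cyc_map]

theorem cartanOp_map (φ : M →+ N) (q : ℤ) (f : List A.Ltr → A.carrier)
    (Φ : A.Ltr → List A.Ltr → M) (a : A.Ltr) (w : List A.Ltr) :
    φ (cartanOp q f Φ a w) = cartanOp q f (fun a w => φ (Φ a w)) a w := by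
  simp only [cartanOp, cyc_map, mR_map]

theorem cartanOp_fun_sub {q : ℤ} (f g : List A.Ltr → A.carrier) (e : ℤˣ)
    {Φ : A.Ltr → List A.Ltr → M} (hΦ : ∀ a, WordAdd (Φ a)) (a : A.Ltr) (w : List A.Ltr) :
    cartanOp q (fun w => f w - e • g w) Φ a w = cartanOp q f Φ a w - e • cartanOp q g Φ a w := by
  have h : ∀ z a s, mR q (fun w => f w - e • g w) (fun z a s => Φ A.unitLt (z ++ a :: s)) z a s
      = mR q f (fun z a s => Φ A.unitLt (z ++ a :: s)) z a s
        - e • mR q g (fun z a s => Φ A.unitLt (z ++ a :: s)) z a s := fun z a s => by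
    have hW : WordAdd fun s => Φ A.unitLt (z ++ a :: s) := fun x y => by
      simpa using hΦ A.unitLt (z ++ a :: x) y
    simp only [mR]
    rw [rins_fun_sub q f g e hW, smul_sub, smul_comm e]
  rw [cartanOp, cartanOp, cartanOp, ← cyc_smul, ← cyc_sub]
  exact cyc_congr fun z r => h z a r

end

theorem b_gen (a : A.Elt) (w : List A.RElt) :
    b (gen a w) = lie (-2) A.mm genL a.ltr (w.map RElt.ltr) := by
  have hg : ∀ (x : List A.RElt) (c : A.RElt) (y : List A.RElt) (c' : A.Ltr), c' = c.ltr →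
      genL a.ltr (x.map RElt.ltr ++ c' :: y.map RElt.ltr) = gen a (x ++ c :: y) := by
    rintro x c y _ rfl
    rw [← genL_ltr, List.map_append, List.map_cons]
  have h2 : frontSum (fun c y => genL (lt (-2) A.mm [a.ltr, c]) y) (w.map RElt.ltr)
      = (match w with
        | [] => 0
        | c :: y => (a.1 + 1).negOnePow • gen (a.mul c.toElt) y) := by
    cases w with
    | nil => rfl
    | cons c y =>
      dsimp only
      rw [← genL_ltr, List.map_cons, frontSum, ← (genL_letterAdd _).smul]
      congr 1
      simp only [lt, mm, Elt.ltr, RElt.ltr, prj_of_mem a.2.2, prj_of_mem c.2.2.1, Elt.mul,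
        RElt.toElt]
      simp
      ring
  have h1 : genL (lt (-2) A.mm [a.ltr]) (w.map RElt.ltr) = gen a.d w := by
    rw [← genL_ltr]
    congr 1
    simp only [lt, mm, Elt.ltr, prj_of_mem a.2.2, Elt.d]
    simp
    ring
  have h3 : backSum (fun y c => ((c.1 + 1) * (a.1 + 1 + wd y)).negOnePow •
      genL (lt (-2) A.mm [c, a.ltr]) y) (w.map RElt.ltr)
      = letterSum (fun x c z => match z with
        | [] => ((eta a x + 1) * (c.1 + 1)).negOnePow • gen (c.toElt.mul a) x
        | _ :: _ => 0) w := by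
    rw [backSum, letterSum_map]
    refine letterSum_congr (fun x c z => ?_) w
    cases z with
    | nil =>
      have : genL (lt (-2) A.mm [c.ltr, a.ltr]) (x.map RElt.ltr)
          = (c.1 + 1).negOnePow • gen (c.toElt.mul a) x := by
        rw [← genL_ltr, ← (genL_letterAdd _).smul]
        congr 1
        simp only [lt, mm, Elt.ltr, RElt.ltr, prj_of_mem a.2.2, prj_of_mem c.2.2.1, Elt.mul,
          RElt.toElt]
        simp
        ring
      simp only [List.map_nil]
      rw [this, negOnePow_smul_smul, wd_map_ltr]
      refine negOnePow_smul_congr ?_ rfl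
      simp only [eta, RElt.ltr_fst, parity_simps]
      grind (splits := 40)
    | cons d z => rfl
  have h4 : ((-2 + 1) * (a.1 + 1)).negOnePow • letterSum (fun x c y => (wd x).negOnePow •
        genL a.ltr (x ++ (c.1 - 1, A.d (A.prj c.1 c.2)) :: y)) (w.map RElt.ltr)
      = letterSum (fun x c y => (eta a x).negOnePow • gen a (x ++ c.d :: y)) w := by
    rw [letterSum_map, ← letterSum_smul]
    refine letterSum_congr (fun x c y => ?_) w
    rw [hg x c.d y, negOnePow_smul_smul, wd_map_ltr]
    · refine negOnePow_smul_congr ?_ rfl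
      simp only [eta, parity_simps]
      grind (splits := 40)
    · simp [RElt.ltr, prj_of_mem c.2.2.1, RElt.d]
  have h5 : ((-2 + 1) * (a.1 + 1)).negOnePow • letterSum (fun x c z => frontSum (fun e y =>
        (wd x + (c.1 + 1)).negOnePow •
          genL a.ltr (x ++ (c.1 + e.1, A.prj c.1 c.2 * A.prj e.1 e.2) :: y)) z) (w.map RElt.ltr)
      = letterSum (fun x c z => match z with
        | [] => 0
        | e :: y => (eta a x + (c.1 + 1)).negOnePow • gen a (x ++ c.mul e :: y)) w := by
    rw [letterSum_map, ← letterSum_smul]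
    refine letterSum_congr (fun x c z => ?_) w
    cases z with
    | nil => simp [frontSum]
    | cons e y =>
      simp only [List.map_cons, frontSum]
      rw [hg x (c.mul e) y, negOnePow_smul_smul, wd_map_ltr]
      · refine negOnePow_smul_congr ?_ rfl
        simp only [eta, RElt.ltr_fst, parity_simps]
        grind (splits := 40)
      · simp [RElt.ltr, prj_of_mem c.2.2.1, prj_of_mem e.2.2.1, RElt.mul]
  rw [b, chainLift_gen, bFun₀, bFun₁.eq_def, lie, tl, rins_mm (genL_wordAdd _), hd_mm genL_letterAdd,
    Elt.ltr_fst, smul_add, h1, h2, h3, h4, h5]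
  have reorder : ∀ x y z v w : A.Chain, x + y + (z + v + w) = (y + v) + (x + z + w) := by
    intros
    abel
  exact reorder _ _ _ _ _

/-- By `b_gen` the formula holds for homogeneous letters with reduced tail. It extends because the
Lie derivative depends on the tail letters only through their homogeneous parts and vanishes on
scalars there. -/
theorem b_genL (a : A.Ltr) (w : List A.Ltr) : b (genL a w) = lie (-2) A.mm genL a w := by
  have hp : WordPrj (lie (-2) A.mm genL a) := fun x r p y => by
    have m : ∀ u v s, genL (lt (-2) A.mm (u ++ (p, A.prj p y) :: v)) s
        = genL (lt (-2) A.mm (u ++ (p, y) :: v)) s := fun u v s => by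
      have := mm_wordPrj u v p y
      simp only [lt, wd_append, wd_cons] at this ⊢
      rw [this]
    have m' : ∀ u c u' v s, genL (lt (-2) A.mm (u ++ c :: (u' ++ (p, A.prj p y) :: v))) s
        = genL (lt (-2) A.mm (u ++ c :: (u' ++ (p, y) :: v))) s := fun u c u' v s => by
      simpa using m (u ++ c :: u') v s
    have g : ∀ (c : A.Ltr) u v, genL c (u ++ (p, A.prj p y) :: v) = genL c (u ++ (p, y) :: v) :=
      fun c u v => genL_wordPrj c u v p y
    have h1 := mm_wordPrj.rins (q := -2) (genL_wordPrj a) x r p y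
    simp only [lie, tl, h1, hd, cyc, splitSum_append, List.append_assoc, List.cons_append, m, m', g,
      wd_append, wd_cons]
  have hl := (ChainLin.lie (q := -2) isWordCochain_mm.lin (genL_lin (A := A))).tail a
  -- The head is only made homogeneous, not reduced: scalars are allowed in that position.
  have e : ∀ w, lie (-2) A.mm genL (Ltr.elt a).ltr w = lie (-2) A.mm genL a w := fun w => by
    have h0 : (Ltr.elt a).ltr = (a.1, A.prj a.1 a.2) := rfl
    have h1 := mm_wordPrj (A := A) [] []
    have h2 := fun c => mm_wordPrj (A := A) [] [c]
    have h3 := fun c => mm_wordPrj (A := A) [c] []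
    simp only [LetterPrj, List.nil_append, List.cons_append] at h1 h2 h3
    rw [h0, lie, lie, hd_mm genL_letterAdd, hd_mm genL_letterAdd, tl, tl]
    simp only [lt, wd_cons, h1, h2, h3]
    congr 2
    have : genL (a.1, A.prj a.1 a.2) = genL a := funext fun w => genL_prj a.1 a.2 w
    rw [this]
  rw [genL, b_gen, e, ← (lie_mm_genL_wordKill a).eq_bar hl.wordAdd hp w, List.map_map]
  rfl

end AugDGRing

namespace AugDGRing
open Braces

variable {k : Type u} [Field k] {t : ℕ} {A : AugDGRing.{u, v} k t}

/-! ### Degrees -/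

theorem genL_mem (a : A.Ltr) (w : List A.Ltr) : genL a w ∈ A.chainDeg (-1 + (a.1 + 1) + wd w) :=
  Submodule.subset_span ⟨_, _, by simp, rfl⟩

theorem chainDeg_map {T : A.Chain →ₗ[k] A.Chain} {d : ℤ}
    (h : ∀ a w, T (genL a w) ∈ A.chainDeg (d + (a.1 + 1) + wd w)) {m n : ℤ} (hn : m + d + 1 = n)
    {x : A.Chain} (hx : x ∈ A.chainDeg m) : T x ∈ A.chainDeg n := by
  have : A.chainDeg m ≤ (A.chainDeg n).comap T := by
    refine Submodule.span_le.2 ?_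
    rintro _ ⟨a, w, ha, rfl⟩
    have := h a.ltr (w.map RElt.ltr)
    rw [genL_ltr, wd_map_ltr] at this
    rw [Elt.ltr_fst, show d + (a.1 + 1) + sdeg w = n by rw [← hn, ← ha]; ring] at this
    exact this
  exact this hx

theorem b_mem {m n : ℤ} (hn : m - 1 = n) {x : A.Chain} (hx : x ∈ A.chainDeg m) :
    b x ∈ A.chainDeg n :=
  chainDeg_map (fun a w => b_genL a w ▸ lie_mem (-2) A.mm genL_mem a w) (by rw [← hn]; ring) hx

theorem connes_mem {m n : ℤ} (hn : m + 1 = n) {x : A.Chain} (hx : x ∈ A.chainDeg m) :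
    connes x ∈ A.chainDeg n :=
  chainDeg_map (d := 0) (fun a w => connes_genL a w ▸ cyc_mem (fun x a v => by
    convert genL_mem A.unitLt (x ++ a :: v) using 2
    simp [unitLt]
    ring) a w) (by rw [← hn]; ring) hx

theorem iOp_mem {q m n : ℤ} (hn : m + q = n) (f : A.Cochain q) {x : A.Chain}
    (hx : x ∈ A.chainDeg m) : iOp f x ∈ A.chainDeg n :=
  chainDeg_map (fun a w => iOp_genL f a w ▸ units_smul_mem _ _
    (contr_mem q (ext f.1) (-2) A.mm genL_mem a w)) (by rw [← hn]; ring) hx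

theorem LOp_mem {q m n : ℤ} (hn : m + q + 1 = n) (f : A.Cochain q) {x : A.Chain}
    (hx : x ∈ A.chainDeg m) : LOp f x ∈ A.chainDeg n :=
  chainDeg_map (fun a w => LOp_genL f a w ▸ units_smul_mem _ _
    (lie_mem q (ext f.1) genL_mem a w)) (by rw [← hn]; ring) hx

/-- The projection to the component of degree `n`. -/
noncomputable def chainProj (n : ℤ) : A.Chain →ₗ[k] A.Chain :=
  chainLift (fun a w => if a.1 + sdeg w = n then gen a w else 0) <| by
    constructor
    · intro p c x y v
      dsimp only
      split_ifs
      · exact gen_admissible.head_lin ..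
      · simp
    · intro a u v p c x y
      simp only [sdeg_append, sdeg_cons]
      split_ifs
      · exact gen_admissible.slot_lin ..
      · simp
    · intro a x v κ
      rw [gen_cons]
      rfl
    · intro a u v x y κ
      simp [gen_pair]
    · intro a u x κ
      simp [gen_last]
    · intro a κ
      simp [gen_nil]

theorem chainProj_of_mem {m : ℤ} {x : A.Chain} (hx : x ∈ A.chainDeg m) (n : ℤ) :
    chainProj n x = if m = n then x else 0 := by
  induction hx using Submodule.span_induction with
  | mem x h =>
    obtain ⟨a, w, h, rfl⟩ := h
    rw [chainProj, chainLift_gen, h]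
  | zero => simp
  | add x y _ _ hx hy => rw [map_add, hx, hy]; split_ifs <;> simp
  | smul c x _ hx => rw [map_smul, hx]; split_ifs <;> simp

theorem chainProj_mem (n : ℤ) (x : A.Chain) : chainProj n x ∈ A.chainDeg n := by
  have : (A.chainDeg n).mkQ ∘ₗ chainProj n = 0 := chain_ext fun a w => by
    rw [LinearMap.comp_apply, chainProj_of_mem (genL_mem a w), LinearMap.zero_apply,
      Submodule.mkQ_apply, Submodule.Quotient.mk_eq_zero]
    split_ifs with h
    · exact h ▸ genL_mem a w
    · exact Submodule.zero_mem _
  rw [← Submodule.Quotient.mk_eq_zero]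
  exact LinearMap.congr_fun this x

theorem chainProj_b (n : ℤ) (x : A.Chain) : chainProj n (b x) = b (chainProj (n + 1) x) := by
  have : chainProj n ∘ₗ b = b ∘ₗ chainProj (A := A) (n + 1) := chain_ext fun a w => by
    rw [LinearMap.comp_apply, LinearMap.comp_apply, chainProj_of_mem (b_mem rfl (genL_mem a w)),
      chainProj_of_mem (genL_mem a w)]
    by_cases h : -1 + (a.1 + 1) + wd w = n + 1
    · rw [if_pos h, if_pos (by omega)]
    · rw [if_neg h, if_neg (by omega), map_zero]
  exact LinearMap.congr_fun this x

/-- b is homogeneous, so a preimage can be replaced by its component of degree n + 1. This allows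
homotopies to be given without a check of their degrees. -/
theorem mem_boundaries {n : ℤ} {x : A.Chain} (hx : x ∈ A.chainDeg n)
    (h : x ∈ LinearMap.range (b (A := A))) : x ∈ A.boundaries n := by
  obtain ⟨y, rfl⟩ := h
  have e := chainProj_b n y
  rw [chainProj_of_mem hx, if_pos rfl] at e
  rw [e]
  exact ⟨_, chainProj_mem _ y, rfl⟩

theorem boundaries_le {n : ℤ} {x : A.Chain} (h : x ∈ A.boundaries n) :
    x ∈ LinearMap.range (b (A := A)) := by
  obtain ⟨y, -, rfl⟩ := h
  exact ⟨y, rfl⟩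

/-! ### Identities between operators on chains -/

theorem b_b (x : A.Chain) : b (b x) = 0 := by
  have : b ∘ₗ b = (0 : A.Chain →ₗ[k] A.Chain) := chain_ext fun a w => by
    rw [LinearMap.comp_apply, b_genL]
    refine (lie_map (-2) A.mm (b (A := A)).toAddMonoidHom genL a w).trans ?_
    refine Eq.trans ?_ (lie_sq (-2) A.mm (by decide) mm_mm genL_letterAdd genL_wordAdd a w)
    congr 1
    funext a w
    exact b_genL a w
  exact LinearMap.congr_fun this x

theorem b_connes (x : A.Chain) : b (connes x) + connes (b x) = 0 := by
  have : b ∘ₗ connes + connes ∘ₗ b = (0 : A.Chain →ₗ[k] A.Chain) := chain_ext fun a w => by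
    rw [LinearMap.add_apply, LinearMap.comp_apply, LinearMap.comp_apply, b_genL, connes_genL]
    refine Eq.trans (congrArg₂ (· + ·) (connesOp_map (b (A := A)).toAddMonoidHom genL a w)
      (lie_map (-2) A.mm (connes (A := A)).toAddMonoidHom genL a w)) ?_
    refine Eq.trans ?_ (lie_mm_connesOp genL_letterAdd genL_prj a w)
    rw [add_comm]
    congr 2
    · funext a w
      exact connes_genL a w
    · funext a w
      exact b_genL a w
  exact LinearMap.congr_fun this x

/-- The second application puts the first 1 into a bar entry, where it projects to zero in Ā. -/
theorem connes_connes (x : A.Chain) : connes (connes x) = 0 := by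
  have e : A.unitLt = A.scalar 1 := by simp [unitLt, scalar]
  have : connes ∘ₗ connes = (0 : A.Chain →ₗ[k] A.Chain) := chain_ext fun a w => by
    rw [LinearMap.comp_apply, connes_genL]
    refine (connesOp_map (connes (A := A)).toAddMonoidHom genL a w).trans ?_
    have : ∀ w, connes (genL A.unitLt w) = 0 := fun w => by
      rw [connes_genL, connesOp, cyc]
      have : ∀ z r, genL A.unitLt (z ++ A.unitLt :: r) = 0 := fun z r => by
        conv_lhs => rw [e]
        exact genL_wordKill _ _ _ _
      simp only [this, smul_zero, splitSum_zero]
    simp [connesOp, cyc, this, splitSum_zero]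
  exact LinearMap.congr_fun this x

theorem iOp_unit (x : A.Chain) : iOp ⟨A.unitCochain, isCochain_unitCochain⟩ x = x := by
  have : iOp ⟨A.unitCochain, isCochain_unitCochain⟩ = (LinearMap.id : A.Chain →ₗ[k] A.Chain) :=
    chain_ext fun a w => by
    rw [iOp, genL, chainLift_gen, iFun, splitSum_eq_self']
    · have : (Ltr.elt a).mul (cval ⟨A.unitCochain, isCochain_unitCochain⟩ []) = Ltr.elt a :=
        Elt.ext' (by simp) (mul_one _)
      rw [this]
      simp
    · intro c x y
      have := gen_head (1 : k) (X := (Ltr.elt a).mul (cval ⟨A.unitCochain, isCochain_unitCochain⟩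
        (c :: x))) rfl rfl (by simp [Elt.mul, cval, unitCochain]) y
      have h0 : gen ((Ltr.elt a).mul (cval ⟨A.unitCochain, isCochain_unitCochain⟩ (c :: x))) y = 0 := by
        simpa using this
      rw [h0, smul_zero]
  exact LinearMap.congr_fun this x

end AugDGRing

/-! ### The homotopies as maps of chains and the identities up to homotopy -/

namespace AugDGRing
open Braces

variable {k : Type u} [Field k] {t : ℕ} {A : AugDGRing.{u, v} k t}

section bar
variable {q : ℤ} (f : A.Cochain q)

theorem wd_bar (w : List A.Ltr) : wd ((w.map Ltr.red).map RElt.ltr) = wd w := by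
  rw [wd_map_ltr, sdeg_map_red]

theorem lt_ext_bar (w : List A.Ltr) :
    lt q (ext f.1) ((w.map Ltr.red).map RElt.ltr) = lt q (ext f.1) w := by
  rw [lt, ext_ltr, wd_bar]
  rfl

theorem rins_bar {M : Type*} [AddCommGroup M] {Φ Φ' : List A.Ltr → M}
    (h : ∀ x c v, Φ' ((x.map Ltr.red).map RElt.ltr ++ c :: (v.map Ltr.red).map RElt.ltr)
      = Φ (x ++ c :: v)) (w : List A.Ltr) :
    rins q (ext f.1) Φ' ((w.map Ltr.red).map RElt.ltr) = rins q (ext f.1) Φ w := by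
  simp only [rins, ins3, splitSum_map, wd_bar, lt_ext_bar, h]

@[simp] theorem Ltr.red_elt_ltr (a : A.Ltr) : Ltr.red (Ltr.elt a).ltr = Ltr.red a := by
  rw [Ltr.red, Elt.elt_ltr, Ltr.red]

theorem mR_bar {M : Type*} [AddCommGroup M] {W : List A.Ltr → M}
    (h : ∀ x v c (a : A.Ltr) y, W ((x.map Ltr.red).map RElt.ltr ++ (Ltr.elt a).ltr ::
      ((v.map Ltr.red).map RElt.ltr ++ c :: (y.map Ltr.red).map RElt.ltr))
      = W (x ++ a :: (v ++ c :: y))) (z : List A.Ltr) (a : A.Ltr) (r : List A.Ltr) :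
    mR q (ext f.1) (fun z a s => W (z ++ a :: s)) ((z.map Ltr.red).map RElt.ltr) (Ltr.elt a).ltr
      ((r.map Ltr.red).map RElt.ltr) = mR q (ext f.1) (fun z a s => W (z ++ a :: s)) z a r := by
  simp only [mR, wd_bar, Elt.ltr_fst, Ltr.elt_fst]
  rw [rins_bar f (Φ := fun s => W (z ++ a :: s)) fun x c v => h z x c a v]

end bar

/-- The homotopy in the Cartan formula, on Hochschild chains. -/
noncomputable def cartanMap {q : ℤ} (f : A.Cochain q) : A.Chain →ₗ[k] A.Chain :=
  chainLift _ ((genL_bal.cartanOp f.2.ext).isAdmissible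
    (ChainLin.cyc ((genL_lin.tail A.unitLt).marked.mR q f.2.ext.lin)))

/-- `chainLift` gives the formula after the letters are made homogeneous and those of the tail
reduced. Nothing is lost: in each term all these letters stand in bar entries or in arguments of f,
where they are reduced anyway. -/
theorem cartanMap_genL {q : ℤ} (f : A.Cochain q) (a : A.Ltr) (w : List A.Ltr) :
    cartanMap f (genL a w) = cartanOp q (ext f.1) genL a w := by
  rw [cartanMap, genL, chainLift_gen, cartanOp, cyc, splitSum_map, splitSum_map, cyc]
  refine splitSum_congr (fun r z => ?_) w
  rw [mR_bar f, wd_bar, wd_bar, Elt.ltr_fst, Ltr.elt_fst]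
  intro x v c a y
  simp [genL, -List.map_map]

/-- The homotopy in the formula for the contraction with a bracket, on Hochschild chains. -/
noncomputable def contrMap {p q : ℤ} (g : A.Cochain p) (f : A.Cochain q) :
    A.Chain →ₗ[k] A.Chain :=
  chainLift _ ((genL_bal.contr g.2.ext f.2.ext).isAdmissible
    (genL_lin.contr f.2.ext.lin g.2.ext.lin))

theorem contrMap_genL {p q : ℤ} (g : A.Cochain p) (f : A.Cochain q) (a : A.Ltr) (w : List A.Ltr) :
    contrMap g f (genL a w) = contr p (ext g.1) q (ext f.1) genL a w := by
  rw [contrMap, genL, chainLift_gen, contr, cyc, splitSum_map, splitSum_map]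
  rw [cyc]
  refine splitSum_congr (fun r z => ?_) w
  rw [wd_bar, wd_bar, Elt.ltr_fst, Ltr.elt_fst, splitSum_map, splitSum_map]
  congr 1
  refine splitSum_congr (fun s v => ?_) r
  have e := mR_bar f (W := fun w => genL (lt p (ext g.1) w) v) (fun x v' c a y => by
    simp [genL, lt, ext, -List.map_map]) z a s
  rw [← e]
  congr 1
  funext z a s
  simp [genL, -List.map_map]

/-- Both contractions multiply the head from the right, and g acts first: (a g) f = a (g f). So the
cup product appears in the order g ∪ f. -/
theorem iOp_iOp {q r s : ℤ} (hs : q + r = s) (f : A.Cochain q) (g : A.Cochain r)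
    (x : A.Chain) : iOp f (iOp g x)
      = (q * r).negOnePow • iOp ⟨cup g.1 q f.1, g.2.cup ((add_comm r q).trans hs) f.2⟩ x := by
  subst hs
  have key : ∀ {q : ℤ} (f : A.Cochain q) (a : A.Ltr) w, iOp f (genL a w)
      = (a.1 * q).negOnePow • splitSum (fun x y =>
        genL (a.1 + (q + wd x), A.prj a.1 a.2 * ext f.1 x) y) w := fun {q} f a w => by
    rw [iOp, genL, chainLift_gen, iFun, splitSum_map, ← splitSum_smul]
    refine splitSum_congr (fun x y => ?_) w
    rw [Ltr.elt_fst]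
    congr 2
    refine Elt.ext' (by simp) ?_
    have h1 : A.prj a.1 a.2 * ext f.1 x ∈ A.gr (a.1 + (q + wd x)) :=
      A.mul_mem (prj_mem _ _) (f.2.ext.mem x)
    simp only [Ltr.elt, prj_of_mem h1]
    rfl
  have : iOp f ∘ₗ iOp g = (q * r).negOnePow •
      iOp ⟨cup g.1 q f.1, g.2.cup (add_comm r q) f.2⟩ := chain_ext fun a w => by
    rw [LinearMap.comp_apply, LinearMap.smul_apply, key, key]
    have e1 : ∀ (e : ℤˣ) (F : List A.Ltr → List A.Ltr → A.Chain), iOp f (e • splitSum F w)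
        = e • splitSum (fun x y => iOp f (F x y)) w := fun e F => by
      refine (map_units_smul' (iOp f).toAddMonoidHom e _).trans ?_
      rw [map_splitSum]
      rfl
    rw [e1]
    simp only [key, ← splitSum_smul]
    have e2 : ∀ x y, genL (a.1 + (q + r + wd x), A.prj a.1 a.2 * ext (cup g.1 q f.1) x) y
        = splitSum (fun x₁ x₂ => (q * wd x₁).negOnePow •
          genL (a.1 + (q + r + wd x), A.prj a.1 a.2 * (ext g.1 x₁ * ext f.1 x₂)) y) x := fun x y => by
      rw [ext, cup, splitSum_map, ← AddMonoidHom.coe_mulLeft, map_splitSum,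
        (genL_letterAdd y).splitSum]
      refine splitSum_congr (fun x₁ x₂ => ?_) x
      rw [AddMonoidHom.coe_mulLeft, mul_smul_comm, (genL_letterAdd y).smul, sdeg_map_red]
      rfl
    simp only [e2]
    simp only [← splitSum_smul]
    refine (splitSum_assoc (fun x₁ x₂ y => (a.1 * r).negOnePow •
      ((a.1 + (r + wd x₁)) * q).negOnePow • genL (a.1 + (r + wd x₁) + (q + wd x₂),
        A.prj (a.1 + (r + wd x₁)) (A.prj a.1 a.2 * ext g.1 x₁) * ext f.1 x₂) y) w).symm.trans ?_
    refine splitSum_congr (fun R y => splitSum_congr_append fun x₁ x₂ hR => ?_) w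
    subst hR
    have h1 : A.prj a.1 a.2 * ext g.1 x₁ ∈ A.gr (a.1 + (r + wd x₁)) :=
      A.mul_mem (prj_mem _ _) (g.2.ext.mem x₁)
    rw [prj_of_mem h1, mul_assoc, show a.1 + (r + wd x₁) + (q + wd x₂)
      = a.1 + (q + r + wd (x₁ ++ x₂)) by rw [wd_append]; ring]
    simp only [negOnePow_smul_smul]
    refine negOnePow_smul_congr ?_ rfl
    simp only [parity_simps]
    grind (splits := 40)
  exact LinearMap.congr_fun this x

section op
variable (T : A.Chain →ₗ[k] A.Chain) (e : ℤˣ) {Φ : A.Ltr → List A.Ltr → A.Chain}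
  (h : ∀ a w, T (genL a w) = e • Φ a w) (a : A.Ltr) (w : List A.Ltr)
include h

/-- An operator applied to a transform of `genL` acts on the functional inside. A composite T T'
thus becomes the transform of T' applied to that of T; this is the reversal of order in the letter
calculus. -/
theorem op_lie (q : ℤ) (f : List A.Ltr → A.carrier) :
    T (lie q f genL a w) = e • lie q f Φ a w := by
  refine (lie_map q f T.toAddMonoidHom genL a w).trans ?_
  refine Eq.trans ?_ (lie_map q f (DistribSMul.toAddMonoidHom _ e) Φ a w).symm
  congr 1
  funext a w
  exact h a w

theorem op_contr (p q : ℤ) (P f : List A.Ltr → A.carrier) :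
    T (contr p P q f genL a w) = e • contr p P q f Φ a w := by
  refine (contr_map q p f P T.toAddMonoidHom genL a w).trans ?_
  refine Eq.trans ?_ (contr_map q p f P (DistribSMul.toAddMonoidHom _ e) Φ a w).symm
  congr 1
  funext a w
  exact h a w

theorem op_connesOp : T (A.connesOp genL a w) = e • A.connesOp Φ a w := by
  refine (connesOp_map T.toAddMonoidHom genL a w).trans ?_
  refine Eq.trans ?_ (connesOp_map (DistribSMul.toAddMonoidHom _ e) Φ a w).symm
  congr 1
  funext a w
  exact h a w

theorem op_cartanOp (q : ℤ) (f : List A.Ltr → A.carrier) :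
    T (cartanOp q f genL a w) = e • cartanOp q f Φ a w := by
  refine (cartanOp_map T.toAddMonoidHom q f genL a w).trans ?_
  refine Eq.trans ?_ (cartanOp_map (DistribSMul.toAddMonoidHom _ e) q f Φ a w).symm
  congr 1
  funext a w
  exact h a w

end op

theorem op_smul (T : A.Chain →ₗ[k] A.Chain) (e : ℤˣ) (x : A.Chain) : T (e • x) = e • T x :=
  map_units_smul' T.toAddMonoidHom e x

section
variable {M : Type*} [AddCommGroup M] {Φ : A.Ltr → List A.Ltr → M}
  (hΦ : ∀ w, LetterAdd fun a => Φ a w) (a : A.Ltr) (w : List A.Ltr)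
include hΦ

/-- In `lie_contr` with m in both roles, the composite m{m} vanishes and the two doubly nested terms
are equal with opposite signs. What remains is the contraction with δf. -/
theorem lie_mm_contr_mm (q : ℤ) (f : List A.Ltr → A.carrier) :
    lie (-2) A.mm (contr (-2) A.mm q f Φ) a w
      = q.negOnePow • contr (-2) A.mm q f (lie (-2) A.mm Φ) a w
      + q.negOnePow • contr (-2) A.mm (q - 1) (wordDelta q f) Φ a w := by
  have e0 : (rins (-2) A.mm A.mm : List A.Ltr → A.carrier) = fun _ => 0 := funext mm_mm
  have e1 : contr (-2) A.mm (q - 1) (wordDelta q f) Φ a w = _ :=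
    contr_fun_sub (q - 1) (-2) (rins q f A.mm) A.mm hΦ mm_wordAdd (rins (-2) A.mm f)
      ((q + 1).negOnePow) a w
  have s1 : ((-2 + q) * (-2 + 1)).negOnePow = q.negOnePow :=
    negOnePow_congr (by simp only [parity_simps]; grind)
  have s2 : ((q + 1) * (-2 + 1)).negOnePow = (q + 1).negOnePow :=
    negOnePow_congr (by simp only [parity_simps]; grind)
  rw [lie_contr (-2) q (-2) A.mm A.mm f mm_wordAdd hΦ, e0, contr_zero _ _ _ hΦ, e1, s1, s2,
    show -2 + q + 1 = q - 1 by ring, show q + -2 + 1 = q - 1 by ring,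
    show ((-2 + 1) * (-2 + 1) : ℤ).negOnePow = -1 by decide, Int.negOnePow_succ]
  generalize q.negOnePow = α
  rcases Int.units_eq_one_or α with rfl | rfl <;>
    simp only [one_smul, Units.neg_smul, neg_neg] <;> abel

/-- The commutators of `lie` along g with `contr` for m, and of `lie` along m with `contr` for g,
contain the same two doubly nested terms. As g is a cocycle, their terms with m{g} and g{m} also
match. Eliminating these leaves the bracket and the commutator of b with `contr` for g. -/
theorem lie_contr_bracket {q r : ℤ} {f g : List A.Ltr → A.carrier} (hf : wordDelta q f = fun _ => 0)
    (hg : wordDelta r g = fun _ => 0) (hg' : WordAdd g) :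
    lie r g (contr (-2) A.mm q f Φ) a w
      = (q * (r + 1)).negOnePow • contr (-2) A.mm q f (lie r g Φ) a w
      + contr (-2) A.mm (q + r + 1) (wordBracket q f r g) Φ a w
      + (q * r + 1).negOnePow • lie (-2) A.mm (contr r g q f Φ) a w
      + (q * r + q + r).negOnePow • contr r g q f (lie (-2) A.mm Φ) a w := by
  have hA := lie_contr (-2) q r A.mm g f mm_wordAdd hΦ a w
  have hB := lie_contr r q (-2) g A.mm f hg' hΦ a w
  have e1 : contr (-2) A.mm (q + r + 1) (wordBracket q f r g) Φ a w = _ :=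
    contr_fun_sub (q + r + 1) (-2) (rins r g f) A.mm hΦ mm_wordAdd (rins q f g)
      (((q + 1) * (r + 1)).negOnePow) a w
  have e2 : contr r g (q - 1) (wordDelta q f) Φ a w = _ :=
    contr_fun_sub (q - 1) r (rins q f A.mm) g hΦ hg' (rins (-2) A.mm f) ((q + 1).negOnePow) a w
  have z : contr r g (q - 1) (fun _ => 0) Φ a w = 0 := by
    have := contr_fun_sub (q - 1) r (fun _ => 0) g hΦ hg' (fun _ => 0) 1 a w
    simpa using this
  have e3 : rins r g A.mm = fun w => (r + 1).negOnePow • rins (-2) A.mm g w :=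
    funext fun w => sub_eq_zero.1 (congrFun hg w)
  rw [hf, z] at e2
  rw [e3, contr_smul_left _ _ _ _ hΦ] at hA
  rw [e1, hA]
  rw [show -2 + q + 1 = q - 1 by ring, show q + -2 + 1 = q - 1 by ring] at hB
  rw [show r + q + 1 = q + r + 1 by ring, show r + -2 + 1 = -2 + r + 1 by ring]
  have s1 : ((-2 + q) * (r + 1)).negOnePow = (q * r).negOnePow * q.negOnePow := by
    rw [← Int.negOnePow_add]
    exact negOnePow_congr (by simp only [parity_simps]; grind)
  have s2 : ((q + 1) * (r + 1)).negOnePow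
      = -((q * r).negOnePow * q.negOnePow * r.negOnePow) := by
    rw [← Int.negOnePow_add, ← Int.negOnePow_add, ← Int.negOnePow_succ]
    exact negOnePow_congr (by simp only [parity_simps]; grind)
  have s3 : ((-2 + 1) * (r + 1)).negOnePow = - r.negOnePow := by
    rw [← Int.negOnePow_succ]
    exact negOnePow_congr (by simp only [parity_simps]; grind)
  have s3' : ((r + 1) * (-2 + 1)).negOnePow = - r.negOnePow := by rw [mul_comm, s3]
  have s4 : ((q + 1) * (-2 + 1)).negOnePow = - q.negOnePow := by
    rw [← Int.negOnePow_succ]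
    exact negOnePow_congr (by simp only [parity_simps]; grind)
  have s5 : ((r + q) * (-2 + 1)).negOnePow = r.negOnePow * q.negOnePow := by
    rw [← Int.negOnePow_add]
    exact negOnePow_congr (by simp only [parity_simps]; grind)
  have s6 : (q * (r + 1)).negOnePow = (q * r).negOnePow * q.negOnePow := by
    rw [← Int.negOnePow_add]
    ring_nf
  rw [s5, s4, s3'] at hB
  rw [s1, s2, s3, s6, hB, Int.negOnePow_add (q * r + q), Int.negOnePow_add (q * r) q,
    Int.negOnePow_succ, Int.negOnePow_succ]
  rw [Int.negOnePow_succ, eq_comm, sub_eq_zero] at e2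
  rw [e2]
  generalize q.negOnePow = α
  generalize r.negOnePow = β
  generalize (q * r).negOnePow = γ
  rcases Int.units_eq_one_or α with rfl | rfl <;> rcases Int.units_eq_one_or β with rfl | rfl <;>
    rcases Int.units_eq_one_or γ with rfl | rfl <;>
    simp only [one_smul, mul_one, Units.neg_smul, mul_neg, neg_neg, smul_add,
      smul_sub, smul_neg] <;> abel

end

/-- Stated for all cochains, so that it gives both that i_f commutes with b up to sign for cocycles
and that the contraction with a coboundary is null-homotopic. -/
theorem iOp_b {q n : ℤ} (hn : q - 1 = n) (f : A.Cochain q) (hd : IsCochain n (delta q f.1))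
    (x : A.Chain) : iOp f (b x) = q.negOnePow • b (iOp f x) + n.negOnePow • iOp ⟨_, hd⟩ x := by
  subst hn
  have : iOp f ∘ₗ b = q.negOnePow • (b ∘ₗ iOp f) + (q - 1).negOnePow • iOp ⟨_, hd⟩ :=
    chain_ext fun a w => by
    simp only [LinearMap.add_apply, LinearMap.smul_apply, LinearMap.comp_apply]
    have e : ext (delta q f.1) = wordDelta q (ext f.1) := funext fun w => ext_delta f.2 w
    rw [b_genL, op_lie _ _ (iOp_genL f), iOp_genL, iOp_genL, op_smul,
      op_contr _ 1 (fun a w => (b_genL a w).trans (one_smul _ _).symm), one_smul, e,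
      lie_mm_contr_mm genL_letterAdd, smul_add, smul_smul, smul_smul, smul_smul,
      Int.units_mul_self, Int.units_mul_self]
  exact LinearMap.congr_fun this x

/-- The last two terms are a homotopy: on cycles i_{[f,g]} differs from the commutator of i_f and
L_g by a boundary. -/
theorem iOp_LOp {q r n : ℤ} (hn : q + r + 1 = n) (f : A.Cochain q) (g : A.Cochain r)
    (hf : f.1 ∈ A.cocycles q) (hg : g.1 ∈ A.cocycles r) (x : A.Chain) :
    iOp f (LOp g x) = (q * (r + 1)).negOnePow • LOp g (iOp f x)
      + iOp ⟨gbracket f g, isCochain_gbracket hn f g⟩ x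
      + (q * r + q + r).negOnePow • contrMap g f (b x)
      + (q * r + 1).negOnePow • b (contrMap g f x) := by
  subst hn
  have : iOp f ∘ₗ LOp g = (q * (r + 1)).negOnePow • (LOp g ∘ₗ iOp f)
      + iOp ⟨gbracket f g, isCochain_gbracket rfl f g⟩
      + (q * r + q + r).negOnePow • (contrMap g f ∘ₗ b)
      + (q * r + 1).negOnePow • (b ∘ₗ contrMap g f) := chain_ext fun a w => by
    simp only [LinearMap.add_apply, LinearMap.smul_apply, LinearMap.comp_apply]
    rw [LOp_genL, op_smul, op_lie _ _ (iOp_genL f), iOp_genL, op_smul,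
      op_contr _ _ (LOp_genL g), iOp_genL, b_genL,
      op_lie _ 1 fun a w => (contrMap_genL g f a w).trans (one_smul _ _).symm, contrMap_genL,
      op_contr _ 1 (fun a w => (b_genL a w).trans (one_smul _ _).symm), one_smul, one_smul,
      lie_contr_bracket genL_letterAdd _ _ (mem_cocycles.1 hf).2 (mem_cocycles.1 hg).2
        g.2.ext.lin.wordAdd, ext_gbracket]
    simp only [smul_add, negOnePow_smul_smul]
    refine congrArg₂ (· + ·) (congrArg₂ (· + ·) (congrArg₂ (· + ·) ?_ ?_) ?_) ?_ <;>
    · refine negOnePow_smul_congr ?_ rfl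
      simp only [parity_simps]
      grind (splits := 40)
  exact LinearMap.congr_fun this x

/-- The Cartan formula `cartan` read on chains. For a cocycle f and a cycle x, only one homotopy
term survives, and it is a boundary. -/
theorem LOp_eq {q n : ℤ} (hn : q - 1 = n) (f : A.Cochain q) (hd : IsCochain n (delta q f.1))
    (x : A.Chain) : LOp f x = connes (iOp f x) - q.negOnePow • iOp f (connes x)
      + q.negOnePow • b (cartanMap f x) - cartanMap f (b x)
      + q.negOnePow • cartanMap ⟨_, hd⟩ x := by
  subst hn
  have : LOp f = connes ∘ₗ iOp f - q.negOnePow • (iOp f ∘ₗ connes)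
      + q.negOnePow • (b ∘ₗ cartanMap f) - cartanMap f ∘ₗ b
      + q.negOnePow • cartanMap ⟨_, hd⟩ := chain_ext fun a w => by
    simp only [LinearMap.add_apply, LinearMap.sub_apply, LinearMap.smul_apply,
      LinearMap.comp_apply]
    have e : ext (delta q f.1) = wordDelta q (ext f.1) := funext fun w => ext_delta f.2 w
    have e1 : cartanOp (q - 1) (wordDelta q (ext f.1)) genL a w = _ :=
      cartanOp_fun_sub (rins q (ext f.1) A.mm) (rins (-2) A.mm (ext f.1)) ((q + 1).negOnePow)
        genL_wordAdd a w
    have h := cartan genL_letterAdd genL_wordAdd genL_prj q (ext f.1) a w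
    rw [show q + -2 + 1 = q - 1 by ring, show -2 + q + 1 = q - 1 by ring] at h
    rw [LOp_genL, iOp_genL, op_smul,
      op_contr _ 1 (fun a w => (connes_genL a w).trans (one_smul _ _).symm), connes_genL,
      op_connesOp _ _ (iOp_genL f), cartanMap_genL,
      op_cartanOp _ 1 (fun a w => (b_genL a w).trans (one_smul _ _).symm), b_genL,
      op_lie _ 1 fun a w => (cartanMap_genL f a w).trans (one_smul _ _).symm, cartanMap_genL, e,
      e1, one_smul, one_smul, one_smul]
    rw [Int.negOnePow_succ] at h ⊢
    generalize q.negOnePow = α at h ⊢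
    rw [← sub_eq_zero]
    rcases Int.units_eq_one_or α with rfl | rfl <;>
      simp only [one_smul, Units.neg_smul, neg_neg, smul_neg, smul_sub] at h ⊢ <;>
      -- For one parity of q the letter identity is the goal itself, for the other its negative.
      first
      | (refine Eq.trans ?_ h; abel1)
      | (rw [← neg_eq_zero]; refine Eq.trans ?_ h; abel1)
  exact LinearMap.congr_fun this x

end AugDGRing

namespace AugDGRing
open Braces

variable {k : Type u} [Field k] {t : ℕ} {A : AugDGRing.{u, v} k t}

/-! ### The operations on cycles -/

theorem iOp_lin {q : ℤ} (c : k) (f g : A.Cochain q) (x : A.Chain) :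
    iOp (c • f + g) x = c • iOp f x + iOp g x := by
  have : iOp (c • f + g) = c • iOp f + iOp g := chain_ext fun a w => by
    rw [LinearMap.add_apply, LinearMap.smul_apply]
    simp only [iOp, genL, chainLift_gen, iFun]
    refine splitSum_lin c (fun x y => ?_) _
    refine sign_lin _ c (gen_head c (by rfl) (by rfl) ?_ y)
    simp [Elt.mul, cval, mul_add]
  exact LinearMap.congr_fun this x

theorem iOp_zero {q : ℤ} (x : A.Chain) : iOp (0 : A.Cochain q) x = 0 := by
  simpa using iOp_lin (1 : k) (0 : A.Cochain q) 0 x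

theorem cartanMap_zero {q : ℤ} (x : A.Chain) : cartanMap (0 : A.Cochain q) x = 0 := by
  have : cartanMap (0 : A.Cochain q) = 0 := chain_ext fun a w => by
    have h := cartanOp_fun_sub (q := q) (fun _ => (0 : A.carrier)) (fun _ => 0) 1 genL_wordAdd a w
    rw [cartanMap_genL, LinearMap.zero_apply,
      show ext (0 : A.Cochain q).1 = fun _ => (0 : A.carrier) from rfl]
    simpa using h
  exact LinearMap.congr_fun this x

theorem IsCochain.delta {q n : ℤ} (hn : q - 1 = n) {f : List A.RElt → A.carrier}
    (hf : IsCochain q f) : IsCochain n (delta q f) := by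
  subst hn
  refine IsWordCochain.of_ext ?_
  rw [show AugDGRing.ext (AugDGRing.delta q f) = AugDGRing.wordDelta q (AugDGRing.ext f) from funext fun w => ext_delta hf w]
  exact hf.ext.wordDelta

section cocycle
variable {q : ℤ} {f : A.Cochain q} (hf : f.1 ∈ A.cocycles q)
include hf

theorem delta_eq_zero : (⟨_, f.2.delta rfl⟩ : A.Cochain (q - 1)) = 0 := Subtype.ext hf.2

theorem b_iOp (x : A.Chain) : b (iOp f x) = q.negOnePow • iOp f (b x) := by
  rw [iOp_b rfl f (f.2.delta rfl), delta_eq_zero hf, iOp_zero, smul_zero, add_zero, smul_smul,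
    Int.units_mul_self, one_smul]

theorem LOp_eq_of_cocycle {x : A.Chain} (hx : b x = 0) : LOp f x = connes (iOp f x)
    - q.negOnePow • iOp f (connes x) + b (q.negOnePow • cartanMap f x) := by
  rw [LOp_eq rfl f (f.2.delta rfl), delta_eq_zero hf, cartanMap_zero, smul_zero, add_zero, hx,
    map_zero, sub_zero, op_smul]

theorem iOp_mem_cycles {m n : ℤ} (hn : m + q = n) {x : A.Chain} (hx : x ∈ A.cycles m) :
    iOp f x ∈ A.cycles n :=
  ⟨iOp_mem hn f hx.1, by
    have : b (iOp f x) = 0 := by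
      rw [b_iOp hf, show b x = 0 from hx.2, map_zero, smul_zero]
    exact this⟩

theorem iOp_mem_boundaries {m n : ℤ} (hn : m + q = n) {x : A.Chain} (hx : x ∈ A.boundaries m) :
    iOp f x ∈ A.boundaries n := by
  obtain ⟨y, hy, rfl⟩ := hx
  refine mem_boundaries (iOp_mem hn f (b_mem (by ring) hy)) ⟨q.negOnePow • iOp f y, ?_⟩
  rw [op_smul, b_iOp hf, smul_smul, Int.units_mul_self, one_smul]

end cocycle

/-- If f = δu and x is a cycle, `iOp_b` for u expresses i_f x as b of i_u x up to sign. -/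
theorem iOp_mem_boundaries_of_coboundary {q m n : ℤ} {f : A.Cochain q} (hf : f.1 ∈ A.coboundaries q)
    (hn : m + q = n) {x : A.Chain} (hx : x ∈ A.cycles m) : iOp f x ∈ A.boundaries n := by
  refine mem_boundaries (iOp_mem hn f hx.1) ?_
  obtain ⟨f, hf'⟩ := f
  obtain ⟨u, hu, rfl⟩ := hf
  have := iOp_b (n := q) (by ring) ⟨u, hu⟩ hf' x
  rw [show b x = 0 from hx.2, map_zero] at this
  refine ⟨iOp ⟨u, hu⟩ x, ?_⟩
  rw [Int.negOnePow_succ] at this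
  rcases Int.units_eq_one_or q.negOnePow with h | h <;> rw [h] at this <;>
    simp only [Units.neg_smul, one_smul, neg_neg] at this
  · exact (neg_add_eq_zero.1 this.symm)
  · exact (add_neg_eq_zero.1 this.symm)

theorem connes_mem_cycles {m n : ℤ} (hn : m + 1 = n) {x : A.Chain} (hx : x ∈ A.cycles m) :
    connes x ∈ A.cycles n :=
  ⟨connes_mem hn hx.1, by
    have := b_connes x
    rwa [show b x = 0 from hx.2, map_zero, add_zero] at this⟩

theorem connes_mem_boundaries {m n : ℤ} (hn : m + 1 = n) {x : A.Chain} (hx : x ∈ A.boundaries m) :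
    connes x ∈ A.boundaries n := by
  obtain ⟨y, hy, rfl⟩ := hx
  refine mem_boundaries (connes_mem hn (b_mem (by ring) hy)) ⟨-connes y, ?_⟩
  rw [map_neg, neg_eq_iff_add_eq_zero, b_connes]

/-- The Cartan formula writes L_f x as a combination of cycles and a boundary, so no commutator of b
and L_f is needed. -/
theorem LOp_mem_cycles {q m n : ℤ} {f : A.Cochain q} (hf : f.1 ∈ A.cocycles q)
    (hn : m + q + 1 = n) {x : A.Chain} (hx : x ∈ A.cycles m) : LOp f x ∈ A.cycles n := by
  refine ⟨LOp_mem hn f hx.1, ?_⟩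
  rw [LOp_eq_of_cocycle hf hx.2]
  refine Submodule.add_mem _ (Submodule.sub_mem _ ?_ (units_smul_mem _ _ ?_)) (b_b _)
  · exact (connes_mem_cycles rfl (iOp_mem_cycles hf rfl hx)).2
  · exact (iOp_mem_cycles hf rfl (connes_mem_cycles rfl hx)).2

/-! ### The operations on homology and cohomology -/

theorem coe_units_smul {V : Type*} [AddCommGroup V] [Module k V] (S : Submodule k V) (e : ℤˣ)
    (x : S) : ((e • x : S) : V) = e • (x : V) := by
  rcases Int.units_eq_one_or e with rfl | rfl <;> simp [Units.neg_smul]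

theorem cohClass_eq {p : ℤ} {f g : A.cocycles (-p)} :
    A.cohClass p f = A.cohClass p g ↔ f.1 - g.1 ∈ A.coboundaries (-p) :=
  Submodule.Quotient.eq _

theorem homClass_eq {n : ℤ} {x y : A.cycles n} :
    A.homClass n x = A.homClass n y ↔ x.1 - y.1 ∈ LinearMap.range (b (A := A)) :=
  (Submodule.Quotient.eq _).trans
    ⟨fun h => boundaries_le h, fun h => mem_boundaries (Submodule.sub_mem _ x.2.1 y.2.1) h⟩

theorem cohClass_smul {p : ℤ} (e : ℤˣ) (f : A.cocycles (-p)) :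
    A.cohClass p (e • f) = e • A.cohClass p f :=
  map_units_smul' (A.cohClass p).toAddMonoidHom e f

theorem homClass_smul {n : ℤ} (e : ℤˣ) (x : A.cycles n) :
    A.homClass n (e • x) = e • A.homClass n x :=
  map_units_smul' (A.homClass n).toAddMonoidHom e x

theorem cohClass_surjective (p : ℤ) : Function.Surjective (A.cohClass p) :=
  Submodule.mkQ_surjective _

theorem homClass_surjective (n : ℤ) : Function.Surjective (A.homClass n) :=
  Submodule.mkQ_surjective _

section operations
variable {p q r m n : ℤ}

theorem cup_mem (h : p + q = r) (f : A.cocycles (-p)) (g : A.cocycles (-q)) :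
    cup f.1 (-q) g.1 ∈ A.cocycles (-r) :=
  cup_mem_cocycles (by omega) f.2 g.2

/-- The cup product on Hochschild cohomology. -/
def cohMul (h : p + q = r) :
    A.HHCohomology p →ₗ[k] A.HHCohomology q →ₗ[k] A.HHCohomology r :=
  LinearMap.liftQ₂ _ _
    (LinearMap.mk₂ k (fun f g => A.cohClass r ⟨cup f.1 (-q) g.1, cup_mem h f g⟩)
      (fun f f' g => by
        rw [← map_add]
        exact congrArg _ (Subtype.ext (by simpa using cup_lin_left (1 : k) f.1 f'.1 (-q) g.1)))
      (fun c f g => by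
        rw [← map_smul]
        have z := cup_lin_left (1 : k) (0 : List A.RElt → A.carrier) 0 (-q) g.1
        refine congrArg _ (Subtype.ext ?_)
        simpa [show cup (0 : List A.RElt → A.carrier) (-q) g.1 = 0 by simpa using z] using
          cup_lin_left c f.1 0 (-q) g.1)
      (fun f g g' => by
        rw [← map_add]
        exact congrArg _ (Subtype.ext (by simpa using cup_lin_right (1 : k) f.1 (-q) g.1 g'.1)))
      (fun c f g => by
        rw [← map_smul]
        have z := cup_lin_right (1 : k) f.1 (-q) (0 : List A.RElt → A.carrier) 0
        refine congrArg _ (Subtype.ext ?_)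
        simpa [show cup f.1 (-q) (0 : List A.RElt → A.carrier) = 0 by simpa using z] using
          cup_lin_right c f.1 (-q) g.1 0))
    (fun f hf => LinearMap.ext fun g => (Submodule.Quotient.mk_eq_zero _).2
      (cup_mem_coboundaries_left (by omega) f.2.1 hf g.2))
    (fun g hg => LinearMap.ext fun f => (Submodule.Quotient.mk_eq_zero _).2
      (cup_mem_coboundaries_right (by omega) f.2 g.2.1 hg))

theorem cohMul_mk (h : p + q = r) (f : A.cocycles (-p)) (g : A.cocycles (-q)) :
    cohMul h (A.cohClass p f) (A.cohClass q g)
      = A.cohClass r ⟨cup f.1 (-q) g.1, cup_mem h f g⟩ := rfl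

theorem gbracket_mem (h : p + q - 1 = r) (f : A.cocycles (-p)) (g : A.cocycles (-q)) :
    gbracket (cocycles.toCochain f) (cocycles.toCochain g) ∈ A.cocycles (-r) :=
  gbracket_mem_cocycles (by omega) _ _ f.2 g.2

/-- The Gerstenhaber bracket on Hochschild cohomology. -/
def cohBracket (h : p + q - 1 = r) :
    A.HHCohomology p →ₗ[k] A.HHCohomology q →ₗ[k] A.HHCohomology r :=
  LinearMap.liftQ₂ _ _
    (LinearMap.mk₂ k (fun f g => A.cohClass r ⟨_, gbracket_mem h f g⟩)
      (fun f f' g => by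
        rw [← map_add]
        have := gbracket_lin_left (1 : k) (cocycles.toCochain f) (cocycles.toCochain f')
          (cocycles.toCochain g)
        rw [one_smul, one_smul] at this
        exact congrArg _ (Subtype.ext this))
      (fun c f g => by
        rw [← map_smul]
        have z := gbracket_lin_left (1 : k) (0 : A.Cochain (-p)) 0 (cocycles.toCochain g)
        have := gbracket_lin_left c (cocycles.toCochain f) 0 (cocycles.toCochain g)
        rw [show gbracket (0 : A.Cochain (-p)) (cocycles.toCochain g) = 0 by simpa using z,
          add_zero, add_zero] at this
        exact congrArg _ (Subtype.ext this))
      (fun f g g' => by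
        rw [← map_add]
        have := gbracket_lin_right (1 : k) (cocycles.toCochain f) (cocycles.toCochain g)
          (cocycles.toCochain g')
        rw [one_smul, one_smul] at this
        exact congrArg _ (Subtype.ext this))
      (fun c f g => by
        rw [← map_smul]
        have z := gbracket_lin_right (1 : k) (cocycles.toCochain f) (0 : A.Cochain (-q)) 0
        have := gbracket_lin_right c (cocycles.toCochain f) (cocycles.toCochain g) 0
        rw [show gbracket (cocycles.toCochain f) (0 : A.Cochain (-q)) = 0 by simpa using z,
          add_zero, add_zero] at this
        exact congrArg _ (Subtype.ext this)))
    (fun f hf => LinearMap.ext fun g => (Submodule.Quotient.mk_eq_zero _).2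
      (gbracket_mem_coboundaries_left (by omega) _ _ hf g.2))
    (fun g hg => LinearMap.ext fun f => (Submodule.Quotient.mk_eq_zero _).2
      (gbracket_mem_coboundaries_right (by omega) _ _ f.2 hg))

theorem cohBracket_mk (h : p + q - 1 = r) (f : A.cocycles (-p)) (g : A.cocycles (-q)) :
    cohBracket h (A.cohClass p f) (A.cohClass q g) = A.cohClass r ⟨_, gbracket_mem h f g⟩ := rfl

theorem iOp_mem' (h : m - p = n) (f : A.cocycles (-p)) (x : A.cycles m) :
    iOp (cocycles.toCochain f) x.1 ∈ A.cycles n :=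
  iOp_mem_cycles (f := cocycles.toCochain f) f.2 (by omega) x.2

/-- The contraction of Hochschild homology with Hochschild cohomology. -/
noncomputable def homContr (h : m - p = n) :
    A.HHCohomology p →ₗ[k] A.HHHomology m →ₗ[k] A.HHHomology n :=
  LinearMap.liftQ₂ _ _
    (LinearMap.mk₂ k (fun f x => A.homClass n ⟨_, iOp_mem' h f x⟩)
      (fun f f' x => by
        rw [← map_add]
        have := iOp_lin (1 : k) (cocycles.toCochain f) (cocycles.toCochain f') x.1
        rw [one_smul, one_smul] at this
        exact congrArg _ (Subtype.ext this))
      (fun c f x => by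
        rw [← map_smul]
        refine congrArg _ (Subtype.ext ?_)
        have := iOp_lin c (cocycles.toCochain f) 0 x.1
        rw [add_zero, iOp_zero, add_zero] at this
        exact this)
      (fun f x x' => by
        rw [← map_add]
        exact congrArg _ (Subtype.ext (map_add _ x.1 x'.1)))
      (fun c f x => by
        rw [← map_smul]
        exact congrArg _ (Subtype.ext (map_smul _ c x.1))))
    (fun f hf => LinearMap.ext fun x => (Submodule.Quotient.mk_eq_zero _).2
      (iOp_mem_boundaries_of_coboundary (f := cocycles.toCochain f) hf (by omega) x.2))
    (fun x hx => LinearMap.ext fun f => (Submodule.Quotient.mk_eq_zero _).2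
      (iOp_mem_boundaries (f := cocycles.toCochain f) f.2 (by omega) hx))

theorem homContr_mk (h : m - p = n) (f : A.cocycles (-p)) (x : A.cycles m) :
    homContr h (A.cohClass p f) (A.homClass m x) = A.homClass n ⟨_, iOp_mem' h f x⟩ := rfl

/-- The Connes operator on Hochschild homology. -/
noncomputable def homConnes (h : m + 1 = n) : A.HHHomology m →ₗ[k] A.HHHomology n :=
  Submodule.liftQ _
    (A.homClass n ∘ₗ connes.restrict (p := A.cycles m) fun _ hx => connes_mem_cycles h hx)
    fun x hx => (Submodule.Quotient.mk_eq_zero _).2 (connes_mem_boundaries (x := x.1) h hx)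

theorem homConnes_mk (h : m + 1 = n) (x : A.cycles m) :
    homConnes h (A.homClass m x) = A.homClass n ⟨connes x.1, connes_mem_cycles h x.2⟩ := rfl

theorem LOp_mem' (h : m - p + 1 = n) (f : A.cocycles (-p)) (x : A.cycles m) :
    LOp (cocycles.toCochain f) x.1 ∈ A.cycles n :=
  LOp_mem_cycles (f := cocycles.toCochain f) f.2 (by omega) x.2

/-- The Lie derivative on Hochschild homology. -/
noncomputable def homLie (h : m - p + 1 = n) :
    A.HHCohomology p →ₗ[k] A.HHHomology m →ₗ[k] A.HHHomology n :=
  -- L is defined by the Cartan formula, so it is well defined because i and B are. Its agreement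
  -- with the operator L_f on cycles is `homLie_mk`.
  (homContr rfl).compr₂ (homConnes h)
    - p.negOnePow • (homContr (by omega)).compl₂ (homConnes (n := m + 1) rfl)

end operations

end AugDGRing

namespace AugDGRing
open Braces

variable {k : Type u} [Field k] {t : ℕ} {A : AugDGRing.{u, v} k t}

/-! ### The calculus -/

/-- The sign bookkeeping for `homLie_cohBracket`. The four elements stand for the terms with B at
the outside, in the middle, or at the inside of the composites of i and L. -/
theorem bracket_signs {M : Type*} [AddCommGroup M] {p q r : ℤ} (h : p + q - 1 = r) (x y z u : M) :
    x - (p * (q + 1)).negOnePow • -(q.negOnePow • y)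
        - r.negOnePow • (z - (p * (q + 1)).negOnePow • u)
      = x - p.negOnePow • -(q.negOnePow • z)
        - ((p + 1) * (q + 1)).negOnePow • (y - p.negOnePow • u) := by
  have e1 : r.negOnePow = -(p.negOnePow * q.negOnePow) := by
    rw [← Int.negOnePow_add, ← Int.negOnePow_succ]
    exact negOnePow_congr (by simp only [← h, parity_simps])
  have e2 : ((p + 1) * (q + 1)).negOnePow
      = -((p * q).negOnePow * p.negOnePow * q.negOnePow) := by
    rw [← Int.negOnePow_add, ← Int.negOnePow_add, ← Int.negOnePow_succ]
    exact negOnePow_congr (by simp only [parity_simps]; grind)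
  have e3 : (p * (q + 1)).negOnePow = (p * q).negOnePow * p.negOnePow := by
    rw [← Int.negOnePow_add]
    ring_nf
  rw [e1, e2, e3]
  generalize p.negOnePow = α
  generalize q.negOnePow = β
  generalize (p * q).negOnePow = γ
  rcases Int.units_eq_one_or α with rfl | rfl <;> rcases Int.units_eq_one_or β with rfl | rfl <;>
    rcases Int.units_eq_one_or γ with rfl | rfl <;>
    simp only [one_smul, mul_one, Units.neg_smul, mul_neg, neg_neg,
      smul_sub, smul_neg] <;> abel

section
variable {p q r m n : ℤ}

theorem cohMul_comm (h : p + q = r) (h' : q + p = r) (a : A.HHCohomology p)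
    (b : A.HHCohomology q) : cohMul h a b = (p * q).negOnePow • cohMul h' b a := by
  obtain ⟨f, rfl⟩ := cohClass_surjective p a
  obtain ⟨g, rfl⟩ := cohClass_surjective q b
  rw [cohMul_mk, cohMul_mk, ← cohClass_smul, cohClass_eq, coe_units_smul]
  have := cup_comm_mem_coboundaries (s := -r) (by omega) f.2 g.2
  rwa [neg_mul_neg] at this

theorem cohBracket_antisymm (h : p + q - 1 = r) (h' : q + p - 1 = r) (a : A.HHCohomology p)
    (b : A.HHCohomology q) :
    cohBracket h a b = -(((p + 1) * (q + 1)).negOnePow • cohBracket h' b a) := by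
  obtain ⟨f, rfl⟩ := cohClass_surjective p a
  obtain ⟨g, rfl⟩ := cohClass_surjective q b
  rw [cohBracket_mk, cohBracket_mk, ← cohClass_smul, ← map_neg]
  refine congrArg _ (Subtype.ext ?_)
  rw [Submodule.coe_neg, coe_units_smul]
  refine (gbracket_antisymm _ _).trans ?_
  rw [negOnePow_congr (b := (p + 1) * (q + 1)) (by simp only [parity_simps]; grind)]

theorem cohBracket_jacobi {pq qr rp s : ℤ} (h₁ : p + q - 1 = pq) (h₁' : pq + r - 1 = s)
    (h₂ : q + r - 1 = qr) (h₂' : qr + p - 1 = s) (h₃ : r + p - 1 = rp) (h₃' : rp + q - 1 = s)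
    (a : A.HHCohomology p) (b : A.HHCohomology q) (c : A.HHCohomology r) :
    ((p + 1) * (r + 1)).negOnePow • cohBracket h₁' (cohBracket h₁ a b) c
      + ((q + 1) * (p + 1)).negOnePow • cohBracket h₂' (cohBracket h₂ b c) a
      + ((r + 1) * (q + 1)).negOnePow • cohBracket h₃' (cohBracket h₃ c a) b = 0 := by
  obtain ⟨f, rfl⟩ := cohClass_surjective p a
  obtain ⟨g, rfl⟩ := cohClass_surjective q b
  obtain ⟨h, rfl⟩ := cohClass_surjective r c
  simp only [cohBracket_mk, ← cohClass_smul, ← map_add]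
  refine (congrArg _ (Subtype.ext ?_)).trans (map_zero _)
  rw [Submodule.coe_add, Submodule.coe_add, coe_units_smul, coe_units_smul, coe_units_smul]
  refine Eq.trans ?_ (gbracket_jacobi (pq := -pq) (qr := -qr) (rp := -rp) (by omega) (by omega)
    (by omega) (cocycles.toCochain f) (cocycles.toCochain g) (cocycles.toCochain h))
  rw [negOnePow_congr (b := (p + 1) * (r + 1)) (a := (-p + 1) * (-r + 1))
      (by simp only [parity_simps]; grind),
    negOnePow_congr (b := (q + 1) * (p + 1)) (a := (-q + 1) * (-p + 1))
      (by simp only [parity_simps]; grind),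
    negOnePow_congr (b := (r + 1) * (q + 1)) (a := (-r + 1) * (-q + 1))
      (by simp only [parity_simps]; grind)]
  rfl

theorem cohBracket_cohMul {qr pq pr s : ℤ} (h₁ : q + r = qr) (h₁' : p + qr - 1 = s)
    (h₂ : p + q - 1 = pq) (h₂' : pq + r = s) (h₃ : p + r - 1 = pr) (h₃' : q + pr = s)
    (a : A.HHCohomology p) (b : A.HHCohomology q) (c : A.HHCohomology r) :
    cohBracket h₁' a (cohMul h₁ b c) = cohMul h₂' (cohBracket h₂ a b) c
      + ((p + 1) * q).negOnePow • cohMul h₃' b (cohBracket h₃ a c) := by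
  obtain ⟨f, rfl⟩ := cohClass_surjective p a
  obtain ⟨g, rfl⟩ := cohClass_surjective q b
  obtain ⟨h, rfl⟩ := cohClass_surjective r c
  simp only [cohMul_mk, cohBracket_mk, ← cohClass_smul, ← map_add]
  rw [cohClass_eq, Submodule.coe_add, coe_units_smul]
  have := gbracket_cup_mem_coboundaries (n := -qr) (s₂ := -pr) (s := -s) (by omega)
    (by omega) (by omega) (cocycles.toCochain f) (cocycles.toCochain g)
    (cocycles.toCochain h) f.2 g.2 h.2 (cocycles.toCochain ⟨_, cup_mem h₁ g h⟩) rfl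
  rwa [negOnePow_congr (b := (p + 1) * q) (by simp only [parity_simps]; grind)] at this

/-- On chains i_f i_g is the contraction with ± g ∪ f; commutativity of the cup product on
cohomology restores the order. -/
theorem homContr_cohMul {pq m' : ℤ} (h : p + q = pq) (h₁ : m - pq = n) (h₂ : m - q = m')
    (h₃ : m' - p = n) (a : A.HHCohomology p) (b : A.HHCohomology q) (x : A.HHHomology m) :
    homContr h₁ (cohMul h a b) x = homContr h₃ a (homContr h₂ b x) := by
  rw [cohMul_comm h (by omega)]
  refine (LinearMap.congr_fun (map_units_smul' (homContr h₁).toAddMonoidHom _ _) x).trans ?_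
  obtain ⟨f, rfl⟩ := cohClass_surjective p a
  obtain ⟨g, rfl⟩ := cohClass_surjective q b
  obtain ⟨x, rfl⟩ := homClass_surjective m x
  change (p * q).negOnePow • homContr h₁ (cohMul (by omega) (A.cohClass q g) (A.cohClass p f))
    (A.homClass m x) = _
  rw [homContr_mk, homContr_mk, cohMul_mk, homContr_mk, ← homClass_smul]
  refine congrArg _ (Subtype.ext ?_)
  rw [coe_units_smul]
  refine Eq.trans ?_ (iOp_iOp (s := -pq) (by omega) (cocycles.toCochain f)
    (cocycles.toCochain g) x.1).symm
  rw [neg_mul_neg]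
  rfl

theorem homLie_apply {m₁ m₂ : ℤ} (h₀ : m - p + 1 = n) (h₁ : m - p = m₁) (h₁' : m₁ + 1 = n)
    (h₂ : m + 1 = m₂) (h₂' : m₂ - p = n) (a : A.HHCohomology p) (x : A.HHHomology m) :
    homLie h₀ a x
      = homConnes h₁' (homContr h₁ a x) - p.negOnePow • homContr h₂' a (homConnes h₂ x) := by
  subst h₁ h₂
  rfl

/-- The difference between the Cartan formula and L_f on a cycle is the boundary of `cartanMap`, up
to sign. -/
theorem homLie_mk (h : m - p + 1 = n) (f : A.cocycles (-p)) (x : A.cycles m) :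
    homLie h (A.cohClass p f) (A.homClass m x) = A.homClass n ⟨_, LOp_mem' h f x⟩ := by
  rw [homLie_apply h rfl h rfl (by omega), homConnes_mk, homContr_mk, homContr_mk, homConnes_mk,
    ← homClass_smul, ← map_sub, eq_comm, homClass_eq, Submodule.coe_sub, coe_units_smul]
  refine ⟨(-p).negOnePow • cartanMap (cocycles.toCochain f) x.1, ?_⟩
  have := LOp_eq_of_cocycle (f := cocycles.toCochain f) f.2 x.2.2
  refine (sub_eq_of_eq_add' ?_).symm
  rw [Int.negOnePow_neg] at this ⊢
  exact this

theorem homConnes_homConnes {m' : ℤ} (h : m + 1 = m') (h' : m' + 1 = n) (x : A.HHHomology m) :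
    homConnes h' (homConnes h x) = 0 := by
  obtain ⟨x, rfl⟩ := homClass_surjective m x
  exact (congrArg (A.homClass n) (Subtype.ext (a2 := (0 : A.cycles n)) (connes_connes x.1))).trans (map_zero _)

theorem homConnes_smul (h : m + 1 = n) (e : ℤˣ) (x : A.HHHomology m) :
    homConnes h (e • x) = e • homConnes h x :=
  map_units_smul' (homConnes h).toAddMonoidHom e x

theorem homContr_smul (h : m - p = n) (a : A.HHCohomology p) (e : ℤˣ) (x : A.HHHomology m) :
    homContr h a (e • x) = e • homContr h a x :=
  map_units_smul' (homContr h a).toAddMonoidHom e x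

theorem homLie_smul (h : m - p + 1 = n) (a : A.HHCohomology p) (e : ℤˣ) (x : A.HHHomology m) :
    homLie h a (e • x) = e • homLie h a x :=
  map_units_smul' (homLie h a).toAddMonoidHom e x

theorem homConnes_sub (h : m + 1 = n) (x y : A.HHHomology m) :
    homConnes h (x - y) = homConnes h x - homConnes h y := map_sub _ _ _

theorem homLie_sub (h : m - p + 1 = n) (a : A.HHCohomology p) (x y : A.HHHomology m) :
    homLie h a (x - y) = homLie h a x - homLie h a y := map_sub _ _ _

theorem homContr_cohBracket {pq m₁ m₂ : ℤ} (h : p + q - 1 = pq) (h₀ : m - pq = n)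
    (h₁ : m - q + 1 = m₁) (h₁' : m₁ - p = n) (h₂ : m - p = m₂) (h₂' : m₂ - q + 1 = n)
    (a : A.HHCohomology p) (b : A.HHCohomology q) (x : A.HHHomology m) :
    homContr h₀ (cohBracket h a b) x = homContr h₁' a (homLie h₁ b x)
      - (p * (q + 1)).negOnePow • homLie h₂' b (homContr h₂ a x) := by
  obtain ⟨f, rfl⟩ := cohClass_surjective p a
  obtain ⟨g, rfl⟩ := cohClass_surjective q b
  obtain ⟨x, rfl⟩ := homClass_surjective m x
  rw [homLie_mk, homContr_mk, homContr_mk, homLie_mk, cohBracket_mk, homContr_mk,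
    ← homClass_smul, ← map_sub, eq_comm, homClass_eq, Submodule.coe_sub, coe_units_smul]
  have := iOp_LOp (n := -pq) (by omega) (cocycles.toCochain f) (cocycles.toCochain g) f.2 g.2 x.1
  rw [show AugDGRing.b x.1 = 0 from x.2.2, map_zero, smul_zero, add_zero,
    negOnePow_congr (b := p * (q + 1)) (a := -p * (-q + 1)) (by simp only [parity_simps]; grind)]
    at this
  refine ⟨(-p * -q + 1).negOnePow • contrMap (cocycles.toCochain g) (cocycles.toCochain f) x.1, ?_⟩
  rw [op_smul, eq_sub_iff_add_eq, eq_sub_iff_add_eq]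
  refine Eq.trans ?_ this.symm
  rw [add_comm _ (iOp _ x.1), add_comm]
  exact (add_assoc _ _ _).symm

/-- Formal: every L is expanded by the Cartan formula and i_{f∪g} by i_f i_g; the terms with B
between i_f and i_g cancel. -/
theorem homLie_cohMul {pq m₁ m₂ : ℤ} (h : p + q = pq) (h₀ : m - pq + 1 = n)
    (h₁ : m - q = m₁) (h₁' : m₁ - p + 1 = n) (h₂ : m - q + 1 = m₂) (h₂' : m₂ - p = n)
    (a : A.HHCohomology p) (b : A.HHCohomology q) (x : A.HHHomology m) :
    homLie h₀ (cohMul h a b) x = homLie h₁' a (homContr h₁ b x)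
      + p.negOnePow • homContr h₂' a (homLie h₂ b x) := by
  have e : pq.negOnePow = p.negOnePow * q.negOnePow := by rw [← h, Int.negOnePow_add]
  rw [homLie_apply h₀ (m₁ := m₁ - p) (by omega) h₁' rfl (by omega),
    homLie_apply h₁' rfl h₁' (m₂ := m₂) (by omega) h₂',
    homLie_apply h₂ h₁ (by omega) rfl (by omega), homContr_cohMul h (by omega) h₁ rfl,
    homContr_cohMul h (by omega) (m' := m₂) (by omega) h₂', map_sub, homContr_smul, smul_sub,
    smul_smul, e]
  abel

/-- Since B² = 0, the Cartan formula reduces both sides to B i B up to sign. -/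
theorem homConnes_homLie {m' n' : ℤ} (h : m - p + 1 = n) (h' : n + 1 = n') (h₁ : m + 1 = m')
    (h₁' : m' - p + 1 = n') (a : A.HHCohomology p) (x : A.HHHomology m) :
    homConnes h' (homLie h a x) = -(p.negOnePow • homLie h₁' a (homConnes h₁ x)) := by
  rw [homLie_apply h rfl h h₁ (by omega), homLie_apply h₁' (m₁ := n) (by omega) h' rfl (by omega),
    homConnes_homConnes, map_sub, homConnes_homConnes, homConnes_smul, map_zero, smul_zero,
    sub_zero, zero_sub]

/-- Formal: L_{[f,g]} is the commutator of B with i_{[f,g]}. The formula for i_{[f,g]} is inserted,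
B is moved past L by `homConnes_homLie`, and the Cartan formula for L_f collects the terms. -/
theorem homLie_cohBracket {pq m₁ m₂ : ℤ} (h : p + q - 1 = pq) (h₀ : m - pq + 1 = n)
    (h₁ : m - q + 1 = m₁) (h₁' : m₁ - p + 1 = n) (h₂ : m - p + 1 = m₂) (h₂' : m₂ - q + 1 = n)
    (a : A.HHCohomology p) (b : A.HHCohomology q) (x : A.HHHomology m) :
    homLie h₀ (cohBracket h a b) x = homLie h₁' a (homLie h₁ b x)
      - ((p + 1) * (q + 1)).negOnePow • homLie h₂' b (homLie h₂ a x) := by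
  have h₃ : m₁ + 1 - p = n := by omega
  have h₄ : m - pq = m₁ - p := by omega
  have h₅ : m - p - q + 1 = m₁ - p := by omega
  have h₆ : m + 1 - p = m₂ := by omega
  have h₇ : m + 1 - q + 1 = m₁ + 1 := by omega
  have h₈ : m + 1 - pq = n := by omega
  have i₁ := homContr_cohBracket h h₄ h₁ rfl rfl h₅ a b x
  have i₂ := homContr_cohBracket h h₈ h₇ h₃ h₆ h₂' a b (homConnes rfl x)
  have l₁ := homLie_apply h₁' rfl h₁' rfl h₃ a (homLie h₁ b x)
  have l₂ := homLie_apply h₂ rfl h₂ rfl h₆ a x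
  have d₁ : homContr h₃ a (homConnes rfl (homLie h₁ b x)) =
      -(q.negOnePow • homContr h₃ a (homLie h₇ b (homConnes rfl x))) :=
    (congrArg (homContr h₃ a) (homConnes_homLie h₁ rfl rfl h₇ b x)).trans
      ((map_neg (homContr h₃ a) _).trans (congrArg _ (homContr_smul h₃ a _ _)))
  have d₂ : homConnes h₁' (homContr h₄ (cohBracket h a b) x)
      = homConnes h₁' (homContr rfl a (homLie h₁ b x))
        - (p * (q + 1)).negOnePow • -(q.negOnePow • homLie h₂' b
          (homConnes h₂ (homContr rfl a x))) :=
    (congrArg (homConnes h₁') i₁).trans ((homConnes_sub h₁' _ _).trans (congrArg _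
      ((homConnes_smul h₁' _ _).trans (congrArg _ (homConnes_homLie h₅ h₁' h₂ h₂' b _)))))
  have d₃ : homLie h₂' b (homLie h₂ a x) = homLie h₂' b (homConnes h₂ (homContr rfl a x))
      - p.negOnePow • homLie h₂' b (homContr h₆ a (homConnes rfl x)) :=
    (congrArg (homLie h₂' b) l₂).trans ((homLie_sub h₂' b _ _).trans (congrArg _
      (homLie_smul h₂' b _ _)))
  have l₀ := homLie_apply h₀ h₄ h₁' rfl h₈ (cohBracket h a b) x
  rw [d₂, i₂] at l₀
  rw [d₁] at l₁
  refine l₀.trans (Eq.trans ?_ (congrArg₂ (fun u v => u - ((p + 1) * (q + 1)).negOnePow • v)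
    l₁ d₃).symm)
  exact bracket_signs h _ _ _ _
end

variable (A) in
/-- The calculus of Hochschild cohomology and homology. -/
noncomputable def calculus : Calculus k A.HHCohomology A.HHHomology where
  mul := cohMul
  one := A.cohClass 0 ⟨A.unitCochain, unitCochain_mem_cocycles⟩
  bracket := cohBracket
  one_mul h a := by
    obtain ⟨f, rfl⟩ := cohClass_surjective _ a
    exact congrArg _ (Subtype.ext (unitCochain_cup _ f.1))
  mul_one h a := by
    obtain ⟨f, rfl⟩ := cohClass_surjective _ a
    exact congrArg _ (Subtype.ext (cup_unitCochain f.1))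
  mul_assoc h₁ h₂ h₃ h₄ a b c := by
    obtain ⟨f, rfl⟩ := cohClass_surjective _ a
    obtain ⟨g, rfl⟩ := cohClass_surjective _ b
    obtain ⟨h, rfl⟩ := cohClass_surjective _ c
    exact congrArg _ (Subtype.ext (cup_assoc f.1 _ _ _ (by omega) g.1 h.1))
  mul_comm := cohMul_comm
  bracket_antisymm := cohBracket_antisymm
  jacobi := cohBracket_jacobi
  leibniz := cohBracket_cohMul
  i := homContr
  L := homLie
  d := homConnes
  i_one h x := by
    obtain ⟨x, rfl⟩ := homClass_surjective _ x
    exact congrArg _ (Subtype.ext (iOp_unit x.1))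
  i_mul := homContr_cohMul
  L_bracket := homLie_cohBracket
  d_d := homConnes_homConnes
  i_bracket := homContr_cohBracket
  L_mul := homLie_cohMul
  L_eq := homLie_apply

end AugDGRing

theorem theorem6 {k : Type u} [Field k] {t : ℕ} (ht : 0 < t) (A : AugDGRing.{u, v} k t) :
    ∃ S : Calculus k A.HHCohomology A.HHHomology, AugDGRing.IsInduced S :=
  ⟨A.calculus, {
    one := ⟨AugDGRing.unitCochain_mem_cocycles, rfl⟩
    mul := fun h f g => ⟨AugDGRing.cup_mem h f g, rfl⟩
    bracket := fun h f g => ⟨AugDGRing.gbracket_mem h f g, rfl⟩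
    i := fun h f x => ⟨AugDGRing.iOp_mem' h f x, rfl⟩
    -- L is the only operation not given on representatives by definition.
    L := fun h f x => ⟨AugDGRing.LOp_mem' h f x, AugDGRing.homLie_mk h f x⟩
    d := fun h x => ⟨AugDGRing.connes_mem_cycles h x.2, rfl⟩ }⟩
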